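/- Let $k$ be a field of characteristic $p\ge 3$ and let $r\ge 1$. **Notation.** Let $k[\mathbb M_r]$ be the commutative Hopf superalgebra generated by the odd element $\tau$ and the even elements $\theta,\sigma_i$ ($i\in\mathbb N$), subject to $\tau^2=0$, $\sigma_0=1$, $\theta^{p^{r-1}}=\sigma_1$, $\sigma_i\sigma_j=\binom{i+j}{i}\sigma_{i+j}$, with $\tau,\theta$ primitive and $\Delta(\sigma_i)=\sum_{u+v=i}\sigma_u\otimes\sigma_v+\sum_{u+v+p=i}\sigma_u\tau\otimes\sigma_v\tau$. For $s\ge 1$ let $k[\mathbb M_{r;s}]\subseteq k[\mathbb M_r]$ be the Hopf subsuperalgebra generated by $\tau,\theta$ and $\sigma_i$ for $1\le i<p^s$; these are the coordinate algebras of affine supergroup schemes $\mathbb M_r$ and $\mathbb M_{r;s}$, and the inclusion corresponds to the quotient map $\mathbb M_r\to\mathbb M_{r;s}$. For a nonzero inseparable $p$-polynomial $f=\sum_{i=1}^t a_iT^{p^i}\in k[T]$ and $\eta\in k$, let $\mathbb M_{r;f,\eta}$ be the finite supergroup scheme with group algebra (the dual of its coordinate algebra) $$k\mathbb M_{r;f,\eta}=k[u_0,\dots,u_{r-1},v]/\langle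 u_0^p,\dots,u_{r-2}^p,\;u_{r-1}^p+v^2,\;f(u_{r-1})+\eta u_0\rangle,$$ with each $u_i$ even and $v$ odd, and let $\mathbb M_{r;f}=\mathbb M_{r;f,0}$. (Here $u_i$ and $v$ correspond to the functionals dual to $\theta^{p^i}$ and $\tau$ in the basis $\theta^i\sigma_j,\ \tau\theta^i\sigma_j$, $0\le i<p^{r-1}$.) Let $\mathbb G_a^-$ be the odd additive supergroup scheme, $k[\mathbb G_a^-]=k[\tau]/\langle\tau^2\rangle$ with $\tau$ odd and primitive. Write $H^\bullet(G,k)$ for the cohomology ring of a supergroup scheme $G$, computed by the Hochschild complex $C^n(G,k)=k[G]^{\otimes n}$, and $[z]$ for the class of a cocycle $z$; it is bigraded by the cohomological degree and the internal $\mathbb Z/2$-degree, $H^n(G,k)=H^n(G,k)_{\bar 0}\oplus H^n(G,k)_{\bar 1}$. "Graded-commutative" means $ab=(-1)^{\deg a\deg b+\bar a\bar b}ba$ for homogeneous $a,b$, and ${}^g\otimes$ is the corresponding graded tensor product. **Proposition.** 1. $H^\bullet(\mathbb M_{r;1},k)$ is generated as an algebra by the classes ($1\le i\le r$) $$x_i=\Big[\sum_{j=1}^{p-1}\tfrac{(p-1)!}{j!(p-j)!}\,(\theta^{p^{i-1}})^j\otimes(\theta^{p^{i-1}})^{p-j}\Big]\in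 H^2_{\bar 0},\qquad \lambda_i=[\theta^{p^{i-1}}]\in H^1_{\bar 0},\qquad y=[\tau]\in H^1_{\bar 1},$$ subject only to graded-commutativity; that is, $H^\bullet(\mathbb M_{r;1},k)\cong k[x_1,\dots,x_r,y]\;{}^g\!\otimes\Lambda(\lambda_1,\dots,\lambda_r)$. 2. The quotient map $\mathbb M_r\to\mathbb M_{r;1}$ induces a surjective algebra homomorphism $H^\bullet(\mathbb M_{r;1},k)\to H^\bullet(\mathbb M_r,k)$ with kernel generated by $x_r-y^2$, and $H^\bullet(\mathbb M_r,k)\cong k[x_1,\dots,x_r,y]/\langle x_r-y^2\rangle\;{}^g\!\otimes\Lambda(\lambda_1,\dots,\lambda_r)$, where $x_i,\lambda_i,y$ are given by the same formulas as in (1). 3. Let $s\ge 2$. The quotient map $\mathbb M_r\to\mathbb M_{r;s}$ induces a surjective algebra homomorphism $H^\bullet(\mathbb M_{r;s},k)\to H^\bullet(\mathbb M_r,k)$ with kernel generated by $$w_s=-\Big[\sum_{j=1}^{p^s-1}\sigma_j\otimes\sigma_{p^s-j}+\sum_{u+v+p=p^s}\sigma_u\tau\otimes\sigma_v\tau\Big]\in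 H^2(\mathbb M_{r;s},k)_{\bar 0},$$ and $H^\bullet(\mathbb M_{r;s},k)\cong k[x_1,\dots,x_r,y,w_s]/\langle x_r-y^2\rangle\;{}^g\!\otimes\Lambda(\lambda_1,\dots,\lambda_r)$, where $x_i,\lambda_i,y$ are given by the same formulas as in (1). 4. Let $f=\sum_{i=s}^ta_iT^{p^i}$ with $1\le s\le t$ and $a_s,a_t\ne0$. The inclusion $\pi^*:k[\mathbb M_{r;s}]\hookrightarrow k[\mathbb M_{r;f}]$, dual to the quotient map $k\mathbb M_{r;f}\to k\mathbb M_{r;s}$ with $u_i\mapsto u_i$ and $v\mapsto v$, induces an isomorphism $H^\bullet(\mathbb M_{r;s},k)\cong H^\bullet(\mathbb M_{r;f},k)$. 5. Let $f\in k[T]$ be a nonzero inseparable $p$-polynomial and $0\ne\eta\in k$. The map $\phi:k\mathbb M_{r+1;f,\eta}\to k\mathbb M_{r;f^p}$ with $v\mapsto v$, $u_i\mapsto u_{i-1}$ for $1\le i\le r$ and $u_0\mapsto-\eta^{-1}f(u_{r-1})$ is an isomorphism of algebras, and it induces an isomorphism $H^\bullet(\mathbb M_{r+1;f,\eta},k)\cong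 H^\bullet(\mathbb M_{r;f^p},k)$. 6. One has $H^\bullet(\mathbb G_a^-,k)\cong k[y]$ with $y=[\tau]$ of degree $1$ and odd. For every nonzero inseparable $p$-polynomial $f\in k[T]$ and $0\ne\eta\in k$, the inclusion $(q^-)^*:k[\mathbb G_a^-]\hookrightarrow k[\mathbb M_{1;f,\eta}]$, dual to the quotient map $k\mathbb M_{1;f,\eta}\to k[v]/\langle v^2\rangle$ with $u_0\mapsto0$ and $v\mapsto v$, induces an isomorphism $k[y]\cong H^\bullet(\mathbb G_a^-,k)\cong H^\bullet(\mathbb M_{1;f,\eta},k)$. -/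

import Mathlib

set_option linter.unusedSectionVars false
set_option linter.unusedSimpArgs false

open scoped TensorProduct

noncomputable section

/-- A supercoalgebra over `k` with a distinguished even group-like element `unit`. The
`ℤ/2`-grading is recorded by its parity involution `parity`, which is `1` on the even and `-1` on
the odd part (in characteristic different from `2` this is the same as a grading). The structure
maps are even. The coordinate Hopf superalgebra `k[G]` of an affine supergroup scheme `G` has such
a structure, the unit being `1`, and the Hochschild complex of `G` with trivial coefficients
depends on this structure only. -/
class UnitalSupercoalgebra (k A : Type*) [Field k] [AddCommGroup A] [Module k A] extends
    Coalgebra k A where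
  unit : A
  comul_unit : comul unit = unit ⊗ₜ[k] unit
  counit_unit : counit unit = 1
  parity : A →ₗ[k] A
  parity_parity : ∀ a, parity (parity a) = a
  parity_unit : parity unit = unit
  counit_parity : ∀ a, counit (parity a) = counit a
  comul_parity : ∀ a, comul (parity a) = TensorProduct.map parity parity (comul a)

namespace UnitalSupercoalgebra

/-- Even homomorphisms of supercoalgebras that preserve the units. The comorphism of a homomorphism
of supergroup schemes is one. -/
structure Hom (k A B : Type*) [Field k] [AddCommGroup A] [Module k A] [AddCommGroup B] [Module k B]
    [UnitalSupercoalgebra k A] [UnitalSupercoalgebra k B] where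
  toLin : A →ₗ[k] B
  map_comul : ∀ a, CoalgebraStruct.comul (R := k) (toLin a) =
    TensorProduct.map toLin toLin (CoalgebraStruct.comul (R := k) a)
  map_counit : ∀ a, CoalgebraStruct.counit (R := k) (toLin a) = CoalgebraStruct.counit (R := k) a
  map_unit : toLin (unit k) = unit k
  map_parity : ∀ a, toLin (parity (k := k) a) = parity (k := k) (toLin a)

section sub
variable {k A : Type*} [Field k] [AddCommGroup A] [Module k A] [UnitalSupercoalgebra k A]
  (S : Submodule k A)

lemma map_subtype_injective :
    Function.Injective (TensorProduct.map S.subtype S.subtype) :=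
  TensorProduct.map_injective_of_flat_flat _ _ S.injective_subtype S.injective_subtype

/-- Restriction of the comultiplication to a subspace `S` with `Δ(S) ⊆ S ⊗ S`. -/
def subComul (hS : ∀ a ∈ S, CoalgebraStruct.comul (R := k) a ∈
    LinearMap.range (TensorProduct.map S.subtype S.subtype)) : S →ₗ[k] S ⊗[k] S :=
  (LinearEquiv.ofInjective _ (map_subtype_injective S)).symm.toLinearMap ∘ₗ
    LinearMap.codRestrict _ (CoalgebraStruct.comul (R := k) ∘ₗ S.subtype) fun a => hS a a.2

lemma map_subComul (hS : ∀ a ∈ S, CoalgebraStruct.comul (R := k) a ∈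
    LinearMap.range (TensorProduct.map S.subtype S.subtype)) (a : S) :
    TensorProduct.map S.subtype S.subtype (subComul S hS a) =
      CoalgebraStruct.comul (R := k) (a : A) := by
  have := LinearEquiv.apply_symm_apply (LinearEquiv.ofInjective _ (map_subtype_injective S))
    (LinearMap.codRestrict _ (CoalgebraStruct.comul (R := k) ∘ₗ S.subtype) (fun a => hS a a.2) a)
  exact congrArg Subtype.val this

/-- The sub-supercoalgebra structure on a subspace that contains the unit and is stable under
the comultiplication and the parity. -/
@[reducible] def ofSubmodule (hS : ∀ a ∈ S, CoalgebraStruct.comul (R := k) a ∈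
      LinearMap.range (TensorProduct.map S.subtype S.subtype))
    (h1 : unit k ∈ S) (hp : ∀ a ∈ S, parity (k := k) a ∈ S) : UnitalSupercoalgebra k S where
  comul := subComul S hS
  counit := CoalgebraStruct.counit (R := k) ∘ₗ S.subtype
  coassoc := by
    have inj : Function.Injective
        (TensorProduct.map S.subtype (TensorProduct.map S.subtype S.subtype)) :=
      TensorProduct.map_injective_of_flat_flat _ _ S.injective_subtype (map_subtype_injective S)
    ext a
    apply inj
    have h1 : ∀ z : S ⊗[k] S, TensorProduct.map S.subtype (TensorProduct.map S.subtype S.subtype)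
        (TensorProduct.assoc k S S S ((subComul S hS).rTensor S z)) =
        TensorProduct.assoc k A A A ((CoalgebraStruct.comul (R := k)).rTensor A
          (TensorProduct.map S.subtype S.subtype z)) := by
      intro z
      induction z with
      | zero => simp
      | add x y hx hy => simp only [map_add, hx, hy]
      | tmul x y =>
        simp only [LinearMap.rTensor_tmul, TensorProduct.map_tmul, Submodule.subtype_apply]
        rw [← map_subComul S hS x]
        generalize subComul S hS x = w
        induction w with
        | zero => simp
        | add x y hx hy => simp only [map_add, TensorProduct.add_tmul, hx, hy]
        | tmul x y => simp
    have h2 : ∀ z : S ⊗[k] S, TensorProduct.map S.subtype (TensorProduct.map S.subtype S.subtype)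
        ((subComul S hS).lTensor S z) =
        ((CoalgebraStruct.comul (R := k)).lTensor A
          (TensorProduct.map S.subtype S.subtype z)) := by
      intro z
      induction z with
      | zero => simp
      | add x y hx hy => simp only [map_add, hx, hy]
      | tmul x y => simp [map_subComul S hS y]
    simp only [LinearMap.comp_apply, LinearEquiv.coe_coe]
    rw [h1, h2, map_subComul, Coalgebra.coassoc_apply]
  rTensor_counit_comp_comul := by
    have inj : Function.Injective (S.subtype.lTensor k) :=
      Module.Flat.lTensor_preserves_injective_linearMap _ S.injective_subtype
    ext a
    apply inj
    have h : ∀ z : S ⊗[k] S, S.subtype.lTensor k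
        ((CoalgebraStruct.counit (R := k) ∘ₗ S.subtype).rTensor S z) =
        (CoalgebraStruct.counit (R := k)).rTensor A (TensorProduct.map S.subtype S.subtype z) := by
      intro z
      induction z with
      | zero => simp
      | add x y hx hy => simp only [map_add, hx, hy]
      | tmul x y => simp
    simp only [LinearMap.comp_apply]
    rw [h, map_subComul, Coalgebra.rTensor_counit_comul]
    simp
  lTensor_counit_comp_comul := by
    have inj : Function.Injective (S.subtype.rTensor k) :=
      Module.Flat.rTensor_preserves_injective_linearMap _ S.injective_subtype
    ext a
    apply inj
    have h : ∀ z : S ⊗[k] S, S.subtype.rTensor k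
        ((CoalgebraStruct.counit (R := k) ∘ₗ S.subtype).lTensor S z) =
        (CoalgebraStruct.counit (R := k)).lTensor A (TensorProduct.map S.subtype S.subtype z) := by
      intro z
      induction z with
      | zero => simp
      | add x y hx hy => simp only [map_add, hx, hy]
      | tmul x y => simp
    simp only [LinearMap.comp_apply]
    rw [h, map_subComul, Coalgebra.lTensor_counit_comul]
    simp
  unit := ⟨unit k, h1⟩
  comul_unit := by
    apply map_subtype_injective S
    rw [map_subComul]
    simp [comul_unit]
  counit_unit := by simp [counit_unit]
  parity := (parity (k := k) ).restrict hp
  parity_parity a := by ext; simp [parity_parity]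
  parity_unit := by ext; simp [parity_unit]
  counit_parity a := by simp [counit_parity]
  comul_parity a := by
    apply map_subtype_injective S
    rw [map_subComul]
    simp only [LinearMap.coe_restrict_apply, comul_parity]
    rw [← map_subComul S hS]
    generalize subComul S hS a = w
    induction w with
    | zero => simp
    | add x y hx hy => simp only [map_add, hx, hy]
    | tmul x y => simp

end sub
end UnitalSupercoalgebra

/-! ### The Hochschild complex of a supergroup scheme

For trivial coefficients `C^n(G, k) = k[G]^{⊗ n}`; the direct sum of these spaces is the tensor
algebra `T(k[G])`, whose product is the cup product of cochains. -/

namespace Hochschild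
open UnitalSupercoalgebra

/-- The algebra homomorphism `T(A) → T(B)` induced by a linear map `A → B`. -/
def cochainMap {k A B : Type*} [Field k] [AddCommGroup A] [Module k A] [AddCommGroup B]
    [Module k B] (f : A →ₗ[k] B) : TensorAlgebra k A →ₐ[k] TensorAlgebra k B :=
  TensorAlgebra.lift k (TensorAlgebra.ι k ∘ₗ f)

@[simp] lemma cochainMap_ι {k A B : Type*} [Field k] [AddCommGroup A] [Module k A]
    [AddCommGroup B] [Module k B] (f : A →ₗ[k] B) (a : A) :
    cochainMap f (TensorAlgebra.ι k a) = TensorAlgebra.ι k (f a) := by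
  simp [cochainMap]

section
variable (k A : Type*) [Field k] [AddCommGroup A] [Module k A] [UnitalSupercoalgebra k A]

/-- The linear map `A ⊗ A → T(A)`, `a ⊗ b ↦ ab`. -/
def tensorTwo : A ⊗[k] A →ₗ[k] TensorAlgebra k A :=
  TensorProduct.lift ((LinearMap.mul k (TensorAlgebra k A)).compl₁₂
    (TensorAlgebra.ι k) (TensorAlgebra.ι k))

/-- The differential on `1`-cochains, `∂(a) = 1 ⊗ a - Δ(a) + a ⊗ 1`. -/
def differentialOne : A →ₗ[k] TensorAlgebra k A :=
  LinearMap.mulLeft k (TensorAlgebra.ι k (unit k : A)) ∘ₗ TensorAlgebra.ι k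
    - tensorTwo k A ∘ₗ CoalgebraStruct.comul
    + LinearMap.mulRight k (TensorAlgebra.ι k (unit k : A)) ∘ₗ TensorAlgebra.ι k

/-- Auxiliary: left multiplication by `a` and the Leibniz rule, on pairs `(t, ∂ t)`. -/
def differentialStep : A →ₗ[k] Module.End k (TensorAlgebra k A × TensorAlgebra k A) where
  toFun a := (LinearMap.mulLeft k (TensorAlgebra.ι k a) ∘ₗ LinearMap.fst k _ _).prod
    (LinearMap.mulLeft k (differentialOne k A a) ∘ₗ LinearMap.fst k _ _
      - LinearMap.mulLeft k (TensorAlgebra.ι k a) ∘ₗ LinearMap.snd k _ _)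
  map_add' a b := by
    ext x <;> simp [add_mul]
    abel
  map_smul' c a := by
    ext x <;> simp

/-- The Hochschild differential: the derivation of the graded algebra `T(A)`, that is
`∂(xy) = ∂(x) y + (-1)^n x ∂(y)` for `x` of degree `n`, that extends `differentialOne`; the usual
formula is `differential_list_prod`. -/
def differential : TensorAlgebra k A →ₗ[k] TensorAlgebra k A :=
  LinearMap.snd k _ _ ∘ₗ LinearMap.applyₗ (1, 0) ∘ₗ
    (TensorAlgebra.lift k (differentialStep k A)).toLinearMap

/-- The sign automorphism, `(-1)^n` on tensors of degree `n`. -/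
def signAut : TensorAlgebra k A →ₐ[k] TensorAlgebra k A :=
  TensorAlgebra.lift k (-TensorAlgebra.ι k)

variable {k A}

lemma fst_lift (t : TensorAlgebra k A) (z : TensorAlgebra k A × TensorAlgebra k A) :
    TensorAlgebra.lift k (differentialStep k A) t z =
      (t * z.1, differential k A t * z.1 + signAut k A t * z.2) := by
  have hd : ∀ t, differential k A t = (TensorAlgebra.lift k (differentialStep k A) t (1, 0)).2 :=
    fun _ => rfl
  rw [hd]
  induction t using TensorAlgebra.induction generalizing z with
  | algebraMap r => simp [Algebra.algebraMap_eq_smul_one, Prod.smul_def]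
  | ι a => simp [differentialStep, signAut, sub_eq_add_neg]
  | mul a b ha hb =>
    rw [map_mul, Module.End.mul_apply, Module.End.mul_apply, hb z, hb (1, 0), ha, ha (b * 1, _)]
    simp [mul_assoc, add_mul, add_assoc, mul_add]
  | add a b ha hb =>
    rw [map_add, LinearMap.add_apply, LinearMap.add_apply, ha, hb, ha (1, 0), hb (1, 0)]
    ext <;> simp [add_mul]; abel

lemma differential_mul (x y : TensorAlgebra k A) : differential k A (x * y) =
    differential k A x * y + signAut k A x * differential k A y := by
  have hd : ∀ t, differential k A t = (TensorAlgebra.lift k (differentialStep k A) t (1, 0)).2 :=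
    fun _ => rfl
  rw [hd, map_mul, Module.End.mul_apply, fst_lift, fst_lift]
  simp

lemma differential_algebraMap (c : k) : differential k A (algebraMap k _ c) = 0 := by
  simp [differential, Algebra.algebraMap_eq_smul_one]

lemma differential_ι (a : A) :
    differential k A (TensorAlgebra.ι k a) = differentialOne k A a := by
  simp [differential, differentialStep]

lemma signAut_signAut (t : TensorAlgebra k A) : signAut k A (signAut k A t) = t := by
  have : (signAut k A).comp (signAut k A) = AlgHom.id k _ := by ext; simp [signAut]
  exact DFunLike.congr_fun this t

lemma differential_tensorTwo (z : A ⊗[k] A) : differential k A (tensorTwo k A z) =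
    TensorAlgebra.ι k (unit k) * tensorTwo k A z - tensorTwo k A z * TensorAlgebra.ι k (unit k)
    - TensorProduct.lift ((LinearMap.mul k (TensorAlgebra k A)).compl₁₂
        (tensorTwo k A) (TensorAlgebra.ι k)) ((CoalgebraStruct.comul (R := k)).rTensor A z)
    + TensorProduct.lift ((LinearMap.mul k (TensorAlgebra k A)).compl₁₂
        (TensorAlgebra.ι k) (tensorTwo k A)) ((CoalgebraStruct.comul (R := k)).lTensor A z) := by
  induction z with
  | zero => simp
  | add x y hx hy => simp only [map_add, hx, hy, mul_add, add_mul]; abel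
  | tmul x y =>
    simp [tensorTwo, differential_mul, differential_ι, differentialOne, signAut]
    noncomm_ring

lemma tensorTwo_assoc (z : (A ⊗[k] A) ⊗[k] A) :
    TensorProduct.lift ((LinearMap.mul k (TensorAlgebra k A)).compl₁₂
        (tensorTwo k A) (TensorAlgebra.ι k)) z =
    TensorProduct.lift ((LinearMap.mul k (TensorAlgebra k A)).compl₁₂
        (TensorAlgebra.ι k) (tensorTwo k A)) (TensorProduct.assoc k A A A z) := by
  have : TensorProduct.lift ((LinearMap.mul k (TensorAlgebra k A)).compl₁₂
        (tensorTwo k A) (TensorAlgebra.ι k)) =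
    TensorProduct.lift ((LinearMap.mul k (TensorAlgebra k A)).compl₁₂
        (TensorAlgebra.ι k) (tensorTwo k A)) ∘ₗ (TensorProduct.assoc k A A A).toLinearMap := by
    ext a b c
    simp [tensorTwo, mul_assoc]
  exact LinearMap.congr_fun this z

lemma signAut_tensorTwo (z : A ⊗[k] A) : signAut k A (tensorTwo k A z) = tensorTwo k A z := by
  induction z with
  | zero => simp
  | add x y hx hy => simp only [map_add, hx, hy]
  | tmul x y => simp [tensorTwo, signAut]

lemma signAut_differentialOne (a : A) :
    signAut k A (differentialOne k A a) = differentialOne k A a := by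
  simp [differentialOne, signAut_tensorTwo]
  simp [signAut]

lemma differential_signAut (t : TensorAlgebra k A) :
    differential k A (signAut k A t) = - signAut k A (differential k A t) := by
  induction t using TensorAlgebra.induction with
  | algebraMap r => simp [differential_algebraMap]
  | ι a =>
    rw [differential_ι, signAut_differentialOne]
    simp [signAut, differential_ι]
  | mul a b ha hb => simp [differential_mul, ha, hb]; abel
  | add a b ha hb => simp [ha, hb]; abel

theorem differential_differential (t : TensorAlgebra k A) :
    differential k A (differential k A t) = 0 := by
  induction t using TensorAlgebra.induction with
  | algebraMap r => simp [differential_algebraMap]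
  | ι a =>
    rw [differential_ι]
    have key := differential_tensorTwo (k := k) (CoalgebraStruct.comul (R := k) a)
    rw [tensorTwo_assoc, Coalgebra.coassoc_apply, sub_add_cancel] at key
    have he : differentialOne k A (unit k) =
        TensorAlgebra.ι k (unit k) * TensorAlgebra.ι k (unit k) := by
      simp [differentialOne, comul_unit, tensorTwo]
    simp only [differentialOne, LinearMap.add_apply, LinearMap.sub_apply, LinearMap.comp_apply,
      LinearMap.mulLeft_apply, LinearMap.mulRight_apply, map_add, map_sub, key, differential_mul,
      differential_ι] at he ⊢
    have he' : differentialOne k A (unit k) =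
        TensorAlgebra.ι k (unit k) * TensorAlgebra.ι k (unit k) := by
      simp [differentialOne, comul_unit, tensorTwo]
    have hs : signAut k A (TensorAlgebra.ι k a) = - TensorAlgebra.ι k a := by simp [signAut]
    have hs' : signAut k A (TensorAlgebra.ι k (unit k)) = - TensorAlgebra.ι k (unit k) := by
      simp [signAut]
    rw [he, hs, hs']
    noncomm_ring
  | mul a b ha hb =>
    simp [differential_mul, differential_signAut, ha, hb, signAut_signAut]
  | add a b ha hb => simp [ha, hb]

/-- Explicitly: `∂(a₁ ⊗ ⋯ ⊗ aₙ) = 1 ⊗ a₁ ⊗ ⋯ ⊗ aₙ + ∑ᵢ (-1)^i a₁ ⊗ ⋯ ⊗ Δ(aᵢ) ⊗ ⋯ ⊗ aₙ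
+ (-1)^(n+1) a₁ ⊗ ⋯ ⊗ aₙ ⊗ 1` (in the sum below the factors are counted from `0`). -/
theorem differential_list_prod (l : List A) :
    differential k A (l.map (TensorAlgebra.ι k)).prod =
      TensorAlgebra.ι k (unit k) * (l.map (TensorAlgebra.ι k)).prod
      + ∑ i : Fin l.length, (-1 : k) ^ (i.val + 1) •
          (((l.take i).map (TensorAlgebra.ι k)).prod *
            tensorTwo k A (CoalgebraStruct.comul (R := k) (l.get i)) *
            ((l.drop (i + 1)).map (TensorAlgebra.ι k)).prod)
      + (-1 : k) ^ (l.length + 1) •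
          ((l.map (TensorAlgebra.ι k)).prod * TensorAlgebra.ι k (unit k)) := by
  induction l with
  | nil => simpa using differential_algebraMap (A := A) (1 : k)
  | cons a l ih =>
    rw [List.map_cons, List.prod_cons, differential_mul, ih, differential_ι]
    erw [Fin.sum_univ_succ]
    simp [differentialOne, signAut, mul_add, add_mul, sub_mul, Finset.mul_sum, pow_succ,
      mul_assoc, ← Finset.sum_neg_distrib]
    abel

variable (k A)

/-- The algebra of cocycles. -/
def cocycles : Subalgebra k (TensorAlgebra k A) where
  carrier := {z | differential k A z = 0}
  mul_mem' {x y} hx hy := by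
    simp only [Set.mem_ofPred_eq] at *
    simp [differential_mul, hx, hy]
  add_mem' {x y} hx hy := by
    simp only [Set.mem_ofPred_eq] at *
    simp [hx, hy]
  algebraMap_mem' c := differential_algebraMap c

/-- The two-sided ideal of coboundaries. -/
def coboundaries : Ideal (cocycles k A) where
  carrier := {z | ∃ w, differential k A w = z}
  add_mem' := by
    rintro a b ⟨x, hx⟩ ⟨y, hy⟩
    exact ⟨x + y, by simp [hx, hy]⟩
  zero_mem' := ⟨0, by simp⟩
  smul_mem' := by
    rintro ⟨c, hc⟩ ⟨b, hb⟩ ⟨x, hx⟩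
    refine ⟨signAut k A c * x, ?_⟩
    change differential k A c = 0 at hc
    simp [differential_mul, differential_signAut, hc, signAut_signAut, hx]

instance : (coboundaries k A).IsTwoSided where
  mul_mem_of_left := by
    rintro ⟨a, ha⟩ ⟨b, hb⟩ ⟨x, hx⟩
    refine ⟨x * b, ?_⟩
    change differential k A b = 0 at hb
    simp [differential_mul, hb, hx]

/-- The cohomology ring `H^•(G, k)`, for `A = k[G]`. -/
abbrev Cohomology : Type _ := cocycles k A ⧸ coboundaries k A

variable {k A}

/-- The class `h` is represented by the cocycle `z`. -/
def Represents (z : TensorAlgebra k A) (h : Cohomology k A) : Prop :=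
  ∃ hz : z ∈ cocycles k A, Ideal.Quotient.mk (coboundaries k A) ⟨z, hz⟩ = h

variable (k A)
/-- The part of cohomological degree `n` and internal superdegree `e`: the classes of the cocycles
in `A^{⊗ n}` that are even (for `e = 0`) or odd (for `e = 1`). -/
def homogeneousPart (n : ℕ) (e : ZMod 2) : Submodule k (Cohomology k A) :=
  ((LinearMap.range (TensorAlgebra.ι k (M := A)) ^ n ⊓
    LinearMap.ker ((cochainMap (parity (k := k) (A := A))).toLinearMap
      - (if e = 0 then (1 : k) else -1) • LinearMap.id)).comap
    (cocycles k A).val.toLinearMap).map (Ideal.Quotient.mkₐ k (coboundaries k A)).toLinearMap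

end

section map
variable {k A B : Type*} [Field k] [AddCommGroup A] [Module k A] [UnitalSupercoalgebra k A]
  [AddCommGroup B] [Module k B] [UnitalSupercoalgebra k B] (f : Hom k A B)

lemma differential_map (t : TensorAlgebra k A) :
    differential k B (cochainMap f.toLin t) =
      cochainMap f.toLin (differential k A t) := by
  have hs : ∀ t, signAut k B (cochainMap f.toLin t) =
      cochainMap f.toLin (signAut k A t) := by
    intro t
    have : (signAut k B).comp (cochainMap f.toLin) =
      (cochainMap f.toLin).comp (signAut k A) := by ext; simp [signAut]
    exact DFunLike.congr_fun this t
  induction t using TensorAlgebra.induction with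
  | algebraMap r => simp [differential_algebraMap]
  | ι a =>
    rw [cochainMap_ι, differential_ι, differential_ι]
    have : ∀ z : A ⊗[k] A, cochainMap f.toLin (tensorTwo k A z) =
        tensorTwo k B (TensorProduct.map f.toLin f.toLin z) := by
      intro z
      induction z with
      | zero => simp
      | add x y hx hy => simp only [map_add, hx, hy]
      | tmul x y => simp [tensorTwo]
    simp [differentialOne, this, f.map_unit, f.map_comul]
  | mul a b ha hb => simp [differential_mul, ha, hb, hs]
  | add a b ha hb => simp [ha, hb]

/-- The map on cocycles induced by a homomorphism. -/
def cocyclesMap : cocycles k A →ₐ[k] cocycles k B :=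
  ((cochainMap f.toLin).comp (cocycles k A).val).codRestrict _ fun z => by
    have hz : differential k A z = 0 := z.2
    change differential k B (cochainMap f.toLin z) = 0
    rw [differential_map, hz, map_zero]

/-- The homomorphism of cohomology rings induced by a homomorphism `A → B`. -/
def cohomologyMap : Cohomology k A →ₐ[k] Cohomology k B :=
  Ideal.quotientMapₐ (coboundaries k B) (cocyclesMap f) (by
    rintro z ⟨w, hw⟩
    exact ⟨cochainMap f.toLin w, by rw [differential_map, hw]; rfl⟩)

end map
end Hochschild

/-! ### The coordinate superalgebras `k[𝕄_r]` and `k[𝕄_{r;s}]`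

`k[𝕄_r]` is the commutative superalgebra generated by the odd element `τ` (with `τ² = 0`) and the
even elements `θ`, `σ_i`. It is `B ⊗ Λ(τ) = B ⊕ B τ`, where `B` is the commutative algebra with the
even generators and relations, so it is realised as the dual numbers over `B` with `ε = τ`. -/

namespace MultiparameterSupergroup
open Finset.HasAntidiagonal (antidiagonal mem_antidiagonal)

/-- Generators of the even part of `k[𝕄_r]`. -/
inductive EvenGen
  | theta
  | sigma (i : ℕ)

section
variable (k : Type*) [Field k] (p r : ℕ)

open MvPolynomial in
/-- The relations `σ_0 = 1`, `θ^{p^{r-1}} = σ_1`, `σ_i σ_j = (i+j choose i) σ_{i+j}`. -/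
def evenRelations : Set (MvPolynomial EvenGen k) :=
  {X (EvenGen.sigma 0) - 1} ∪ {X EvenGen.theta ^ p ^ (r - 1) - X (EvenGen.sigma 1)} ∪
    Set.range fun ij : ℕ × ℕ => X (EvenGen.sigma ij.1) * X (EvenGen.sigma ij.2) -
      C (((ij.1 + ij.2).choose ij.1 : ℕ) : k) * X (EvenGen.sigma (ij.1 + ij.2))

/-- The even part of `k[𝕄_r]`. -/
def EvenCoord : Type _ := MvPolynomial EvenGen k ⧸ Ideal.span (evenRelations k p r)

instance : CommRing (EvenCoord k p r) :=
  inferInstanceAs (CommRing (MvPolynomial EvenGen k ⧸ Ideal.span (evenRelations k p r)))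

instance : Algebra k (EvenCoord k p r) :=
  inferInstanceAs (Algebra k (MvPolynomial EvenGen k ⧸ Ideal.span (evenRelations k p r)))

/-- The coordinate superalgebra `k[𝕄_r]`. -/
def Coord : Type _ := DualNumber (EvenCoord k p r)

instance : CommRing (Coord k p r) := inferInstanceAs (CommRing (DualNumber (EvenCoord k p r)))

instance : Algebra k (Coord k p r) := inferInstanceAs (Algebra k (DualNumber (EvenCoord k p r)))

/-- The quotient map onto the even part. -/
def evenMk : MvPolynomial EvenGen k →ₐ[k] EvenCoord k p r := Ideal.Quotient.mkₐ k _

/-- The inclusion of the even part. -/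
def evenIncl : EvenCoord k p r →ₐ[k] Coord k p r := TrivSqZeroExt.inlAlgHom k _ _

/-- The projection onto the even part, `a + b τ ↦ a`. -/
def evenPart : Coord k p r →ₐ[k] EvenCoord k p r := TrivSqZeroExt.fstHom k _ _

/-- The coefficient of `τ`, `a + b τ ↦ b`. -/
def oddPart : Coord k p r →ₗ[k] EvenCoord k p r :=
  (TrivSqZeroExt.sndHom (EvenCoord k p r) (EvenCoord k p r)).restrictScalars k

variable {k p r}
/-- `θ` in the even part. -/
def evenTheta : EvenCoord k p r := evenMk k p r (MvPolynomial.X EvenGen.theta)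
/-- `σ_i` in the even part. -/
def evenSigma (i : ℕ) : EvenCoord k p r := evenMk k p r (MvPolynomial.X (EvenGen.sigma i))
/-- The even generator `θ`. -/
def theta : Coord k p r := evenIncl k p r evenTheta
/-- The even generator `σ_i`. -/
def sigma (i : ℕ) : Coord k p r := evenIncl k p r (evenSigma i)
/-- The odd generator `τ`. -/
def tau : Coord k p r := (DualNumber.eps : DualNumber (EvenCoord k p r))

lemma evenMk_eq {a b : MvPolynomial EvenGen k} (h : a - b ∈ evenRelations k p r) :
    evenMk k p r a = evenMk k p r b :=
  Ideal.Quotient.eq.mpr (Ideal.subset_span h)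

lemma evenSigma_zero : (evenSigma 0 : EvenCoord k p r) = 1 := by
  rw [evenSigma, ← map_one (evenMk k p r)]
  exact evenMk_eq (Or.inl (Or.inl rfl))

lemma evenTheta_pow : (evenTheta : EvenCoord k p r) ^ p ^ (r - 1) = evenSigma 1 := by
  rw [evenSigma, evenTheta, ← map_pow]
  exact evenMk_eq (Or.inl (Or.inr rfl))

lemma evenSigma_mul (i j : ℕ) : (evenSigma i * evenSigma j : EvenCoord k p r) =
    ((i + j).choose i : k) • evenSigma (i + j) := by
  rw [evenSigma, evenSigma, evenSigma, ← map_mul, ← map_smul, MvPolynomial.smul_eq_C_mul]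
  exact evenMk_eq (Or.inr ⟨(i, j), rfl⟩)

/-- The function on generators with values `t` and `s i`. -/
def evenGenMap {R : Type*} (t : R) (s : ℕ → R) : EvenGen → R
  | EvenGen.theta => t
  | EvenGen.sigma i => s i

/-- An algebra homomorphism out of the even part, from images of the generators. -/
def evenLift {R : Type*} [CommRing R] [Algebra k R] (t : R) (s : ℕ → R) (h0 : s 0 = 1)
    (h1 : t ^ p ^ (r - 1) = s 1)
    (hs : ∀ i j, s i * s j = ((i + j).choose i : k) • s (i + j)) : EvenCoord k p r →ₐ[k] R :=
  Ideal.Quotient.liftₐ _ (MvPolynomial.aeval (evenGenMap t s)) (by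
      intro a ha
      rw [← RingHom.mem_ker]
      revert a
      change Ideal.span _ ≤ _
      rw [Ideal.span_le]
      rintro _ ((rfl | rfl) | ⟨⟨i, j⟩, rfl⟩)
      · simp [RingHom.mem_ker, evenGenMap, h0]
      · simp [RingHom.mem_ker, evenGenMap, h1]
      · simp [RingHom.mem_ker, evenGenMap, hs, Algebra.smul_def])

section lift
variable {R : Type*} [CommRing R] [Algebra k R] (t : R) (s : ℕ → R) (h0 : s 0 = 1)
    (h1 : t ^ p ^ (r - 1) = s 1)
    (hs : ∀ i j, s i * s j = ((i + j).choose i : k) • s (i + j))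
@[simp] lemma evenLift_theta : evenLift t s h0 h1 hs (evenTheta : EvenCoord k p r) = t :=
  MvPolynomial.aeval_X (R := k) (evenGenMap t s) EvenGen.theta
@[simp] lemma evenLift_sigma (i : ℕ) :
    evenLift t s h0 h1 hs (evenSigma i : EvenCoord k p r) = s i :=
  MvPolynomial.aeval_X (R := k) (evenGenMap t s) (EvenGen.sigma i)
end lift

lemma even_algHom_ext {R : Type*} [Semiring R] [Algebra k R] {f g : EvenCoord k p r →ₐ[k] R}
    (ht : f evenTheta = g evenTheta) (hs : ∀ i, f (evenSigma i) = g (evenSigma i)) : f = g := by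
  apply Ideal.Quotient.algHom_ext
  apply MvPolynomial.algHom_ext
  rintro (_ | i)
  · exact ht
  · exact hs i

variable (k p r)
/-- The coproduct of `σ_n`,
`∑_{u+v=n} σ_u ⊗ σ_v + ∑_{u+v+p=n} σ_u τ ⊗ σ_v τ`. -/
def comulSigma (n : ℕ) : Coord k p r ⊗[k] Coord k p r :=
  ∑ ij ∈ antidiagonal n, sigma ij.1 ⊗ₜ[k] sigma ij.2 +
    if p ≤ n then ∑ ij ∈ antidiagonal (n - p),
      (sigma ij.1 * tau) ⊗ₜ[k] (sigma ij.2 * tau) else 0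

variable {k p r}

lemma tau_mul_tau : (tau * tau : Coord k p r) = 0 :=
  (DualNumber.eps_mul_eps : (DualNumber.eps * DualNumber.eps : DualNumber (EvenCoord k p r)) = 0)

lemma dualNumber_eq {R : Type*} [CommRing R] (a : DualNumber R) :
    a = TrivSqZeroExt.inl a.fst + TrivSqZeroExt.inl a.snd * DualNumber.eps := by
  ext <;> simp

lemma dualNumber_snd_inl_mul {R : Type*} [CommRing R] (b : R) (a : DualNumber R) :
    TrivSqZeroExt.snd (TrivSqZeroExt.inl b * a) = b * a.snd := by
  simp

lemma coord_eq (a : Coord k p r) : a = evenIncl k p r (evenPart k p r a) +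
    evenIncl k p r (oddPart k p r a) * tau :=
  dualNumber_eq (R := EvenCoord k p r) a

@[simp] lemma evenPart_incl (b : EvenCoord k p r) : evenPart k p r (evenIncl k p r b) = b := rfl

@[simp] lemma oddPart_incl (b : EvenCoord k p r) : oddPart k p r (evenIncl k p r b) = 0 := rfl

@[simp] lemma evenPart_tau : evenPart k p r tau = 0 := rfl

@[simp] lemma oddPart_incl_mul (b : EvenCoord k p r) (a : Coord k p r) :
    oddPart k p r (evenIncl k p r b * a) = b * oddPart k p r a :=
  dualNumber_snd_inl_mul (R := EvenCoord k p r) b a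

@[simp] lemma oddPart_tau : oddPart k p r tau = 1 := rfl

lemma sigma_zero : (sigma 0 : Coord k p r) = 1 := by
  simp [sigma, evenSigma_zero]

lemma theta_pow : (theta : Coord k p r) ^ p ^ (r - 1) = sigma 1 := by
  rw [theta, sigma, ← evenTheta_pow, map_pow]

lemma sigma_mul (i j : ℕ) : (sigma i * sigma j : Coord k p r) =
    ((i + j).choose i : k) • sigma (i + j) := by
  rw [sigma, sigma, sigma, ← map_mul, evenSigma_mul, map_smul]

/-- Vandermonde convolution for two divided power sequences. -/
lemma divPow_conv {R : Type*} [CommRing R] [Algebra k R] (a b : ℕ → R)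
    (ha : ∀ i j, a i * a j = ((i + j).choose i : k) • a (i + j))
    (hb : ∀ i j, b i * b j = ((i + j).choose i : k) • b (i + j)) (i j : ℕ) :
    (∑ x ∈ antidiagonal i, a x.1 * b x.2) * (∑ x ∈ antidiagonal j, a x.1 * b x.2) =
      ((i + j).choose i : k) • ∑ x ∈ antidiagonal (i + j), a x.1 * b x.2 := by
  rw [Finset.sum_mul_sum, ← Finset.sum_product', Finset.smul_sum]
  have h : ∀ x ∈ antidiagonal (i + j), ((i + j).choose i : k) • (a x.1 * b x.2) =
      ∑ y ∈ antidiagonal i, ((x.1.choose y.1 * x.2.choose y.2 : ℕ) : k) •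
        (a x.1 * b x.2) := by
    intro x hx
    rw [← Finset.sum_smul, ← mem_antidiagonal.mp hx, Nat.add_choose_eq]
    push_cast
    rfl
  rw [Finset.sum_congr rfl h, ← Finset.sum_product']
  refine Finset.sum_of_injOn (fun x => ((x.1.1 + x.2.1, x.1.2 + x.2.2), x.1)) ?_ ?_ ?_ ?_
  · rintro ⟨⟨u, v⟩, ⟨u', v'⟩⟩ _ ⟨⟨w, z⟩, ⟨w', z'⟩⟩ _ h
    simp only [Prod.mk.injEq] at h ⊢
    omega
  · rintro ⟨⟨u, v⟩, ⟨u', v'⟩⟩ h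
    simp only [Finset.coe_product, Set.mem_prod, Finset.mem_coe, mem_antidiagonal] at h ⊢
    omega
  · rintro ⟨⟨m, n⟩, ⟨u, v⟩⟩ h h'
    simp only [Finset.mem_product, mem_antidiagonal] at h
    by_cases hu : u ≤ m
    · by_cases hv : v ≤ n
      · refine absurd ⟨((u, v), (m - u, n - v)), ?_, ?_⟩ h'
        · simp only [Finset.coe_product, Set.mem_prod, Finset.mem_coe, mem_antidiagonal]
          refine ⟨h.2, ?_⟩
          have h3 : m + n = i + j := h.1
          have h4 : u + v = i := h.2
          change m - u + (n - v) = j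
          omega
        · refine Prod.ext (Prod.ext ?_ ?_) rfl
          · exact Nat.add_sub_cancel' hu
          · exact Nat.add_sub_cancel' hv
      · simp [Nat.choose_eq_zero_of_lt (not_le.mp hv)]
    · simp [Nat.choose_eq_zero_of_lt (not_le.mp hu)]
  · rintro ⟨⟨u, v⟩, ⟨u', v'⟩⟩ _
    simp only
    rw [mul_mul_mul_comm, ha, hb]
    rw [smul_mul_smul_comm]
    push_cast
    rfl

lemma comulSigma_eq (n : ℕ) : comulSigma k p r n =
    ∑ ij ∈ antidiagonal n, (sigma ij.1 ⊗ₜ[k] 1) * ((1 : Coord k p r) ⊗ₜ[k] sigma ij.2) +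
    (if p ≤ n then ∑ ij ∈ antidiagonal (n - p),
      (sigma ij.1 ⊗ₜ[k] 1) * ((1 : Coord k p r) ⊗ₜ[k] sigma ij.2) else 0) *
        ((tau : Coord k p r) ⊗ₜ[k] (tau : Coord k p r)) := by
  simp [comulSigma, Finset.sum_mul]

lemma comulSigma_zero [Fact p.Prime] : comulSigma k p r 0 = 1 := by
  have := (Fact.out : p.Prime).pos
  simp [comulSigma, sigma_zero, this.ne', Algebra.TensorProduct.one_def]

lemma comulSigma_one [Fact p.Prime] :
    comulSigma k p r 1 = sigma 1 ⊗ₜ[k] 1 + 1 ⊗ₜ[k] sigma 1 := by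
  have := (Fact.out : p.Prime).one_lt
  have h : ¬ p ≤ 1 := by omega
  simp [comulSigma, sigma_zero, h, Finset.Nat.antidiagonal_succ, add_comm]

lemma choose_sub (k : Type*) [Field k] (p : ℕ) [Fact p.Prime] [CharP k p] (n i : ℕ) (hn : p ≤ n) :
    (n.choose i : k) = ((n - p).choose i : k) + if p ≤ i then ((n - p).choose (i - p) : k) else 0 := by
  have h : (1 + Polynomial.X : Polynomial k) ^ n =
      (1 + Polynomial.X) ^ (n - p) + Polynomial.X ^ p * (1 + Polynomial.X) ^ (n - p) := by
    have h2 : (1 + Polynomial.X : Polynomial k) ^ p = 1 + Polynomial.X ^ p := by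
      rw [add_pow_char, one_pow]
    conv_lhs => rw [← Nat.sub_add_cancel hn, pow_add, h2]
    ring
  have := congrArg (fun q => Polynomial.coeff q i) h
  simp only [Polynomial.coeff_add, Polynomial.coeff_one_add_X_pow, Polynomial.coeff_X_pow_mul'] at this
  exact this

lemma comulSigma_mul [Fact p.Prime] [CharP k p] (i j : ℕ) :
    comulSigma k p r i * comulSigma k p r j =
      ((i + j).choose i : k) • comulSigma k p r (i + j) := by
  set a : ℕ → Coord k p r ⊗[k] Coord k p r := fun i => sigma i ⊗ₜ[k] 1
  set b : ℕ → Coord k p r ⊗[k] Coord k p r := fun i => 1 ⊗ₜ[k] sigma i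
  set S : ℕ → Coord k p r ⊗[k] Coord k p r := fun n =>
    ∑ x ∈ antidiagonal n, a x.1 * b x.2
  set w : Coord k p r ⊗[k] Coord k p r := tau ⊗ₜ[k] tau
  have hw : w * w = 0 := by simp [w, tau_mul_tau]
  have hS : ∀ i j, S i * S j = ((i + j).choose i : k) • S (i + j) := by
    apply divPow_conv
    · intro i j
      simp [a, sigma_mul, TensorProduct.smul_tmul']
    · intro i j
      simp [b, sigma_mul, TensorProduct.tmul_smul]
  have hc : ∀ n, comulSigma k p r n = S n + (if p ≤ n then S (n - p) else 0) * w :=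
    fun n => comulSigma_eq n
  have e : ∀ x x' y y' : Coord k p r ⊗[k] Coord k p r,
      (x + x' * w) * (y + y' * w) = x * y + (x * y' + x' * y) * w := by
    intro x x' y y'
    linear_combination x' * y' * hw
  rw [hc, hc, hc, e, hS, smul_add, ← smul_mul_assoc]
  congr 2
  by_cases hij : p ≤ i + j
  · rw [if_pos hij, choose_sub k p (i + j) i hij, add_smul]
    congr 1
    · by_cases hj : p ≤ j
      · rw [if_pos hj, hS, Nat.add_sub_assoc hj]
      · rw [if_neg hj, Nat.choose_eq_zero_of_lt (by omega)]
        simp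
    · by_cases hi : p ≤ i
      · rw [if_pos hi, if_pos hi, hS]
        have : i + j - p = i - p + j := by omega
        rw [this]
      · simp [if_neg hi]
  · have hi : ¬ p ≤ i := by omega
    have hj : ¬ p ≤ j := by omega
    simp [hi, hj, hij]

variable (k p r)
/-- The augmentation of the even part. -/
def evenCounit [Fact p.Prime] : EvenCoord k p r →ₐ[k] k :=
  evenLift 0 (fun i => if i = 0 then 1 else 0) (by simp)
    (by simp [(Fact.out : p.Prime).ne_zero]) (by
      intro i j
      by_cases hi : i = 0
      · by_cases hj : j = 0 <;> simp [hi, hj]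
      · simp [hi])

variable {k p r}
instance [Fact p.Prime] : Nontrivial (EvenCoord k p r) := (evenCounit k p r).toRingHom.domain_nontrivial

variable (k p r) in
/-- The counit of `k[𝕄_r]`. -/
def counitHom [Fact p.Prime] : Coord k p r →ₐ[k] k :=
  (evenCounit k p r).comp (evenPart k p r)

lemma comulTheta_pow [Fact p.Prime] [CharP k p] :
    ((theta : Coord k p r) ⊗ₜ[k] (1 : Coord k p r) + 1 ⊗ₜ[k] theta) ^ p ^ (r - 1) =
      comulSigma k p r 1 := by
  have : Nontrivial (Coord k p r ⊗[k] Coord k p r) :=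
    (Algebra.TensorProduct.lift (counitHom k p r) (counitHom k p r)
      (fun _ _ => Commute.all _ _)).toRingHom.domain_nontrivial
  have : CharP (Coord k p r ⊗[k] Coord k p r) p :=
    charP_of_injective_algebraMap (algebraMap k _).injective p
  rw [add_pow_char_pow, Algebra.TensorProduct.tmul_pow, Algebra.TensorProduct.tmul_pow, theta_pow,
    comulSigma_one, one_pow]

variable (k p r) in
/-- The coproduct on the even part: the algebra homomorphism with `θ ↦ θ ⊗ 1 + 1 ⊗ θ` and
`σ_n ↦ comulSigma n`. Its values lie in the span of `B ⊗ B` and `B τ ⊗ B τ`; on these the products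
needed here are the same in the super tensor product and in the ordinary one, since
`(τ ⊗ τ)² = 0` in both. -/
def evenComul [Fact p.Prime] [CharP k p] : EvenCoord k p r →ₐ[k] Coord k p r ⊗[k] Coord k p r :=
  evenLift (theta ⊗ₜ[k] 1 + 1 ⊗ₜ[k] theta) (comulSigma k p r) comulSigma_zero comulTheta_pow
    comulSigma_mul

variable (k p r) in
/-- The coproduct, `Δ(a + b τ) = Δ(a) + Δ(b) (τ ⊗ 1 + 1 ⊗ τ)`. This is the homomorphism of
superalgebras for which `τ` and `θ` are primitive and `Δ(σ_n)` is `comulSigma n`. (The sign rule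
does not intervene: `(τ ⊗ τ)(τ ⊗ 1 + 1 ⊗ τ) = 0`, and `B ⊗ B` is even.) -/
def comulLin [Fact p.Prime] [CharP k p] : Coord k p r →ₗ[k] Coord k p r ⊗[k] Coord k p r :=
  (evenComul k p r).toLinearMap ∘ₗ (evenPart k p r).toLinearMap +
    LinearMap.mulRight k (tau ⊗ₜ[k] 1 + 1 ⊗ₜ[k] tau) ∘ₗ (evenComul k p r).toLinearMap ∘ₗ
      oddPart k p r

variable (k p r) in
/-- The parity automorphism, `a + b τ ↦ a - b τ`. -/
def parityHom : Coord k p r →ₐ[k] Coord k p r :=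
  DualNumber.lift ⟨(evenIncl k p r, -tau),
    by simp [tau_mul_tau], fun _ => Commute.all _ _⟩

end
end MultiparameterSupergroup

namespace MultiparameterSupergroup
open Finset.HasAntidiagonal (antidiagonal mem_antidiagonal)

section
variable {k : Type*} [Field k] {p r : ℕ}

lemma even_span (b : EvenCoord k p r) :
    b ∈ Submodule.span k (Set.range fun ij : ℕ × ℕ =>
      (evenTheta ^ ij.1 * evenSigma ij.2 : EvenCoord k p r)) := by
  obtain ⟨q, rfl⟩ : ∃ q, evenMk k p r q = b := Ideal.Quotient.mk_surjective b
  induction q using MvPolynomial.induction_on with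
  | C a =>
    have : evenMk k p r (MvPolynomial.C a) = a • (evenTheta ^ 0 * evenSigma 0) := by
      rw [pow_zero, one_mul, evenSigma_zero, ← map_one (evenMk k p r), ← map_smul,
        MvPolynomial.smul_eq_C_mul, mul_one]
    rw [this]
    exact Submodule.smul_mem _ _ (Submodule.subset_span ⟨(0, 0), rfl⟩)
  | add x y hx hy => rw [map_add]; exact add_mem hx hy
  | mul_X q n hq =>
    rw [map_mul]
    generalize evenMk k p r q = c at hq
    induction hq using Submodule.span_induction with
    | zero => simp
    | add x y _ _ hx hy => rw [add_mul]; exact add_mem hx hy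
    | smul a x _ hx => rw [smul_mul_assoc]; exact Submodule.smul_mem _ _ hx
    | mem x hx =>
      obtain ⟨⟨i, j⟩, rfl⟩ := hx
      cases n with
      | theta =>
        exact Submodule.subset_span ⟨(i + 1, j), by
          change evenTheta ^ (i + 1) * evenSigma j = evenTheta ^ i * evenSigma j * evenTheta
          ring⟩
      | sigma l =>
        change evenTheta ^ i * evenSigma j * evenSigma l ∈ _
        rw [mul_assoc, evenSigma_mul, mul_smul_comm]
        exact Submodule.smul_mem _ _ (Submodule.subset_span ⟨(i, j + l), rfl⟩)

lemma coeff_conv {R : Type*} [CommRing R] (a b : ℕ → R) (c : R) (n : ℕ) :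
    PowerSeries.coeff n (PowerSeries.mk a * PowerSeries.mk b *
      (1 + PowerSeries.X ^ p * PowerSeries.C c)) =
    ∑ x ∈ antidiagonal n, a x.1 * b x.2 +
      (if p ≤ n then ∑ x ∈ antidiagonal (n - p), a x.1 * b x.2 * c else 0) := by
  have : (PowerSeries.mk a * PowerSeries.mk b * (1 + PowerSeries.X ^ p * PowerSeries.C c)) =
    PowerSeries.mk a * PowerSeries.mk b +
      PowerSeries.X ^ p * (PowerSeries.mk a * PowerSeries.mk b * PowerSeries.C c) := by ring
  rw [this, map_add, PowerSeries.coeff_X_pow_mul', PowerSeries.coeff_mul,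
    PowerSeries.coeff_mul_C, PowerSeries.coeff_mul, Finset.sum_mul]
  simp

section
variable [Fact p.Prime] [CharP k p]

@[simp] lemma evenComul_theta : evenComul k p r evenTheta = theta ⊗ₜ[k] 1 + 1 ⊗ₜ[k] theta :=
  evenLift_theta ..

@[simp] lemma evenComul_sigma (i : ℕ) : evenComul k p r (evenSigma i) = comulSigma k p r i :=
  evenLift_sigma ..

lemma comul_incl (b : EvenCoord k p r) : comulLin k p r (evenIncl k p r b) = evenComul k p r b := by
  simp [comulLin]

lemma comul_incl_mul (b : EvenCoord k p r) (a : Coord k p r) :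
    comulLin k p r (evenIncl k p r b * a) = evenComul k p r b * comulLin k p r a := by
  simp [comulLin, mul_add, mul_assoc]

lemma comul_tau : comulLin k p r tau = tau ⊗ₜ[k] 1 + 1 ⊗ₜ[k] tau := by
  simp [comulLin]

lemma comul_sigma (i : ℕ) : comulLin k p r (sigma i) = comulSigma k p r i := by
  rw [sigma, comul_incl, evenComul_sigma]

lemma comul_theta : comulLin k p r theta = theta ⊗ₜ[k] 1 + 1 ⊗ₜ[k] theta := by
  exact (comul_incl _).trans evenComul_theta

lemma comul_one : comulLin k p r 1 = 1 ⊗ₜ[k] 1 := by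
  rw [← map_one (evenIncl k p r), comul_incl, map_one, map_one]; rfl

lemma comul_theta_mul (a : Coord k p r) : comulLin k p r (theta * a) =
    (theta ⊗ₜ[k] 1 + 1 ⊗ₜ[k] theta) * comulLin k p r a := by
  exact (comul_incl_mul _ _).trans (by rw [evenComul_theta])

lemma comul_sigma_mul (i : ℕ) (a : Coord k p r) : comulLin k p r (sigma i * a) =
    comulSigma k p r i * comulLin k p r a := by
  rw [sigma, comul_incl_mul, evenComul_sigma]

variable (k p r) in
/-- The threefold tensor power. -/
abbrev W3 : Type _ := Coord k p r ⊗[k] (Coord k p r ⊗[k] Coord k p r)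

variable (k p r) in
/-- `(Δ ⊗ 1)`, with values in `A ⊗ (A ⊗ A)`. -/
def comulLeft : Coord k p r ⊗[k] Coord k p r →ₗ[k] W3 k p r :=
  (TensorProduct.assoc k _ _ _).toLinearMap ∘ₗ (comulLin k p r).rTensor _

variable (k p r) in
/-- `(1 ⊗ Δ)`. -/
def comulRight : Coord k p r ⊗[k] Coord k p r →ₗ[k] W3 k p r :=
  (comulLin k p r).lTensor _

variable (k p r) in
/-- `x ⊗ y ↦ x ⊗ y ⊗ 1`. -/
def incl12 : Coord k p r ⊗[k] Coord k p r →ₐ[k] W3 k p r :=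
  (Algebra.TensorProduct.assoc k k k _ _ _).toAlgHom.comp Algebra.TensorProduct.includeLeft

variable (k p r) in
/-- `x ⊗ y ↦ 1 ⊗ x ⊗ y`. -/
def incl23 : Coord k p r ⊗[k] Coord k p r →ₐ[k] W3 k p r :=
  Algebra.TensorProduct.includeRight

@[simp] lemma incl12_tmul (x y : Coord k p r) :
    incl12 k p r (x ⊗ₜ y) = x ⊗ₜ (y ⊗ₜ 1) := by
  simp [incl12]

@[simp] lemma incl23_tmul (x y : Coord k p r) :
    incl23 k p r (x ⊗ₜ y) = 1 ⊗ₜ (x ⊗ₜ y) := by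
  simp [incl23]

lemma comulLeft_tmul (x y : Coord k p r) : comulLeft k p r (x ⊗ₜ y) =
    incl12 k p r (comulLin k p r x) * (1 ⊗ₜ (1 ⊗ₜ y)) := by
  simp only [comulLeft, incl12, LinearMap.comp_apply, LinearMap.rTensor_tmul]
  generalize comulLin k p r x = z
  induction z with
  | zero => simp
  | add a b ha hb => simp only [TensorProduct.add_tmul, map_add, ha, hb, add_mul]
  | tmul a b => simp

lemma comulRight_tmul (x y : Coord k p r) : comulRight k p r (x ⊗ₜ y) =
    (x ⊗ₜ (1 ⊗ₜ 1)) * incl23 k p r (comulLin k p r y) := by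
  simp [comulRight, incl23, ← Algebra.TensorProduct.one_def]

lemma comulLeft_theta_mul (z : Coord k p r ⊗[k] Coord k p r) :
    comulLeft k p r ((theta ⊗ₜ[k] 1 + 1 ⊗ₜ[k] theta) * z) =
      (theta ⊗ₜ (1 ⊗ₜ 1) + 1 ⊗ₜ (theta ⊗ₜ 1) + 1 ⊗ₜ (1 ⊗ₜ theta)) * comulLeft k p r z := by
  induction z with
  | zero => simp
  | add a b ha hb => simp only [mul_add, map_add, ha, hb]
  | tmul a b =>
    simp only [add_mul, Algebra.TensorProduct.tmul_mul_tmul, one_mul, map_add, comulLeft_tmul,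
      comul_theta_mul, map_mul]
    have h : (1 : Coord k p r) ⊗ₜ[k] ((1 : Coord k p r) ⊗ₜ[k] (theta * b)) =
      (1 ⊗ₜ (1 ⊗ₜ theta)) * (1 ⊗ₜ (1 ⊗ₜ b)) := by simp
    rw [h, incl12_tmul, incl12_tmul]
    ring

lemma comulRight_theta_mul (z : Coord k p r ⊗[k] Coord k p r) :
    comulRight k p r ((theta ⊗ₜ[k] 1 + 1 ⊗ₜ[k] theta) * z) =
      (theta ⊗ₜ (1 ⊗ₜ 1) + 1 ⊗ₜ (theta ⊗ₜ 1) + 1 ⊗ₜ (1 ⊗ₜ theta)) * comulRight k p r z := by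
  induction z with
  | zero => simp
  | add a b ha hb => simp only [mul_add, map_add, ha, hb]
  | tmul a b =>
    simp only [add_mul, Algebra.TensorProduct.tmul_mul_tmul, one_mul, map_add, comulRight_tmul,
      comul_theta_mul, map_mul]
    have h : (theta * a) ⊗ₜ[k] ((1 : Coord k p r) ⊗ₜ[k] (1 : Coord k p r)) =
      (theta ⊗ₜ (1 ⊗ₜ 1)) * (a ⊗ₜ (1 ⊗ₜ 1)) := by simp
    rw [h, incl23_tmul, incl23_tmul]
    ring

variable (k p r) in
def t1 : W3 k p r := tau ⊗ₜ (1 ⊗ₜ 1)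
variable (k p r) in
def t2 : W3 k p r := 1 ⊗ₜ (tau ⊗ₜ 1)
variable (k p r) in
def t3 : W3 k p r := 1 ⊗ₜ (1 ⊗ₜ tau)
variable (k p r) in
def s1 (i : ℕ) : W3 k p r := sigma i ⊗ₜ (1 ⊗ₜ 1)
variable (k p r) in
def s2 (i : ℕ) : W3 k p r := 1 ⊗ₜ (sigma i ⊗ₜ 1)
variable (k p r) in
def s3 (i : ℕ) : W3 k p r := 1 ⊗ₜ (1 ⊗ₜ sigma i)

lemma t1_sq : t1 k p r * t1 k p r = 0 := by simp [t1, tau_mul_tau]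
lemma t2_sq : t2 k p r * t2 k p r = 0 := by simp [t2, tau_mul_tau]
lemma t3_sq : t3 k p r * t3 k p r = 0 := by simp [t3, tau_mul_tau]

lemma incl12_comulSigma (n : ℕ) : incl12 k p r (comulSigma k p r n) =
    PowerSeries.coeff n (PowerSeries.mk (s1 k p r) * PowerSeries.mk (s2 k p r) *
      (1 + PowerSeries.X ^ p * PowerSeries.C (t1 k p r * t2 k p r))) := by
  rw [coeff_conv, comulSigma, map_add, map_sum, apply_ite (incl12 k p r), map_sum, map_zero]
  simp [s1, s2, t1, t2]

lemma incl23_comulSigma (n : ℕ) : incl23 k p r (comulSigma k p r n) =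
    PowerSeries.coeff n (PowerSeries.mk (s2 k p r) * PowerSeries.mk (s3 k p r) *
      (1 + PowerSeries.X ^ p * PowerSeries.C (t2 k p r * t3 k p r))) := by
  rw [coeff_conv, comulSigma, map_add, map_sum, apply_ite (incl23 k p r), map_sum, map_zero]
  simp [s2, s3, t2, t3]

variable (k p r) in
/-- The generating series `∑ Δ(σ_n) Xⁿ` pushed to the first two factors. -/
def P12 : PowerSeries (W3 k p r) := PowerSeries.mk (s1 k p r) * PowerSeries.mk (s2 k p r) *
      (1 + PowerSeries.X ^ p * PowerSeries.C (t1 k p r * t2 k p r))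
variable (k p r) in
def P23 : PowerSeries (W3 k p r) := PowerSeries.mk (s2 k p r) * PowerSeries.mk (s3 k p r) *
      (1 + PowerSeries.X ^ p * PowerSeries.C (t2 k p r * t3 k p r))

lemma mk_coeff {R : Type*} [CommRing R] (f : PowerSeries R) :
    PowerSeries.mk (fun n => PowerSeries.coeff n f) = f := by ext; simp

lemma comulLeft_sigma (n : ℕ) : comulLeft k p r (comulSigma k p r n) =
    PowerSeries.coeff n (P12 k p r * PowerSeries.mk (s3 k p r) *
      (1 + PowerSeries.X ^ p * PowerSeries.C ((t1 k p r + t2 k p r) * t3 k p r))) := by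
  conv_rhs => rw [← mk_coeff (P12 k p r)]
  rw [coeff_conv, comulSigma, map_add, map_sum, apply_ite (comulLeft k p r), map_sum, map_zero]
  congr 1
  · refine Finset.sum_congr rfl fun x _ => ?_
    rw [comulLeft_tmul, comul_sigma, incl12_comulSigma]
    rfl
  · refine if_congr Iff.rfl (Finset.sum_congr rfl fun x _ => ?_) rfl
    rw [comulLeft_tmul, comul_sigma_mul, map_mul, incl12_comulSigma, comul_tau]
    have h : (1 : Coord k p r) ⊗ₜ[k] ((1 : Coord k p r) ⊗ₜ[k] (sigma x.2 * tau)) =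
      s3 k p r x.2 * t3 k p r := by simp [s3, t3]
    have h' : incl12 k p r (tau ⊗ₜ 1 + 1 ⊗ₜ tau) = t1 k p r + t2 k p r := by
      simp [t1, t2]
    rw [h, h', P12]
    ring

lemma comulRight_sigma (n : ℕ) : comulRight k p r (comulSigma k p r n) =
    PowerSeries.coeff n (PowerSeries.mk (s1 k p r) * P23 k p r *
      (1 + PowerSeries.X ^ p * PowerSeries.C (t1 k p r * (t2 k p r + t3 k p r)))) := by
  conv_rhs => rw [← mk_coeff (P23 k p r)]
  rw [coeff_conv, comulSigma, map_add, map_sum, apply_ite (comulRight k p r), map_sum, map_zero]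
  congr 1
  · refine Finset.sum_congr rfl fun x _ => ?_
    rw [comulRight_tmul, comul_sigma, incl23_comulSigma]
    rfl
  · refine if_congr Iff.rfl (Finset.sum_congr rfl fun x _ => ?_) rfl
    rw [comulRight_tmul, comul_sigma_mul, map_mul, incl23_comulSigma, comul_tau]
    have h : (sigma x.1 * tau : Coord k p r) ⊗ₜ[k] ((1 : Coord k p r) ⊗ₜ[k] (1 : Coord k p r)) =
      s1 k p r x.1 * t1 k p r := by simp [s1, t1]
    have h' : incl23 k p r (tau ⊗ₜ 1 + 1 ⊗ₜ tau) = t2 k p r + t3 k p r := by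
      simp [t2, t3]
    rw [h, h', P23]
    ring

lemma comulSigma_mul_tau (n : ℕ) :
    comulSigma k p r n * (tau ⊗ₜ 1 + 1 ⊗ₜ tau) =
      ∑ x ∈ antidiagonal n, (sigma x.1 * tau) ⊗ₜ[k] sigma x.2 +
      ∑ x ∈ antidiagonal n, sigma x.1 ⊗ₜ[k] (sigma x.2 * tau) := by
  rw [comulSigma_eq]
  have h : ((tau : Coord k p r) ⊗ₜ[k] (tau : Coord k p r)) * (tau ⊗ₜ 1 + 1 ⊗ₜ tau) = 0 := by
    simp [mul_add, tau_mul_tau]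
  rw [add_mul, mul_assoc _ _ (tau ⊗ₜ 1 + 1 ⊗ₜ tau), h, mul_zero, add_zero, mul_add,
    Finset.sum_mul, Finset.sum_mul]
  simp

lemma coeff_conv' {R : Type*} [CommRing R] (a b : ℕ → R) (c : R) (n : ℕ) :
    PowerSeries.coeff n (PowerSeries.mk a * PowerSeries.mk b * PowerSeries.C c) =
    ∑ x ∈ antidiagonal n, a x.1 * b x.2 * c := by
  rw [PowerSeries.coeff_mul_C, PowerSeries.coeff_mul, Finset.sum_mul]
  simp

lemma comulLeft_sigma_tau (n : ℕ) :
    comulLeft k p r (comulSigma k p r n * (tau ⊗ₜ 1 + 1 ⊗ₜ tau)) =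
    PowerSeries.coeff n (P12 k p r * PowerSeries.mk (s3 k p r) *
      PowerSeries.C (t1 k p r + t2 k p r + t3 k p r)) := by
  rw [comulSigma_mul_tau]
  conv_rhs => rw [← mk_coeff (P12 k p r)]
  rw [coeff_conv', map_add, map_sum, map_sum, ← Finset.sum_add_distrib]
  refine Finset.sum_congr rfl fun x _ => ?_
  rw [comulLeft_tmul, comulLeft_tmul, comul_sigma_mul, map_mul, comul_sigma, incl12_comulSigma,
    comul_tau]
  have h : (1 : Coord k p r) ⊗ₜ[k] ((1 : Coord k p r) ⊗ₜ[k] (sigma x.2 * tau)) =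
    s3 k p r x.2 * t3 k p r := by simp [s3, t3]
  have h2 : (1 : Coord k p r) ⊗ₜ[k] ((1 : Coord k p r) ⊗ₜ[k] (sigma x.2)) =
    s3 k p r x.2 := rfl
  have h' : incl12 k p r (tau ⊗ₜ 1 + 1 ⊗ₜ tau) = t1 k p r + t2 k p r := by
    simp [t1, t2]
  rw [h, h', h2, P12]
  ring

lemma comulRight_sigma_tau (n : ℕ) :
    comulRight k p r (comulSigma k p r n * (tau ⊗ₜ 1 + 1 ⊗ₜ tau)) =
    PowerSeries.coeff n (PowerSeries.mk (s1 k p r) * P23 k p r *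
      PowerSeries.C (t1 k p r + t2 k p r + t3 k p r)) := by
  rw [comulSigma_mul_tau]
  conv_rhs => rw [← mk_coeff (P23 k p r)]
  rw [coeff_conv', map_add, map_sum, map_sum, ← Finset.sum_add_distrib]
  refine Finset.sum_congr rfl fun x _ => ?_
  rw [comulRight_tmul, comulRight_tmul, comul_sigma_mul, map_mul, comul_sigma, incl23_comulSigma,
    comul_tau]
  have h : (sigma x.1 * tau : Coord k p r) ⊗ₜ[k] ((1 : Coord k p r) ⊗ₜ[k] (1 : Coord k p r)) =
      s1 k p r x.1 * t1 k p r := by simp [s1, t1]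
  have h2 : (sigma x.1 : Coord k p r) ⊗ₜ[k] ((1 : Coord k p r) ⊗ₜ[k] (1 : Coord k p r)) =
    s1 k p r x.1 := rfl
  have h' : incl23 k p r (tau ⊗ₜ 1 + 1 ⊗ₜ tau) = t2 k p r + t3 k p r := by
    simp [t2, t3]
  rw [h, h', h2, P23]
  ring

lemma C_sq_zero {R : Type*} [CommRing R] {t : R} (h : t * t = 0) :
    (PowerSeries.C t) * (PowerSeries.C t) = (0 : PowerSeries R) := by
  rw [← map_mul, h, map_zero]

lemma comul_coassoc (a : Coord k p r) :
    comulLeft k p r (comulLin k p r a) = comulRight k p r (comulLin k p r a) := by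
  have e1 := C_sq_zero (t1_sq (k := k) (p := p) (r := r))
  have e2 := C_sq_zero (t2_sq (k := k) (p := p) (r := r))
  have e3 := C_sq_zero (t3_sq (k := k) (p := p) (r := r))
  have hs : ∀ n, comulLeft k p r (comulSigma k p r n) = comulRight k p r (comulSigma k p r n) := by
    intro n
    rw [comulLeft_sigma, comulRight_sigma, P12, P23]
    congr 1
    simp only [map_mul, map_add]
    linear_combination PowerSeries.mk (s1 k p r) * PowerSeries.mk (s2 k p r) *
      PowerSeries.mk (s3 k p r) * PowerSeries.X ^ (2 * p) *
      (PowerSeries.C (t2 k p r) * PowerSeries.C (t3 k p r) * e1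
        - PowerSeries.C (t1 k p r) * PowerSeries.C (t2 k p r) * e3)
  have hst : ∀ n, comulLeft k p r (comulSigma k p r n * (tau ⊗ₜ 1 + 1 ⊗ₜ tau)) =
      comulRight k p r (comulSigma k p r n * (tau ⊗ₜ 1 + 1 ⊗ₜ tau)) := by
    intro n
    rw [comulLeft_sigma_tau, comulRight_sigma_tau, P12, P23]
    congr 1
    simp only [map_mul, map_add]
    linear_combination PowerSeries.mk (s1 k p r) * PowerSeries.mk (s2 k p r) *
      PowerSeries.mk (s3 k p r) * PowerSeries.X ^ p *
      (PowerSeries.C (t2 k p r) * e1 + PowerSeries.C (t1 k p r) * e2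
        - PowerSeries.C (t3 k p r) * e2 - PowerSeries.C (t2 k p r) * e3)
  have hth : ∀ (z : Coord k p r ⊗[k] Coord k p r) (i : ℕ),
      comulLeft k p r z = comulRight k p r z →
      comulLeft k p r ((theta ⊗ₜ[k] 1 + 1 ⊗ₜ[k] theta) ^ i * z) =
      comulRight k p r ((theta ⊗ₜ[k] 1 + 1 ⊗ₜ[k] theta) ^ i * z) := by
    intro z i hz
    induction i with
    | zero => simpa using hz
    | succ i ih => rw [pow_succ', mul_assoc, comulLeft_theta_mul, comulRight_theta_mul, ih]
  have he : ∀ b, comulLeft k p r (evenComul k p r b) = comulRight k p r (evenComul k p r b) ∧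
      comulLeft k p r (evenComul k p r b * (tau ⊗ₜ 1 + 1 ⊗ₜ tau)) =
        comulRight k p r (evenComul k p r b * (tau ⊗ₜ 1 + 1 ⊗ₜ tau)) := by
    intro b
    induction even_span b using Submodule.span_induction with
    | zero => simp
    | add x y _ _ hx hy => simp only [map_add, add_mul, hx.1, hx.2, hy.1, hy.2, and_self]
    | smul c x _ hx => simp only [map_smul, smul_mul_assoc, hx.1, hx.2, and_self]
    | mem x hx =>
      obtain ⟨⟨i, j⟩, rfl⟩ := hx
      simp only [map_mul, map_pow, evenComul_theta, evenComul_sigma, mul_assoc]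
      exact ⟨hth _ _ (hs j), hth _ _ (hst j)⟩
  rw [coord_eq a, map_add, comul_incl, comul_incl_mul, comul_tau, map_add, map_add,
    (he _).1, (he _).2]

@[simp] lemma evenCounit_theta : evenCounit k p r evenTheta = 0 := evenLift_theta ..

@[simp] lemma evenCounit_sigma (i : ℕ) :
    evenCounit k p r (evenSigma i) = if i = 0 then 1 else 0 := evenLift_sigma ..


@[simp] lemma counit_incl (b : EvenCoord k p r) :
    counitHom k p r (evenIncl k p r b) = evenCounit k p r b := rfl

@[simp] lemma counit_theta : counitHom k p r theta = 0 :=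
  evenCounit_theta (k := k) (p := p) (r := r)

@[simp] lemma counit_sigma (i : ℕ) : counitHom k p r (sigma i) = if i = 0 then 1 else 0 :=
  evenCounit_sigma (k := k) (p := p) (r := r) i

@[simp] lemma counit_tau : counitHom k p r tau = 0 := by simp [counitHom]

@[simp] lemma parity_incl (b : EvenCoord k p r) :
    parityHom k p r (evenIncl k p r b) = evenIncl k p r b := by
  exact DualNumber.lift_apply_inl (R := k) _ b
@[simp] lemma parity_tau : parityHom k p r tau = -tau := DualNumber.lift_apply_eps (R := k) _
@[simp] lemma parity_theta : parityHom k p r theta = theta := parity_incl _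
@[simp] lemma parity_sigma (i : ℕ) : parityHom k p r (sigma i) = sigma i := parity_incl _

lemma rTensor_counit (a : Coord k p r) :
    (counitHom k p r).toLinearMap.rTensor _ (comulLin k p r a) = 1 ⊗ₜ[k] a := by
  set F : Coord k p r ⊗[k] Coord k p r →ₐ[k] k ⊗[k] Coord k p r :=
    Algebra.TensorProduct.map (counitHom k p r) (AlgHom.id k _)
  have hF : ∀ z, (counitHom k p r).toLinearMap.rTensor _ z = F z := fun z => rfl
  have h : F.comp (evenComul k p r) =
      (Algebra.TensorProduct.includeRight : Coord k p r →ₐ[k] k ⊗[k] Coord k p r).comp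
        (evenIncl k p r) := by
    apply even_algHom_ext
    · simp [F, theta]
    · intro i
      simp only [AlgHom.comp_apply, evenComul_sigma, comulSigma_eq, F]
      rw [map_add, map_sum, map_mul]
      simp [sigma]
      rw [Finset.sum_eq_single (0, i)]
      · simp
      · rintro ⟨a, b⟩ hab hne
        rw [if_neg, TensorProduct.zero_tmul]
        rintro rfl
        simp only [mem_antidiagonal, zero_add] at hab
        exact hne (by rw [hab])
      · simp
  rw [hF, coord_eq a, map_add, comul_incl, comul_incl_mul, map_add, map_mul]
  have h' : ∀ b, F (evenComul k p r b) = 1 ⊗ₜ evenIncl k p r b := fun b => DFunLike.congr_fun h b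
  rw [h', h', comul_tau]
  simp [F, TensorProduct.tmul_add]

lemma lTensor_counit (a : Coord k p r) :
    (counitHom k p r).toLinearMap.lTensor _ (comulLin k p r a) = a ⊗ₜ[k] 1 := by
  set F : Coord k p r ⊗[k] Coord k p r →ₐ[k] Coord k p r ⊗[k] k :=
    Algebra.TensorProduct.map (AlgHom.id k _) (counitHom k p r)
  have hF : ∀ z, (counitHom k p r).toLinearMap.lTensor _ z = F z := fun z => rfl
  have h : F.comp (evenComul k p r) =
      (Algebra.TensorProduct.includeLeft : Coord k p r →ₐ[k] Coord k p r ⊗[k] k).comp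
        (evenIncl k p r) := by
    apply even_algHom_ext
    · simp [F, theta]
    · intro i
      simp only [AlgHom.comp_apply, evenComul_sigma, comulSigma_eq, F]
      rw [map_add, map_sum, map_mul]
      simp [sigma]
      rw [Finset.sum_eq_single (i, 0)]
      · simp
      · rintro ⟨a, b⟩ hab hne
        rw [if_neg, TensorProduct.tmul_zero]
        rintro rfl
        simp only [mem_antidiagonal, add_zero] at hab
        exact hne (by rw [hab])
      · simp
  rw [hF, coord_eq a, map_add, comul_incl, comul_incl_mul, map_add, map_mul]
  have h' : ∀ b, F (evenComul k p r b) = evenIncl k p r b ⊗ₜ 1 := fun b => DFunLike.congr_fun h b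
  rw [h', h', comul_tau]
  simp [F, TensorProduct.add_tmul]

lemma parityHom_parityHom (a : Coord k p r) : parityHom k p r (parityHom k p r a) = a := by
  conv_rhs => rw [coord_eq a]
  rw [coord_eq a]
  simp

lemma comul_parityHom (a : Coord k p r) : comulLin k p r (parityHom k p r a) =
    TensorProduct.map (parityHom k p r).toLinearMap (parityHom k p r).toLinearMap
      (comulLin k p r a) := by
  set F : Coord k p r ⊗[k] Coord k p r →ₐ[k] Coord k p r ⊗[k] Coord k p r :=
    Algebra.TensorProduct.map (parityHom k p r) (parityHom k p r)
  have hF : ∀ z, TensorProduct.map (parityHom k p r).toLinearMap (parityHom k p r).toLinearMap z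
    = F z := fun z => rfl
  have h : F.comp (evenComul k p r) = evenComul k p r := by
    apply even_algHom_ext
    · simp [F]
    · intro i
      simp only [AlgHom.comp_apply, evenComul_sigma, comulSigma_eq, F]
      rw [map_add, map_sum, map_mul, apply_ite (Algebra.TensorProduct.map _ _), map_sum]
      simp [TensorProduct.neg_tmul, TensorProduct.tmul_neg]
  have h' : ∀ b, F (evenComul k p r b) = evenComul k p r b := fun b => DFunLike.congr_fun h b
  rw [hF, coord_eq a, map_add, map_mul, parity_incl, parity_incl, parity_tau, mul_neg, map_add,
    map_add, map_neg, comul_incl, comul_incl_mul, map_add, map_mul, h', h', comul_tau]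
  simp [F, TensorProduct.neg_tmul, TensorProduct.tmul_neg]
  ring

instance : UnitalSupercoalgebra k (Coord k p r) where
  comul := comulLin k p r
  counit := (counitHom k p r).toLinearMap
  coassoc := LinearMap.ext comul_coassoc
  rTensor_counit_comp_comul := LinearMap.ext rTensor_counit
  lTensor_counit_comp_comul := LinearMap.ext lTensor_counit
  unit := 1
  comul_unit := comul_one
  counit_unit := map_one (counitHom k p r)
  parity := (parityHom k p r).toLinearMap
  parity_parity := parityHom_parityHom
  parity_unit := map_one (parityHom k p r)
  counit_parity a := by
    change counitHom k p r (parityHom k p r a) = counitHom k p r a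
    rw [coord_eq a]
    simp
  comul_parity := comul_parityHom

end

variable (k p r) in
/-- `k[𝕄_{r;s}]`, the subalgebra generated by `τ`, `θ` and the `σ_i` with `1 ≤ i < p^s`. -/
def coordSub (s : ℕ) : Subalgebra k (Coord k p r) :=
  Algebra.adjoin k ({tau, theta} ∪ {a | ∃ i, 1 ≤ i ∧ i < p ^ s ∧ a = sigma i})

lemma tau_mem (s : ℕ) : (tau : Coord k p r) ∈ coordSub k p r s :=
  Algebra.subset_adjoin (Or.inl (Or.inl rfl))

lemma theta_mem (s : ℕ) : (theta : Coord k p r) ∈ coordSub k p r s :=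
  Algebra.subset_adjoin (Or.inl (Or.inr rfl))

lemma sigma_mem {s i : ℕ} (hi : i < p ^ s) : (sigma i : Coord k p r) ∈ coordSub k p r s := by
  rcases Nat.eq_zero_or_pos i with rfl | h
  · rw [sigma_zero]; exact one_mem _
  · exact Algebra.subset_adjoin (Or.inr ⟨i, h, hi, rfl⟩)

variable (k p r) in
/-- The even part of `k[𝕄_{r;s}]`. -/
def evenSub (s : ℕ) : Subalgebra k (EvenCoord k p r) :=
  Algebra.adjoin k ({evenTheta} ∪ {a | ∃ i, 1 ≤ i ∧ i < p ^ s ∧ a = evenSigma i})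

lemma coordSub_decomp {s : ℕ} {a : Coord k p r} (ha : a ∈ coordSub k p r s) :
    evenPart k p r a ∈ evenSub k p r s ∧ oddPart k p r a ∈ evenSub k p r s := by
  induction ha using Algebra.adjoin_induction with
  | mem x hx =>
    rcases hx with (rfl | rfl) | ⟨i, h1, h2, rfl⟩
    · simp [zero_mem, one_mem]
    · exact ⟨Algebra.subset_adjoin (Or.inl rfl), by simp [theta, zero_mem]⟩
    · exact ⟨Algebra.subset_adjoin (Or.inr ⟨i, h1, h2, rfl⟩), by simp [sigma, zero_mem]⟩
  | algebraMap c =>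
    rw [AlgHom.commutes, ← (evenIncl k p r).commutes, oddPart_incl]
    exact ⟨Subalgebra.algebraMap_mem _ _, zero_mem _⟩
  | add x y _ _ hx hy => simp only [map_add]; exact ⟨add_mem hx.1 hy.1, add_mem hx.2 hy.2⟩
  | mul x y _ _ hx hy =>
    have : oddPart k p r (x * y) = evenPart k p r x * oddPart k p r y +
        evenPart k p r y * oddPart k p r x := by
      conv_lhs => rw [coord_eq x, coord_eq y]
      have : (evenIncl k p r (evenPart k p r x) + evenIncl k p r (oddPart k p r x) * tau) *
          (evenIncl k p r (evenPart k p r y) + evenIncl k p r (oddPart k p r y) * tau) =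
          evenIncl k p r (evenPart k p r x * evenPart k p r y) +
          evenIncl k p r (evenPart k p r x * oddPart k p r y +
            evenPart k p r y * oddPart k p r x) * tau := by
        simp only [map_add, map_mul]
        linear_combination evenIncl k p r (oddPart k p r x) * evenIncl k p r (oddPart k p r y) *
          tau_mul_tau (k := k) (p := p) (r := r)
      rw [this, map_add, oddPart_incl, oddPart_incl_mul, oddPart_tau, zero_add, mul_one]
    rw [map_mul, this]
    exact ⟨mul_mem hx.1 hy.1, add_mem (mul_mem hx.1 hy.2) (mul_mem hy.1 hx.2)⟩

lemma evenIncl_mem {s : ℕ} {b : EvenCoord k p r} (hb : b ∈ evenSub k p r s) :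
    evenIncl k p r b ∈ coordSub k p r s := by
  have : evenSub k p r s ≤ (coordSub k p r s).comap (evenIncl k p r) := by
    refine Algebra.adjoin_le ?_
    rintro _ (rfl | ⟨i, _, h2, rfl⟩)
    · exact theta_mem s
    · exact sigma_mem h2
  exact this hb

section
variable [Fact p.Prime] [CharP k p]
lemma parityHom_mem {s : ℕ} {a : Coord k p r} (ha : a ∈ coordSub k p r s) :
    parityHom k p r a ∈ coordSub k p r s := by
  have : coordSub k p r s ≤ (coordSub k p r s).comap (parityHom k p r) := by
    refine Algebra.adjoin_le ?_
    rintro _ ((rfl | rfl) | ⟨i, _, h2, rfl⟩) <;> rw [SetLike.mem_coe, Subalgebra.mem_comap]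
    · simpa using tau_mem (k := k) s
    · simpa using theta_mem (k := k) s
    · simpa using sigma_mem (k := k) h2
  exact this ha

lemma comulLin_mem {s : ℕ} {a : Coord k p r} (ha : a ∈ coordSub k p r s) :
    comulLin k p r a ∈
      (Algebra.TensorProduct.map (coordSub k p r s).val (coordSub k p r s).val).range := by
  have key : ∀ x ∈ coordSub k p r s, ∀ y ∈ coordSub k p r s, x ⊗ₜ[k] y ∈
      (Algebra.TensorProduct.map (coordSub k p r s).val (coordSub k p r s).val).range :=
    fun x hx y hy => ⟨⟨x, hx⟩ ⊗ₜ ⟨y, hy⟩, by simp⟩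
  have he : evenSub k p r s ≤
      (Algebra.TensorProduct.map (coordSub k p r s).val (coordSub k p r s).val).range.comap
        (evenComul k p r) := by
    refine Algebra.adjoin_le ?_
    rintro _ (rfl | ⟨i, _, h2, rfl⟩)
    · rw [SetLike.mem_coe, Subalgebra.mem_comap, evenComul_theta]
      exact add_mem (key _ (theta_mem s) _ (one_mem _)) (key _ (one_mem _) _ (theta_mem s))
    · rw [SetLike.mem_coe, Subalgebra.mem_comap, evenComul_sigma, comulSigma]
      refine add_mem (sum_mem fun x hx => ?_) ?_
      · rw [mem_antidiagonal] at hx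
        exact key _ (sigma_mem (by omega)) _ (sigma_mem (by omega))
      · split_ifs with hp
        · refine sum_mem fun x hx => ?_
          rw [mem_antidiagonal] at hx
          exact key _ (mul_mem (sigma_mem (by omega)) (tau_mem s)) _
            (mul_mem (sigma_mem (by omega)) (tau_mem s))
        · exact zero_mem _
  obtain ⟨h1, h2⟩ := coordSub_decomp ha
  rw [coord_eq a, map_add, comul_incl, comul_incl_mul, comul_tau]
  exact add_mem (he h1) (mul_mem (he h2) (add_mem (key _ (tau_mem s) _ (one_mem _))
    (key _ (one_mem _) _ (tau_mem s))))

instance (s : ℕ) : UnitalSupercoalgebra k (coordSub k p r s) :=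
  UnitalSupercoalgebra.ofSubmodule (Subalgebra.toSubmodule (coordSub k p r s))
    (fun _ ha => comulLin_mem ha) (one_mem (coordSub k p r s)) (fun _ ha => parityHom_mem ha)

variable (k p r) in
/-- The inclusion `k[𝕄_{r;s}] → k[𝕄_r]`, that is the comorphism of the quotient map
`𝕄_r → 𝕄_{r;s}`. -/
def coordSubIncl (s : ℕ) : UnitalSupercoalgebra.Hom k (coordSub k p r s) (Coord k p r) where
  toLin := (coordSub k p r s).val.toLinearMap
  map_comul a := (UnitalSupercoalgebra.map_subComul (Subalgebra.toSubmodule (coordSub k p r s))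
    (fun _ ha => comulLin_mem ha) a).symm
  map_counit _ := rfl
  map_unit := rfl
  map_parity _ := rfl

end
end
end MultiparameterSupergroup

/-! ### Coordinate supercoalgebras of finite supergroup schemes given by their group algebras -/

/-- An augmented superalgebra; the grading is recorded by its parity automorphism. -/
class AugmentedSuperalgebra (k Q : Type*) [Field k] [Ring Q] [Algebra k Q] where
  aug : Q →ₐ[k] k
  parity : Q →ₐ[k] Q
  parity_parity : ∀ x, parity (parity x) = x
  aug_parity : ∀ x, aug (parity x) = aug x

namespace AugmentedSuperalgebra

section
variable (k Q : Type*) [Field k] [Ring Q] [Algebra k Q] [AugmentedSuperalgebra k Q]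

/-- The underlying space of `Q^# = Hom_k(Q, k)`. For the group algebra `Q = kG` of a finite
supergroup scheme it is the coordinate supercoalgebra `k[G]`. -/
def DualCoord : Type _ := Module.Dual k Q

instance : AddCommGroup (DualCoord k Q) := inferInstanceAs (AddCommGroup (Module.Dual k Q))
instance : Module k (DualCoord k Q) := inferInstanceAs (Module k (Module.Dual k Q))

/-- The linear map with `x ⊗ y ↦ (-1)^{|x||y|} xy` for homogeneous `x` and `y`; for arbitrary
elements it is expressed through the parity automorphism. -/
def koszulMul : Q ⊗[k] Q →ₗ[k] Q :=
  (2 : k)⁻¹ • (LinearMap.mul' k Q ∘ₗ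
    (LinearMap.id + TensorProduct.map (parity (k := k)).toLinearMap LinearMap.id
      + TensorProduct.map LinearMap.id (parity (k := k)).toLinearMap
      - TensorProduct.map (parity (k := k)).toLinearMap (parity (k := k)).toLinearMap))

variable {k Q}
/-- An element of the dual, viewed as a functional. -/
def toDual : DualCoord k Q ≃ₗ[k] Module.Dual k Q := LinearEquiv.refl k (Module.Dual k Q)

lemma koszulMul_tmul (x y : Q) : koszulMul k Q (x ⊗ₜ y) = (2 : k)⁻¹ • (x * y +
    parity (k := k) x * y + x * parity (k := k) y - parity (k := k) x * parity (k := k) y) := by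
  simp [koszulMul]

lemma koszulMul_assoc [NeZero (2 : k)] (x y z : Q) :
    koszulMul k Q (koszulMul k Q (x ⊗ₜ y) ⊗ₜ z) = koszulMul k Q (x ⊗ₜ koszulMul k Q (y ⊗ₜ z)) := by
  simp only [koszulMul_tmul, map_smul, map_add, map_sub, map_mul, parity_parity]
  simp only [smul_mul_assoc, mul_smul_comm, ← smul_add, ← smul_sub, smul_smul]
  congr 1
  noncomm_ring

lemma koszulMul_one_left [NeZero (2 : k)] (x : Q) : koszulMul k Q (1 ⊗ₜ x) = x := by
  rw [koszulMul_tmul]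
  simp only [map_one, one_mul, add_sub_cancel_right]
  rw [← two_smul k x, smul_smul, inv_mul_cancel₀ (NeZero.ne _), one_smul]

lemma koszulMul_one_right [NeZero (2 : k)] (x : Q) : koszulMul k Q (x ⊗ₜ 1) = x := by
  rw [koszulMul_tmul]
  simp only [map_one, mul_one]
  have : x + parity (k := k) x + x - parity (k := k) x = (2 : k) • x := by
    rw [two_smul]; abel
  rw [this, smul_smul, inv_mul_cancel₀ (NeZero.ne _), one_smul]

variable [Module.Finite k Q]

variable (k Q) in
/-- The coproduct on the dual, with the sign rule for dual superspaces
`(φ ⊗ ψ)(x ⊗ y) = (-1)^{|ψ||x|} φ(x) ψ(y)`: it is characterised by `φ(xy) = (Δ φ)(x ⊗ y)`. Written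
without signs in the pairing, `φ((-1)^{|x||y|} xy) = ∑ φ₁(x) φ₂(y)` for `Δ φ = ∑ φ₁ ⊗ φ₂`, because
`|φ₂| = |y|` in every term that contributes. -/
def dualComul : DualCoord k Q →ₗ[k] DualCoord k Q ⊗[k] DualCoord k Q :=
  (TensorProduct.dualDistribEquiv k Q Q).symm.toLinearMap ∘ₗ (koszulMul k Q).dualMap ∘ₗ
    toDual.toLinearMap

variable (k Q) in
/-- The pairing `(φ ⊗ ψ)(x ⊗ y) = φ(x)ψ(y)`. -/
def dualPair : DualCoord k Q ⊗[k] DualCoord k Q ≃ₗ[k] Module.Dual k (Q ⊗[k] Q) :=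
  TensorProduct.dualDistribEquiv k Q Q

lemma dualPair_tmul (f g : DualCoord k Q) (x y : Q) :
    dualPair k Q (f ⊗ₜ g) (x ⊗ₜ y) = (toDual f) x *
      (toDual g) y :=
  TensorProduct.dualDistrib_apply (R := k) (M := Q) (N := Q) f g x y

lemma dualPair_comul (f : DualCoord k Q) (z : Q ⊗[k] Q) :
    dualPair k Q (dualComul k Q f) z = (toDual f) (koszulMul k Q z) := by
  have := LinearEquiv.apply_symm_apply (TensorProduct.dualDistribEquiv k Q Q)
    ((koszulMul k Q).dualMap (toDual f))
  exact DFunLike.congr_fun this z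

lemma dual_ext2 {z w : DualCoord k Q ⊗[k] DualCoord k Q}
    (h : ∀ x y, dualPair k Q z (x ⊗ₜ y) = dualPair k Q w (x ⊗ₜ y)) : z = w := by
  apply (dualPair k Q).injective
  ext x y
  exact h x y

variable (k Q) in
/-- The pairing of threefold tensor powers. -/
def dualPair3 : DualCoord k Q ⊗[k] (DualCoord k Q ⊗[k] DualCoord k Q) ≃ₗ[k]
    Module.Dual k (Q ⊗[k] (Q ⊗[k] Q)) :=
  (TensorProduct.congr (LinearEquiv.refl k _) (dualPair k Q)).trans
    (TensorProduct.dualDistribEquiv k Q (Q ⊗[k] Q))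

lemma dualPair3_tmul (f : DualCoord k Q) (g : DualCoord k Q ⊗[k] DualCoord k Q) (x : Q)
    (y : Q ⊗[k] Q) : dualPair3 k Q (f ⊗ₜ g) (x ⊗ₜ y) =
      (toDual f) x * dualPair k Q g y :=
  TensorProduct.dualDistrib_apply (R := k) (M := Q) (N := Q ⊗[k] Q) f (dualPair k Q g) x y

lemma dualPair3_assoc (z : DualCoord k Q ⊗[k] DualCoord k Q) (g : DualCoord k Q) (x y w : Q) :
    dualPair3 k Q (TensorProduct.assoc k _ _ _ (z ⊗ₜ g)) (x ⊗ₜ (y ⊗ₜ w)) =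
      dualPair k Q z (x ⊗ₜ y) * (toDual g) w := by
  induction z with
  | zero => simp
  | add a b ha hb => simp only [TensorProduct.add_tmul, map_add, LinearMap.add_apply, ha, hb,
      add_mul]
  | tmul a b => 
    rw [TensorProduct.assoc_tmul, dualPair3_tmul, dualPair_tmul, dualPair_tmul, mul_assoc]

lemma dual_coassoc [NeZero (2 : k)] (f : DualCoord k Q) :
    TensorProduct.assoc k _ _ _ ((dualComul k Q).rTensor _ (dualComul k Q f)) =
      (dualComul k Q).lTensor _ (dualComul k Q f) := by
  have h1 : ∀ (z : DualCoord k Q ⊗[k] DualCoord k Q) (x y w : Q),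
      dualPair3 k Q (TensorProduct.assoc k _ _ _ ((dualComul k Q).rTensor _ z))
        (x ⊗ₜ (y ⊗ₜ w)) = dualPair k Q z (koszulMul k Q (x ⊗ₜ y) ⊗ₜ w) := by
    intro z x y w
    induction z with
    | zero => simp
    | add a b ha hb => simp only [map_add, LinearMap.add_apply, ha, hb]
    | tmul a b =>
      rw [LinearMap.rTensor_tmul, dualPair3_assoc, dualPair_comul, dualPair_tmul]
  have h2 : ∀ (z : DualCoord k Q ⊗[k] DualCoord k Q) (x y w : Q),
      dualPair3 k Q ((dualComul k Q).lTensor _ z)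
        (x ⊗ₜ (y ⊗ₜ w)) = dualPair k Q z (x ⊗ₜ koszulMul k Q (y ⊗ₜ w)) := by
    intro z x y w
    induction z with
    | zero => simp
    | add a b ha hb => simp only [map_add, LinearMap.add_apply, ha, hb]
    | tmul a b =>
      rw [LinearMap.lTensor_tmul, dualPair3_tmul, dualPair_comul, dualPair_tmul]
  apply (dualPair3 k Q).injective
  ext x y w
  simp only [TensorProduct.AlgebraTensorModule.curry_apply, TensorProduct.curry_apply,
    LinearMap.restrictScalars_self, LinearMap.coe_restrictScalars]
  rw [h1, h2, dualPair_comul, dualPair_comul, koszulMul_assoc]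

variable (k Q) in
/-- The counit of the dual, evaluation at `1`. -/
def dualCounit : DualCoord k Q →ₗ[k] k := Module.Dual.eval k Q 1 ∘ₗ toDual.toLinearMap

variable (k Q) in
/-- The parity involution of the dual, the transpose of the parity. -/
def dualParity : DualCoord k Q →ₗ[k] DualCoord k Q :=
  toDual.symm.toLinearMap ∘ₗ (parity (k := k) (Q := Q)).toLinearMap.dualMap ∘ₗ toDual.toLinearMap

lemma koszulMul_parity (x y : Q) : koszulMul k Q (parity (k := k) x ⊗ₜ parity (k := k) y) =
    parity (k := k) (koszulMul k Q (x ⊗ₜ y)) := by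
  simp [koszulMul_tmul, parity_parity]

lemma aug_koszulMul [NeZero (2 : k)] (x y : Q) : aug (k := k) (koszulMul k Q (x ⊗ₜ y)) =
    aug (k := k) x * aug (k := k) y := by
  simp only [koszulMul_tmul, map_smul, map_add, map_sub, map_mul, aug_parity, smul_eq_mul]
  have := NeZero.ne (2 : k)
  field_simp
  ring

variable (k Q) in
/-- The augmentation, as an element of the dual. -/
def dualUnit : DualCoord k Q := toDual.symm (aug (k := k) (Q := Q)).toLinearMap

instance [NeZero (2 : k)] : UnitalSupercoalgebra k (DualCoord k Q) where
  comul := dualComul k Q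
  counit := dualCounit k Q
  coassoc := LinearMap.ext dual_coassoc
  rTensor_counit_comp_comul := by
    ext f
    apply (TensorProduct.lid k (DualCoord k Q)).injective
    apply LinearMap.ext (R := k) (M := Q)
    intro x
    have h : ∀ z : DualCoord k Q ⊗[k] DualCoord k Q,
        (toDual (TensorProduct.lid k (DualCoord k Q)
          ((dualCounit k Q).rTensor (DualCoord k Q) z))) x =
          dualPair k Q z (1 ⊗ₜ x) := by
      intro z
      induction z with
      | zero => simp
      | add a b ha hb => simp only [map_add, LinearMap.add_apply, ← ha, ← hb]
      | tmul a b => rw [dualPair_tmul]; simp; exact Or.inl rfl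
    refine (h _).trans ?_
    rw [dualPair_comul, koszulMul_one_left]
    simp
    rfl
  lTensor_counit_comp_comul := by
    ext f
    apply (TensorProduct.rid k (DualCoord k Q)).injective
    apply LinearMap.ext (R := k) (M := Q)
    intro x
    have h : ∀ z : DualCoord k Q ⊗[k] DualCoord k Q,
        (toDual (TensorProduct.rid k (DualCoord k Q)
          ((dualCounit k Q).lTensor (DualCoord k Q) z))) x =
          dualPair k Q z (x ⊗ₜ 1) := by
      intro z
      induction z with
      | zero => simp
      | add a b ha hb => simp only [map_add, LinearMap.add_apply, ← ha, ← hb]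
      | tmul a b => rw [dualPair_tmul, mul_comm]; simp; exact Or.inl rfl
    refine (h _).trans ?_
    rw [dualPair_comul, koszulMul_one_right]
    simp
    rfl
  unit := dualUnit k Q
  comul_unit := by
    apply dual_ext2
    intro x y
    rw [dualPair_comul, dualPair_tmul]
    exact aug_koszulMul x y
  counit_unit := map_one (aug (k := k) (Q := Q))
  parity := dualParity k Q
  parity_parity f := LinearMap.ext (R := k) (M := Q) fun x =>
    congrArg (toDual f) (parity_parity x)
  parity_unit := LinearMap.ext (R := k) (M := Q) fun x => aug_parity x
  counit_parity f := congrArg (toDual f) (map_one (parity (k := k)))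
  comul_parity f := by
    apply dual_ext2
    intro x y
    have h : ∀ z : DualCoord k Q ⊗[k] DualCoord k Q,
        dualPair k Q (TensorProduct.map (dualParity k Q) (dualParity k Q) z) (x ⊗ₜ y) =
          dualPair k Q z (parity (k := k) x ⊗ₜ parity (k := k) y) := by
      intro z
      induction z with
      | zero => simp
      | add a b ha hb => simp only [map_add, LinearMap.add_apply, ha, hb]
      | tmul a b => rw [TensorProduct.map_tmul, dualPair_tmul, dualPair_tmul]; rfl
    rw [h, dualPair_comul, dualPair_comul, koszulMul_parity]
    rfl
end

section map
variable {k Q Q' : Type*} [Field k] [NeZero (2 : k)] [Ring Q] [Algebra k Q]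
  [AugmentedSuperalgebra k Q] [Ring Q'] [Algebra k Q'] [AugmentedSuperalgebra k Q']
  [Module.Finite k Q] [Module.Finite k Q']

/-- The transpose, as a linear map. -/
def transpose (g : Q →ₐ[k] Q') : DualCoord k Q' →ₗ[k] DualCoord k Q :=
  toDual.symm.toLinearMap ∘ₗ g.toLinearMap.dualMap ∘ₗ toDual.toLinearMap

/-- The transpose of a homomorphism of augmented superalgebras -/
def dualHom (g : Q →ₐ[k] Q') (ha : ∀ x, aug (k := k) (g x) = aug (k := k) x)
    (hp : ∀ x, g (parity (k := k) x) = parity (k := k) (g x)) :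
    UnitalSupercoalgebra.Hom k (DualCoord k Q') (DualCoord k Q) where
  toLin := transpose g
  map_comul f := by
    apply dual_ext2
    intro x y
    have h : ∀ z : DualCoord k Q' ⊗[k] DualCoord k Q',
        dualPair k Q (TensorProduct.map (transpose g) (transpose g) z) (x ⊗ₜ y) =
          dualPair k Q' z (g x ⊗ₜ g y) := by
      intro z
      induction z with
      | zero => simp
      | add a b ha hb => simp only [map_add, LinearMap.add_apply, ha, hb]
      | tmul a b => rw [TensorProduct.map_tmul, dualPair_tmul, dualPair_tmul]; rfl
    refine Eq.trans ?_ (h _).symm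
    refine (dualPair_comul _ _).trans (Eq.trans ?_ (dualPair_comul _ _).symm)
    change (toDual f) (g _) = _
    congr 1
    simp [koszulMul_tmul, hp]
  map_counit f := congrArg (toDual f) (map_one g)
  map_unit := LinearMap.ext (R := k) (M := Q) ha
  map_parity f := LinearMap.ext (R := k) (M := Q) fun x =>
    congrArg (toDual f) (hp x).symm
end map
end AugmentedSuperalgebra

namespace MultiparameterSupergroup

/-! ### The group algebras `k𝕄_{r;f,η}` -/

/-- A nonzero inseparable `p`-polynomial, `f = ∑_{i=1}^t a_i T^{p^i}`. -/
structure InsepPPoly (k : Type*) [Field k] (p : ℕ) where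
  poly : Polynomial k
  ne_zero : poly ≠ 0
  exists_eq : ∃ (t : ℕ) (a : ℕ → k),
    poly = ∑ i ∈ Finset.Icc 1 t, Polynomial.C (a i) * Polynomial.X ^ p ^ i

namespace InsepPPoly
variable {k : Type*} [Field k] {p : ℕ}

lemma eval_zero [Fact p.Prime] (f : InsepPPoly k p) : f.poly.eval 0 = 0 := by
  obtain ⟨t, a, h⟩ := f.exists_eq
  rw [h, Polynomial.eval_finsetSum]
  refine Finset.sum_eq_zero fun i _ => ?_
  simp [(Fact.out : p.Prime).ne_zero]

lemma coeff_one [Fact p.Prime] (f : InsepPPoly k p) : f.poly.coeff 1 = 0 := by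
  obtain ⟨t, a, h⟩ := f.exists_eq
  rw [h, Polynomial.finsetSum_coeff]
  refine Finset.sum_eq_zero fun i hi => ?_
  rw [Polynomial.coeff_C_mul, Polynomial.coeff_X_pow, if_neg, mul_zero]
  have := Nat.one_lt_pow (Nat.one_le_iff_ne_zero.mp (Finset.mem_Icc.mp hi).1)
    (Fact.out : p.Prime).one_lt
  omega

/-- The `p`-th power `f^p`. -/
def frob [Fact p.Prime] [CharP k p] (f : InsepPPoly k p) : InsepPPoly k p where
  poly := f.poly ^ p
  ne_zero := pow_ne_zero p f.ne_zero
  exists_eq := by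
    obtain ⟨t, a, h⟩ := f.exists_eq
    refine ⟨t + 1, fun i => if i = 1 then 0 else a (i - 1) ^ p, ?_⟩
    have h2 : Finset.Icc 1 (t + 1) = insert 1 ((Finset.Icc 1 t).image (· + 1)) := by
      ext i
      simp only [Finset.mem_Icc, Finset.mem_insert, Finset.mem_image]
      constructor
      · intro hi
        by_cases h1 : i = 1
        · exact Or.inl h1
        · exact Or.inr ⟨i - 1, by omega, by omega⟩
      · rintro (rfl | ⟨j, hj, rfl⟩) <;> omega
    rw [h2, Finset.sum_insert (by simp), Finset.sum_image (fun _ _ _ _ h => Nat.succ.inj h),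
      h, sum_pow_char]
    simp only [if_true, map_zero, zero_mul, zero_add]
    refine Finset.sum_congr rfl fun i hi => ?_
    have : i + 1 ≠ 1 := by have := (Finset.mem_Icc.mp hi).1; omega
    rw [if_neg this, mul_pow, ← map_pow, ← pow_mul, pow_succ]
    rfl

end InsepPPoly

/-- The index of the last variable `u_{r-1}`. -/
def lastIdx (r : ℕ) [NeZero r] : Fin r := ⟨r - 1, Nat.sub_lt (NeZero.pos r) one_pos⟩

section
variable (k : Type*) [Field k] (p r : ℕ) [NeZero r] (f : InsepPPoly k p) (η : k)

open MvPolynomial in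
/-- The relations `u_i^p = 0` for `0 ≤ i ≤ r - 2`, `u_{r-1}^p + v^2 = 0` and
`f(u_{r-1}) + η u_0 = 0`, where `u_i` is the variable `some i` and `v` is the variable `none`. -/
def groupAlgRelations : Set (MvPolynomial (Option (Fin r)) k) :=
  {a | ∃ i : Fin r, i ≠ lastIdx r ∧ a = X (some i) ^ p} ∪
    {X (some (lastIdx r)) ^ p + X none ^ 2,
      Polynomial.aeval (X (some (lastIdx r))) f.poly + C η * X (some 0)}

/-- The group algebra
`k𝕄_{r;f,η} = k[u_0, …, u_{r-1}, v] / (u_0^p, …, u_{r-2}^p, u_{r-1}^p + v^2, f(u_{r-1}) + η u_0)`,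
which is commutative in the ordinary sense; `v` is odd and the `u_i` are even. Its dual
`DualCoord k (GroupAlg k p r f η)` is the coordinate supercoalgebra `k[𝕄_{r;f,η}]`. -/
def GroupAlg : Type _ :=
  MvPolynomial (Option (Fin r)) k ⧸ Ideal.span (groupAlgRelations k p r f η)

instance : CommRing (GroupAlg k p r f η) := inferInstanceAs
  (CommRing (MvPolynomial (Option (Fin r)) k ⧸ Ideal.span (groupAlgRelations k p r f η)))

instance : Algebra k (GroupAlg k p r f η) := inferInstanceAs
  (Algebra k (MvPolynomial (Option (Fin r)) k ⧸ Ideal.span (groupAlgRelations k p r f η)))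

/-- The quotient map. -/
def groupAlgMk : MvPolynomial (Option (Fin r)) k →ₐ[k] GroupAlg k p r f η :=
  Ideal.Quotient.mkₐ k _

variable {k p r f η}

/-- The generator `u_i`. -/
def uGen (i : Fin r) : GroupAlg k p r f η := groupAlgMk k p r f η (MvPolynomial.X (some i))

/-- The odd generator `v`. -/
def vGen : GroupAlg k p r f η := groupAlgMk k p r f η (MvPolynomial.X none)

lemma groupAlgMk_eq_zero {a : MvPolynomial (Option (Fin r)) k}
    (h : a ∈ groupAlgRelations k p r f η) : groupAlgMk k p r f η a = 0 :=
  Ideal.Quotient.eq_zero_iff_mem.mpr (Ideal.subset_span h)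

lemma uGen_pow (i : Fin r) (hi : i ≠ lastIdx r) : (uGen i : GroupAlg k p r f η) ^ p = 0 := by
  rw [uGen, ← map_pow]
  exact groupAlgMk_eq_zero (Or.inl ⟨i, hi, rfl⟩)

lemma uGen_last_pow : (uGen (lastIdx r) : GroupAlg k p r f η) ^ p + vGen ^ 2 = 0 := by
  rw [uGen, vGen, ← map_pow, ← map_pow, ← map_add]
  exact groupAlgMk_eq_zero (Or.inr (Or.inl rfl))

lemma aeval_uGen_last : Polynomial.aeval (uGen (lastIdx r) : GroupAlg k p r f η) f.poly +
    η • uGen 0 = 0 := by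
  rw [uGen, uGen, Polynomial.aeval_algHom_apply, ← map_smul, ← map_add, MvPolynomial.smul_eq_C_mul]
  exact groupAlgMk_eq_zero (Or.inr (Or.inr rfl))

/-- Algebra homomorphisms out of the group algebra. -/
def groupAlgLift {R : Type*} [CommRing R] [Algebra k R] (u : Fin r → R) (v : R)
    (h0 : ∀ i, i ≠ lastIdx r → u i ^ p = 0) (h1 : u (lastIdx r) ^ p + v ^ 2 = 0)
    (h2 : Polynomial.aeval (u (lastIdx r)) f.poly + η • u 0 = 0) : GroupAlg k p r f η →ₐ[k] R :=
  Ideal.Quotient.liftₐ _ (MvPolynomial.aeval (fun o : Option (Fin r) => o.elim v u)) (by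
    intro a ha
    rw [← RingHom.mem_ker]
    revert a
    change Ideal.span _ ≤ _
    rw [Ideal.span_le]
    rintro _ (⟨i, hi, rfl⟩ | rfl | rfl)
    · simp [RingHom.mem_ker, h0 i hi]
    · simp [RingHom.mem_ker, h1]
    · rw [SetLike.mem_coe, RingHom.mem_ker, map_add, ← Polynomial.aeval_algHom_apply]
      simpa [Algebra.smul_def] using h2)

section lift
variable {R : Type*} [CommRing R] [Algebra k R] (u : Fin r → R) (v : R)
    (h0 : ∀ i, i ≠ lastIdx r → u i ^ p = 0) (h1 : u (lastIdx r) ^ p + v ^ 2 = 0)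
    (h2 : Polynomial.aeval (u (lastIdx r)) f.poly + η • u 0 = 0)
@[simp] lemma groupAlgLift_uGen (i : Fin r) :
    groupAlgLift u v h0 h1 h2 (uGen i : GroupAlg k p r f η) = u i :=
  MvPolynomial.aeval_X (R := k) (fun o : Option (Fin r) => o.elim v u) (some i)
@[simp] lemma groupAlgLift_vGen :
    groupAlgLift u v h0 h1 h2 (vGen : GroupAlg k p r f η) = v :=
  MvPolynomial.aeval_X (R := k) (fun o : Option (Fin r) => o.elim v u) none
end lift

lemma groupAlg_ext {R : Type*} [Semiring R] [Algebra k R] {g h : GroupAlg k p r f η →ₐ[k] R}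
    (hu : ∀ i, g (uGen i) = h (uGen i)) (hv : g vGen = h vGen) : g = h := by
  apply Ideal.Quotient.algHom_ext
  apply MvPolynomial.algHom_ext
  rintro (_ | i)
  · exact hv
  · exact hu i

lemma uGen_last_isIntegral [Fact p.Prime] [CharP k p] :
    IsIntegral k (uGen (lastIdx r) : GroupAlg k p r f η) := by
  rw [← isAlgebraic_iff_isIntegral]
  by_cases h : (0 : Fin r) = lastIdx r
  · refine ⟨f.poly + Polynomial.C η * Polynomial.X, ?_, ?_⟩
    · intro h'
      have h1 := congrArg (fun q => Polynomial.coeff q 1) h'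
      simp only [Polynomial.coeff_add, f.coeff_one, Polynomial.coeff_C_mul, Polynomial.coeff_X_one,
        Polynomial.coeff_zero, zero_add, mul_one] at h1
      rw [h1] at h'
      simp only [map_zero, zero_mul, add_zero] at h'
      exact f.ne_zero h'
    · have h1 := aeval_uGen_last (k := k) (p := p) (r := r) (f := f) (η := η)
      simp only [h] at h1
      simpa [Algebra.smul_def] using h1
  · refine ⟨f.poly ^ p, pow_ne_zero p f.ne_zero, ?_⟩
    have h1 := aeval_uGen_last (k := k) (p := p) (r := r) (f := f) (η := η)
    rw [map_pow, eq_neg_of_add_eq_zero_left h1, neg_pow, smul_pow, uGen_pow 0 h, smul_zero,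
      mul_zero]

instance [Fact p.Prime] [CharP k p] : Module.Finite k (GroupAlg k p r f η) := by
  have hu : ∀ i, IsIntegral k (uGen i : GroupAlg k p r f η) := by
    intro i
    by_cases hi : i = lastIdx r
    · rw [hi]; exact uGen_last_isIntegral
    · refine IsIntegral.of_pow (Fact.out : p.Prime).pos ?_
      rw [uGen_pow i hi]
      exact isIntegral_zero
  have hv : IsIntegral k (vGen : GroupAlg k p r f η) := by
    refine IsIntegral.of_pow two_pos ?_
    rw [eq_neg_of_add_eq_zero_right uGen_last_pow]
    exact (uGen_last_isIntegral.pow p).neg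
  have hi : Algebra.IsIntegral k (GroupAlg k p r f η) := by
    constructor
    intro x
    obtain ⟨q, rfl⟩ : ∃ q, groupAlgMk k p r f η q = x := Ideal.Quotient.mk_surjective x
    induction q using MvPolynomial.induction_on with
    | C a =>
      rw [← MvPolynomial.algebraMap_eq, AlgHom.commutes]
      exact isIntegral_algebraMap
    | add x y hx hy => rw [map_add]; exact hx.add hy
    | mul_X q n hq =>
      rw [map_mul]
      refine hq.mul ?_
      cases n with
      | none => exact hv
      | some i => exact hu i
  have hf : Algebra.FiniteType k (GroupAlg k p r f η) :=
    Algebra.FiniteType.of_surjective (groupAlgMk k p r f η) Ideal.Quotient.mk_surjective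
  exact Algebra.IsIntegral.finite

lemma InsepPPoly.aeval_zero [Fact p.Prime] {R : Type*} [CommRing R] [Algebra k R] :
    Polynomial.aeval (0 : R) f.poly = 0 := by
  rw [Polynomial.aeval_def, Polynomial.eval₂_at_zero, Polynomial.coeff_zero_eq_eval_zero,
    f.eval_zero, map_zero]

variable (k p r f η) in
/-- The augmentation, sending all the generators to zero. -/
def groupAlgAug [Fact p.Prime] : GroupAlg k p r f η →ₐ[k] k :=
  groupAlgLift 0 0 (by simp [(Fact.out : p.Prime).ne_zero])
    (by simp [(Fact.out : p.Prime).ne_zero]) (by simp [InsepPPoly.aeval_zero])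

variable (k p r f η) in
/-- The parity automorphism, `u_i ↦ u_i`, `v ↦ -v`. -/
def groupAlgParity : GroupAlg k p r f η →ₐ[k] GroupAlg k p r f η :=
  groupAlgLift uGen (-vGen) uGen_pow (by rw [neg_sq]; exact uGen_last_pow) aeval_uGen_last

instance [Fact p.Prime] : AugmentedSuperalgebra k (GroupAlg k p r f η) where
  aug := groupAlgAug k p r f η
  parity := groupAlgParity k p r f η
  parity_parity x := by
    have : (groupAlgParity k p r f η).comp (groupAlgParity k p r f η) = AlgHom.id k _ :=
      groupAlg_ext (fun i => by simp [groupAlgParity]) (by simp [groupAlgParity])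
    exact DFunLike.congr_fun this x
  aug_parity x := by
    have : (groupAlgAug k p r f η).comp (groupAlgParity k p r f η) = groupAlgAug k p r f η :=
      groupAlg_ext (fun i => by simp [groupAlgParity]) (by simp [groupAlgParity, groupAlgAug])
    exact DFunLike.congr_fun this x

end

section phi
variable {k : Type*} [Field k] {p r : ℕ} [NeZero r] [Fact p.Prime] [CharP k p]
  (f : InsepPPoly k p)

lemma lastIdx_succ : lastIdx (r + 1) = (lastIdx r).succ := by
  have := NeZero.pos r
  ext
  simp only [lastIdx, Fin.val_succ]
  omega

variable (r) in
/-- The homomorphism `k𝕄_{r+1;f,η} → k𝕄_{r;f^p}` with `v ↦ v`, `u_i ↦ u_{i-1}` for `1 ≤ i ≤ r`,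
and `u_0 ↦ -η⁻¹ f(u_{r-1})`. -/
def phi (η : k) (hη : η ≠ 0) : GroupAlg k p (r + 1) f η →ₐ[k] GroupAlg k p r f.frob 0 :=
  groupAlgLift (Fin.cons (-(η⁻¹ • Polynomial.aeval (uGen (lastIdx r)) f.poly)) uGen) vGen
    (by
      intro i hi
      induction i using Fin.cases with
      | zero =>
        have h := aeval_uGen_last (k := k) (p := p) (r := r) (f := f.frob) (η := 0)
        rw [zero_smul, add_zero] at h
        change Polynomial.aeval _ (f.poly ^ p) = 0 at h
        rw [map_pow] at h
        rw [Fin.cons_zero, neg_pow, smul_pow, h, smul_zero, mul_zero]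
      | succ i =>
        rw [Fin.cons_succ]
        refine uGen_pow i fun h => hi ?_
        rw [h, lastIdx_succ])
    (by rw [lastIdx_succ, Fin.cons_succ]; exact uGen_last_pow)
    (by
      rw [lastIdx_succ, Fin.cons_succ, Fin.cons_zero, smul_neg, smul_smul, mul_inv_cancel₀ hη,
        one_smul, add_neg_cancel])

open AugmentedSuperalgebra (aug parity)

lemma phi_aug (η : k) (hη : η ≠ 0) (x : GroupAlg k p (r + 1) f η) :
    aug (k := k) (phi r f η hη x) = aug (k := k) x := by
  have : (groupAlgAug k p r f.frob 0).comp (phi r f η hη) = groupAlgAug k p (r + 1) f η := by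
    apply groupAlg_ext
    · intro i
      induction i using Fin.cases with
      | zero =>
        simp only [AlgHom.comp_apply, phi, groupAlgLift_uGen, Fin.cons_zero, map_neg, map_smul]
        rw [← Polynomial.aeval_algHom_apply]
        simp [groupAlgAug, InsepPPoly.aeval_zero]
      | succ i => simp [phi, groupAlgAug]
    · simp [phi, groupAlgAug]
  exact DFunLike.congr_fun this x

lemma phi_parity (η : k) (hη : η ≠ 0) (x : GroupAlg k p (r + 1) f η) :
    phi r f η hη (parity (k := k) x) = parity (k := k) (phi r f η hη x) := by
  have : (phi r f η hη).comp (groupAlgParity k p (r + 1) f η) =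
      (groupAlgParity k p r f.frob 0).comp (phi r f η hη) := by
    apply groupAlg_ext
    · intro i
      induction i using Fin.cases with
      | zero =>
        simp only [AlgHom.comp_apply, phi, groupAlgLift_uGen, groupAlgParity, Fin.cons_zero,
          map_neg, map_smul]
        rw [← Polynomial.aeval_algHom_apply]
        simp
      | succ i => simp [phi, groupAlgParity]
    · simp [phi, groupAlgParity]
  exact DFunLike.congr_fun this x

end phi
end MultiparameterSupergroup

namespace MultiparameterSupergroup
open AugmentedSuperalgebra (aug parity DualCoord toDual dualPair dualPair_tmul dualPair_comul
  koszulMul koszulMul_tmul dual_ext2 dualUnit)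

/-! ### The odd additive supergroup scheme -/

section oddAdditive
variable (k : Type*) [Field k]

/-- Underlying space of the exterior algebra `Λ(τ) = k[τ]/(τ²)`. -/
def OddAddCoord : Type _ := DualNumber k

instance : CommRing (OddAddCoord k) := inferInstanceAs (CommRing (DualNumber k))
instance : Algebra k (OddAddCoord k) := inferInstanceAs (Algebra k (DualNumber k))

variable {k}
/-- The odd generator `τ`. -/
def oddTau : OddAddCoord k := (DualNumber.eps : DualNumber k)
variable (k)

/-- `a + b τ ↦ a`. -/
def oddFst : OddAddCoord k →ₗ[k] k := (TrivSqZeroExt.fstHom k k k).toLinearMap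

/-- `a + b τ ↦ b`. -/
def oddSnd : OddAddCoord k →ₗ[k] k := TrivSqZeroExt.sndHom k k

variable {k}
@[simp] lemma oddFst_one : oddFst k 1 = 1 := rfl
@[simp] lemma oddSnd_one : oddSnd k 1 = 0 := rfl
@[simp] lemma oddFst_tau : oddFst k oddTau = 0 := rfl
@[simp] lemma oddSnd_tau : oddSnd k oddTau = 1 := rfl

lemma odd_eq (a : OddAddCoord k) : a = oddFst k a • 1 + oddSnd k a • oddTau := by
  have : ∀ a : DualNumber k, a = a.fst • 1 + a.snd • DualNumber.eps := by
    intro a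
    ext <;> simp
  exact this a

lemma odd_linearMap_ext {V : Type*} [AddCommGroup V] [Module k V] {g h : OddAddCoord k →ₗ[k] V}
    (h1 : g 1 = h 1) (h2 : g oddTau = h oddTau) : g = h := by
  ext a
  rw [odd_eq a]
  simp [h1, h2]

/-- The linear map with given values at `1` and `τ`. -/
def oddLin {V : Type*} [AddCommGroup V] [Module k V] (x y : V) : OddAddCoord k →ₗ[k] V :=
  (oddFst k).smulRight x + (oddSnd k).smulRight y

@[simp] lemma oddLin_one {V : Type*} [AddCommGroup V] [Module k V] (x y : V) :
    oddLin x y (1 : OddAddCoord k) = x := by simp [oddLin]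
@[simp] lemma oddLin_tau {V : Type*} [AddCommGroup V] [Module k V] (x y : V) :
    oddLin x y (oddTau : OddAddCoord k) = y := by simp [oddLin]

/-- The coordinate supercoalgebra `k[𝔾_a⁻] = k[τ]/(τ²)`, with `τ` odd and primitive. -/
instance : UnitalSupercoalgebra k (OddAddCoord k) where
  comul := oddLin (1 ⊗ₜ 1) (oddTau ⊗ₜ 1 + 1 ⊗ₜ oddTau)
  counit := oddLin 1 0
  coassoc := odd_linearMap_ext (by simp)
    (by simp [TensorProduct.add_tmul, TensorProduct.tmul_add, add_assoc])
  rTensor_counit_comp_comul := odd_linearMap_ext (by simp) (by simp)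
  lTensor_counit_comp_comul := odd_linearMap_ext (by simp) (by simp)
  unit := 1
  comul_unit := by simp
  counit_unit := by simp
  parity := oddLin 1 (-oddTau)
  parity_parity a := by
    have : oddLin (k := k) 1 (-oddTau) ∘ₗ oddLin (1 : OddAddCoord k) (-oddTau) = LinearMap.id :=
      odd_linearMap_ext (by simp) (by simp)
    exact LinearMap.congr_fun this a
  parity_unit := by simp
  counit_parity a := by
    have : oddLin (1 : k) 0 ∘ₗ oddLin (1 : OddAddCoord k) (-oddTau) = oddLin (1 : k) 0 :=
      odd_linearMap_ext (by simp) (by simp)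
    exact LinearMap.congr_fun this a
  comul_parity a := by
    have : oddLin (k := k) ((1 : OddAddCoord k) ⊗ₜ[k] (1 : OddAddCoord k))
        (oddTau ⊗ₜ 1 + 1 ⊗ₜ oddTau) ∘ₗ oddLin (1 : OddAddCoord k) (-oddTau) =
        TensorProduct.map (oddLin 1 (-oddTau)) (oddLin 1 (-oddTau)) ∘ₗ
          oddLin ((1 : OddAddCoord k) ⊗ₜ[k] (1 : OddAddCoord k))
        (oddTau ⊗ₜ 1 + 1 ⊗ₜ oddTau) :=
      odd_linearMap_ext (by simp) (by
        simp [TensorProduct.neg_tmul, TensorProduct.tmul_neg]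
        abel)
    exact LinearMap.congr_fun this a

end oddAdditive

section qMinus
variable {k : Type*} [Field k] {p r : ℕ} [NeZero r] [Fact p.Prime]

variable (r) in
/-- The quotient map `k𝕄_{r;f,η} → k𝔾_a⁻ = k[v]/(v²)`, with `u_i ↦ 0` and `v ↦ v`. -/
def qMinus (f : InsepPPoly k p) (η : k) : GroupAlg k p r f η →ₐ[k] DualNumber k :=
  groupAlgLift 0 DualNumber.eps (by simp [(Fact.out : p.Prime).ne_zero])
    (by simp [(Fact.out : p.Prime).ne_zero, pow_two, DualNumber.eps_mul_eps])
    (by simp [InsepPPoly.aeval_zero])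

variable {f : InsepPPoly k p} {η : k}

lemma qMinus_fst (x : GroupAlg k p r f η) : (qMinus r f η x).fst = aug (k := k) x := by
  have : (TrivSqZeroExt.fstHom k k k).comp (qMinus r f η) = groupAlgAug k p r f η :=
    groupAlg_ext (fun i => by simp [qMinus, groupAlgAug]) (by simp [qMinus, groupAlgAug])
  exact DFunLike.congr_fun this x

lemma qMinus_snd_parity (x : GroupAlg k p r f η) :
    (qMinus r f η (parity (k := k) x)).snd = -(qMinus r f η x).snd := by
  set c : DualNumber k →ₐ[k] DualNumber k :=
    DualNumber.lift ⟨(Algebra.ofId k (DualNumber k), -DualNumber.eps),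
      by simp [DualNumber.eps_mul_eps], fun _ => Commute.all _ _⟩
  have hc : ∀ a, (c a).snd = -a.snd := by
    intro a
    rw [DualNumber.lift_apply_apply]
    simp [Algebra.ofId_apply, TrivSqZeroExt.algebraMap_eq_inl]
  have : (qMinus r f η).comp (groupAlgParity k p r f η) = c.comp (qMinus r f η) :=
    groupAlg_ext (fun i => by simp [qMinus, groupAlgParity])
      (by simp [qMinus, groupAlgParity, c])
  rw [← hc]
  exact congrArg TrivSqZeroExt.snd (DFunLike.congr_fun this x)

variable (r f η) in
/-- The element `τ` of `k[𝕄_{r;f,η}]`, as a functional on `k𝕄_{r;f,η}`. Since `v(τ) = 1`, the sign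
rule for the double dual gives `τ(v) = -1`. -/
def tauFunctional : DualCoord k (GroupAlg k p r f η) :=
  toDual.symm (-(TrivSqZeroExt.sndHom k k ∘ₗ (qMinus r f η).toLinearMap))

lemma tauFunctional_apply (x : GroupAlg k p r f η) :
    toDual (tauFunctional r f η) x = -(qMinus r f η x).snd := rfl

variable [CharP k p] [NeZero (2 : k)]

lemma tauFunctional_comul : CoalgebraStruct.comul (R := k) (tauFunctional r f η) =
    tauFunctional r f η ⊗ₜ[k] dualUnit k (GroupAlg k p r f η) +
      dualUnit k (GroupAlg k p r f η) ⊗ₜ[k] tauFunctional r f η := by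
  apply dual_ext2
  intro x y
  rw [map_add, LinearMap.add_apply, dualPair_tmul, dualPair_tmul]
  refine (dualPair_comul _ _).trans ?_
  change -(qMinus r f η _).snd = -(qMinus r f η x).snd * aug (k := k) y +
    aug (k := k) x * (-(qMinus r f η y).snd)
  have h2 := NeZero.ne (2 : k)
  rw [koszulMul_tmul]
  simp only [map_smul, map_add, map_sub, map_mul, TrivSqZeroExt.snd_smul, TrivSqZeroExt.snd_add,
    TrivSqZeroExt.snd_sub, TrivSqZeroExt.snd_mul, qMinus_fst, qMinus_snd_parity,
    AugmentedSuperalgebra.aug_parity, smul_eq_mul, MulOpposite.smul_eq_mul_unop,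
    MulOpposite.unop_op]
  field_simp
  ring

variable (r f η) in
/-- The inclusion `(q⁻)^* : k[𝔾_a⁻] → k[𝕄_{r;f,η}]`, with `1 ↦ 1` and `τ ↦ τ`. -/
def qMinusStar : UnitalSupercoalgebra.Hom k (OddAddCoord k) (DualCoord k (GroupAlg k p r f η)) where
  toLin := oddLin (dualUnit k (GroupAlg k p r f η)) (tauFunctional r f η)
  map_comul a := by
    have : CoalgebraStruct.comul (R := k) ∘ₗ
        oddLin (dualUnit k (GroupAlg k p r f η)) (tauFunctional r f η) =
        TensorProduct.map (oddLin (dualUnit k (GroupAlg k p r f η)) (tauFunctional r f η))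
          (oddLin (dualUnit k (GroupAlg k p r f η)) (tauFunctional r f η)) ∘ₗ
          (oddLin (1 ⊗ₜ 1) (oddTau ⊗ₜ 1 + 1 ⊗ₜ oddTau) :
            OddAddCoord k →ₗ[k] OddAddCoord k ⊗[k] OddAddCoord k) :=
      odd_linearMap_ext (by
        simp only [LinearMap.comp_apply, oddLin_one, TensorProduct.map_tmul]
        exact UnitalSupercoalgebra.comul_unit) (by
        simp only [LinearMap.comp_apply, oddLin_one, oddLin_tau, TensorProduct.map_tmul, map_add]
        exact tauFunctional_comul)
    exact LinearMap.congr_fun this a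
  map_counit a := by
    have : CoalgebraStruct.counit (R := k) ∘ₗ
        oddLin (dualUnit k (GroupAlg k p r f η)) (tauFunctional r f η) =
        (oddLin 1 0 : OddAddCoord k →ₗ[k] k) :=
      odd_linearMap_ext (by
        simp only [LinearMap.comp_apply, oddLin_one]
        exact UnitalSupercoalgebra.counit_unit) (by
        simp only [LinearMap.comp_apply, oddLin_tau]
        change -(qMinus r f η 1).snd = 0
        simp)
    exact LinearMap.congr_fun this a
  map_unit := oddLin_one _ _
  map_parity a := by
    have : oddLin (dualUnit k (GroupAlg k p r f η)) (tauFunctional r f η) ∘ₗ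
        (oddLin 1 (-oddTau) : OddAddCoord k →ₗ[k] OddAddCoord k) =
        UnitalSupercoalgebra.parity (k := k) ∘ₗ
          oddLin (dualUnit k (GroupAlg k p r f η)) (tauFunctional r f η) :=
      odd_linearMap_ext (by
        simp only [LinearMap.comp_apply, oddLin_one]
        exact (UnitalSupercoalgebra.parity_unit (k := k)
          (A := DualCoord k (GroupAlg k p r f η))).symm) (by
        simp only [LinearMap.comp_apply, oddLin_tau, map_neg]
        apply LinearMap.ext (R := k) (M := GroupAlg k p r f η)
        intro x
        change - -(qMinus r f η x).snd = -(qMinus r f η (parity (k := k) x)).snd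
        rw [qMinus_snd_parity])
    exact LinearMap.congr_fun this a
end qMinus

/-! ### The presented graded-commutative algebras -/

section model

/-- The generators `x_1, …, x_r`, `λ_1, …, λ_r`, `y` (indices are counted from `0` here), and one
further generator for each element of `W`. -/
inductive CohGen (r : ℕ) (W : Type)
  | x (i : Fin r)
  | lam (i : Fin r)
  | y
  | w (j : W)

namespace CohGen
variable {r : ℕ} {W : Type}

/-- Cohomological degree. -/
def deg : CohGen r W → ℕ
  | x _ => 2
  | lam _ => 1
  | y => 1
  | w _ => 2

/-- Internal superdegree. -/
def par : CohGen r W → ℕ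
  | y => 1
  | _ => 0

end CohGen

variable (k : Type*) [Field k] (r : ℕ) [NeZero r] (W : Type) (q : Prop)

/-- The relations: graded commutativity `ab = (-1)^{deg a deg b + |a| |b|} ba` of the generators, and
`x_r = y^2` if `q` holds. -/
inductive CohRel : FreeAlgebra k (CohGen r W) → FreeAlgebra k (CohGen r W) → Prop
  | comm (a b : CohGen r W) : CohRel (FreeAlgebra.ι k a * FreeAlgebra.ι k b)
      ((-1 : k) ^ (a.deg * b.deg + a.par * b.par) • (FreeAlgebra.ι k b * FreeAlgebra.ι k a))
  | xy (h : q) : CohRel (FreeAlgebra.ι k (CohGen.x (lastIdx r))) (FreeAlgebra.ι k CohGen.y ^ 2)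

/-- The free graded-commutative algebra on the generators, modulo `x_r = y^2` if `q` holds. As `2` is
invertible, this is `k[x_1, …, x_r, y, …] ⊗ Λ(λ_1, …, λ_r)` (graded tensor product), modulo
`x_r - y^2` if `q` holds. -/
abbrev CohModel : Type _ := RingQuot (CohRel k r W q)

variable {k r W}
/-- The generators of the algebra. -/
def CohModel.gen (a : CohGen r W) : CohModel k r W q :=
  RingQuot.mkAlgHom k (CohRel k r W q) (FreeAlgebra.ι k a)

end model

section cochains
variable {k : Type*} [Field k] {A : Type*} [CommRing A] [Algebra k A] (p : ℕ)

/-- The cochain `∑_{j=1}^{p-1} (p-1)! / (j! (p-j)!) b^j ⊗ b^{p-j}`. -/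
def xCochain (b : A) : TensorAlgebra k A :=
  ∑ j ∈ Finset.Icc 1 (p - 1), (((p - 1).factorial : k) / (j.factorial * (p - j).factorial)) •
    (TensorAlgebra.ι k (b ^ j) * TensorAlgebra.ι k (b ^ (p - j)))

/-- The representing cochains: for `x_i` the cochain `xCochain` of `θ^{p^{i-1}}`, for `λ_i` the
element `θ^{p^{i-1}}`, for `y` the element `τ`, and `wc` for the further generators. (The index `i`
is counted from `0` here.) -/
def genCochain {r : ℕ} {W : Type} (th ta : A) (wc : W → TensorAlgebra k A) :
    CohGen r W → TensorAlgebra k A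
  | CohGen.x i => xCochain p (th ^ p ^ (i : ℕ))
  | CohGen.lam i => TensorAlgebra.ι k (th ^ p ^ (i : ℕ))
  | CohGen.y => TensorAlgebra.ι k ta
  | CohGen.w j => wc j
end cochains

section sub
variable (k : Type*) [Field k] (p r s : ℕ)
/-- The element `θ` of `k[𝕄_{r;s}]`. -/
def thetaSub : coordSub k p r s := ⟨theta, theta_mem s⟩
/-- The element `τ` of `k[𝕄_{r;s}]`. -/
def tauSub : coordSub k p r s := ⟨tau, tau_mem s⟩
/-- The element `σ_i` of `k[𝕄_{r;s}]`, for `i < p^s` (and `0` otherwise). -/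
def sigmaSub (i : ℕ) : coordSub k p r s :=
  if h : i < p ^ s then ⟨sigma i, sigma_mem h⟩ else 0

/-- The cochain `-(∑_{j=1}^{p^s-1} σ_j ⊗ σ_{p^s-j} + ∑_{u+v+p=p^s} σ_u τ ⊗ σ_v τ)`; all the indices
are smaller than `p^s`. -/
def wCochain : TensorAlgebra k (coordSub k p r s) :=
  -(∑ j ∈ Finset.Icc 1 (p ^ s - 1), TensorAlgebra.ι k (sigmaSub k p r s j) *
      TensorAlgebra.ι k (sigmaSub k p r s (p ^ s - j))
    + ∑ uv ∈ Finset.HasAntidiagonal.antidiagonal (p ^ s - p),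
      TensorAlgebra.ι k (sigmaSub k p r s uv.1 * tauSub k p r s) *
        TensorAlgebra.ι k (sigmaSub k p r s uv.2 * tauSub k p r s))
end sub

open UnitalSupercoalgebra Hochschild

/-- The isomorphism `Φ` sends each generator to the class of the given cochain, which is homogeneous
of the stated degrees. -/
def IsPresentation {k A : Type*} [Field k] [AddCommGroup A] [Module k A]
    [UnitalSupercoalgebra k A] {r : ℕ} [NeZero r] {W : Type} {q : Prop}
    (z : CohGen r W → TensorAlgebra k A)
    (Φ : CohModel k r W q ≃ₐ[k] Cohomology k A) : Prop :=
  ∀ a : CohGen r W, Represents (z a) (Φ (CohModel.gen q a)) ∧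
    Φ (CohModel.gen q a) ∈ homogeneousPart k A a.deg a.par

section
variable {k : Type*} [Field k] {p r : ℕ} [NeZero r] [Fact p.Prime] [CharP k p] [NeZero (2 : k)]

/-- The map `π` is the inclusion `π^* : k[𝕄_{r;s}] → k[𝕄_{r;f}]`, dual to the quotient map
`k𝕄_{r;f} → k𝕄_{r;s}`, `u_i ↦ u_i`, `v ↦ v`. Here `u_0, …, u_{r-1}, v` are viewed as functionals on
`k[𝕄_{r;s}]`, dual to `θ, θ^p, …, θ^{p^{r-1}} = σ_1` and `τ` in the basis of the
`θ^i σ_j τ^e`, so that (for `a_l < p` when `l < r - 1`) the functional `∏ u_l^{a_l} v^e` is the product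
of the `a_l!`, `l < r - 1`, times the functional dual to `θ^i σ_j τ^e`, `i = ∑_{l < r - 1} a_l p^l`,
`j = a_{r-1}`; the sign `(-1)^e` is that of the double dual of a superspace. -/
def IsPiStar {s : ℕ} (f : InsepPPoly k p)
    (π : Hom k (coordSub k p r s) (DualCoord k (GroupAlg k p r f 0))) : Prop :=
  ∀ i < p ^ (r - 1), ∀ j < p ^ s, ∀ e < 2, ∀ a : Fin r → ℕ, (∀ l, l ≠ lastIdx r → a l < p) →
    ∀ e' < 2,
      toDual (π.toLin (thetaSub k p r s ^ i * sigmaSub k p r s j * tauSub k p r s ^ e))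
        ((∏ l, uGen l ^ a l) * vGen ^ e') =
      if e = e' ∧ a (lastIdx r) = j ∧ ∑ l ∈ Finset.univ.erase (lastIdx r), a l * p ^ (l : ℕ) = i
      then (-1) ^ e * ∏ l ∈ Finset.univ.erase (lastIdx r), ((a l).factorial : k) else 0
end
end MultiparameterSupergroup

end

/-!
The cohomology rings are computed without spectral sequences, from explicit homotopies on the
Hochschild complex, which is the tensor algebra `T(A)` of the coordinate supercoalgebra `A` with
the cobar differential `∂`.

**The Gysin sequence.** Apart from the isomorphism `φ`, all maps in question are inclusions `C ⊆
A` of supercoalgebras of one type (`Hochschild.IsPrincipal`): `C` is the kernel of a bicomodule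
endomorphism `D` of `A` with a partial section `σ`. Dually, the algebra `C^*` is the quotient of
`A^*` by one central element, which is a nonzerodivisor or an idempotent. The homotopy
`gysinHomotopy` gives a chain endomorphism of `T(A)` that moves one tensor factor after the other
from `A` into `C`; so the inclusion of the subcomplex `T(C) + T(C) σ(1)` in `T(A)` is a
quasi-isomorphism (`IsPrincipal.exists_cocycle_eq`, `IsPrincipal.exists_coboundary_eq`). There are
three cases.

* If `σ(1) = 0`, which is the case of an idempotent, then `H(C) = H(A)`
  (`IsPrincipal.bijective_cohomologyMap`).
* If `D σ(1) = 1` and `σ(1)` is a cocycle, then `H(A)` is free over `H(C)` with the basis formed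
  by `1` and the class of `σ(1)`: an exterior generator is adjoined
  (`IsPrincipal.bijective_of_cocycle`).
* If `D σ(1) = 1` and `H(C) → H(A)` is surjective, then its kernel is generated by the class `w`
  of `∂ σ(1)`, which is a nonzerodivisor: a presentation of `H(A)` that lifts to `H(C)` becomes
  one of `H(C)` on adjoining `w` as a polynomial generator (`IsPrincipal.bijective_of_lift`).

**The tower.** The operators `σ_j ↦ σ_{j-1}` on `k[𝕄_{r+1}]` and `σ_j ↦ σ_{j-p^s}` on `k[𝕄_r]`
show that `k[𝕄_{r;1}] → k[𝕄_{r+1}]` is of the second type, with the exterior generator `λ_{r+1}`,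
and that `k[𝕄_{r;s}] ⊆ k[𝕄_r]` is of the third type, with `w = w_s`. For `s = 1` the class of
`w_s` is `x_r - y^2`, so that passing to `𝕄_{r;1}` just removes a relation. Since `k[𝔾_a⁻] →
k[𝕄_1]` is of the second type, too, and the cohomology of `𝔾_a⁻` is the polynomial ring in `y`
(`odd_bijective`), the rings of all `𝕄_r` and `𝕄_{r;s}` follow by induction on `r`
(`hasCoordPresentation`). The homomorphism from the presented algebra exists because the
generators commute in the graded sense. The homotopies for this are twisted derivations of `T(A)`:
for the class of a primitive element the one that extends the multiplication by it
(`differential_twistedDer_primitive`), for the classes `x_i` the cup-one product with the cocycle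
(`differential_twistedDer_twoCocycle`). The basis of the `θ^i σ_j τ^e` of `k[𝕄_r]` comes from an
integral form, a lattice of divided powers in `ℚ[X]` (`coordBasis`).

**The finite supergroup schemes.** If `f = T^{p^s} g` with `g(0) ≠ 0`, the Chinese remainder
theorem gives an idempotent that generates the ideal of `u_{r-1}^{p^s}` in `k𝕄_{r;f}`. The
inclusion `k[𝕄_{r;s}] → k[𝕄_{r;f}]` comes from an action of `k𝕄_{r;f}` on `k[𝕄_{r;s}]` by
translation operators (`IsSuperAction.toHom`). The pairing of the monomials in `u_0, …, u_{r-1},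
v` with the basis elements `θ^i σ_j τ^e` is diagonal with nonzero entries, by the `p`-adic digits
of `i`, so the image of the inclusion is the kernel of the operator dual to the idempotent, and
the first type applies (`exists_piStar`). In the same way, for `η ≠ 0` the relation `f(u_0) + η
u_0 = 0` makes the ideal of `u_0` in `k𝕄_{1;f,η}` generated by an idempotent
(`exists_idempotent_one`), which gives the cohomology of `𝕄_{1;f,η}`
(`bijective_cohomologyMap_qMinusStar`). The map `φ` has the inverse `u_i ↦ u_{i+1}`, `v ↦ v`,
since `u_0` is determined by `u_r` if `η ≠ 0` (`phi_bijective`).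
-/


noncomputable section

namespace Hochschild
open UnitalSupercoalgebra TensorAlgebra

/-! ### Left recursion and twisted derivations on the tensor algebra -/

section recursion
variable {k A : Type*} [Field k] [AddCommGroup A] [Module k A]

/-- Induction that peels off the first tensor factor. -/
lemma tensorAlgebra_left_induction (N : Submodule k (TensorAlgebra k A)) (h1 : 1 ∈ N)
    (hι : ∀ a, ∀ x ∈ N, ι k a * x ∈ N) (x : TensorAlgebra k A) : x ∈ N := by
  suffices h : ∀ x : TensorAlgebra k A, ∀ y ∈ N, x * y ∈ N by simpa using h x 1 h1
  intro x
  induction x using TensorAlgebra.induction with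
  | algebraMap c =>
    intro y hy
    rw [← Algebra.smul_def]
    exact N.smul_mem c hy
  | ι a => exact fun y hy => hι a y hy
  | mul a b ha hb =>
    intro y hy
    rw [mul_assoc]
    exact ha _ (hb _ hy)
  | add a b ha hb =>
    intro y hy
    rw [add_mul]
    exact add_mem (ha y hy) (hb y hy)

lemma linearMap_ext_left {V : Type*} [AddCommGroup V] [Module k V]
    {f g : TensorAlgebra k A →ₗ[k] V} (h1 : f 1 = g 1)
    (hι : ∀ a x, f x = g x → f (ι k a * x) = g (ι k a * x)) : f = g :=
  LinearMap.ext fun x => tensorAlgebra_left_induction (LinearMap.eqLocus f g) h1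
    (fun a x hx => hι a x hx) x

/-- Auxiliary: one step of the recursion `leftRec`, on pairs `(x, R x)`. -/
def leftRecStep (F : A →ₗ[k] Module.End k (TensorAlgebra k A)) (L : A →ₗ[k] TensorAlgebra k A) :
    A →ₗ[k] Module.End k (TensorAlgebra k A × TensorAlgebra k A) where
  toFun a := (LinearMap.mulLeft k (ι k a) ∘ₗ LinearMap.fst k _ _).prod
    (F a ∘ₗ LinearMap.fst k _ _ + LinearMap.mulLeft k (L a) ∘ₗ LinearMap.snd k _ _)
  map_add' a b := by
    ext x <;> simp [add_mul]
  map_smul' c a := by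
    ext x <;> simp

/-- The linear operator `R` on `T(A)` with `R(1) = 0` and `R(a x) = F(a)(x) + L(a) R(x)` for
`a ∈ A`. -/
def leftRec (F : A →ₗ[k] Module.End k (TensorAlgebra k A)) (L : A →ₗ[k] TensorAlgebra k A) :
    TensorAlgebra k A →ₗ[k] TensorAlgebra k A :=
  LinearMap.snd k _ _ ∘ₗ LinearMap.applyₗ (1, 0) ∘ₗ
    (TensorAlgebra.lift k (leftRecStep F L)).toLinearMap

variable (F : A →ₗ[k] Module.End k (TensorAlgebra k A)) (L : A →ₗ[k] TensorAlgebra k A)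

@[simp] lemma leftRec_one : leftRec F L 1 = 0 := by simp [leftRec]

lemma leftRec_ι_mul (a : A) (x : TensorAlgebra k A) :
    leftRec F L (ι k a * x) = F a x + L a * leftRec F L x := by
  have h : ∀ x : TensorAlgebra k A, (TensorAlgebra.lift k (leftRecStep F L) x (1, 0)).1 = x := by
    intro x
    have : LinearMap.fst k _ _ ∘ₗ LinearMap.applyₗ (1, 0) ∘ₗ
        (TensorAlgebra.lift k (leftRecStep F L)).toLinearMap = LinearMap.id := by
      apply linearMap_ext_left
      · simp
      · intro a x hx
        simp only [LinearMap.comp_apply, LinearMap.fst_apply, AlgHom.toLinearMap_apply, map_mul,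
          lift_ι_apply, LinearMap.applyₗ_apply_apply, Module.End.mul_apply, LinearMap.id_apply]
          at hx ⊢
        conv_rhs => rw [← hx]
        simp [leftRecStep]
    exact LinearMap.congr_fun this x
  simp only [leftRec, LinearMap.comp_apply, AlgHom.toLinearMap_apply, map_mul, lift_ι_apply,
    LinearMap.applyₗ_apply_apply, Module.End.mul_apply]
  have hx := h x
  generalize TensorAlgebra.lift k (leftRecStep F L) x (1, 0) = z at hx ⊢
  rw [← hx]
  rfl

/-- The `Q`-twisted derivation of `T(A)` that extends `δ`: `Θ(xy) = Θ(x) y + Q(x) Θ(y)`. -/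
def twistedDer (Q : TensorAlgebra k A →ₐ[k] TensorAlgebra k A) (δ : A →ₗ[k] TensorAlgebra k A) :
    TensorAlgebra k A →ₗ[k] TensorAlgebra k A :=
  leftRec (LinearMap.mul k _ ∘ₗ δ) (Q.toLinearMap ∘ₗ ι k)

variable (Q : TensorAlgebra k A →ₐ[k] TensorAlgebra k A) (δ : A →ₗ[k] TensorAlgebra k A)

@[simp] lemma twistedDer_one : twistedDer Q δ 1 = 0 := leftRec_one _ _

lemma twistedDer_ι_mul (a : A) (x : TensorAlgebra k A) :
    twistedDer Q δ (ι k a * x) = δ a * x + Q (ι k a) * twistedDer Q δ x :=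
  leftRec_ι_mul _ _ a x

@[simp] lemma twistedDer_ι (a : A) : twistedDer Q δ (ι k a) = δ a := by
  simpa using twistedDer_ι_mul Q δ a 1

lemma twistedDer_mul (x y : TensorAlgebra k A) :
    twistedDer Q δ (x * y) = twistedDer Q δ x * y + Q x * twistedDer Q δ y := by
  have : twistedDer Q δ ∘ₗ LinearMap.mulRight k y =
      LinearMap.mulRight k y ∘ₗ twistedDer Q δ +
        LinearMap.mulRight k (twistedDer Q δ y) ∘ₗ Q.toLinearMap := by
    apply linearMap_ext_left
    · simp
    · intro a x hx
      simp only [LinearMap.comp_apply, LinearMap.mulRight_apply, LinearMap.add_apply,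
        AlgHom.toLinearMap_apply] at hx ⊢
      rw [mul_assoc, twistedDer_ι_mul, hx, twistedDer_ι_mul, map_mul]
      noncomm_ring
  exact LinearMap.congr_fun this x

end recursion

/-! ### Gradings -/

section grading
variable {k A : Type*} [Field k] [AddCommGroup A] [Module k A]

variable (k A) in
/-- The cochains of degree `n`, that is `A^{⊗ n}`. -/
abbrev degreePart (n : ℕ) : Submodule k (TensorAlgebra k A) := LinearMap.range (ι k (M := A)) ^ n

lemma ι_mem_degreePart (a : A) : ι k a ∈ degreePart k A 1 := by
  rw [degreePart, pow_one]; exact LinearMap.mem_range_self _ a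

lemma mul_mem_degreePart {m n : ℕ} {x y : TensorAlgebra k A} (hx : x ∈ degreePart k A m)
    (hy : y ∈ degreePart k A n) : x * y ∈ degreePart k A (m + n) := by
  rw [degreePart, pow_add]; exact Submodule.mul_mem_mul hx hy

lemma ι_mul_mem_degreePart {n : ℕ} (a : A) {y : TensorAlgebra k A}
    (hy : y ∈ degreePart k A n) : ι k a * y ∈ degreePart k A (n + 1) := by
  rw [add_comm]; exact mul_mem_degreePart (ι_mem_degreePart a) hy

lemma degreePart_zero {x : TensorAlgebra k A} (hx : x ∈ degreePart k A 0) :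
    ∃ c : k, x = algebraMap k _ c := by
  rw [degreePart, pow_zero] at hx
  obtain ⟨c, rfl⟩ := Submodule.mem_one.mp hx
  exact ⟨c, rfl⟩

lemma degreePart_succ_induction {n : ℕ} {N : Submodule k (TensorAlgebra k A)}
    (h : ∀ a, ∀ x ∈ degreePart k A n, ι k a * x ∈ N) : degreePart k A (n + 1) ≤ N := by
  rw [degreePart, pow_succ', Submodule.mul_le]
  rintro _ ⟨a, rfl⟩ x hx
  exact h a x hx

lemma iSup_degreePart : ⨆ n, degreePart k A n = ⊤ :=
  (DirectSum.Decomposition.isInternal (degreePart k A)).submodule_iSup_eq_top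

/-- The projection of `T(A)` onto its part of degree `n`. -/
def degreeProj (n : ℕ) : TensorAlgebra k A →ₗ[k] TensorAlgebra k A :=
  GradedAlgebra.proj (degreePart k A) n

lemma degreeProj_mem (n : ℕ) (x : TensorAlgebra k A) : degreeProj n x ∈ degreePart k A n :=
  (DirectSum.decompose (degreePart k A) x n).2

lemma degreeProj_of_mem {n : ℕ} {x : TensorAlgebra k A} (hx : x ∈ degreePart k A n) (m : ℕ) :
    degreeProj m x = if n = m then x else 0 := by
  split_ifs with h
  · subst h; exact DirectSum.decompose_of_mem_same _ hx
  · exact DirectSum.decompose_of_mem_ne _ hx h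

lemma ext_degreePart {V : Type*} [AddCommGroup V] [Module k V]
    {f g : TensorAlgebra k A →ₗ[k] V} (h : ∀ n, ∀ x ∈ degreePart k A n, f x = g x) : f = g := by
  have : ⨆ n, degreePart k A n ≤ LinearMap.eqLocus f g := iSup_le fun n x hx => h n x hx
  rw [iSup_degreePart] at this
  exact LinearMap.ext fun x => this trivial

lemma exists_sum_degreeProj (x : TensorAlgebra k A) :
    ∃ s : Finset ℕ, x = ∑ n ∈ s, degreeProj n x := by
  classical
  exact ⟨_, (DirectSum.sum_support_decompose (degreePart k A) x).symm⟩

lemma degreeProj_mul (n : ℕ) (x y : TensorAlgebra k A) :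
    degreeProj n (x * y) =
      ∑ ij ∈ Finset.HasAntidiagonal.antidiagonal n, degreeProj ij.1 x * degreeProj ij.2 y := by
  have : ∀ i, ∀ x ∈ degreePart k A i, degreeProj n ∘ₗ LinearMap.mulLeft k x =
      ∑ ij ∈ Finset.HasAntidiagonal.antidiagonal n,
        LinearMap.mulLeft k (degreeProj ij.1 x) ∘ₗ degreeProj ij.2 := by
    intro i x hx
    apply ext_degreePart
    intro j y hy
    simp only [LinearMap.comp_apply, LinearMap.mulLeft_apply, LinearMap.sum_apply,
      degreeProj_of_mem (mul_mem_degreePart hx hy), degreeProj_of_mem hx, degreeProj_of_mem hy]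
    split_ifs with h
    · rw [Finset.sum_eq_single (i, j)]
      · simp
      · rintro ⟨a, b⟩ _ hne
        by_cases ha : i = a
        · by_cases hb : j = b
          · exact absurd (by rw [ha, hb]) hne
          · simp [hb]
        · simp [ha]
      · intro h'
        exact absurd (Finset.HasAntidiagonal.mem_antidiagonal.mpr h) h'
    · symm
      refine Finset.sum_eq_zero ?_
      rintro ⟨a, b⟩ hab
      rw [Finset.HasAntidiagonal.mem_antidiagonal] at hab
      by_cases ha : i = a
      · have hb : j ≠ b := by dsimp only at hab; omega
        simp [hb]
      · simp [ha]
  have h2 : degreeProj n ∘ₗ LinearMap.mulRight k y =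
      ∑ ij ∈ Finset.HasAntidiagonal.antidiagonal n,
        LinearMap.mulRight k (degreeProj ij.2 y) ∘ₗ degreeProj ij.1 := by
    apply ext_degreePart
    intro i x hx
    have := LinearMap.congr_fun (this i x hx) y
    simpa using this
  simpa using LinearMap.congr_fun h2 x

end grading

section gradingDifferential
variable {k A : Type*} [Field k] [AddCommGroup A] [Module k A] [UnitalSupercoalgebra k A]

lemma tensorTwo_mem_degreePart (z : A ⊗[k] A) : tensorTwo k A z ∈ degreePart k A 2 := by
  induction z with
  | zero => simp
  | add x y hx hy => rw [map_add]; exact add_mem hx hy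
  | tmul x y => exact ι_mul_mem_degreePart x (ι_mem_degreePart y)

lemma differentialOne_eq (a : A) : differentialOne k A a =
    ι k (unit k) * ι k a - tensorTwo k A (CoalgebraStruct.comul (R := k) a) +
      ι k a * ι k (unit k) := rfl

lemma tensorTwo_tmul (a b : A) : tensorTwo k A (a ⊗ₜ b) = ι k a * ι k b := by simp [tensorTwo]

@[simp] lemma signAut_ι (a : A) : signAut k A (ι k a) = - ι k a := by simp [signAut]

lemma differential_one : differential k A 1 = 0 := by
  simpa using differential_algebraMap (A := A) (1 : k)

lemma differential_ι_mul (a : A) (x : TensorAlgebra k A) : differential k A (ι k a * x) =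
    differentialOne k A a * x - ι k a * differential k A x := by
  rw [differential_mul, differential_ι, signAut_ι, neg_mul, sub_eq_add_neg]

lemma differential_mem_degreePart {n : ℕ} {x : TensorAlgebra k A} (hx : x ∈ degreePart k A n) :
    differential k A x ∈ degreePart k A (n + 1) := by
  induction n generalizing x with
  | zero =>
    obtain ⟨c, rfl⟩ := degreePart_zero hx
    rw [differential_algebraMap]; exact zero_mem _
  | succ n ih =>
    refine (degreePart_succ_induction (N := (degreePart k A (n + 1 + 1)).comap
      (differential k A)) ?_) hx
    intro a x hx
    rw [Submodule.mem_comap, differential_ι_mul]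
    refine sub_mem ?_ (ι_mul_mem_degreePart a (ih hx))
    rw [add_assoc, add_comm]
    refine mul_mem_degreePart ?_ hx
    rw [differentialOne_eq]
    exact add_mem (sub_mem (ι_mul_mem_degreePart _ (ι_mem_degreePart a))
      (tensorTwo_mem_degreePart _)) (ι_mul_mem_degreePart _ (ι_mem_degreePart _))

lemma degreeProj_differential (n : ℕ) (x : TensorAlgebra k A) :
    degreeProj (n + 1) (differential k A x) = differential k A (degreeProj n x) := by
  have : degreeProj (n + 1) ∘ₗ differential k A = differential k A ∘ₗ degreeProj n := by
    apply ext_degreePart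
    intro m x hx
    simp only [LinearMap.comp_apply, degreeProj_of_mem (differential_mem_degreePart hx),
      degreeProj_of_mem hx, add_left_inj]
    split_ifs <;> simp
  exact LinearMap.congr_fun this x

lemma degreeProj_zero_differential (x : TensorAlgebra k A) :
    degreeProj 0 (differential k A x) = 0 := by
  have : degreeProj 0 ∘ₗ differential k A = 0 := by
    apply ext_degreePart
    intro m x hx
    simp [degreeProj_of_mem (differential_mem_degreePart hx)]
  exact LinearMap.congr_fun this x

lemma signAut_of_mem {n : ℕ} {x : TensorAlgebra k A} (hx : x ∈ degreePart k A n) :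
    signAut k A x = (-1 : k) ^ n • x := by
  induction n generalizing x with
  | zero =>
    obtain ⟨c, rfl⟩ := degreePart_zero hx
    simp
  | succ n ih =>
    refine (degreePart_succ_induction (N := LinearMap.eqLocus (signAut k A).toLinearMap
      ((-1 : k) ^ (n + 1) • LinearMap.id)) ?_) hx
    intro a x hx
    change signAut k A (ι k a * x) = (-1 : k) ^ (n + 1) • (ι k a * x)
    rw [map_mul, ih hx, signAut_ι, pow_succ]
    simp

end gradingDifferential
end Hochschild

namespace Hochschild
open UnitalSupercoalgebra TensorAlgebra

/-! ### The retraction onto the cochains of a principal subcoalgebra -/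

section maps
variable {k A C : Type*} [Field k] [AddCommGroup A] [Module k A] [UnitalSupercoalgebra k A]
  [AddCommGroup C] [Module k C] [UnitalSupercoalgebra k C]

lemma cochainMap_injective {j : C →ₗ[k] A} (hj : Function.Injective j) :
    Function.Injective (cochainMap j) := by
  obtain ⟨g, hg⟩ := LinearMap.exists_leftInverse_of_injective j (LinearMap.ker_eq_bot.mpr hj)
  have : (cochainMap g).comp (cochainMap j) = AlgHom.id k _ := by
    ext c
    simpa using congrArg (ι k) (LinearMap.congr_fun hg c)
  exact Function.LeftInverse.injective fun x => DFunLike.congr_fun this x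

lemma signAut_cochainMap (j : C →ₗ[k] A) (x : TensorAlgebra k C) :
    signAut k A (cochainMap j x) = cochainMap j (signAut k C x) := by
  have : (signAut k A).comp (cochainMap j) = (cochainMap j).comp (signAut k C) := by
    ext; simp [signAut]
  exact DFunLike.congr_fun this x

/-- A supercoalgebra `C ⊆ A` that is the kernel of an endomorphism `D` of the bicomodule `A`,
together with a partial section `σ` of `D`. Two cases are used: `D` is surjective with
`D ∘ σ = 1`, or `σ = D` is idempotent and kills the unit. Dually, `D` is the multiplication by a
central element `z` and `C^* = A^* / (z)`, where `z` is a nonzerodivisor or an idempotent. -/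
structure IsPrincipal (j : Hom k C A) (D σ : A →ₗ[k] A) : Prop where
  injective : Function.Injective j.toLin
  range_eq : LinearMap.range j.toLin = LinearMap.ker D
  comul_left : ∀ a, D.rTensor A (CoalgebraStruct.comul (R := k) a) =
    CoalgebraStruct.comul (R := k) (D a)
  comul_right : ∀ a, D.lTensor A (CoalgebraStruct.comul (R := k) a) =
    CoalgebraStruct.comul (R := k) (D a)
  section_apply : ∀ a, D (σ (D a)) = D a
  comul_section : ∀ a, (D ∘ₗ σ).rTensor A (CoalgebraStruct.comul (R := k) a) =
    CoalgebraStruct.comul (R := k) (D (σ a))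
  section_unit : σ (unit k) = 0 ∨ D (σ (unit k)) = unit k

/-- The operator `S(b y) = σ(b) y`, `S(1) = 0`: the partial section in the first tensor factor. -/
def headMap (σ : A →ₗ[k] A) : TensorAlgebra k A →ₗ[k] TensorAlgebra k A :=
  leftRec (LinearMap.mul k _ ∘ₗ ι k ∘ₗ σ) 0

/-- The homotopy `H(a x) = ε(D a) S(x) - π(a) H(x)`, `H(1) = 0`, where `π = 1 - σ D`. As `π` takes
values in `C`, the homotopy passes over the tensor factors with their part in `C`, and where it
meets a factor `a` outside `C` it contracts it by `ε ∘ D` and lifts the next factor by `σ`. -/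
def gysinHomotopy (D σ : A →ₗ[k] A) : TensorAlgebra k A →ₗ[k] TensorAlgebra k A :=
  leftRec ((CoalgebraStruct.counit (R := k) ∘ₗ D).smulRight (headMap σ))
    (-(ι k ∘ₗ (LinearMap.id - σ ∘ₗ D)))

/-- The chain endomorphism `1 + ∂ H + H ∂` of `T(A)`, homotopic to the identity. It fixes
`T(C) + T(C) σ(1)`, and moves one more tensor factor into `C` with each application. -/
def gysinRetract (D σ : A →ₗ[k] A) : TensorAlgebra k A →ₗ[k] TensorAlgebra k A :=
  LinearMap.id + differential k A ∘ₗ gysinHomotopy D σ + gysinHomotopy D σ ∘ₗ differential k A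

/-- The subcomplex `T(C) + T(C) σ(1)` of `T(A)`. -/
def gysinSubmodule (j : Hom k C A) (σ : A →ₗ[k] A) : Submodule k (TensorAlgebra k A) :=
  LinearMap.range (cochainMap j.toLin).toLinearMap ⊔
    LinearMap.range (LinearMap.mulRight k (ι k (σ (unit k))) ∘ₗ (cochainMap j.toLin).toLinearMap)

section
variable (D σ : A →ₗ[k] A)

@[simp] lemma headMap_one : headMap σ 1 = 0 := leftRec_one _ _

@[simp] lemma headMap_ι_mul (b : A) (x : TensorAlgebra k A) :
    headMap σ (ι k b * x) = ι k (σ b) * x := by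
  simp [headMap, leftRec_ι_mul]

lemma headMap_tensorTwo_mul (z : A ⊗[k] A) (x : TensorAlgebra k A) :
    headMap σ (tensorTwo k A z * x) = tensorTwo k A (σ.rTensor A z) * x := by
  induction z with
  | zero => simp
  | add x y hx hy => simp only [map_add, add_mul, hx, hy]
  | tmul a b => simp [tensorTwo_tmul, mul_assoc]

@[simp] lemma gysinHomotopy_one : gysinHomotopy D σ 1 = 0 := leftRec_one _ _

lemma gysinHomotopy_ι_mul (a : A) (x : TensorAlgebra k A) : gysinHomotopy D σ (ι k a * x) =
    CoalgebraStruct.counit (R := k) (D a) • headMap σ x -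
      ι k (a - σ (D a)) * gysinHomotopy D σ x := by
  rw [gysinHomotopy, leftRec_ι_mul]
  simp only [LinearMap.neg_apply, LinearMap.comp_apply, LinearMap.sub_apply, LinearMap.id_apply,
    LinearMap.smulRight_apply, LinearMap.smul_apply, neg_mul]
  rw [← sub_eq_add_neg]

lemma gysinHomotopy_tensorTwo_mul (z : A ⊗[k] A) (x : TensorAlgebra k A) :
    gysinHomotopy D σ (tensorTwo k A z * x) =
      ι k (σ (TensorProduct.lid k A ((CoalgebraStruct.counit (R := k) ∘ₗ D).rTensor A z))) * x
      - ι k ((LinearMap.id - σ ∘ₗ D : A →ₗ[k] A)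
          (TensorProduct.rid k A ((CoalgebraStruct.counit (R := k) ∘ₗ D).lTensor A z)))
          * headMap σ x
      + tensorTwo k A (TensorProduct.map (LinearMap.id - σ ∘ₗ D) (LinearMap.id - σ ∘ₗ D) z)
          * gysinHomotopy D σ x := by
  induction z with
  | zero => simp
  | add x y hx hy => simp only [map_add, add_mul, hx, hy]; abel
  | tmul a b =>
    simp only [tensorTwo_tmul, mul_assoc, gysinHomotopy_ι_mul, headMap_ι_mul,
      LinearMap.rTensor_tmul, LinearMap.lTensor_tmul, TensorProduct.lid_tmul,
      TensorProduct.rid_tmul, TensorProduct.map_tmul, LinearMap.comp_apply, map_smul,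
      LinearMap.sub_apply, LinearMap.id_apply, smul_mul_assoc, mul_sub, mul_smul_comm]
    abel

end

namespace IsPrincipal
variable {j : Hom k C A} {D σ : A →ₗ[k] A} (h : IsPrincipal j D σ)
include h

lemma apply_toLin (c : C) : D (j.toLin c) = 0 := by
  rw [← LinearMap.mem_ker, ← h.range_eq]
  exact LinearMap.mem_range_self _ c

lemma apply_unit : D (unit k) = 0 := by
  rw [← j.map_unit]; exact h.apply_toLin _

lemma exists_of_apply_eq_zero {a : A} (ha : D a = 0) : ∃ c, j.toLin c = a := by
  rw [← LinearMap.mem_ker, ← h.range_eq] at ha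
  exact ha

/-- The operator `1 - σ D` takes values in `C`. -/
lemma exists_proj (a : A) : ∃ c, j.toLin c = a - σ (D a) :=
  h.exists_of_apply_eq_zero (by rw [map_sub, h.section_apply, sub_self])

lemma lid_counit_comul (a : A) : TensorProduct.lid k A
    ((CoalgebraStruct.counit (R := k) ∘ₗ D).rTensor A (CoalgebraStruct.comul (R := k) a)) = D a := by
  rw [LinearMap.rTensor_comp, LinearMap.comp_apply, h.comul_left, Coalgebra.rTensor_counit_comul]
  simp

lemma rid_counit_comul (a : A) : TensorProduct.rid k A
    ((CoalgebraStruct.counit (R := k) ∘ₗ D).lTensor A (CoalgebraStruct.comul (R := k) a)) = D a := by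
  rw [LinearMap.lTensor_comp, LinearMap.comp_apply, h.comul_right, Coalgebra.lTensor_counit_comul]
  simp

lemma homotopy_differentialOne_mul (a : A) (x : TensorAlgebra k A) :
    gysinHomotopy D σ (differentialOne k A a * x) =
      - (ι k (unit k) * (CoalgebraStruct.counit (R := k) (D a) • headMap σ x -
          ι k (a - σ (D a)) * gysinHomotopy D σ x))
      - (ι k (σ (D a)) * x - ι k (D a - σ (D (D a))) * headMap σ x +
          tensorTwo k A (TensorProduct.map (LinearMap.id - σ ∘ₗ D) (LinearMap.id - σ ∘ₗ D)
            (CoalgebraStruct.comul (R := k) a)) * gysinHomotopy D σ x)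
      + (CoalgebraStruct.counit (R := k) (D a) • (ι k (σ (unit k)) * x) +
          ι k (a - σ (D a)) * (ι k (unit k) * gysinHomotopy D σ x)) := by
  have h1 : ∀ y, gysinHomotopy D σ (ι k (unit k) * y) = -(ι k (unit k) * gysinHomotopy D σ y) := by
    intro y
    rw [gysinHomotopy_ι_mul, h.apply_unit]
    simp
  rw [differentialOne_eq, add_mul, sub_mul, mul_assoc, mul_assoc, map_add, map_sub, h1,
    gysinHomotopy_tensorTwo_mul, h.lid_counit_comul, h.rid_counit_comul, gysinHomotopy_ι_mul,
    gysinHomotopy_ι_mul, h1, headMap_ι_mul]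
  simp only [LinearMap.sub_apply, LinearMap.id_apply, LinearMap.comp_apply, mul_neg, sub_neg_eq_add]

lemma retract_ι_mul (a : A) (x : TensorAlgebra k A) : gysinRetract D σ (ι k a * x) =
    ι k (a - σ (D a)) * gysinRetract D σ x
    + (tensorTwo k A (CoalgebraStruct.comul (R := k) (a - σ (D a))) -
        tensorTwo k A (TensorProduct.map (LinearMap.id - σ ∘ₗ D) (LinearMap.id - σ ∘ₗ D)
            (CoalgebraStruct.comul (R := k) a))) * gysinHomotopy D σ x
    + CoalgebraStruct.counit (R := k) (D a) • (differential k A (headMap σ x)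
        - headMap σ (differential k A x) - ι k (unit k) * headMap σ x + ι k (σ (unit k)) * x)
    + ι k (D a - σ (D (D a))) * headMap σ x := by
  simp only [gysinRetract, LinearMap.add_apply, LinearMap.id_apply, LinearMap.comp_apply]
  rw [differential_ι_mul, map_sub (gysinHomotopy D σ), h.homotopy_differentialOne_mul,
    gysinHomotopy_ι_mul, gysinHomotopy_ι_mul, map_sub (differential k A), map_smul,
    differential_ι_mul, differentialOne_eq]
  simp only [mul_add, mul_sub, sub_mul, add_mul, smul_add, smul_sub, mul_smul_comm, map_sub,
    mul_assoc]
  abel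

/-- The commutator of `S` with the differential, corrected by the unit, sends `b y` to an element of
`C ⊗ A ⊗ T(A)`, since the first factor is in the image of `1 - σ D`. -/
lemma head_commutator_ι_mul (b : A) (y : TensorAlgebra k A) :
    differential k A (headMap σ (ι k b * y)) - headMap σ (differential k A (ι k b * y))
      - ι k (unit k) * headMap σ (ι k b * y) + ι k (σ (unit k)) * (ι k b * y) =
    tensorTwo k A ((LinearMap.id - σ ∘ₗ D).rTensor A
      (σ.rTensor A (CoalgebraStruct.comul (R := k) b) - CoalgebraStruct.comul (R := k) (σ b))) * y := by
  -- `D σ` is a comodule endomorphism, so `D` kills the first factor.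
  have hz : ∀ b, (LinearMap.id - σ ∘ₗ D).rTensor A
      (σ.rTensor A (CoalgebraStruct.comul (R := k) b) - CoalgebraStruct.comul (R := k) (σ b)) =
      σ.rTensor A (CoalgebraStruct.comul (R := k) b) - CoalgebraStruct.comul (R := k) (σ b) := by
    intro b
    rw [LinearMap.rTensor_sub, LinearMap.sub_apply, LinearMap.rTensor_id, LinearMap.id_apply,
      LinearMap.rTensor_comp, LinearMap.comp_apply, map_sub (D.rTensor A), h.comul_left,
      ← h.comul_section, LinearMap.rTensor_comp, LinearMap.comp_apply, sub_self, map_zero, sub_zero]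
  rw [hz, headMap_ι_mul, differential_ι_mul, differential_ι_mul, differentialOne_eq,
    differentialOne_eq, map_sub (headMap σ), add_mul, sub_mul, add_mul (_ - _), sub_mul,
    map_add (headMap σ), map_sub (headMap σ), mul_assoc (ι k (unit k)) (ι k b), headMap_ι_mul,
    headMap_tensorTwo_mul, mul_assoc (ι k b), headMap_ι_mul, headMap_ι_mul, map_sub]
  noncomm_ring

lemma homotopy_cochainMap_mul (y : TensorAlgebra k C) (x : TensorAlgebra k A) :
    gysinHomotopy D σ (cochainMap j.toLin y * x) =
      cochainMap j.toLin (signAut k C y) * gysinHomotopy D σ x := by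
  have : gysinHomotopy D σ ∘ₗ LinearMap.mulRight k x ∘ₗ (cochainMap j.toLin).toLinearMap =
      LinearMap.mulRight k (gysinHomotopy D σ x) ∘ₗ (cochainMap j.toLin).toLinearMap ∘ₗ
        (signAut k C).toLinearMap := by
    apply linearMap_ext_left
    · simp
    · intro c y hy
      simp only [LinearMap.comp_apply, LinearMap.mulRight_apply, AlgHom.toLinearMap_apply, map_mul,
        cochainMap_ι, signAut_ι, map_neg, mul_assoc] at hy ⊢
      rw [gysinHomotopy_ι_mul, h.apply_toLin, hy]
      simp [mul_assoc]
  exact LinearMap.congr_fun this y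

lemma retract_cochainMap_mul (y : TensorAlgebra k C) (x : TensorAlgebra k A) :
    gysinRetract D σ (cochainMap j.toLin y * x) = cochainMap j.toLin y * gysinRetract D σ x := by
  simp only [gysinRetract, LinearMap.add_apply, LinearMap.id_apply, LinearMap.comp_apply]
  rw [h.homotopy_cochainMap_mul, differential_mul, differential_mul, map_add,
    differential_map, differential_map, h.homotopy_cochainMap_mul, signAut_cochainMap,
    signAut_cochainMap, h.homotopy_cochainMap_mul, differential_signAut, signAut_signAut]
  simp only [map_neg, mul_add, neg_mul]
  abel

lemma retract_one : gysinRetract D σ 1 = 1 := by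
  simp [gysinRetract, differential_one]

lemma homotopy_section_unit : gysinHomotopy D σ (ι k (σ (unit k))) = 0 := by
  have := gysinHomotopy_ι_mul D σ (σ (unit k)) 1
  simpa using this

lemma retract_section_unit :
    gysinRetract D σ (ι k (σ (unit k))) = ι k (σ (unit k)) := by
  rcases h.section_unit with h0 | h1
  · simp [h0]
  · have := h.homotopy_differentialOne_mul (σ (unit k)) 1
    simp only [mul_one, headMap_one, gysinHomotopy_one, h1, counit_unit, h.apply_unit] at this
    simp only [gysinRetract, LinearMap.add_apply, LinearMap.id_apply, LinearMap.comp_apply,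
      h.homotopy_section_unit, differential_ι, this]
    simp

lemma retract_of_mem {m : TensorAlgebra k A} (hm : m ∈ gysinSubmodule j σ) :
    gysinRetract D σ m = m := by
  obtain ⟨_, ⟨x, rfl⟩, _, ⟨y, rfl⟩, rfl⟩ := Submodule.mem_sup.mp hm
  have h1 := h.retract_cochainMap_mul x 1
  rw [h.retract_one, mul_one] at h1
  simp only [AlgHom.toLinearMap_apply, LinearMap.comp_apply, LinearMap.mulRight_apply, map_add, h1,
    h.retract_cochainMap_mul, h.retract_section_unit]

omit h in
lemma cochainMap_mul_mem (j : Hom k C A) (y : TensorAlgebra k C) {m : TensorAlgebra k A}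
    (hm : m ∈ gysinSubmodule j σ) : cochainMap j.toLin y * m ∈ gysinSubmodule j σ := by
  obtain ⟨_, ⟨x, rfl⟩, _, ⟨z, rfl⟩, rfl⟩ := Submodule.mem_sup.mp hm
  rw [mul_add]
  refine Submodule.add_mem_sup ⟨y * x, ?_⟩ ⟨y * z, ?_⟩ <;> simp [mul_assoc]

lemma headMap_mem {n : ℕ} {x : TensorAlgebra k A} (hx : x ∈ degreePart k A n) :
    headMap σ x ∈ degreePart k A n := by
  cases n with
  | zero =>
    obtain ⟨c, rfl⟩ := degreePart_zero hx
    rw [Algebra.algebraMap_eq_smul_one, map_smul, headMap_one, smul_zero]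
    exact zero_mem _
  | succ n =>
    refine (degreePart_succ_induction (N := (degreePart k A (n + 1)).comap (headMap σ)) ?_) hx
    intro a x hx
    rw [Submodule.mem_comap, headMap_ι_mul]
    exact ι_mul_mem_degreePart _ hx

lemma homotopy_zero {x : TensorAlgebra k A} (hx : x ∈ degreePart k A 0) :
    gysinHomotopy D σ x = 0 := by
  obtain ⟨c, rfl⟩ := degreePart_zero hx
  rw [Algebra.algebraMap_eq_smul_one, map_smul, gysinHomotopy_one, smul_zero]

lemma homotopy_mem {n : ℕ} {x : TensorAlgebra k A} (hx : x ∈ degreePart k A (n + 1)) :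
    gysinHomotopy D σ x ∈ degreePart k A n := by
  induction n generalizing x with
  | zero =>
    refine (degreePart_succ_induction (N := (degreePart k A 0).comap (gysinHomotopy D σ)) ?_) hx
    intro a x hx
    rw [Submodule.mem_comap, gysinHomotopy_ι_mul, h.homotopy_zero hx, mul_zero, sub_zero]
    exact Submodule.smul_mem _ _ (h.headMap_mem hx)
  | succ n ih =>
    refine (degreePart_succ_induction
      (N := (degreePart k A (n + 1)).comap (gysinHomotopy D σ)) ?_) hx
    intro a x hx
    rw [Submodule.mem_comap, gysinHomotopy_ι_mul]
    exact sub_mem (Submodule.smul_mem _ _ (h.headMap_mem hx)) (ι_mul_mem_degreePart _ (ih hx))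

lemma retract_mem {n : ℕ} {x : TensorAlgebra k A} (hx : x ∈ degreePart k A n) :
    gysinRetract D σ x ∈ degreePart k A n := by
  simp only [gysinRetract, LinearMap.add_apply, LinearMap.id_apply, LinearMap.comp_apply]
  refine add_mem (add_mem hx ?_) (h.homotopy_mem (differential_mem_degreePart hx))
  cases n with
  | zero => rw [h.homotopy_zero hx, map_zero]; exact zero_mem _
  | succ n => exact differential_mem_degreePart (h.homotopy_mem hx)

omit h in
lemma tensorTwo_mul_mem {π τ : A →ₗ[k] A} (hπ : ∀ a, ∃ c, j.toLin c = π a) (z : A ⊗[k] A) {n : ℕ}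
    {y : TensorAlgebra k A} (hy : y ∈ degreePart k A n) :
    tensorTwo k A (TensorProduct.map π τ z) * y ∈
      LinearMap.range (ι k ∘ₗ j.toLin) * degreePart k A (n + 1) := by
  induction z with
  | zero => simp
  | add x y hx hy => rw [map_add, map_add, add_mul]; exact add_mem hx hy
  | tmul a b =>
    obtain ⟨c, hc⟩ := hπ a
    rw [TensorProduct.map_tmul, tensorTwo_tmul, mul_assoc, ← hc]
    exact Submodule.mul_mem_mul ⟨c, rfl⟩ (ι_mul_mem_degreePart _ hy)

/-- The retraction moves a cochain of degree `n + 1` into `k σ(1) + C ⊗ A^{⊗ n}`. -/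
lemma retract_succ_mem {n : ℕ} {x : TensorAlgebra k A} (hx : x ∈ degreePart k A (n + 1)) :
    gysinRetract D σ x ∈ Submodule.span k {ι k (σ (unit k))} ⊔
      LinearMap.range (ι k ∘ₗ j.toLin) * degreePart k A n := by
  refine (degreePart_succ_induction (N := (Submodule.span k {ι k (σ (unit k))} ⊔
      LinearMap.range (ι k ∘ₗ j.toLin) * degreePart k A n).comap (gysinRetract D σ)) ?_) hx
  intro a x hx
  have hπ : ∀ a, ∃ c, j.toLin c = (LinearMap.id - σ ∘ₗ D : A →ₗ[k] A) a := h.exists_proj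
  rw [Submodule.mem_comap, h.retract_ι_mul]
  -- In each of the four summands the first factor is in the image of `1 - σ D`, apart from the term
  -- `ε(D a) σ(1)` that the third one gives for constant `x`.
  refine add_mem (add_mem (add_mem ?_ ?_) (Submodule.smul_mem _ _ ?_)) ?_
  · obtain ⟨c, hc⟩ := h.exists_proj a
    rw [← hc]
    exact Submodule.mem_sup_right (Submodule.mul_mem_mul ⟨c, rfl⟩ (h.retract_mem hx))
  · refine Submodule.mem_sup_right ?_
    cases n with
    | zero => rw [h.homotopy_zero hx, mul_zero]; exact zero_mem _
    | succ n =>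
      rw [sub_mul]
      refine sub_mem ?_ (tensorTwo_mul_mem hπ _ (h.homotopy_mem hx))
      obtain ⟨c, hc⟩ := h.exists_proj a
      have hj : CoalgebraStruct.comul (R := k) (a - σ (D a)) = TensorProduct.map
          (LinearMap.id - σ ∘ₗ D) LinearMap.id (CoalgebraStruct.comul (R := k) (a - σ (D a))) := by
        rw [← hc, j.map_comul, TensorProduct.map_map]
        congr 2
        ext c
        simp [h.apply_toLin]
      rw [hj]
      exact tensorTwo_mul_mem hπ _ (h.homotopy_mem hx)
  · cases n with
    | zero =>
      obtain ⟨c, rfl⟩ := degreePart_zero hx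
      refine Submodule.mem_sup_left (Submodule.mem_span_singleton.mpr ⟨c, ?_⟩)
      simp [differential_one, Algebra.algebraMap_eq_smul_one]
    | succ n =>
      refine Submodule.mem_sup_right ?_
      refine (degreePart_succ_induction (N := (LinearMap.range (ι k ∘ₗ j.toLin) *
        degreePart k A (n + 1)).comap (differential k A ∘ₗ headMap σ - headMap σ ∘ₗ differential k A
          - LinearMap.mulLeft k (ι k (unit k)) ∘ₗ headMap σ +
          LinearMap.mulLeft k (ι k (σ (unit k))))) ?_) hx
      intro b y hy
      rw [Submodule.mem_comap]
      simp only [LinearMap.add_apply, LinearMap.sub_apply, LinearMap.comp_apply,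
        LinearMap.mulLeft_apply]
      rw [h.head_commutator_ι_mul]
      exact tensorTwo_mul_mem hπ _ hy
  · obtain ⟨c, hc⟩ := h.exists_proj (D a)
    rw [← hc]
    exact Submodule.mem_sup_right (Submodule.mul_mem_mul ⟨c, rfl⟩ (h.headMap_mem hx))

omit h in
lemma iterate_retract (hm : ∀ m ∈ gysinSubmodule j σ, gysinRetract D σ m = m) (N : ℕ)
    {m : TensorAlgebra k A} (hmem : m ∈ gysinSubmodule j σ) :
    (gysinRetract D σ ^ N) m = m := by
  induction N with
  | zero => rfl
  | succ N ih => rw [pow_succ, Module.End.mul_apply, hm m hmem, ih]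

/-- In degree `n`, after `n` applications of the retraction all tensor factors are in `C`, except
possibly a last factor `σ(1)`. -/
lemma iterate_retract_mem_of_degree {n : ℕ} {x : TensorAlgebra k A}
    (hx : x ∈ degreePart k A n) : (gysinRetract D σ ^ n) x ∈ gysinSubmodule j σ := by
  induction n generalizing x with
  | zero =>
    obtain ⟨c, rfl⟩ := degreePart_zero hx
    exact Submodule.mem_sup_left ⟨algebraMap k _ c, by simp⟩
  | succ n ih =>
    rw [pow_succ, Module.End.mul_apply]
    have h1 : ∀ z ∈ Submodule.span k {ι k (σ (unit k))} ⊔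
      LinearMap.range (ι k ∘ₗ j.toLin) * degreePart k A n,
        (gysinRetract D σ ^ n) z ∈ gysinSubmodule j σ := by
      suffices h2 : Submodule.span k {ι k (σ (unit k))} ⊔
          LinearMap.range (ι k ∘ₗ j.toLin) * degreePart k A n ≤
            (gysinSubmodule j σ).comap (gysinRetract D σ ^ n) from fun z hz => h2 hz
      refine sup_le ?_ ?_
      · rw [Submodule.span_le, Set.singleton_subset_iff, SetLike.mem_coe, Submodule.mem_comap]
        have hs : ι k (σ (unit k)) ∈ gysinSubmodule j σ :=
          Submodule.mem_sup_right ⟨1, by simp⟩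
        rw [iterate_retract (fun m hm => h.retract_of_mem hm) n hs]
        exact hs
      · rw [Submodule.mul_le]
        rintro _ ⟨c, rfl⟩ y hy
        -- The retraction is linear over `T(C)`, so it goes on with the remaining factors `y`.
        have h2 : ∀ N y, (gysinRetract D σ ^ N) (cochainMap j.toLin (ι k c) * y) =
            cochainMap j.toLin (ι k c) * (gysinRetract D σ ^ N) y := by
          intro N
          induction N with
          | zero => intro y; rfl
          | succ N ihN =>
            intro y
            rw [pow_succ, Module.End.mul_apply, h.retract_cochainMap_mul, ihN]
            rfl
        have h3 := h2 n y
        rw [cochainMap_ι] at h3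
        rw [Submodule.mem_comap, LinearMap.comp_apply, h3, ← cochainMap_ι]
        exact cochainMap_mul_mem j _ (ih hy)
    exact h1 _ (h.retract_succ_mem hx)

lemma exists_iterate_retract_mem (x : TensorAlgebra k A) :
    ∃ N, (gysinRetract D σ ^ N) x ∈ gysinSubmodule j σ := by
  obtain ⟨s, hs⟩ := exists_sum_degreeProj x
  refine ⟨s.sup id, ?_⟩
  rw [hs, map_sum]
  refine sum_mem fun n hn => ?_
  obtain ⟨l, hl⟩ := Nat.exists_eq_add_of_le' (Finset.le_sup (f := id) hn)
  rw [hl, pow_add, Module.End.mul_apply, id_eq]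
  have := h.iterate_retract_mem_of_degree (degreeProj_mem n x)
  rwa [iterate_retract (fun m hm => h.retract_of_mem hm) l this]

lemma differential_retract (N : ℕ) (x : TensorAlgebra k A) :
    differential k A ((gysinRetract D σ ^ N) x) = (gysinRetract D σ ^ N) (differential k A x) := by
  induction N generalizing x with
  | zero => rfl
  | succ N ih =>
    rw [pow_succ, Module.End.mul_apply, Module.End.mul_apply, ih]
    congr 1
    simp [gysinRetract, differential_differential]

lemma exists_iterate_retract_eq (N : ℕ) {z : TensorAlgebra k A} (hz : differential k A z = 0) :
    ∃ u, (gysinRetract D σ ^ N) z = z + differential k A u := by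
  induction N with
  | zero => exact ⟨0, by simp⟩
  | succ N ih =>
    obtain ⟨u, hu⟩ := ih
    refine ⟨u + gysinHomotopy D σ (z + differential k A u), ?_⟩
    rw [pow_succ', Module.End.mul_apply, hu]
    simp only [gysinRetract, LinearMap.add_apply, LinearMap.id_apply, LinearMap.comp_apply, map_add,
      hz, differential_differential]
    simp only [map_zero, add_zero]
    abel

/-- Every cocycle is cohomologous to an element of `T(C) + T(C) σ(1)`. -/
theorem exists_cocycle_eq {z : TensorAlgebra k A} (hz : differential k A z = 0) :
    ∃ x y u, z + differential k A u =
      cochainMap j.toLin x + cochainMap j.toLin y * ι k (σ (unit k)) := by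
  obtain ⟨N, hN⟩ := h.exists_iterate_retract_mem z
  obtain ⟨u, hu⟩ := h.exists_iterate_retract_eq N hz
  rw [hu] at hN
  obtain ⟨_, ⟨x, rfl⟩, _, ⟨y, rfl⟩, hxy⟩ := Submodule.mem_sup.mp hN
  exact ⟨x, y, u, hxy.symm⟩

/-- An element of `T(C) + T(C) σ(1)` that is a coboundary in `T(A)` is the coboundary of an element
of `T(C) + T(C) σ(1)`. -/
theorem exists_coboundary_eq {x y : TensorAlgebra k C} {q : TensorAlgebra k A}
    (hq : cochainMap j.toLin x + cochainMap j.toLin y * ι k (σ (unit k)) = differential k A q) :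
    ∃ x' y', cochainMap j.toLin x + cochainMap j.toLin y * ι k (σ (unit k)) =
      differential k A (cochainMap j.toLin x' + cochainMap j.toLin y' * ι k (σ (unit k))) := by
  obtain ⟨N, hN⟩ := h.exists_iterate_retract_mem q
  have hd := h.differential_retract N q
  have hmem : cochainMap j.toLin x + cochainMap j.toLin y * ι k (σ (unit k)) ∈
      gysinSubmodule j σ := Submodule.add_mem_sup ⟨x, rfl⟩ ⟨y, rfl⟩
  rw [← hq, iterate_retract (fun m hm => h.retract_of_mem hm) N hmem] at hd
  obtain ⟨_, ⟨x', rfl⟩, _, ⟨y', rfl⟩, hxy⟩ := Submodule.mem_sup.mp hN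
  exact ⟨x', y', by rw [← hd, ← hxy]; rfl⟩

/-- The sum `T(C) + T(C) σ(1)` is direct if `D σ(1) = 1`: the twisted derivation extending `ε ∘ D`
kills `T(C)` and sends `y σ(1)` to `± y`. -/
theorem eq_zero_of_add_eq_zero (hs : D (σ (unit k)) = unit k) {x y : TensorAlgebra k C}
    (hxy : cochainMap j.toLin x + cochainMap j.toLin y * ι k (σ (unit k)) = 0) :
    x = 0 ∧ y = 0 := by
  set ρ := twistedDer (signAut k A)
    ((CoalgebraStruct.counit (R := k) ∘ₗ D).smulRight (1 : TensorAlgebra k A))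
  have h0 : ∀ x : TensorAlgebra k C, ρ (cochainMap j.toLin x) = 0 := by
    intro x
    have : ρ ∘ₗ (cochainMap j.toLin).toLinearMap = 0 := by
      apply linearMap_ext_left
      · simp [ρ]
      · intro c x hx
        simp only [LinearMap.comp_apply, AlgHom.toLinearMap_apply, map_mul, cochainMap_ι,
          LinearMap.zero_apply] at hx ⊢
        rw [twistedDer_mul, hx]
        simp [h.apply_toLin]
    exact LinearMap.congr_fun this x
  have h1 := congrArg ρ hxy
  rw [map_add, h0, twistedDer_mul, h0, twistedDer_ι, map_zero] at h1
  simp only [LinearMap.smulRight_apply, LinearMap.comp_apply, hs, counit_unit, one_smul, zero_mul,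
    zero_add, mul_one, signAut_cochainMap] at h1
  have hy : signAut k C y = 0 := cochainMap_injective h.injective (by rw [h1, map_zero])
  have hy' : y = 0 := by rw [← signAut_signAut y, hy, map_zero]
  refine ⟨cochainMap_injective h.injective ?_, hy'⟩
  rw [hy', map_zero, zero_mul, add_zero] at hxy
  rw [hxy, map_zero]

end IsPrincipal
end maps
end Hochschild

namespace Hochschild
open UnitalSupercoalgebra TensorAlgebra

/-! ### Representing cocycles -/

section represents
variable {k A : Type*} [Field k] [AddCommGroup A] [Module k A] [UnitalSupercoalgebra k A]

lemma exists_represents (h : Cohomology k A) : ∃ z, Represents z h := by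
  obtain ⟨⟨z, hz⟩, rfl⟩ := Ideal.Quotient.mk_surjective h
  exact ⟨z, hz, rfl⟩

lemma exists_represented {z : TensorAlgebra k A} (hz : differential k A z = 0) :
    ∃ h : Cohomology k A, Represents z h := ⟨_, hz, rfl⟩

namespace Represents
variable {z z' : TensorAlgebra k A} {h h' : Cohomology k A}

lemma differential_eq (hz : Represents z h) : differential k A z = 0 := hz.1

lemma eq_iff (hz : Represents z h) (hz' : Represents z' h') :
    h = h' ↔ ∃ u, z - z' = differential k A u := by
  obtain ⟨hz, rfl⟩ := hz
  obtain ⟨hz', rfl⟩ := hz'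
  rw [Ideal.Quotient.eq]
  exact ⟨fun ⟨u, hu⟩ => ⟨u, hu.symm⟩, fun ⟨u, hu⟩ => ⟨u, hu.symm⟩⟩

lemma unique (hz : Represents z h) (hz' : Represents z h') : h = h' :=
  (hz.eq_iff hz').mpr ⟨0, by simp⟩

lemma add (hz : Represents z h) (hz' : Represents z' h') : Represents (z + z') (h + h') := by
  obtain ⟨hz, rfl⟩ := hz
  obtain ⟨hz', rfl⟩ := hz'
  exact ⟨add_mem hz hz', rfl⟩

lemma mul (hz : Represents z h) (hz' : Represents z' h') : Represents (z * z') (h * h') := by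
  obtain ⟨hz, rfl⟩ := hz
  obtain ⟨hz', rfl⟩ := hz'
  exact ⟨mul_mem hz hz', rfl⟩

lemma smul (c : k) (hz : Represents z h) : Represents (c • z) (c • h) := by
  obtain ⟨hz, rfl⟩ := hz
  exact ⟨Subalgebra.smul_mem _ hz c, rfl⟩

lemma sub (hz : Represents z h) (hz' : Represents z' h') : Represents (z - z') (h - h') := by
  obtain ⟨hz, rfl⟩ := hz
  obtain ⟨hz', rfl⟩ := hz'
  exact ⟨sub_mem hz hz', rfl⟩

protected lemma algebraMap (c : k) :
    Represents (algebraMap k _ c) (algebraMap k (Cohomology k A) c) :=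
  ⟨Subalgebra.algebraMap_mem _ c, rfl⟩

protected lemma zero : Represents (0 : TensorAlgebra k A) (0 : Cohomology k A) :=
  ⟨zero_mem _, rfl⟩

protected lemma one : Represents (1 : TensorAlgebra k A) (1 : Cohomology k A) :=
  ⟨one_mem _, rfl⟩

lemma pow (hz : Represents z h) (n : ℕ) : Represents (z ^ n) (h ^ n) := by
  induction n with
  | zero => simpa using Represents.one
  | succ n ih => rw [pow_succ, pow_succ]; exact ih.mul hz

protected lemma sum {I : Type*} (s : Finset I) (z : I → TensorAlgebra k A)
    (h : I → Cohomology k A) (hz : ∀ i ∈ s, Represents (z i) (h i)) :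
    Represents (∑ i ∈ s, z i) (∑ i ∈ s, h i) := by
  classical
  induction s using Finset.induction_on with
  | empty => simpa using Represents.zero
  | insert a s ha ih =>
    rw [Finset.sum_insert ha, Finset.sum_insert ha]
    exact (hz a (Finset.mem_insert_self _ _)).add
      (ih fun i hi => hz i (Finset.mem_insert_of_mem hi))

lemma eq_zero_iff (hz : Represents z h) : h = 0 ↔ ∃ u, z = differential k A u := by
  simpa using hz.eq_iff Represents.zero

lemma map {B : Type*} [AddCommGroup B] [Module k B] [UnitalSupercoalgebra k B]
    (f : Hom k A B) (hz : Represents z h) :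
    Represents (cochainMap f.toLin z) (cohomologyMap f h) := by
  obtain ⟨hz, rfl⟩ := hz
  exact ⟨(cocyclesMap f ⟨z, hz⟩).2, rfl⟩

end Represents

lemma differential_degreeProj_eq_zero {z : TensorAlgebra k A} (hz : differential k A z = 0)
    (n : ℕ) : differential k A (degreeProj n z) = 0 := by
  rw [← degreeProj_differential, hz, map_zero]

lemma exists_degreeProj_differential (n : ℕ) (u : TensorAlgebra k A) :
    ∃ u', degreeProj n (differential k A u) = differential k A u' := by
  cases n with
  | zero => exact ⟨0, by rw [degreeProj_zero_differential, map_zero]⟩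
  | succ n => exact ⟨_, degreeProj_differential n u⟩

/-- A subset of the cohomology ring that contains the homogeneous components of its elements. -/
def IsGradedSubset (V : Set (Cohomology k A)) : Prop :=
  ∀ v ∈ V, ∃ z, Represents z v ∧ ∀ n, ∃ v' ∈ V, Represents (degreeProj n z) v'

lemma isGradedSubset_adjoin {S : Set (Cohomology k A)}
    (hS : ∀ v ∈ S, ∃ n, ∃ z ∈ degreePart k A n, Represents z v) :
    IsGradedSubset (Algebra.adjoin k S : Set (Cohomology k A)) := by
  have hom : ∀ v ∈ Algebra.adjoin k S, (∃ n, ∃ z ∈ degreePart k A n, Represents z v) →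
      ∃ z, Represents z v ∧ ∀ n, ∃ v' ∈ Algebra.adjoin k S, Represents (degreeProj n z) v' := by
    rintro v hv ⟨m, z, hz, hzv⟩
    refine ⟨z, hzv, fun n => ?_⟩
    rw [degreeProj_of_mem hz]
    split_ifs
    · exact ⟨v, hv, hzv⟩
    · exact ⟨0, zero_mem _, Represents.zero⟩
  intro v hv
  change v ∈ Algebra.adjoin k S at hv
  change ∃ z, Represents z v ∧ ∀ n, ∃ v' ∈ Algebra.adjoin k S, Represents (degreeProj n z) v'
  induction hv using Algebra.adjoin_induction with
  | mem v hv => exact hom v (Algebra.subset_adjoin hv) (hS v hv)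
  | algebraMap c =>
    refine hom _ (Subalgebra.algebraMap_mem _ c) ⟨0, _, ?_, Represents.algebraMap c⟩
    rw [degreePart, pow_zero]
    exact Submodule.mem_one.mpr ⟨c, rfl⟩
  | add v w _ _ hv hw =>
    obtain ⟨z, hz, h1⟩ := hv
    obtain ⟨z', hz', h2⟩ := hw
    refine ⟨z + z', hz.add hz', fun n => ?_⟩
    obtain ⟨a, ha, ha'⟩ := h1 n
    obtain ⟨b, hb, hb'⟩ := h2 n
    exact ⟨a + b, add_mem ha hb, by rw [map_add]; exact ha'.add hb'⟩
  | mul v w _ _ hv hw =>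
    obtain ⟨z, hz, h1⟩ := hv
    obtain ⟨z', hz', h2⟩ := hw
    choose a ha ha' using h1
    choose b hb hb' using h2
    refine ⟨z * z', hz.mul hz', fun n => ?_⟩
    refine ⟨_, sum_mem (t := Finset.HasAntidiagonal.antidiagonal n)
      fun ij _ => mul_mem (ha ij.1) (hb ij.2), ?_⟩
    rw [degreeProj_mul]
    exact Represents.sum _ _ _ fun ij _ => (ha' ij.1).mul (hb' ij.2)

end represents

section maps
variable {k A B : Type*} [Field k] [AddCommGroup A] [Module k A] [UnitalSupercoalgebra k A]
  [AddCommGroup B] [Module k B] [UnitalSupercoalgebra k B]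

lemma cohomologyMap_cohomologyMap (f : Hom k A B) (g : Hom k B A)
    (hgf : ∀ a, g.toLin (f.toLin a) = a) (h : Cohomology k A) :
    cohomologyMap g (cohomologyMap f h) = h := by
  obtain ⟨z, hz⟩ := exists_represents h
  refine ((hz.map f).map g).unique ?_
  have : (cochainMap g.toLin).comp (cochainMap f.toLin) = AlgHom.id k _ := by
    ext a
    simp [hgf]
  have h2 : cochainMap g.toLin (cochainMap f.toLin z) = z := DFunLike.congr_fun this z
  rw [h2]
  exact hz

lemma cohomologyMap_bijective_of_inverse (f : Hom k A B) (g : Hom k B A)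
    (hfg : ∀ b, f.toLin (g.toLin b) = b) (hgf : ∀ a, g.toLin (f.toLin a) = a) :
    Function.Bijective (cohomologyMap f) :=
  ⟨Function.LeftInverse.injective (cohomologyMap_cohomologyMap f g hgf),
    Function.RightInverse.surjective (cohomologyMap_cohomologyMap g f hfg)⟩

end maps

/-! ### The Gysin sequence -/

namespace IsPrincipal
variable {k A C : Type*} [Field k] [AddCommGroup A] [Module k A] [UnitalSupercoalgebra k A]
  [AddCommGroup C] [Module k C] [UnitalSupercoalgebra k C]
  {j : Hom k C A} {D σ : A →ₗ[k] A} (h : IsPrincipal j D σ)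
include h

/-- If `σ(1) = 0`, the subcomplex `T(C) + T(C) σ(1)` is just `T(C)`, so that the inclusion of `C`
induces an isomorphism. This is the case of an idempotent `D`. -/
theorem bijective_cohomologyMap (hs : σ (unit k) = 0) :
    Function.Bijective (cohomologyMap j) := by
  constructor
  · rw [injective_iff_map_eq_zero]
    intro c hc
    obtain ⟨x, hx⟩ := exists_represents c
    obtain ⟨q, hq⟩ := (hx.map j).eq_zero_iff.mp hc
    obtain ⟨x', y', h'⟩ := h.exists_coboundary_eq (x := x) (y := 0) (q := q) (by simpa using hq)
    simp only [map_zero, zero_mul, add_zero, hs, mul_zero] at h'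
    rw [differential_map] at h'
    exact hx.eq_zero_iff.mpr ⟨x', cochainMap_injective h.injective h'⟩
  · intro a
    obtain ⟨z, hz⟩ := exists_represents a
    obtain ⟨x, y, u, hu⟩ := h.exists_cocycle_eq hz.differential_eq
    simp only [hs, map_zero, mul_zero, add_zero] at hu
    have hx : differential k C x = 0 := by
      apply cochainMap_injective h.injective
      rw [← differential_map, ← hu, map_add, hz.differential_eq, differential_differential, map_zero,
        add_zero]
    obtain ⟨c, hc⟩ := exists_represented hx
    exact ⟨c, ((hc.map j).eq_iff hz).mpr ⟨u, by rw [← hu]; abel⟩⟩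

section regular
variable (hs : D (σ (unit k)) = unit k)
include hs

/-- The differential of `x + y σ(1)`, where `w = ∂ σ(1)` is a cochain of `C`: the subcomplex
`T(C) + T(C) σ(1)` is the mapping cone of the multiplication by `w`. -/
lemma differential_add_mul (x y w : TensorAlgebra k C)
    (hw : cochainMap j.toLin w = differential k A (ι k (σ (unit k)))) :
    differential k A (cochainMap j.toLin x + cochainMap j.toLin y * ι k (σ (unit k))) =
      cochainMap j.toLin (differential k C x + signAut k C y * w) +
        cochainMap j.toLin (differential k C y) * ι k (σ (unit k)) := by
  rw [map_add, differential_mul, differential_map, differential_map, ← hw, signAut_cochainMap,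
    map_add, map_mul]
  abel

/-- If `σ(1)` is a cocycle, with class `l`, every class is of the form `c + c' l` with `c` and `c'`
from `C`. -/
lemma exists_add_mul (hd : differential k A (ι k (σ (unit k))) = 0) {l : Cohomology k A}
    (hl : Represents (ι k (σ (unit k))) l) (a : Cohomology k A) :
    ∃ c c', a = cohomologyMap j c + cohomologyMap j c' * l := by
  obtain ⟨z, hz⟩ := exists_represents a
  obtain ⟨x, y, u, hu⟩ := h.exists_cocycle_eq hz.differential_eq
  have h1 := congrArg (differential k A) hu
  rw [map_add, hz.differential_eq, differential_differential, add_zero,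
    h.differential_add_mul hs x y 0 (by rw [hd, map_zero])] at h1
  obtain ⟨hx, hy⟩ := h.eq_zero_of_add_eq_zero hs h1.symm
  rw [mul_zero, add_zero] at hx
  obtain ⟨c, hc⟩ := exists_represented hx
  obtain ⟨c', hc'⟩ := exists_represented hy
  refine ⟨c, c', (hz.eq_iff ((hc.map j).add ((hc'.map j).mul hl))).mpr ⟨-u, ?_⟩⟩
  rw [← hu, map_neg]
  abel

/-- If `σ(1)` is a cocycle, with class `l`, the classes `c` and `c'` in `c + c' l` are unique. -/
lemma eq_zero_of_add_mul_eq_zero (hd : differential k A (ι k (σ (unit k))) = 0)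
    {l : Cohomology k A} (hl : Represents (ι k (σ (unit k))) l) {c c' : Cohomology k C}
    (hcc : cohomologyMap j c + cohomologyMap j c' * l = 0) : c = 0 ∧ c' = 0 := by
  obtain ⟨x, hx⟩ := exists_represents c
  obtain ⟨y, hy⟩ := exists_represents c'
  obtain ⟨q, hq⟩ := ((hx.map j).add ((hy.map j).mul hl)).eq_zero_iff.mp hcc
  obtain ⟨x', y', h'⟩ := h.exists_coboundary_eq hq
  rw [h.differential_add_mul hs x' y' 0 (by rw [hd, map_zero]), ← sub_eq_zero] at h'
  have h2 : cochainMap j.toLin (x - differential k C x') +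
      cochainMap j.toLin (y - differential k C y') * ι k (σ (unit k)) = 0 := by
    rw [← h']
    simp only [map_sub, sub_mul, mul_zero, add_zero]
    abel
  obtain ⟨h3, h4⟩ := h.eq_zero_of_add_eq_zero hs h2
  exact ⟨hx.eq_zero_iff.mpr ⟨x', sub_eq_zero.mp h3⟩, hy.eq_zero_iff.mpr ⟨y', sub_eq_zero.mp h4⟩⟩

/-- A class of `C` that vanishes in `A` is a multiple of the class of `∂ σ(1)`. -/
lemma exists_mul_of_map_eq_zero {w : TensorAlgebra k C}
    (hw : cochainMap j.toLin w = differential k A (ι k (σ (unit k)))) {l : Cohomology k C}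
    (hl : Represents w l) {c : Cohomology k C} (hc : cohomologyMap j c = 0) :
    ∃ c', c = c' * l := by
  obtain ⟨x, hx⟩ := exists_represents c
  obtain ⟨q, hq⟩ := (hx.map j).eq_zero_iff.mp hc
  obtain ⟨x', y', h'⟩ := h.exists_coboundary_eq (x := x) (y := 0) (q := q) (by simpa using hq)
  rw [h.differential_add_mul hs x' y' w hw, ← sub_eq_zero] at h'
  have h2 : cochainMap j.toLin (x - (differential k C x' + signAut k C y' * w)) +
      cochainMap j.toLin (0 - differential k C y') * ι k (σ (unit k)) = 0 := by
    rw [← h']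
    simp only [map_sub, map_zero, sub_mul]
    abel
  obtain ⟨h3, h4⟩ := h.eq_zero_of_add_eq_zero hs h2
  have hy : differential k C (signAut k C y') = 0 := by
    rw [differential_signAut, ← zero_sub, ← map_zero (signAut k C), ← map_sub]
    rw [map_zero, h4, map_zero]
  obtain ⟨c', hc'⟩ := exists_represented hy
  refine ⟨c', (hx.eq_iff (hc'.mul hl)).mpr ⟨x', ?_⟩⟩
  rw [sub_eq_zero.mp h3]
  abel

lemma map_eq_zero {w : TensorAlgebra k C}
    (hw : cochainMap j.toLin w = differential k A (ι k (σ (unit k)))) {l : Cohomology k C}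
    (hl : Represents w l) : cohomologyMap j l = 0 :=
  (hl.map j).eq_zero_iff.mpr ⟨_, hw⟩

/-- If every class of `A` comes from `C`, the class of `w = ∂ σ(1)` is a nonzerodivisor: if
`x w = ∂ u`, the cocycle `-u ± x σ(1)` of `A` is cohomologous to one of `C`, and the comparison of
the coefficients of `σ(1)` shows that `x` is a coboundary. -/
lemma eq_zero_of_mul_eq_zero {w : TensorAlgebra k C}
    (hw : cochainMap j.toLin w = differential k A (ι k (σ (unit k)))) {l : Cohomology k C}
    (hl : Represents w l) (hsurj : Function.Surjective (cohomologyMap j)) {c : Cohomology k C}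
    (hc : c * l = 0) : c = 0 := by
  obtain ⟨x, hx⟩ := exists_represents c
  obtain ⟨u, hu⟩ := (hx.mul hl).eq_zero_iff.mp hc
  have hcoc : differential k A (cochainMap j.toLin (-u) +
      cochainMap j.toLin (signAut k C x) * ι k (σ (unit k))) = 0 := by
    rw [h.differential_add_mul hs _ _ w hw, signAut_signAut, hu, differential_signAut,
      hx.differential_eq]
    simp
  obtain ⟨b, hb⟩ := exists_represented hcoc
  obtain ⟨b', hb'⟩ := hsurj b
  obtain ⟨v, hv⟩ := exists_represents b'
  obtain ⟨q, hq⟩ := (hb.eq_iff (hv.map j)).mp hb'.symm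
  obtain ⟨x', y', h'⟩ := h.exists_coboundary_eq (x := -u - v) (y := signAut k C x) (q := q) (by
    rw [← hq, map_sub]; abel)
  rw [h.differential_add_mul hs x' y' w hw, ← sub_eq_zero] at h'
  have h2 : cochainMap j.toLin (-u - v - (differential k C x' + signAut k C y' * w)) +
      cochainMap j.toLin (signAut k C x - differential k C y') * ι k (σ (unit k)) = 0 := by
    rw [← h']
    simp only [map_sub, sub_mul]
    abel
  obtain ⟨-, h4⟩ := h.eq_zero_of_add_eq_zero hs h2
  refine hx.eq_zero_iff.mpr ⟨-signAut k C y', ?_⟩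
  rw [map_neg, differential_signAut, neg_neg, ← sub_eq_zero.mp h4, signAut_signAut]

/-- If `σ(1)` is a cocycle, an algebra `M_C` that presents `H(C)` and an element over the class of
`σ(1)` present `H(A)`. -/
theorem bijective_of_cocycle (hd : differential k A (ι k (σ (unit k))) = 0)
    {MC MA : Type*} [Ring MC] [Algebra k MC] [Ring MA] [Algebra k MA]
    {ΦC : MC →ₐ[k] Cohomology k C} (hC : Function.Bijective ΦC) {ΦA : MA →ₐ[k] Cohomology k A}
    (i : MC →ₐ[k] MA) (hi : ∀ m, ΦA (i m) = cohomologyMap j (ΦC m)) {l : MA}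
    (hl : Represents (ι k (σ (unit k))) (ΦA l)) (hspan : ∀ m, ∃ c c', m = i c + i c' * l) :
    Function.Bijective ΦA := by
  constructor
  · rw [injective_iff_map_eq_zero]
    intro m hm
    obtain ⟨c, c', rfl⟩ := hspan m
    rw [map_add, map_mul, hi, hi] at hm
    obtain ⟨h1, h2⟩ := h.eq_zero_of_add_mul_eq_zero hs hd hl hm
    rw [(injective_iff_map_eq_zero _).mp hC.1 _ h1, (injective_iff_map_eq_zero _).mp hC.1 _ h2]
    simp
  · intro a
    obtain ⟨c, c', rfl⟩ := h.exists_add_mul hs hd hl a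
    obtain ⟨m, rfl⟩ := hC.2 c
    obtain ⟨m', rfl⟩ := hC.2 c'
    exact ⟨i m + i m' * l, by rw [map_add, map_mul, hi, hi]⟩

/-- If `M_A` presents `H(A)` and lifts to `M_C`, then an algebra `M_C`, generated by `M_A` and a
central element over the class of `∂ σ(1)`, presents `H(C)`. The lift makes the restriction to `A`
surjective, so `H(A) = H(C) / (w)` with `w` a nonzerodivisor. -/
theorem bijective_of_lift {w : TensorAlgebra k C}
    (hw : cochainMap j.toLin w = differential k A (ι k (σ (unit k)))) (hw2 : w ∈ degreePart k C 2)
    {MC MA : Type*} [Ring MC] [Algebra k MC] [Ring MA] [Algebra k MA]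
    {ΦA : MA →ₐ[k] Cohomology k A} (hA : Function.Bijective ΦA) {ΦC : MC →ₐ[k] Cohomology k C}
    (i : MA →ₐ[k] MC) (hi : ∀ m, cohomologyMap j (ΦC (i m)) = ΦA m) {ω : MC}
    (hω : Represents w (ΦC ω)) (hcomm : ∀ m, Commute m ω)
    (hgen : ∀ S : Subring MC, (∀ m, i m ∈ S) → ω ∈ S → S = ⊤)
    (hgr : IsGradedSubset (Set.range ΦC)) :
    Function.Surjective (cohomologyMap j) ∧ Function.Bijective ΦC := by
  have hsurj : Function.Surjective (cohomologyMap j) := by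
    intro a
    obtain ⟨m, rfl⟩ := hA.2 a
    exact ⟨_, hi m⟩
  refine ⟨hsurj, ?_, ?_⟩
  · set e : Polynomial MA →+* MC :=
      Polynomial.eval₂RingHom' i.toRingHom ω fun a => hcomm _
    have heX : e Polynomial.X = ω := Polynomial.eval₂_X _ _
    have heC : ∀ m, e (Polynomial.C m) = i m := fun m => Polynomial.eval₂_C _ _
    have he : Function.Surjective e := by
      rw [← RingHom.range_eq_top]
      exact hgen _ (fun m => ⟨Polynomial.C m, heC m⟩) ⟨Polynomial.X, heX⟩
    -- A polynomial over `M_A` with image zero has all its coefficients zero: reduce modulo `w`.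
    have key : ∀ n (q : Polynomial MA), q.natDegree < n → ΦC (e q) = 0 → q = 0 := by
      intro n
      induction n with
      | zero => intro q hq; omega
      | succ n ih =>
        intro q hq h0
        have h1 : ΦC (e q) = ΦC (e q.divX) * ΦC ω + ΦC (i (q.coeff 0)) := by
          conv_lhs => rw [← q.divX_mul_X_add]
          rw [map_add, map_mul, heX, heC, map_add, map_mul]
        have h2 := congrArg (cohomologyMap j) h1
        rw [h0, map_add, map_mul, h.map_eq_zero hs hw hω, mul_zero, zero_add, map_zero, hi] at h2
        have h3 := (injective_iff_map_eq_zero _).mp hA.1 _ h2.symm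
        rw [h0, h3, map_zero, map_zero, add_zero] at h1
        have h4 := h.eq_zero_of_mul_eq_zero hs hw hω hsurj h1.symm
        have h5 : q.divX = 0 := by
          by_cases hd : q.divX = 0
          · exact hd
          · refine ih _ ?_ h4
            rw [Polynomial.natDegree_divX_eq_natDegree_tsub_one]
            by_cases hz : q.natDegree = 0
            · exact absurd (by rw [Polynomial.eq_C_of_natDegree_eq_zero hz, Polynomial.divX_C]) hd
            · omega
        rw [← q.divX_mul_X_add, h5, h3]
        simp
    rw [injective_iff_map_eq_zero]
    intro m hm
    obtain ⟨q, rfl⟩ := he m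
    rw [key _ q (Nat.lt_succ_self _) hm, map_zero]
  · have h1 : ∀ (n : ℕ) (c : Cohomology k C), ∃ m c', c = ΦC m + c' * ΦC ω ^ n := by
      intro n
      induction n with
      | zero => exact fun c => ⟨0, c, by simp⟩
      | succ n ih =>
        intro c
        obtain ⟨m, c', rfl⟩ := ih c
        obtain ⟨m', hm'⟩ := hA.2 (cohomologyMap j c')
        obtain ⟨c'', hc''⟩ := h.exists_mul_of_map_eq_zero hs hw hω (c := c' - ΦC (i m')) (by
          rw [map_sub, hi, hm', sub_self])
        refine ⟨m + i m' * ω ^ n, c'', ?_⟩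
        rw [sub_eq_iff_eq_add] at hc''
        rw [hc'', map_add, map_mul, map_pow, pow_succ', add_mul, ← mul_assoc]
        abel
    -- A class of degree `n` is in the range: the remainder above starts in degree `2 n + 2`.
    have h2 : ∀ n, ∀ z ∈ degreePart k C n, ∀ c, Represents z c → c ∈ Set.range ΦC := by
      intro n z hz c hc
      obtain ⟨m, c', hcm⟩ := h1 (n + 1) c
      obtain ⟨zv, hzv, hgr'⟩ := hgr (ΦC m) ⟨m, rfl⟩
      obtain ⟨v, hv, hv'⟩ := hgr' n
      obtain ⟨z', hz'⟩ := exists_represents c'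
      obtain ⟨u, hu⟩ := (hc.eq_iff (hzv.add (hz'.mul (hω.pow (n + 1))))).mp hcm
      have hwn : w ^ (n + 1) ∈ degreePart k C (2 * (n + 1)) := by
        rw [degreePart, pow_mul]
        exact Submodule.pow_mem_pow _ hw2 _
      have h0 : degreeProj n (z' * w ^ (n + 1)) = 0 := by
        rw [degreeProj_mul]
        refine Finset.sum_eq_zero fun ij hij => ?_
        rw [Finset.HasAntidiagonal.mem_antidiagonal] at hij
        rw [degreeProj_of_mem hwn, if_neg (by omega), mul_zero]
      have h3 := congrArg (degreeProj n) hu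
      obtain ⟨u', hu'⟩ := exists_degreeProj_differential n u
      rw [map_sub, map_add, h0, add_zero, degreeProj_of_mem hz, if_pos rfl, hu'] at h3
      rw [(hc.eq_iff hv').mpr ⟨u', h3⟩]
      exact hv
    intro c
    obtain ⟨z, hz⟩ := exists_represents c
    obtain ⟨s, hzs⟩ := exists_sum_degreeProj z
    have h3 : ∀ n, ∃ m, Represents (degreeProj n z) (ΦC m) := by
      intro n
      obtain ⟨c', hc'⟩ := exists_represented (differential_degreeProj_eq_zero hz.differential_eq n)
      obtain ⟨m, rfl⟩ := h2 n _ (degreeProj_mem n z) c' hc'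
      exact ⟨m, hc'⟩
    choose m hm using h3
    refine ⟨∑ n ∈ s, m n, ?_⟩
    rw [map_sum]
    refine (Represents.sum s _ _ fun n _ => hm n).unique ?_
    rw [← hzs]
    exact hz

end regular
end IsPrincipal
end Hochschild

namespace Hochschild
open UnitalSupercoalgebra TensorAlgebra

/-! ### Homotopies for graded commutativity -/

section primitive
variable {k A : Type*} [Field k] [AddCommGroup A] [Module k A] [UnitalSupercoalgebra k A]

variable (k A) in
/-- The identity, as a homomorphism. -/
def idHom : Hom k A A where
  toLin := LinearMap.id
  map_comul a := by simp
  map_counit _ := rfl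
  map_unit := rfl
  map_parity _ := rfl

variable (k A) in
/-- The parity involution, as a homomorphism. -/
def parityEnd : Hom k A A where
  toLin := parity (k := k)
  map_comul := comul_parity
  map_counit := counit_parity
  map_unit := parity_unit
  map_parity _ := rfl

lemma cochainMap_id (x : TensorAlgebra k A) : cochainMap (idHom k A).toLin x = x := by
  have : cochainMap (idHom k A).toLin = AlgHom.id k _ := by ext; simp [idHom]
  exact DFunLike.congr_fun this x

/-- If `m` is the multiplication by a primitive element `m(1)`, the `Q`-twisted derivation `Θ`
extending `m` is a homotopy between left and right multiplication by `m(1)`. Here `Q` is the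
identity or the parity, according to the parity of `m(1)`. -/
lemma differential_twistedDer_primitive (Q : Hom k A A) (m : A →ₗ[k] A)
    (hm : ∀ b, CoalgebraStruct.comul (R := k) (m b) =
      m.rTensor A (CoalgebraStruct.comul (R := k) b) +
        TensorProduct.map Q.toLin m (CoalgebraStruct.comul (R := k) b)) (x : TensorAlgebra k A) :
    differential k A (twistedDer (cochainMap Q.toLin) (ι k ∘ₗ m) x) -
      twistedDer (cochainMap Q.toLin) (ι k ∘ₗ m) (differential k A x) =
    signAut k A (cochainMap Q.toLin x) * ι k (m (unit k)) - ι k (m (unit k)) * x := by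
  set Θ := twistedDer (cochainMap Q.toLin) (ι k ∘ₗ m)
  have hT : ∀ z : A ⊗[k] A, Θ (tensorTwo k A z) =
      tensorTwo k A (m.rTensor A z + TensorProduct.map Q.toLin m z) := by
    intro z
    induction z with
    | zero => simp
    | add x y hx hy => simp only [map_add, hx, hy]; abel
    | tmul a b => simp [tensorTwo_tmul, Θ, twistedDer_mul]
  have hd : ∀ a, Θ (differentialOne k A a) = differentialOne k A (m a) +
      ι k (m (unit k)) * ι k a + ι k (Q.toLin a) * ι k (m (unit k)) := by
    intro a
    rw [differentialOne_eq, differentialOne_eq, map_add, map_sub, hT, ← hm]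
    simp only [Θ, twistedDer_mul, twistedDer_ι, cochainMap_ι, LinearMap.comp_apply, Q.map_unit]
    abel
  have hQ : ∀ a, cochainMap Q.toLin (differentialOne k A a) =
      differentialOne k A (Q.toLin a) := by
    intro a
    rw [← differential_ι, ← differential_map, cochainMap_ι, differential_ι]
  have : differential k A ∘ₗ Θ - Θ ∘ₗ differential k A =
      LinearMap.mulRight k (ι k (m (unit k))) ∘ₗ (signAut k A).toLinearMap ∘ₗ
        (cochainMap Q.toLin).toLinearMap - LinearMap.mulLeft k (ι k (m (unit k))) := by
    apply linearMap_ext_left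
    · simp [Θ, differential_one]
    · intro a x hx
      simp only [LinearMap.sub_apply, LinearMap.comp_apply, LinearMap.mulRight_apply,
        LinearMap.mulLeft_apply, AlgHom.toLinearMap_apply] at hx ⊢
      have h1 : Θ (ι k a * x) = ι k (m a) * x + ι k (Q.toLin a) * Θ x := by
        simp [Θ, twistedDer_mul]
      have h2 : Θ (differential k A (ι k a * x)) = (differentialOne k A (m a) +
          ι k (m (unit k)) * ι k a + ι k (Q.toLin a) * ι k (m (unit k))) * x +
          differentialOne k A (Q.toLin a) * Θ x -
          (ι k (m a) * differential k A x + ι k (Q.toLin a) * Θ (differential k A x)) := by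
        rw [differential_ι_mul, map_sub, ← hd, ← hQ]
        simp only [Θ, twistedDer_mul, twistedDer_ι, cochainMap_ι, LinearMap.comp_apply]
      rw [h1, h2, map_add, differential_ι_mul, differential_ι_mul, eq_add_of_sub_eq hx]
      simp only [map_mul, cochainMap_ι, signAut_ι]
      noncomm_ring
  exact LinearMap.congr_fun this x

/-- Graded commutation with the class of a primitive element. -/
lemma Represents.primitive_mul (Q : Hom k A A) (m : A →ₗ[k] A)
    (hm : ∀ b, CoalgebraStruct.comul (R := k) (m b) =
      m.rTensor A (CoalgebraStruct.comul (R := k) b) +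
        TensorProduct.map Q.toLin m (CoalgebraStruct.comul (R := k) b)) {a : A}
    (ha : m (unit k) = a) {l h : Cohomology k A} (hl : Represents (ι k a) l) {x : TensorAlgebra k A}
    (hx : Represents x h) {n : ℕ} (hn : x ∈ degreePart k A n) {c : k}
    (hQ : cochainMap Q.toLin x = c • x) : l * h = ((-1) ^ n * c) • (h * l) := by
  refine ((hl.mul hx).eq_iff ((hx.mul hl).smul ((-1) ^ n * c))).mpr
    ⟨-twistedDer (cochainMap Q.toLin) (ι k ∘ₗ m) x, ?_⟩
  have := differential_twistedDer_primitive Q m hm x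
  rw [hx.differential_eq, map_zero, sub_zero, ha, hQ, map_smul, signAut_of_mem hn] at this
  rw [map_neg, this, smul_smul, smul_mul_assoc, mul_comm c]
  abel

end primitive

section twoCocycle
variable {k A : Type*} [Field k] [CommRing A] [Algebra k A] [UnitalSupercoalgebra k A]

variable (k A) in
/-- The map `A ⊗ (A ⊗ A) → T(A)`. -/
def tensorThree : A ⊗[k] (A ⊗[k] A) →ₗ[k] TensorAlgebra k A :=
  TensorProduct.lift ((LinearMap.mul k (TensorAlgebra k A)).compl₁₂ (ι k) (tensorTwo k A))

variable (k A) in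
/-- `Δ ⊗ 1`, with values in `A ⊗ (A ⊗ A)`. -/
def comulFst : A ⊗[k] A →ₗ[k] A ⊗[k] (A ⊗[k] A) :=
  (TensorProduct.assoc k A A A).toLinearMap ∘ₗ (CoalgebraStruct.comul (R := k)).rTensor A

variable (k A) in
/-- `1 ⊗ Δ`. -/
def comulSnd : A ⊗[k] A →ₗ[k] A ⊗[k] (A ⊗[k] A) := (CoalgebraStruct.comul (R := k)).lTensor A

lemma assoc_mul (x y : (A ⊗[k] A) ⊗[k] A) : TensorProduct.assoc k A A A (x * y) =
    TensorProduct.assoc k A A A x * TensorProduct.assoc k A A A y :=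
  map_mul (Algebra.TensorProduct.assoc k k k A A A) x y

lemma tensorThree_assoc_tmul (z : A ⊗[k] A) (q : A) :
    tensorThree k A (TensorProduct.assoc k A A A (z ⊗ₜ q)) = tensorTwo k A z * ι k q := by
  rw [tensorThree, ← tensorTwo_assoc]
  simp

lemma tensorThree_tmul (p : A) (z : A ⊗[k] A) :
    tensorThree k A (p ⊗ₜ z) = ι k p * tensorTwo k A z := by
  simp [tensorThree]

/-- A `2`-cocycle `z`, given by an element of `A ⊗ A` on which `Δ ⊗ 1` and `1 ⊗ Δ` are
multiplicative, commutes with all cocycles up to coboundaries: the derivation of degree `1` with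
`a ↦ Δ(a) z` (the cup-one product with `z`) is a homotopy for the commutator. -/
lemma differential_twistedDer_twoCocycle (hu : (unit k : A) = 1) (z : A ⊗[k] A)
    (hL : ∀ y, comulFst k A (y * z) = comulFst k A y * comulFst k A z)
    (hR : ∀ y, comulSnd k A (y * z) = comulSnd k A y * comulSnd k A z)
    (hz : comulFst k A z - comulSnd k A z = 1 ⊗ₜ z - TensorProduct.assoc k A A A (z ⊗ₜ 1))
    (x : TensorAlgebra k A) :
    differential k A (twistedDer (signAut k A) (tensorTwo k A ∘ₗ LinearMap.mulRight k z ∘ₗ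
        CoalgebraStruct.comul) x) +
      twistedDer (signAut k A) (tensorTwo k A ∘ₗ LinearMap.mulRight k z ∘ₗ
        CoalgebraStruct.comul) (differential k A x) =
    tensorTwo k A z * x - x * tensorTwo k A z := by
  set Θ := twistedDer (signAut k A) (tensorTwo k A ∘ₗ LinearMap.mulRight k z ∘ₗ
        CoalgebraStruct.comul)
  have hΘ : ∀ a, Θ (ι k a) = tensorTwo k A (CoalgebraStruct.comul (R := k) a * z) := by
    intro a
    simp [Θ]
  have hT : ∀ y : A ⊗[k] A, Θ (tensorTwo k A y) =
      tensorThree k A (comulFst k A y * TensorProduct.assoc k A A A (z ⊗ₜ 1)) -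
        tensorThree k A (comulSnd k A y * (1 ⊗ₜ z)) := by
    intro y
    induction y with
    | zero => simp
    | add x y hx hy => simp only [map_add, add_mul, hx, hy]; abel
    | tmul a b =>
      rw [tensorTwo_tmul, twistedDer_mul]
      change Θ _ * _ + _ * Θ _ = _
      rw [hΘ, hΘ, signAut_ι]
      simp only [comulFst, comulSnd, LinearMap.comp_apply, LinearMap.rTensor_tmul,
        LinearMap.lTensor_tmul, LinearEquiv.coe_coe, ← assoc_mul,
        Algebra.TensorProduct.tmul_mul_tmul, mul_one, tensorThree_assoc_tmul, tensorThree_tmul]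
      rw [neg_mul, sub_eq_add_neg]
  have hone : Θ (ι k (unit k)) = tensorTwo k A z := by
    rw [hΘ, comul_unit, hu, ← Algebra.TensorProduct.one_def, one_mul]
  have hE : ∀ a, differential k A (Θ (ι k a)) + Θ (differentialOne k A a) =
      tensorTwo k A z * ι k a - ι k a * tensorTwo k A z := by
    intro a
    have hco : comulFst k A (CoalgebraStruct.comul (R := k) a) =
        comulSnd k A (CoalgebraStruct.comul (R := k) a) := Coalgebra.coassoc_apply a
    have h1 : differential k A (tensorTwo k A (CoalgebraStruct.comul (R := k) a * z)) =
        ι k (unit k) * tensorTwo k A (CoalgebraStruct.comul (R := k) a * z)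
        - tensorTwo k A (CoalgebraStruct.comul (R := k) a * z) * ι k (unit k)
        - tensorThree k A (comulFst k A (CoalgebraStruct.comul (R := k) a * z))
        + tensorThree k A (comulSnd k A (CoalgebraStruct.comul (R := k) a * z)) := by
      rw [differential_tensorTwo, tensorTwo_assoc]
      rfl
    have h2 : comulFst k A (CoalgebraStruct.comul (R := k) a * z) -
        comulSnd k A (CoalgebraStruct.comul (R := k) a * z) =
        comulSnd k A (CoalgebraStruct.comul (R := k) a) * (1 ⊗ₜ z) -
          comulFst k A (CoalgebraStruct.comul (R := k) a) *
            TensorProduct.assoc k A A A (z ⊗ₜ 1) := by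
      rw [hL, hR, hco, ← mul_sub, hz, mul_sub]
    have h3 := congrArg (tensorThree k A) h2
    rw [map_sub, map_sub] at h3
    rw [hΘ, h1, differentialOne_eq, map_add, map_sub, hT]
    have h4 : Θ (ι k (unit k) * ι k a) = tensorTwo k A z * ι k a -
        ι k (unit k) * tensorTwo k A (CoalgebraStruct.comul (R := k) a * z) := by
      rw [← hΘ, ← hone]
      simp only [Θ, twistedDer_mul, signAut_ι]
      noncomm_ring
    have h5 : Θ (ι k a * ι k (unit k)) =
        tensorTwo k A (CoalgebraStruct.comul (R := k) a * z) * ι k (unit k) -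
          ι k a * tensorTwo k A z := by
      rw [← hΘ, ← hone]
      simp only [Θ, twistedDer_mul, signAut_ι]
      noncomm_ring
    rw [h4, h5, sub_eq_iff_eq_add.mp h3]
    abel
  have : differential k A ∘ₗ Θ + Θ ∘ₗ differential k A =
      LinearMap.mulLeft k (tensorTwo k A z) - LinearMap.mulRight k (tensorTwo k A z) := by
    apply linearMap_ext_left
    · simp [Θ, differential_one]
    · intro a x hx
      simp only [LinearMap.sub_apply, LinearMap.add_apply, LinearMap.comp_apply,
        LinearMap.mulRight_apply, LinearMap.mulLeft_apply] at hx ⊢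
      have h1 : ∀ u v, Θ (u * v) = Θ u * v + signAut k A u * Θ v := twistedDer_mul _ _
      have hxx := eq_sub_of_add_eq hx
      rw [h1, differential_ι_mul, map_sub, h1, h1, map_add, differential_mul, signAut_ι, neg_mul,
        map_neg, differential_ι_mul, hxx, signAut_differentialOne, eq_sub_of_add_eq (hE a)]
      have h6 : signAut k A (Θ (ι k a)) = Θ (ι k a) := by rw [hΘ, signAut_tensorTwo]
      rw [h6]
      noncomm_ring
  exact LinearMap.congr_fun this x

end twoCocycle
end Hochschild

namespace MultiparameterSupergroup
open UnitalSupercoalgebra Hochschild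
open Finset.HasAntidiagonal (antidiagonal mem_antidiagonal)

/-! ### The cocycles attached to primitive elements -/

section divided
variable {k A : Type*} [Field k] [CommRing A] [Algebra k A] [UnitalSupercoalgebra k A]

lemma sum_antidiagonal_assoc {M : Type*} [AddCommMonoid M] (F : ℕ → ℕ → ℕ → M) (n : ℕ) :
    ∑ x ∈ antidiagonal n, ∑ y ∈ antidiagonal x.1, F y.1 y.2 x.2 =
      ∑ x ∈ antidiagonal n, ∑ y ∈ antidiagonal x.2, F x.1 y.1 y.2 := by
  rw [Finset.sum_sigma', Finset.sum_sigma']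
  refine Finset.sum_nbij' (fun x => ⟨(x.2.1, x.2.2 + x.1.2), (x.2.2, x.1.2)⟩)
    (fun x => ⟨(x.1.1 + x.2.1, x.2.2), (x.1.1, x.2.1)⟩) ?_ ?_ ?_ ?_ ?_
  · rintro ⟨⟨a, b⟩, ⟨c, d⟩⟩ h
    simp only [Finset.mem_sigma, mem_antidiagonal] at h ⊢
    obtain ⟨h1, h2⟩ := h
    refine ⟨?_, trivial⟩
    omega
  · rintro ⟨⟨a, b⟩, ⟨c, d⟩⟩ h
    simp only [Finset.mem_sigma, mem_antidiagonal] at h ⊢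
    obtain ⟨h1, h2⟩ := h
    refine ⟨?_, trivial⟩
    omega
  · rintro ⟨⟨a, b⟩, ⟨c, d⟩⟩ h
    simp only [Finset.mem_sigma, mem_antidiagonal] at h ⊢
    obtain ⟨h1, rfl⟩ := h
    rfl
  · rintro ⟨⟨a, b⟩, ⟨c, d⟩⟩ h
    simp only [Finset.mem_sigma, mem_antidiagonal] at h ⊢
    obtain ⟨h1, rfl⟩ := h
    rfl
  · rintro ⟨⟨a, b⟩, ⟨c, d⟩⟩ h
    rfl

/-- The divided power `b^n / n!` for `n < p`, and `0` otherwise. -/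
def truncDivPow (k : Type*) {A : Type*} [Field k] [CommRing A] [Algebra k A] (p : ℕ) (b : A)
    (n : ℕ) : A :=
  if n < p then ((n.factorial : k)⁻¹) • b ^ n else 0

variable (k) in
/-- The element `∑_{i + j = p} (b^i / i!) ⊗ (b^j / j!)` of `A ⊗ A`. -/
def divPowCocycle (p : ℕ) (b : A) : A ⊗[k] A :=
  ∑ ij ∈ antidiagonal p, truncDivPow k p b ij.1 ⊗ₜ truncDivPow k p b ij.2

variable {p : ℕ} [Fact p.Prime] [CharP k p]

lemma factorial_ne_zero_of_lt {n : ℕ} (hn : n < p) : (n.factorial : k) ≠ 0 := by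
  rw [Ne, CharP.cast_eq_zero_iff k p, (Fact.out : p.Prime).dvd_factorial]
  omega

lemma truncDivPow_zero (b : A) : truncDivPow k p b 0 = 1 := by
  simp [truncDivPow, (Fact.out : p.Prime).pos]

/-- The defining cocycle of a class `x_i` is a multiple of the sum of the products of divided
powers, whose cocycle condition needs no binomial coefficients. -/
lemma tensorTwo_divPowCocycle (b : A) :
    xCochain p b = ((p - 1).factorial : k) • tensorTwo k A (divPowCocycle k p b) := by
  have hp := (Fact.out : p.Prime).two_le
  rw [divPowCocycle, Finset.Nat.sum_antidiagonal_eq_sum_range_succ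
    (fun i j => truncDivPow k p b i ⊗ₜ[k] truncDivPow k p b j), map_sum, Finset.smul_sum, xCochain]
  have hsub : Finset.Icc 1 (p - 1) ⊆ Finset.range p.succ := by
    intro i
    rw [Finset.mem_Icc, Finset.mem_range]
    omega
  rw [← Finset.sum_subset hsub]
  · refine Finset.sum_congr rfl fun j hj => ?_
    rw [Finset.mem_Icc] at hj
    rw [truncDivPow, truncDivPow, if_pos (by omega), if_pos (by omega), tensorTwo_tmul, map_smul,
      map_smul, smul_mul_smul_comm, smul_smul, div_eq_mul_inv, mul_inv]
  · intro j hj hj'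
    rw [Finset.mem_Icc] at hj'
    rw [Finset.mem_range] at hj
    have : j = 0 ∨ j = p := by omega
    rcases this with rfl | rfl <;> simp [truncDivPow]

lemma xCochain_mem_degreePart (b : A) : (xCochain p b : TensorAlgebra k A) ∈ degreePart k A 2 := by
  rw [tensorTwo_divPowCocycle]
  exact Submodule.smul_mem _ _ (tensorTwo_mem_degreePart _)

variable {b : A} (hu : (unit k : A) = 1)
  (hb : ∀ a, CoalgebraStruct.comul (R := k) (b * a) =
    (b ⊗ₜ[k] 1 + 1 ⊗ₜ[k] b) * CoalgebraStruct.comul (R := k) a)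

include hb in
lemma comul_pow_mul (n : ℕ) (a : A) : CoalgebraStruct.comul (R := k) (b ^ n * a) =
    (b ⊗ₜ[k] 1 + 1 ⊗ₜ[k] b) ^ n * CoalgebraStruct.comul (R := k) a := by
  induction n with
  | zero => simp
  | succ n ih => rw [pow_succ', mul_assoc, hb, ih, pow_succ', mul_assoc]

include hu hb

lemma comul_pow (n : ℕ) : CoalgebraStruct.comul (R := k) (b ^ n) =
    (b ⊗ₜ[k] 1 + 1 ⊗ₜ[k] b) ^ n := by
  have := comul_pow_mul hb n 1
  rwa [mul_one, ← hu, comul_unit, hu, ← Algebra.TensorProduct.one_def, mul_one] at this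

lemma comul_truncDivPow {n : ℕ} (hn : n < p) : CoalgebraStruct.comul (R := k)
    (truncDivPow k p b n) =
    ∑ ij ∈ antidiagonal n, truncDivPow k p b ij.1 ⊗ₜ truncDivPow k p b ij.2 := by
  rw [truncDivPow, if_pos hn, map_smul, comul_pow hu hb, Commute.add_pow' (Commute.all _ _),
    Finset.smul_sum]
  refine Finset.sum_congr rfl ?_
  rintro ⟨i, j⟩ hij
  rw [mem_antidiagonal] at hij
  dsimp only at hij ⊢
  subst hij
  rw [truncDivPow, truncDivPow, if_pos (by omega), if_pos (by omega), TensorProduct.smul_tmul_smul,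
    ← Nat.cast_smul_eq_nsmul k, smul_smul, Algebra.TensorProduct.tmul_pow,
    Algebra.TensorProduct.tmul_pow, Algebra.TensorProduct.tmul_mul_tmul, one_pow, one_pow, one_mul,
    mul_one]
  congr 1
  have h1 := factorial_ne_zero_of_lt (k := k) hn
  have h2 := factorial_ne_zero_of_lt (k := k) (show i < p by omega)
  have h3 := factorial_ne_zero_of_lt (k := k) (show j < p by omega)
  have h4 : ((i + j).choose i : k) * i.factorial * j.factorial = (i + j).factorial := by
    rw [← Nat.add_choose_mul_factorial_mul_factorial i j, Nat.choose_symm_add]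
    push_cast
    ring
  rw [← h4] at h1 ⊢
  have h5 : ((i + j).choose i : k) ≠ 0 := fun h => h1 (by rw [h]; ring)
  field_simp

/-- The cocycle condition: both sides of the coassociativity sum are
`∑_{u + v + w = p} (b^u / u!) ⊗ (b^v / v!) ⊗ (b^w / w!)` up to the terms where `Δ` would be applied
to the missing divided power of index `p`. -/
lemma comulFst_sub_comulSnd_divPowCocycle :
    comulFst k A (divPowCocycle k p b) - comulSnd k A (divPowCocycle k p b) =
      1 ⊗ₜ divPowCocycle k p b - TensorProduct.assoc k A A A (divPowCocycle k p b ⊗ₜ 1) := by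
  set a := truncDivPow k p b
  have ha0 : a 0 = 1 := truncDivPow_zero b
  have hap : a p = 0 := by simp [a, truncDivPow]
  have h1 : comulFst k A (divPowCocycle k p b) =
      ∑ x ∈ antidiagonal p, ∑ y ∈ antidiagonal x.1, a y.1 ⊗ₜ (a y.2 ⊗ₜ a x.2) -
        TensorProduct.assoc k A A A (divPowCocycle k p b ⊗ₜ 1) := by
    have : ∀ x ∈ antidiagonal p, comulFst k A (a x.1 ⊗ₜ a x.2) =
        ∑ y ∈ antidiagonal x.1, a y.1 ⊗ₜ (a y.2 ⊗ₜ a x.2) -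
          if x = (p, 0) then TensorProduct.assoc k A A A (divPowCocycle k p b ⊗ₜ 1) else 0 := by
      rintro ⟨i, j⟩ hij
      rw [mem_antidiagonal] at hij
      dsimp only at hij ⊢
      split_ifs with h
      · obtain ⟨rfl, rfl⟩ := Prod.mk.inj h
        rw [hap, TensorProduct.zero_tmul, map_zero, ha0, divPowCocycle, TensorProduct.sum_tmul,
          map_sum, eq_comm, sub_eq_zero]
        rfl
      · have hi : i < p := by
          rcases Nat.lt_or_ge i p with h' | h'
          · exact h'
          · exact absurd (by rw [Prod.mk.injEq]; omega) h
        rw [sub_zero, comulFst, LinearMap.comp_apply, LinearMap.rTensor_tmul,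
          comul_truncDivPow hu hb hi, TensorProduct.sum_tmul, map_sum]
        rfl
    rw [divPowCocycle, map_sum, Finset.sum_congr rfl this, Finset.sum_sub_distrib,
      Finset.sum_ite_eq', if_pos (by simp)]
    rfl
  have h2 : comulSnd k A (divPowCocycle k p b) =
      ∑ x ∈ antidiagonal p, ∑ y ∈ antidiagonal x.2, a x.1 ⊗ₜ (a y.1 ⊗ₜ a y.2) -
        1 ⊗ₜ divPowCocycle k p b := by
    have : ∀ x ∈ antidiagonal p, comulSnd k A (a x.1 ⊗ₜ a x.2) =
        ∑ y ∈ antidiagonal x.2, a x.1 ⊗ₜ (a y.1 ⊗ₜ a y.2) -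
          if x = (0, p) then 1 ⊗ₜ divPowCocycle k p b else 0 := by
      rintro ⟨i, j⟩ hij
      rw [mem_antidiagonal] at hij
      dsimp only at hij ⊢
      split_ifs with h
      · obtain ⟨rfl, rfl⟩ := Prod.mk.inj h
        rw [hap, TensorProduct.tmul_zero, map_zero, ha0, divPowCocycle, TensorProduct.tmul_sum,
          eq_comm, sub_eq_zero]
      · have hj : j < p := by
          rcases Nat.lt_or_ge j p with h' | h'
          · exact h'
          · exact absurd (by rw [Prod.mk.injEq]; omega) h
        rw [sub_zero, comulSnd, LinearMap.lTensor_tmul,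
          comul_truncDivPow hu hb hj, TensorProduct.tmul_sum]
    rw [divPowCocycle, map_sum, Finset.sum_congr rfl this, Finset.sum_sub_distrib,
      Finset.sum_ite_eq', if_pos (by simp)]
    rfl
  rw [h1, h2, sum_antidiagonal_assoc (fun i j l => a i ⊗ₜ[k] (a j ⊗ₜ[k] a l))]
  abel

/-- `Δ ⊗ 1` is multiplicative on the products with the cocycle, although `Δ` need not be an algebra
homomorphism for the ungraded tensor product: the first factors of the cocycle are powers of the
primitive element `b`. -/
lemma comulFst_mul_divPowCocycle (y : A ⊗[k] A) : comulFst k A (y * divPowCocycle k p b) =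
    comulFst k A y * comulFst k A (divPowCocycle k p b) := by
  have key : ∀ (i : ℕ) (c : A), comulFst k A (y * ((b ^ i) ⊗ₜ[k] c)) =
      comulFst k A y * comulFst k A ((b ^ i) ⊗ₜ[k] c) := by
    intro i c
    induction y with
    | zero => simp
    | add x y hx hy => simp only [add_mul, map_add, hx, hy]
    | tmul u v =>
      simp only [comulFst, LinearMap.comp_apply, LinearEquiv.coe_coe, LinearMap.rTensor_tmul,
        Algebra.TensorProduct.tmul_mul_tmul, ← assoc_mul, mul_comm u, comul_pow_mul hb,
        comul_pow hu hb]
      rw [mul_comm (CoalgebraStruct.comul (R := k) u)]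
  rw [divPowCocycle, Finset.mul_sum, map_sum, map_sum, Finset.mul_sum]
  refine Finset.sum_congr rfl fun ij _ => ?_
  rw [truncDivPow]
  split_ifs
  · rw [← TensorProduct.smul_tmul', mul_smul_comm, map_smul, map_smul, key, mul_smul_comm]
  · simp

lemma comulSnd_mul_divPowCocycle (y : A ⊗[k] A) : comulSnd k A (y * divPowCocycle k p b) =
    comulSnd k A y * comulSnd k A (divPowCocycle k p b) := by
  have key : ∀ (i : ℕ) (c : A), comulSnd k A (y * (c ⊗ₜ[k] (b ^ i))) =
      comulSnd k A y * comulSnd k A (c ⊗ₜ[k] (b ^ i)) := by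
    intro i c
    induction y with
    | zero => simp
    | add x y hx hy => simp only [add_mul, map_add, hx, hy]
    | tmul u v =>
      rw [Algebra.TensorProduct.tmul_mul_tmul, mul_comm v]
      simp only [comulSnd, LinearMap.lTensor_tmul, Algebra.TensorProduct.tmul_mul_tmul,
        comul_pow_mul hb, comul_pow hu hb]
      rw [mul_comm (CoalgebraStruct.comul (R := k) v)]
  rw [divPowCocycle, Finset.mul_sum, map_sum, map_sum, Finset.mul_sum]
  refine Finset.sum_congr rfl fun ij _ => ?_
  rw [show truncDivPow k p b ij.2 = if ij.2 < p then ((ij.2.factorial : k)⁻¹) • b ^ ij.2 else 0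
    from rfl]
  split_ifs
  · rw [TensorProduct.tmul_smul, mul_smul_comm, map_smul, map_smul, key, mul_smul_comm]
  · simp

lemma differential_xCochain : differential k A (xCochain p b) = 0 := by
  rw [tensorTwo_divPowCocycle, map_smul, differential_tensorTwo, tensorTwo_assoc]
  have h := congrArg (tensorThree k A) (comulFst_sub_comulSnd_divPowCocycle (k := k) (p := p) hu hb)
  rw [map_sub, map_sub, tensorThree_tmul, tensorThree_assoc_tmul, sub_eq_iff_eq_add] at h
  change _ • (_ - _ - tensorThree k A (comulFst k A _) + tensorThree k A (comulSnd k A _)) = 0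
  rw [h, hu]
  simp

/-- The class of the cocycle attached to a primitive element is central, by the cup-one homotopy. -/
lemma Represents.xCochain_mul {h l : Cohomology k A} (hl : Represents (xCochain p b) l)
    {x : TensorAlgebra k A} (hx : Represents x h) : l * h = h * l := by
  refine ((hl.mul hx).eq_iff (hx.mul hl)).mpr ⟨((p - 1).factorial : k) • twistedDer (signAut k A)
    (tensorTwo k A ∘ₗ LinearMap.mulRight k (divPowCocycle k p b) ∘ₗ CoalgebraStruct.comul) x, ?_⟩
  have := differential_twistedDer_twoCocycle hu (divPowCocycle k p b)
    (comulFst_mul_divPowCocycle hu hb) (comulSnd_mul_divPowCocycle hu hb)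
    (comulFst_sub_comulSnd_divPowCocycle hu hb) x
  rw [hx.differential_eq, map_zero, add_zero] at this
  rw [map_smul, this, tensorTwo_divPowCocycle, smul_sub, smul_mul_assoc, mul_smul_comm]

end divided

/-! ### The homomorphism from the presented algebra -/

/-- A commutative algebra with a supercoalgebra structure, and elements `θ`, even and primitive,
and `τ`, odd and primitive, such that the comultiplication and the parity are compatible with the
multiplication by `θ` and `τ`. -/
structure IsThetaTau {k A : Type*} [Field k] [CommRing A] [Algebra k A] [UnitalSupercoalgebra k A]
    (th ta : A) : Prop where
  unit_eq : (unit k : A) = 1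
  comul_theta_mul : ∀ a, CoalgebraStruct.comul (R := k) (th * a) =
    (th ⊗ₜ[k] 1 + 1 ⊗ₜ[k] th) * CoalgebraStruct.comul (R := k) a
  comul_tau_mul : ∀ a, CoalgebraStruct.comul (R := k) (ta * a) =
    (LinearMap.mulLeft k ta).rTensor A (CoalgebraStruct.comul (R := k) a) +
      TensorProduct.map (parity (k := k)) (LinearMap.mulLeft k ta)
        (CoalgebraStruct.comul (R := k) a)
  parity_theta_mul : ∀ a, parity (k := k) (th * a) = th * parity (k := k) a
  parity_tau : parity (k := k) ta = -ta

namespace IsThetaTau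
variable {k A : Type*} [Field k] {p : ℕ} [Fact p.Prime] [CharP k p] [CommRing A] [Algebra k A]
  [UnitalSupercoalgebra k A] {th ta : A}

lemma parity_theta_pow (h : IsThetaTau (k := k) th ta) (n : ℕ) :
    parity (k := k) (th ^ n) = th ^ n := by
  induction n with
  | zero => rw [pow_zero, ← h.unit_eq, parity_unit]
  | succ n ih => rw [pow_succ', h.parity_theta_mul, ih]

variable (p) in
lemma comul_theta_pow_mul (h : IsThetaTau (k := k) th ta) (i : ℕ) (a : A) :
    CoalgebraStruct.comul (R := k) (th ^ p ^ i * a) =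
    ((th ^ p ^ i) ⊗ₜ[k] 1 + 1 ⊗ₜ[k] (th ^ p ^ i)) * CoalgebraStruct.comul (R := k) a := by
  rw [comul_pow_mul h.comul_theta_mul]
  rcases subsingleton_or_nontrivial (A ⊗[k] A) with hs | hn
  · exact Subsingleton.elim _ _
  · have : CharP (A ⊗[k] A) p := charP_of_injective_algebraMap (algebraMap k _).injective p
    rw [add_pow_char_pow, Algebra.TensorProduct.tmul_pow, Algebra.TensorProduct.tmul_pow, one_pow]

lemma cochainMap_parity_xCochain (h : IsThetaTau (k := k) th ta) (n : ℕ) :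
    cochainMap (parity (k := k)) (xCochain p (th ^ n) : TensorAlgebra k A) =
      xCochain p (th ^ n) := by
  simp only [xCochain, map_sum, map_smul, map_mul, cochainMap_ι, ← pow_mul, h.parity_theta_pow]

lemma differential_tau (h : IsThetaTau (k := k) th ta) :
    differential k A (TensorAlgebra.ι k ta) = 0 := by
  have := h.comul_tau_mul 1
  rw [mul_one, ← h.unit_eq, comul_unit, h.unit_eq] at this
  have hp : parity (k := k) (1 : A) = 1 := by rw [← h.unit_eq, parity_unit]
  rw [differential_ι, differentialOne_eq, this, h.unit_eq]
  simp [tensorTwo_tmul, hp]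

lemma differential_theta_pow (h : IsThetaTau (k := k) th ta) (i : ℕ) :
    differential k A (TensorAlgebra.ι k (th ^ p ^ i)) = 0 := by
  have := h.comul_theta_pow_mul p i 1
  rw [mul_one, ← h.unit_eq, comul_unit, h.unit_eq] at this
  rw [differential_ι, differentialOne_eq, this, h.unit_eq, ← Algebra.TensorProduct.one_def, mul_one,
    map_add, tensorTwo_tmul, tensorTwo_tmul]
  abel

variable {r : ℕ} [NeZero r] {W : Type} {wc : W → TensorAlgebra k A}

lemma differential_genCochain (h : IsThetaTau (k := k) th ta)
    (hw : ∀ j, differential k A (wc j) = 0) (a : CohGen r W) :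
    differential k A (genCochain p th ta wc a) = 0 := by
  cases a with
  | x i => exact differential_xCochain h.unit_eq (h.comul_theta_pow_mul p i)
  | lam i => exact h.differential_theta_pow i
  | y => exact h.differential_tau
  | w j => exact hw j

lemma genCochain_mem_degreePart (hw : ∀ j, wc j ∈ degreePart k A 2) (a : CohGen r W) :
    genCochain p th ta wc a ∈ degreePart k A a.deg := by
  cases a with
  | x i => exact xCochain_mem_degreePart _
  | lam i => exact ι_mem_degreePart _
  | y => exact ι_mem_degreePart _
  | w j => exact hw j

lemma cochainMap_parity_genCochain (h : IsThetaTau (k := k) th ta)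
    (hw : ∀ j, cochainMap (parity (k := k)) (wc j) = wc j) (a : CohGen r W) :
    cochainMap (parity (k := k)) (genCochain p th ta wc a) =
      ((-1 : k) ^ a.par) • genCochain p th ta wc a := by
  cases a with
  | x i =>
    rw [show (CohGen.x i : CohGen r W).par = 0 from rfl, pow_zero, one_smul]
    exact h.cochainMap_parity_xCochain _
  | lam i => simp [CohGen.par, genCochain, h.parity_theta_pow]
  | y => simp [CohGen.par, genCochain, h.parity_tau]
  | w j =>
    rw [show (CohGen.w j : CohGen r W).par = 0 from rfl, pow_zero, one_smul]
    exact hw j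

/-- The homomorphism from the presented algebra to the cohomology ring. It exists because the
classes of the generators commute in the graded sense; for two classes one of which is `x_i`,
`λ_i` or `y` an explicit homotopy shows this, and at most one generator is of another kind. -/
theorem exists_hom (h : IsThetaTau (k := k) th ta) (q : Prop) [Subsingleton W]
    (hw : ∀ j, differential k A (wc j) = 0) (hw2 : ∀ j, wc j ∈ degreePart k A 2)
    (hwp : ∀ j, cochainMap (parity (k := k)) (wc j) = wc j)
    (hq : q → ∃ u, xCochain p (th ^ p ^ (r - 1)) -
      TensorAlgebra.ι k ta * TensorAlgebra.ι k ta = differential k A u) :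
    ∃ Φ : CohModel k r W q →ₐ[k] Cohomology k A, ∀ a,
      Represents (genCochain p th ta wc a) (Φ (CohModel.gen q a)) ∧
      Φ (CohModel.gen q a) ∈ homogeneousPart k A a.deg a.par := by
  have hd : ∀ a : CohGen r W, differential k A (genCochain p th ta wc a) = 0 :=
    h.differential_genCochain hw
  have hdeg : ∀ a : CohGen r W, genCochain p th ta wc a ∈ degreePart k A a.deg :=
    genCochain_mem_degreePart hw2
  have hpar : ∀ a : CohGen r W, cochainMap (parity (k := k)) (genCochain p th ta wc a) =
      ((-1 : k) ^ a.par) • genCochain p th ta wc a := h.cochainMap_parity_genCochain hwp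
  choose g hg using fun a : CohGen r W => exists_represented (hd a)
  have hx : ∀ i b, g (CohGen.x i) * g b = g b * g (CohGen.x i) := fun i b =>
    Represents.xCochain_mul h.unit_eq (h.comul_theta_pow_mul p i) (hg (CohGen.x i)) (hg b)
  have hlam : ∀ i b, g (CohGen.lam i) * g b = (-1 : k) ^ b.deg • (g b * g (CohGen.lam i)) := by
    intro i b
    have := Represents.primitive_mul (idHom k A) (LinearMap.mulLeft k (th ^ p ^ (i : ℕ)))
      (fun a => by
        rw [LinearMap.mulLeft_apply, h.comul_theta_pow_mul p i]
        generalize CoalgebraStruct.comul (R := k) a = z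
        induction z with
        | zero => simp
        | add x y hx hy => simp only [mul_add, map_add, hx, hy]; abel
        | tmul x y => simp [add_mul, idHom])
      (by rw [LinearMap.mulLeft_apply, h.unit_eq, mul_one]) (hg (CohGen.lam i)) (hg b) (hdeg b)
      (c := 1) (by rw [cochainMap_id, one_smul])
    rwa [mul_one] at this
  have hy : ∀ b, g CohGen.y * g b = (-1 : k) ^ (b.deg + b.par) • (g b * g CohGen.y) := by
    intro b
    have := Represents.primitive_mul (parityEnd k A) (LinearMap.mulLeft k ta)
      (fun a => h.comul_tau_mul a)
      (by rw [LinearMap.mulLeft_apply, h.unit_eq, mul_one]) (hg CohGen.y) (hg b) (hdeg b)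
      (hpar b)
    rwa [← pow_add] at this
  have hcomm : ∀ a b : CohGen r W,
      g a * g b = (-1 : k) ^ (a.deg * b.deg + a.par * b.par) • (g b * g a) := by
    have hsymm : ∀ (n : ℕ) (u v : Cohomology k A), u = (-1 : k) ^ n • v → v = (-1 : k) ^ n • u := by
      rintro n u v rfl
      rw [smul_smul, ← mul_pow]
      simp
    have h4 : (-1 : k) ^ 4 = 1 := by norm_num
    intro a b
    cases a with
    | x i => simpa [CohGen.deg, CohGen.par, pow_mul] using hx i b
    | lam i => simpa [CohGen.deg, CohGen.par] using hlam i b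
    | y => simpa [CohGen.deg, CohGen.par] using hy b
    | w j =>
      -- Exchange the two classes, to use the homotopy for the other one.
      rw [mul_comm (CohGen.deg _), mul_comm (CohGen.par _)]
      apply hsymm
      cases b with
      | x i => simpa [CohGen.deg, CohGen.par, h4] using hx i (CohGen.w j)
      | lam i => simpa [CohGen.deg, CohGen.par] using hlam i (CohGen.w j)
      | y => simpa [CohGen.deg, CohGen.par] using hy (CohGen.w j)
      | w j' =>
        rw [Subsingleton.elim j' j]
        simp [CohGen.deg, CohGen.par, h4]
  refine ⟨RingQuot.liftAlgHom k ⟨FreeAlgebra.lift k g, ?_⟩, fun a => ?_⟩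
  · rintro _ _ (⟨a, b⟩ | hq')
    · simpa using hcomm a b
    · obtain ⟨u, hu⟩ := hq hq'
      rw [map_pow, FreeAlgebra.lift_ι_apply, FreeAlgebra.lift_ι_apply, pow_two]
      exact ((hg (CohGen.x (lastIdx r))).eq_iff ((hg CohGen.y).mul (hg CohGen.y))).mpr ⟨u, hu⟩
  · rw [CohModel.gen, RingQuot.liftAlgHom_mkAlgHom_apply, FreeAlgebra.lift_ι_apply]
    refine ⟨hg a, ?_⟩
    obtain ⟨hz, hza⟩ := hg a
    refine ⟨⟨_, hz⟩, ⟨hdeg a, ?_⟩, hza⟩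
    refine LinearMap.mem_ker.mpr (sub_eq_zero.mpr ((hpar a).trans ?_))
    change _ = (if (a.par : ZMod 2) = 0 then (1 : k) else -1) • genCochain p th ta wc a
    congr 1
    cases a <;> simp [CohGen.par]

end IsThetaTau

/-! ### The presented algebras -/

namespace CohModel
variable {k : Type*} [Field k] {r : ℕ} [NeZero r] {W : Type} {q : Prop}

lemma gen_mul (a b : CohGen r W) : gen (k := k) q a * gen q b =
    (-1 : k) ^ (a.deg * b.deg + a.par * b.par) • (gen q b * gen q a) := by
  rw [gen, gen, ← map_mul, ← map_mul, ← map_smul]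
  exact RingQuot.mkAlgHom_rel k (CohRel.comm a b)

lemma gen_last (hq : q) : gen (k := k) (W := W) q (CohGen.x (lastIdx r)) = gen q CohGen.y ^ 2 := by
  rw [gen, gen, ← map_pow]
  exact RingQuot.mkAlgHom_rel k (CohRel.xy hq)

lemma exists_lift {R : Type*} [Ring R] [Algebra k R] (g : CohGen r W → R)
    (hcomm : ∀ a b, g a * g b = (-1 : k) ^ (a.deg * b.deg + a.par * b.par) • (g b * g a))
    (hq : q → g (CohGen.x (lastIdx r)) = g CohGen.y ^ 2) :
    ∃ f : CohModel k r W q →ₐ[k] R, ∀ a, f (gen q a) = g a := by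
  refine ⟨RingQuot.liftAlgHom k ⟨FreeAlgebra.lift k g, ?_⟩, fun a => ?_⟩
  · rintro _ _ (⟨a, b⟩ | h)
    · simpa using hcomm a b
    · simpa using hq h
  · rw [gen, RingQuot.liftAlgHom_mkAlgHom_apply, FreeAlgebra.lift_ι_apply]

/-- A subspace that is stable under right multiplication by the generators is a right ideal. -/
lemma mul_mem_of_gen {N : Submodule k (CohModel k r W q)}
    (hN : ∀ m ∈ N, ∀ a, m * gen q a ∈ N) {m : CohModel k r W q} (hm : m ∈ N)
    (t : CohModel k r W q) : m * t ∈ N := by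
  obtain ⟨t, rfl⟩ := RingQuot.mkAlgHom_surjective k (CohRel k r W q) t
  induction t using FreeAlgebra.induction generalizing m with
  | grade0 c =>
    rw [AlgHom.commutes, ← Algebra.commutes, ← Algebra.smul_def]
    exact N.smul_mem _ hm
  | grade1 a => exact hN m hm a
  | mul a b ha hb =>
    rw [map_mul, ← mul_assoc]
    exact hb (ha hm)
  | add a b ha hb =>
    rw [map_add, mul_add]
    exact add_mem (ha hm) (hb hm)

lemma adjoin_range_gen : Algebra.adjoin k (Set.range (gen (k := k) (r := r) (W := W) q)) = ⊤ := by
  rw [eq_top_iff]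
  intro t _
  set S := Algebra.adjoin k (Set.range (gen (k := k) (r := r) (W := W) q))
  have := mul_mem_of_gen (N := S.toSubmodule)
    (fun m hm a => S.mul_mem hm (Algebra.subset_adjoin ⟨a, rfl⟩)) S.one_mem t
  rwa [one_mul] at this

lemma algHom_ext {R : Type*} [Semiring R] [Algebra k R] {f g : CohModel k r W q →ₐ[k] R}
    (h : ∀ a, f (gen q a) = g (gen q a)) : f = g :=
  AlgHom.ext_of_adjoin_eq_top adjoin_range_gen (by rintro _ ⟨a, rfl⟩; exact h a)

lemma isGradedSubset_range {A : Type*} [AddCommGroup A] [Module k A] [UnitalSupercoalgebra k A]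
    {z : CohGen r W → TensorAlgebra k A} {Φ : CohModel k r W q →ₐ[k] Cohomology k A}
    (hΦ : ∀ a, Represents (z a) (Φ (gen q a))) (hz : ∀ a, z a ∈ degreePart k A a.deg) :
    IsGradedSubset (Set.range Φ) := by
  have : Set.range Φ = (Algebra.adjoin k (Φ '' Set.range (gen q)) : Set (Cohomology k A)) := by
    rw [← AlgHom.map_adjoin, adjoin_range_gen, Algebra.map_top]
    rfl
  rw [this]
  apply isGradedSubset_adjoin
  rintro _ ⟨_, ⟨a, rfl⟩, rfl⟩
  exact ⟨_, z a, hz a, hΦ a⟩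

end CohModel
end MultiparameterSupergroup

namespace MultiparameterSupergroup
open UnitalSupercoalgebra Hochschild
open Finset.HasAntidiagonal (antidiagonal mem_antidiagonal)

/-! ### The monomial basis of `k[𝕄_r]` -/

section lattice
variable (N : ℕ)

/-- The ring of the polynomials `∑ c_n X^n` over `ℚ` for which all `⌊n / N⌋! c_n` are integers. It
contains `X` and `X^{N j} / j!`, and is an integral form of the even part of `k[𝕄_r]`, with `X` in
the role of `θ` and `N = p^{r-1}`. -/
def divPowLattice : Subring (Polynomial ℚ) where
  carrier := {f | ∀ n, ∃ z : ℤ, ((n / N).factorial : ℚ) * f.coeff n = z}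
  mul_mem' := by
    intro f g hf hg n
    choose a ha using hf
    choose b hb using hg
    refine ⟨∑ x ∈ antidiagonal n, a x.1 * b x.2 * (((n / N).factorial /
      ((x.1 / N).factorial * (x.2 / N).factorial) : ℕ) : ℤ), ?_⟩
    rw [Polynomial.coeff_mul, Finset.mul_sum]
    rw [Int.cast_sum]
    refine Finset.sum_congr rfl fun x hx => ?_
    rw [Int.cast_mul, Int.cast_mul, Int.cast_natCast, ← ha, ← hb, Nat.cast_div]
    · have h1 : ((x.1 / N).factorial : ℚ) ≠ 0 := Nat.cast_ne_zero.mpr (Nat.factorial_ne_zero _)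
      have h2 : ((x.2 / N).factorial : ℚ) ≠ 0 := Nat.cast_ne_zero.mpr (Nat.factorial_ne_zero _)
      push_cast
      field_simp
    · refine (Nat.factorial_mul_factorial_dvd_factorial_add _ _).trans
        (Nat.factorial_dvd_factorial ?_)
      rw [← mem_antidiagonal.mp hx]
      exact Nat.div_add_div_le_add_div
    · push_cast
      exact mul_ne_zero (Nat.cast_ne_zero.mpr (Nat.factorial_ne_zero _))
        (Nat.cast_ne_zero.mpr (Nat.factorial_ne_zero _))
  one_mem' n := by
    rw [Polynomial.coeff_one]
    split_ifs
    · exact ⟨(n / N).factorial, by simp⟩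
    · exact ⟨0, by simp⟩
  add_mem' := by
    intro f g hf hg n
    obtain ⟨a, ha⟩ := hf n
    obtain ⟨b, hb⟩ := hg n
    exact ⟨a + b, by rw [Polynomial.coeff_add, mul_add, ha, hb]; push_cast; rfl⟩
  zero_mem' n := ⟨0, by simp⟩
  neg_mem' := by
    intro f hf n
    obtain ⟨a, ha⟩ := hf n
    exact ⟨-a, by rw [Polynomial.coeff_neg, mul_neg, ha]; push_cast; rfl⟩

/-- The integer `⌊n / N⌋! c_n`. -/
def latticeCoeff (n : ℕ) : divPowLattice N →ₗ[ℤ] ℤ where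
  toFun f := (f.2 n).choose
  map_add' f g := by
    have : (((f + g).2 n).choose : ℚ) = (f.2 n).choose + (g.2 n).choose := by
      rw [← (f.2 n).choose_spec, ← (g.2 n).choose_spec, ← ((f + g).2 n).choose_spec, ← mul_add,
        ← Polynomial.coeff_add]
      rfl
    exact_mod_cast this
  map_smul' c f := by
    have : (((c • f).2 n).choose : ℚ) = c * (f.2 n).choose := by
      rw [← (f.2 n).choose_spec, ← ((c • f).2 n).choose_spec]
      have : ((c • f : divPowLattice N) : Polynomial ℚ) = (c : Polynomial ℚ) * f := by simp
      rw [this, Polynomial.coeff_intCast_mul]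
      ring
    exact_mod_cast this

lemma latticeCoeff_spec (n : ℕ) (f : divPowLattice N) :
    (latticeCoeff N n f : ℚ) = (n / N).factorial * (f : Polynomial ℚ).coeff n :=
  (f.2 n).choose_spec.symm

variable {N} (hN : 0 < N)

/-- The element `X`. -/
def latticeX : divPowLattice N :=
  ⟨Polynomial.X, fun n => by
    rw [Polynomial.coeff_X]
    split_ifs
    · exact ⟨(n / N).factorial, by simp⟩
    · exact ⟨0, by simp⟩⟩

/-- The element `X^{N j} / j!`. -/
def latticeSigma (j : ℕ) : divPowLattice N :=
  ⟨Polynomial.monomial (N * j) ((j.factorial : ℚ)⁻¹), fun n => by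
    rw [Polynomial.coeff_monomial]
    split_ifs with h
    · refine ⟨1, ?_⟩
      rw [← h, Nat.mul_div_cancel_left _ hN]
      simp [Nat.factorial_ne_zero]
    · exact ⟨0, by simp⟩⟩

lemma latticeCoeff_monomial (n i j : ℕ) (hi : i < N) :
    latticeCoeff N n (latticeX ^ i * latticeSigma hN j) = if n = i + N * j then 1 else 0 := by
  have h : (latticeCoeff N n (latticeX ^ i * latticeSigma hN j) : ℚ) =
      if n = i + N * j then 1 else 0 := by
    rw [latticeCoeff_spec]
    change _ * (Polynomial.X ^ i * Polynomial.monomial (N * j) ((j.factorial : ℚ)⁻¹)).coeff n = _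
    rw [Polynomial.X_pow_mul_monomial, Polynomial.coeff_monomial]
    split_ifs with h1 h2 h2
    · rw [h2, Nat.add_mul_div_left _ _ hN, Nat.div_eq_of_lt hi, zero_add,
        mul_inv_cancel₀ (Nat.cast_ne_zero.mpr (Nat.factorial_ne_zero _))]
    · omega
    · omega
    · simp
  exact_mod_cast h

end lattice

section basis
variable {k : Type*} [Field k] {p r : ℕ} [Fact p.Prime]

lemma prime_pow_pos (n : ℕ) : 0 < p ^ n := Nat.pow_pos (Fact.out : p.Prime).pos

variable (k p r) in
/-- The map from the even part of `k[𝕄_r]` to the base change of its integral form. -/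
def evenToLattice : EvenCoord k p r →ₐ[k] k ⊗[ℤ] divPowLattice (p ^ (r - 1)) :=
  evenLift (1 ⊗ₜ latticeX) (fun j => 1 ⊗ₜ latticeSigma (prime_pow_pos _) j)
    (by
      rw [Algebra.TensorProduct.one_def]
      congr 1
      ext1
      change Polynomial.monomial _ _ = _
      simp)
    (by
      rw [Algebra.TensorProduct.tmul_pow, one_pow]
      congr 1
      ext1
      change Polynomial.X ^ _ = Polynomial.monomial _ _
      rw [Polynomial.X_pow_eq_monomial]
      simp)
    (by
      intro i j
      rw [Algebra.TensorProduct.tmul_mul_tmul, one_mul, TensorProduct.smul_tmul', smul_eq_mul,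
        mul_one]
      have : latticeSigma (prime_pow_pos (p := p) (r - 1)) i * latticeSigma (prime_pow_pos _) j =
          ((i + j).choose i : ℤ) • latticeSigma (prime_pow_pos _) (i + j) := by
        ext1
        change Polynomial.monomial _ _ * Polynomial.monomial _ _ =
          ((i + j).choose i : ℤ) • Polynomial.monomial _ _
        rw [Polynomial.monomial_mul_monomial, ← mul_add, ← map_zsmul]
        congr 1
        rw [zsmul_eq_mul, Int.cast_natCast, Nat.choose_symm_add]
        have h0 := congrArg (Nat.cast (R := ℚ)) (Nat.add_choose_mul_factorial_mul_factorial i j)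
        push_cast at h0
        have h1 : (i.factorial : ℚ) ≠ 0 := Nat.cast_ne_zero.mpr (Nat.factorial_ne_zero _)
        have h2 : (j.factorial : ℚ) ≠ 0 := Nat.cast_ne_zero.mpr (Nat.factorial_ne_zero _)
        have h3 : ((i + j).factorial : ℚ) ≠ 0 := Nat.cast_ne_zero.mpr (Nat.factorial_ne_zero _)
        field_simp
        linear_combination -h0
      rw [this, TensorProduct.tmul_smul, TensorProduct.smul_tmul', zsmul_eq_mul, mul_one,
        Int.cast_natCast])

/-- The coefficient of `θ^i σ_j` in an element of the even part, where `n = i + p^{r-1} j` and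
`i < p^{r-1}`. -/
def evenCoeff (n : ℕ) : EvenCoord k p r →ₗ[k] k :=
  TensorProduct.AlgebraTensorModule.rid ℤ k k ∘ₗ
    (latticeCoeff (p ^ (r - 1)) n).baseChange k ∘ₗ (evenToLattice k p r).toLinearMap

lemma evenCoeff_monomial (n i j : ℕ) (hi : i < p ^ (r - 1)) :
    evenCoeff n (evenTheta ^ i * evenSigma j : EvenCoord k p r) =
      if n = i + p ^ (r - 1) * j then 1 else 0 := by
  have : evenToLattice k p r (evenTheta ^ i * evenSigma j) =
      1 ⊗ₜ (latticeX ^ i * latticeSigma (prime_pow_pos _) j) := by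
    rw [map_mul, map_pow, evenToLattice, evenLift_theta, evenLift_sigma,
      Algebra.TensorProduct.tmul_pow, Algebra.TensorProduct.tmul_mul_tmul, one_pow, one_mul]
  simp [evenCoeff, this, latticeCoeff_monomial _ _ _ _ hi]

/-- The monomial `θ^i σ_j τ^e`. -/
def mono (k : Type*) [Field k] (p r i j e : ℕ) : Coord k p r := theta ^ i * sigma j * tau ^ e

lemma mono_eq_incl (i j : ℕ) :
    mono k p r i j 0 = evenIncl k p r (evenTheta ^ i * evenSigma j) := by
  rw [mono, pow_zero, mul_one, map_mul, map_pow]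
  rfl

lemma mono_one_eq (i j : ℕ) : mono k p r i j 1 = mono k p r i j 0 * tau := by
  rw [mono, mono, pow_zero, pow_one, mul_one]

variable (k p r) in
/-- The coefficients of an element of `k[𝕄_r]` at the monomials `θ^i σ_j τ^e`. -/
def coordCoeff : Coord k p r →ₗ[k] (Fin (p ^ (r - 1)) × ℕ × Fin 2 → k) :=
  LinearMap.pi fun x => if x.2.2 = 0 then
    evenCoeff (x.1 + p ^ (r - 1) * x.2.1) ∘ₗ (evenPart k p r).toLinearMap
  else evenCoeff (x.1 + p ^ (r - 1) * x.2.1) ∘ₗ oddPart k p r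

lemma add_mul_inj {N i j i' j' : ℕ} (hi : i < N) (hi' : i' < N) (h : i + N * j = i' + N * j') :
    i = i' ∧ j = j' := by
  have h1 := congrArg (· % N) h
  have h2 := congrArg (· / N) h
  simp only [Nat.add_mul_mod_self_left, Nat.mod_eq_of_lt hi, Nat.mod_eq_of_lt hi',
    Nat.add_mul_div_left _ _ (Nat.zero_lt_of_lt hi), Nat.div_eq_of_lt hi, Nat.div_eq_of_lt hi',
    zero_add] at h1 h2
  exact ⟨h1, h2⟩

lemma coordCoeff_mono (x : Fin (p ^ (r - 1)) × ℕ × Fin 2) :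
    coordCoeff k p r (mono k p r x.1 x.2.1 x.2.2) = Pi.single x 1 := by
  obtain ⟨i, j, e⟩ := x
  funext ⟨i', j', e'⟩
  rw [Pi.single_apply]
  have hiff : (((i' : ℕ) + p ^ (r - 1) * j' = i + p ^ (r - 1) * j) ↔ (i' = i ∧ j' = j)) :=
    ⟨fun h => ⟨Fin.ext (add_mul_inj i'.2 i.2 h).1, (add_mul_inj i'.2 i.2 h).2⟩,
      by rintro ⟨rfl, rfl⟩; rfl⟩
  have hm := evenCoeff_monomial (k := k) (p := p) (r := r) (i' + p ^ (r - 1) * j') i j i.2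
  simp only [hiff] at hm
  fin_cases e <;> fin_cases e'
  · simp [coordCoeff, mono_eq_incl, hm]
  · simp [coordCoeff, mono_eq_incl, - map_mul]
  · simp [coordCoeff, mono_one_eq, mono_eq_incl]
  · simp [coordCoeff, mono_one_eq, mono_eq_incl, - map_mul, hm]

/-- Powers `θ^n` with `n ≥ p^{r-1}` are reduced by `θ^{p^{r-1}} = σ_1`. -/
lemma exists_theta_pow_mul_sigma (n j : ℕ) : ∃ (c : k),
    (evenTheta ^ n * evenSigma j : EvenCoord k p r) =
      c • (evenTheta ^ (n % p ^ (r - 1)) * evenSigma (j + n / p ^ (r - 1))) := by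
  have h : ∀ m j, ∃ c : k, (evenSigma 1 ^ m * evenSigma j : EvenCoord k p r) =
      c • evenSigma (j + m) := by
    intro m
    induction m with
    | zero => exact fun j => ⟨1, by simp⟩
    | succ m ih =>
      intro j
      obtain ⟨c, hc⟩ := ih (1 + j)
      refine ⟨((1 + j).choose 1 : k) * c, ?_⟩
      rw [pow_succ, mul_assoc, evenSigma_mul, mul_smul_comm, hc, smul_smul]
      congr 2
      ring
  obtain ⟨c, hc⟩ := h (n / p ^ (r - 1)) j
  refine ⟨c, ?_⟩
  conv_lhs => rw [← Nat.mod_add_div n (p ^ (r - 1)), pow_add, pow_mul, evenTheta_pow, mul_assoc, hc]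
  rw [mul_smul_comm]

lemma mono_mem_span (n j e : ℕ) (he : e < 2) : mono k p r n j e ∈ Submodule.span k
    (Set.range fun x : Fin (p ^ (r - 1)) × ℕ × Fin 2 => mono k p r x.1 x.2.1 x.2.2) := by
  obtain ⟨c, hc⟩ := exists_theta_pow_mul_sigma (k := k) (p := p) (r := r) n j
  have : mono k p r n j e = c • mono k p r (n % p ^ (r - 1)) (j + n / p ^ (r - 1)) e := by
    have h0 : ∀ i j, mono k p r i j e =
        evenIncl k p r (evenTheta ^ i * evenSigma j) * tau ^ e := by
      intro i j
      rw [← mono_eq_incl, mono, mono, pow_zero, mul_one]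
    rw [h0, hc, map_smul, smul_mul_assoc, ← h0]
  rw [this]
  exact Submodule.smul_mem _ _ (Submodule.subset_span
    ⟨(⟨_, Nat.mod_lt _ (prime_pow_pos _)⟩, _, ⟨e, he⟩), rfl⟩)

variable (k p r) in
/-- The basis of the `θ^i σ_j τ^e`, `i < p^{r-1}`, `e < 2`, of `k[𝕄_r]`. The linear independence
comes from the coefficients in the integral form. -/
def coordBasis : Module.Basis (Fin (p ^ (r - 1)) × ℕ × Fin 2) k (Coord k p r) :=
  Module.Basis.mk (v := fun x => mono k p r x.1 x.2.1 x.2.2)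
    (LinearIndependent.of_comp (coordCoeff k p r) (by
      have : (coordCoeff k p r ∘ fun x : Fin (p ^ (r - 1)) × ℕ × Fin 2 =>
          mono k p r x.1 x.2.1 x.2.2) = fun x => Pi.single x 1 := funext coordCoeff_mono
      rw [this]
      exact Pi.linearIndependent_single_one _ _))
    (by
      intro a _
      have key : ∀ b : EvenCoord k p r, ∀ e < 2, evenIncl k p r b * tau ^ e ∈ Submodule.span k
          (Set.range fun x : Fin (p ^ (r - 1)) × ℕ × Fin 2 => mono k p r x.1 x.2.1 x.2.2) := by
        intro b e he
        induction even_span b using Submodule.span_induction with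
        | zero => simp
        | add x y _ _ hx hy => rw [map_add, add_mul]; exact add_mem hx hy
        | smul c x _ hx => rw [map_smul, smul_mul_assoc]; exact Submodule.smul_mem _ _ hx
        | mem x hx =>
          obtain ⟨⟨i, j⟩, rfl⟩ := hx
          have := mono_mem_span (k := k) (p := p) (r := r) i j e he
          rwa [mono, ← mul_one (theta ^ i * sigma j), ← pow_zero tau, ← mono, mono_eq_incl] at this
      rw [coord_eq a]
      refine add_mem ?_ ?_
      · simpa using key _ 0 (by norm_num)
      · simpa using key _ 1 (by norm_num))

lemma coordBasis_apply (x : Fin (p ^ (r - 1)) × ℕ × Fin 2) :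
    coordBasis k p r x = mono k p r x.1 x.2.1 x.2.2 := by
  rw [coordBasis, Module.Basis.mk_apply]

section lin
variable {V : Type*} [AddCommGroup V] [Module k V]

/-- The linear map on `k[𝕄_r]` with the value `F i j e` at `θ^i σ_j τ^e`; the values of `F` with
`i ≥ p^{r-1}` or `e ≥ 2` are not used. -/
def coordLin (F : ℕ → ℕ → ℕ → V) : Coord k p r →ₗ[k] V :=
  (coordBasis k p r).constr k fun x => F x.1 x.2.1 x.2.2

lemma coordLin_mono (F : ℕ → ℕ → ℕ → V) {i e : ℕ} (hi : i < p ^ (r - 1)) (j : ℕ) (he : e < 2) :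
    coordLin F (mono k p r i j e) = F i j e := by
  have := (coordBasis k p r).constr_basis k (fun x => F x.1 x.2.1 x.2.2) (⟨i, hi⟩, j, ⟨e, he⟩)
  rwa [coordBasis_apply] at this

lemma coord_linearMap_ext {f g : Coord k p r →ₗ[k] V}
    (h : ∀ i < p ^ (r - 1), ∀ j, ∀ e < 2, f (mono k p r i j e) = g (mono k p r i j e)) : f = g :=
  (coordBasis k p r).ext fun x => by
    rw [coordBasis_apply]
    exact h _ x.1.2 _ _ x.2.2.2

end lin
end basis
end MultiparameterSupergroup

/-! ### Translation operators -/

namespace UnitalSupercoalgebra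
section slice
variable {k A : Type*} [Field k] [AddCommGroup A] [Module k A] [UnitalSupercoalgebra k A]

/-- The operator `(φ ⊗ 1) Δ` attached to a functional `φ`. It is an endomorphism of the right
comodule `A`, dual to the left multiplication by `φ` in the algebra `A^*`. -/
def slice (φ : A →ₗ[k] k) : A →ₗ[k] A :=
  (TensorProduct.lid k A).toLinearMap ∘ₗ φ.rTensor A ∘ₗ CoalgebraStruct.comul (R := k)

lemma rTensor_slice_comul (φ : A →ₗ[k] k) (a : A) :
    (slice φ).rTensor A (CoalgebraStruct.comul (R := k) a) =
      CoalgebraStruct.comul (R := k) (slice φ a) := by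
  set F : A ⊗[k] (A ⊗[k] A) →ₗ[k] A ⊗[k] A :=
    (TensorProduct.lid k (A ⊗[k] A)).toLinearMap ∘ₗ φ.rTensor (A ⊗[k] A)
  have h1 : ∀ z : A ⊗[k] A, (slice φ).rTensor A z =
      F (TensorProduct.assoc k A A A ((CoalgebraStruct.comul (R := k)).rTensor A z)) := by
    intro z
    induction z with
    | zero => simp
    | add x y hx hy => simp only [map_add, hx, hy]
    | tmul x y =>
      simp only [LinearMap.rTensor_tmul, slice, LinearMap.comp_apply]
      generalize CoalgebraStruct.comul (R := k) x = w
      induction w with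
      | zero => simp
      | add x y hx hy => simp only [map_add, TensorProduct.add_tmul, hx, hy]
      | tmul u v => simp [F, TensorProduct.smul_tmul']
  have h2 : ∀ z : A ⊗[k] A, F ((CoalgebraStruct.comul (R := k)).lTensor A z) =
      CoalgebraStruct.comul (R := k) (TensorProduct.lid k A (φ.rTensor A z)) := by
    intro z
    induction z with
    | zero => simp
    | add x y hx hy => simp only [map_add, hx, hy]
    | tmul x y => simp [F]
  rw [h1, Coalgebra.coassoc_apply, h2]
  rfl

/-- For a cocommutative coalgebra the operator is an endomorphism of the left comodule, too. -/
lemma lTensor_slice_comul (h : ∀ a : A, TensorProduct.comm k A A (CoalgebraStruct.comul (R := k) a) =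
    CoalgebraStruct.comul (R := k) a) (φ : A →ₗ[k] k) (a : A) :
    (slice φ).lTensor A (CoalgebraStruct.comul (R := k) a) =
      CoalgebraStruct.comul (R := k) (slice φ a) := by
  have h1 : ∀ z : A ⊗[k] A, (slice φ).lTensor A (TensorProduct.comm k A A z) =
      TensorProduct.comm k A A ((slice φ).rTensor A z) := by
    intro z
    induction z with
    | zero => simp
    | add x y hx hy => simp only [map_add, hx, hy]
    | tmul x y => simp
  rw [← h, h1, rTensor_slice_comul, h]

end slice
end UnitalSupercoalgebra

namespace MultiparameterSupergroup
open UnitalSupercoalgebra Hochschild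
open Finset.HasAntidiagonal (antidiagonal mem_antidiagonal)

section
variable {k : Type*} [Field k] {p r : ℕ} [Fact p.Prime] [CharP k p]

lemma coord_comul_comm (a : Coord k p r) :
    TensorProduct.comm k _ _ (CoalgebraStruct.comul (R := k) a) =
      CoalgebraStruct.comul (R := k) a := by
  change TensorProduct.comm k _ _ (comulLin k p r a) = comulLin k p r a
  set F : Coord k p r ⊗[k] Coord k p r →ₐ[k] Coord k p r ⊗[k] Coord k p r :=
    (Algebra.TensorProduct.comm k (Coord k p r) (Coord k p r)).toAlgHom
  have hF : ∀ z, TensorProduct.comm k _ _ z = F z := fun z => rfl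
  have hF' : ∀ x y, F (x ⊗ₜ y) = y ⊗ₜ x := fun x y => rfl
  have h : F.comp (evenComul k p r) = evenComul k p r := by
    apply even_algHom_ext
    · rw [AlgHom.comp_apply, evenComul_theta, map_add, hF', hF', add_comm]
    · intro n
      have hs : ∀ (n : ℕ) (c d : ℕ → Coord k p r), c = d →
          F (∑ x ∈ antidiagonal n, c x.1 ⊗ₜ d x.2) = ∑ x ∈ antidiagonal n, c x.1 ⊗ₜ d x.2 := by
        rintro n c _ rfl
        rw [map_sum, ← Finset.Nat.sum_antidiagonal_swap]
        exact Finset.sum_congr rfl fun x _ => hF' _ _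
      rw [AlgHom.comp_apply, evenComul_sigma, comulSigma, map_add, apply_ite F, map_zero,
        hs n sigma sigma rfl, hs (n - p) (fun i => sigma i * tau) (fun i => sigma i * tau) rfl]
  have h' : ∀ b, F (evenComul k p r b) = evenComul k p r b := fun b => DFunLike.congr_fun h b
  rw [hF, coord_eq a, map_add, map_add, comul_incl, comul_incl_mul, map_mul, h', h', comul_tau,
    map_add, hF', hF', add_comm (1 ⊗ₜ[k] tau)]

lemma comul_theta_pow_mono (i : ℕ) (a : Coord k p r) : comulLin k p r (theta ^ i * a) =
    ∑ m ∈ antidiagonal i, (i.choose m.1 : k) •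
      ((theta ^ m.1) ⊗ₜ[k] (theta ^ m.2)) * comulLin k p r a := by
  have : comulLin k p r (theta ^ i * a) =
      (theta ⊗ₜ[k] 1 + 1 ⊗ₜ[k] theta) ^ i * comulLin k p r a := comul_pow_mul comul_theta_mul i a
  rw [this, Commute.add_pow' (Commute.all _ _), Finset.sum_mul]
  refine Finset.sum_congr rfl fun m _ => ?_
  rw [Algebra.TensorProduct.tmul_pow, Algebra.TensorProduct.tmul_pow, one_pow, one_pow,
    Algebra.TensorProduct.tmul_mul_tmul, one_mul, mul_one, ← Nat.cast_smul_eq_nsmul k]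

/-- The coproduct of the monomials without `τ`. -/
lemma comul_mono_zero (i j : ℕ) : comulLin k p r (mono k p r i j 0) =
    ∑ m ∈ antidiagonal i, (i.choose m.1 : k) •
      (∑ x ∈ antidiagonal j, mono k p r m.1 x.1 0 ⊗ₜ[k] mono k p r m.2 x.2 0 +
        if p ≤ j then ∑ x ∈ antidiagonal (j - p),
          mono k p r m.1 x.1 1 ⊗ₜ[k] mono k p r m.2 x.2 1 else 0) := by
  rw [mono, pow_zero, mul_one, comul_theta_pow_mono, comul_sigma, comulSigma]
  refine Finset.sum_congr rfl fun m _ => ?_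
  rw [smul_mul_assoc, mul_add, Finset.mul_sum, mul_ite, mul_zero, Finset.mul_sum]
  simp only [mono, pow_zero, pow_one, mul_one, Algebra.TensorProduct.tmul_mul_tmul, mul_assoc]

/-- The coproduct of the monomials with `τ`. -/
lemma comul_mono_one (i j : ℕ) : comulLin k p r (mono k p r i j 1) =
    ∑ m ∈ antidiagonal i, (i.choose m.1 : k) •
      ∑ x ∈ antidiagonal j, (mono k p r m.1 x.1 1 ⊗ₜ[k] mono k p r m.2 x.2 0 +
        mono k p r m.1 x.1 0 ⊗ₜ[k] mono k p r m.2 x.2 1) := by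
  have h : comulSigma k p r j * (tau ⊗ₜ 1 + 1 ⊗ₜ tau) = ∑ x ∈ antidiagonal j,
      ((sigma x.1 * tau) ⊗ₜ[k] sigma x.2 + sigma x.1 ⊗ₜ[k] (sigma x.2 * tau)) := by
    have ht : ∀ x y : Coord k p r, ((x * tau) ⊗ₜ[k] (y * tau)) * (tau ⊗ₜ[k] 1 + 1 ⊗ₜ[k] tau) = 0 := by
      intro x y
      simp [mul_add, mul_assoc, tau_mul_tau]
    rw [comulSigma, add_mul, ite_mul, zero_mul, Finset.sum_mul, Finset.sum_mul,
      Finset.sum_congr rfl fun x _ => ht _ _, Finset.sum_const_zero, ite_self, add_zero]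
    simp [mul_add]
  rw [mono, pow_one, mul_assoc, comul_theta_pow_mono, comul_sigma_mul, comul_tau, h]
  refine Finset.sum_congr rfl fun m _ => ?_
  rw [smul_mul_assoc, Finset.mul_sum]
  simp only [mono, pow_zero, pow_one, mul_one, mul_add, Algebra.TensorProduct.tmul_mul_tmul,
    mul_assoc]

variable (k p r) in
/-- The coefficient of `θ^a σ_u τ^d`. -/
def coeff (a u d : ℕ) : Coord k p r →ₗ[k] k :=
  coordLin fun i j e => if i = a ∧ j = u ∧ e = d then 1 else 0

lemma coeff_mono {a u d i j e : ℕ} (hi : i < p ^ (r - 1)) (he : e < 2) :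
    coeff k p r a u d (mono k p r i j e) = if i = a ∧ j = u ∧ e = d then 1 else 0 :=
  coordLin_mono _ hi j he

lemma sum_antidiagonal_ite {M : Type*} [AddCommMonoid M] (i a : ℕ) (F : ℕ × ℕ → M) :
    ∑ m ∈ antidiagonal i, (if m.1 = a then F m else 0) =
      if a ≤ i then F (a, i - a) else 0 := by
  split_ifs with h
  · rw [Finset.sum_eq_single (a, i - a)]
    · simp
    · rintro ⟨m, n⟩ hm hne
      rw [mem_antidiagonal] at hm
      rw [if_neg]
      rintro rfl
      refine hne (Prod.ext rfl ?_)
      simp only at hm ⊢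
      omega
    · intro hm
      refine absurd (mem_antidiagonal.mpr ?_) hm
      simp only
      omega
  · refine Finset.sum_eq_zero fun m hm => if_neg ?_
    rw [mem_antidiagonal] at hm
    omega

lemma slice_mono_zero (φ : Coord k p r →ₗ[k] k) (i j : ℕ) : slice φ (mono k p r i j 0) =
    ∑ m ∈ antidiagonal i, (i.choose m.1 : k) •
      (∑ x ∈ antidiagonal j, φ (mono k p r m.1 x.1 0) • mono k p r m.2 x.2 0 +
        if p ≤ j then ∑ x ∈ antidiagonal (j - p),
          φ (mono k p r m.1 x.1 1) • mono k p r m.2 x.2 1 else 0) := by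
  change TensorProduct.lid k _ (φ.rTensor _ (comulLin k p r _)) = _
  rw [comul_mono_zero]
  simp only [map_sum, map_add, map_smul, LinearMap.rTensor_tmul, TensorProduct.lid_tmul,
    apply_ite (φ.rTensor (Coord k p r)), apply_ite (TensorProduct.lid k (Coord k p r)), map_zero]

lemma slice_mono_one (φ : Coord k p r →ₗ[k] k) (i j : ℕ) : slice φ (mono k p r i j 1) =
    ∑ m ∈ antidiagonal i, (i.choose m.1 : k) •
      ∑ x ∈ antidiagonal j, (φ (mono k p r m.1 x.1 1) • mono k p r m.2 x.2 0 +
        φ (mono k p r m.1 x.1 0) • mono k p r m.2 x.2 1) := by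
  change TensorProduct.lid k _ (φ.rTensor _ (comulLin k p r _)) = _
  rw [comul_mono_one]
  simp only [map_sum, map_add, map_smul, LinearMap.rTensor_tmul, TensorProduct.lid_tmul]

lemma slice_coeff_zero (a u : ℕ) {i e : ℕ} (j : ℕ) (hi : i < p ^ (r - 1)) (he : e < 2) :
    slice (coeff k p r a u 0) (mono k p r i j e) =
      if u ≤ j then (i.choose a : k) • mono k p r (i - a) (j - u) e else 0 := by
  have hm : ∀ m ∈ antidiagonal i, m.1 < p ^ (r - 1) := by
    intro m hm
    rw [mem_antidiagonal] at hm
    omega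
  have key : ∑ m ∈ antidiagonal i, (i.choose m.1 : k) • ∑ x ∈ antidiagonal j,
      (if m.1 = a ∧ x.1 = u then (1 : k) else 0) • mono k p r m.2 x.2 e =
      if u ≤ j then (i.choose a : k) • mono k p r (i - a) (j - u) e else 0 := by
    have : ∀ m : ℕ × ℕ, ∑ x ∈ antidiagonal j,
        (if m.1 = a ∧ x.1 = u then (1 : k) else 0) • mono k p r m.2 x.2 e =
        if m.1 = a then (if u ≤ j then mono k p r m.2 (j - u) e else 0) else 0 := by
      intro m
      split_ifs with h1 h2
      · simp only [h1, true_and, ite_smul, one_smul, zero_smul]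
        rw [sum_antidiagonal_ite, if_pos h2]
      · simp only [h1, true_and, ite_smul, one_smul, zero_smul]
        rw [sum_antidiagonal_ite, if_neg h2]
      · simp [h1]
    simp only [this, smul_ite, smul_zero]
    rw [sum_antidiagonal_ite i a (fun m => if u ≤ j then
      (i.choose m.1 : k) • mono k p r m.2 (j - u) e else 0)]
    split_ifs with h1 h2
    · rfl
    · rfl
    · rw [Nat.choose_eq_zero_of_lt (by omega), Nat.cast_zero, zero_smul]
    · rfl
  rw [← key]
  interval_cases e
  · rw [slice_mono_zero]
    refine Finset.sum_congr rfl fun m h => ?_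
    simp [coeff_mono (hm m h)]
  · rw [slice_mono_one]
    refine Finset.sum_congr rfl fun m h => ?_
    simp [coeff_mono (hm m h)]

lemma slice_coeff_tau_zero {i : ℕ} (j : ℕ) (hi : i < p ^ (r - 1)) :
    slice (coeff k p r 0 0 1) (mono k p r i j 0) =
      if p ≤ j then mono k p r i (j - p) 1 else 0 := by
  have hm : ∀ m ∈ antidiagonal i, m.1 < p ^ (r - 1) := by
    intro m hm
    rw [mem_antidiagonal] at hm
    omega
  rw [slice_mono_zero]
  have : ∀ m ∈ antidiagonal i, (i.choose m.1 : k) •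
      (∑ x ∈ antidiagonal j, coeff k p r 0 0 1 (mono k p r m.1 x.1 0) • mono k p r m.2 x.2 0 +
        if p ≤ j then ∑ x ∈ antidiagonal (j - p),
          coeff k p r 0 0 1 (mono k p r m.1 x.1 1) • mono k p r m.2 x.2 1 else 0) =
      if m.1 = 0 then (if p ≤ j then (i.choose m.1 : k) • mono k p r m.2 (j - p) 1 else 0)
        else 0 := by
    intro m h
    simp only [coeff_mono (hm m h) (show 0 < 2 by norm_num),
      coeff_mono (hm m h) (show 1 < 2 by norm_num)]
    by_cases h1 : m.1 = 0
    · simp only [h1, true_and, ite_smul, one_smul, zero_smul, and_true]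
      rw [sum_antidiagonal_ite]
      simp
    · simp [h1]
  rw [Finset.sum_congr rfl this, sum_antidiagonal_ite i 0 (fun m => if p ≤ j then
    (i.choose m.1 : k) • mono k p r m.2 (j - p) 1 else 0)]
  simp

lemma slice_coeff_tau_one {i : ℕ} (j : ℕ) (hi : i < p ^ (r - 1)) :
    slice (coeff k p r 0 0 1) (mono k p r i j 1) = mono k p r i j 0 := by
  have hm : ∀ m ∈ antidiagonal i, m.1 < p ^ (r - 1) := by
    intro m hm
    rw [mem_antidiagonal] at hm
    omega
  rw [slice_mono_one]
  have : ∀ m ∈ antidiagonal i, (i.choose m.1 : k) •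
      ∑ x ∈ antidiagonal j, (coeff k p r 0 0 1 (mono k p r m.1 x.1 1) • mono k p r m.2 x.2 0 +
        coeff k p r 0 0 1 (mono k p r m.1 x.1 0) • mono k p r m.2 x.2 1) =
      if m.1 = 0 then (i.choose m.1 : k) • mono k p r m.2 j 0 else 0 := by
    intro m h
    simp only [coeff_mono (hm m h) (show 0 < 2 by norm_num),
      coeff_mono (hm m h) (show 1 < 2 by norm_num)]
    by_cases h1 : m.1 = 0
    · simp only [h1, true_and, ite_smul, one_smul, zero_smul, and_true, and_false, if_false,
        if_true, zero_ne_one, add_zero]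
      rw [sum_antidiagonal_ite j 0 (fun x => mono k p r m.2 x.2 0)]
      simp
    · simp [h1]
  rw [Finset.sum_congr rfl this, sum_antidiagonal_ite i 0 (fun m =>
    (i.choose m.1 : k) • mono k p r m.2 j 0)]
  simp

end
end MultiparameterSupergroup

namespace MultiparameterSupergroup
open UnitalSupercoalgebra Hochschild
open Finset.HasAntidiagonal (antidiagonal mem_antidiagonal)

/-! ### The elements `θ`, `τ` and the subalgebras `k[𝕄_{r;s}]` -/

section
variable {k : Type*} [Field k] {p : ℕ} [Fact p.Prime] [CharP k p]

section generalTheta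
variable {A : Type*} [CommRing A] [Algebra k A] [UnitalSupercoalgebra k A] {th ta : A}

lemma IsThetaTau.of_injective {C : Type*} [CommRing C] [Algebra k C] [UnitalSupercoalgebra k C]
    (j : Hom k C A) (f : C →ₐ[k] A) (hf : ∀ c, j.toLin c = f c) (hj : Function.Injective f)
    {th ta : C} (h : IsThetaTau (k := k) (f th) (f ta)) : IsThetaTau (k := k) th ta := by
  have hj' : Function.Injective j.toLin := by
    intro x y hxy
    rw [hf, hf] at hxy
    exact hj hxy
  have hinj : Function.Injective (TensorProduct.map j.toLin j.toLin) :=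
    TensorProduct.map_injective_of_flat_flat _ _ hj' hj'
  have hmul : ∀ x y : C ⊗[k] C, TensorProduct.map j.toLin j.toLin (x * y) =
      TensorProduct.map j.toLin j.toLin x * TensorProduct.map j.toLin j.toLin y := by
    intro x y
    induction x with
    | zero => simp
    | add a b ha hb => simp only [add_mul, map_add, ha, hb]
    | tmul a b =>
      induction y with
      | zero => simp
      | add x y hx hy => simp only [mul_add, map_add, hx, hy]
      | tmul c d => simp [hf]
  refine ⟨?_, ?_, ?_, ?_, ?_⟩
  · apply hj
    rw [← hf, j.map_unit, h.unit_eq, map_one]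
  · intro a
    apply hinj
    rw [← j.map_comul, hf, map_mul, h.comul_theta_mul, hmul, ← j.map_comul, hf]
    simp [hf]
  · intro a
    apply hinj
    rw [← j.map_comul, hf, map_mul, h.comul_tau_mul, ← hf a, j.map_comul, map_add]
    generalize CoalgebraStruct.comul (R := k) a = z
    induction z with
    | zero => simp
    | add x y hx hy =>
      simp only [map_add] at hx hy ⊢
      rw [add_add_add_comm, hx, hy]
      abel
    | tmul x y =>
      have hpar : f (parity (k := k) x) = parity (k := k) (f x) := by
        rw [← hf, j.map_parity, hf]
      simp [hf, hpar]
  · intro a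
    apply hj
    rw [← hf, j.map_parity, hf, map_mul, h.parity_theta_mul, map_mul, ← hf a, ← j.map_parity, hf]
  · apply hj
    rw [← hf, j.map_parity, hf, h.parity_tau, map_neg]

variable (h : IsThetaTau (k := k) th ta)
include h

lemma IsThetaTau.comul_theta_pow (m : ℕ) : CoalgebraStruct.comul (R := k) (th ^ m) =
    ∑ x ∈ antidiagonal m, (m.choose x.1 : k) • (th ^ x.1) ⊗ₜ[k] (th ^ x.2) := by
  rw [comul_pow h.unit_eq h.comul_theta_mul, Commute.add_pow' (Commute.all _ _)]
  refine Finset.sum_congr rfl fun x _ => ?_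
  rw [Algebra.TensorProduct.tmul_pow, Algebra.TensorProduct.tmul_pow, one_pow, one_pow,
    Algebra.TensorProduct.tmul_mul_tmul, one_mul, mul_one, ← Nat.cast_smul_eq_nsmul k]

lemma IsThetaTau.comul_theta_pow_mul_tau (m : ℕ) : CoalgebraStruct.comul (R := k) (th ^ m * ta) =
    ∑ x ∈ antidiagonal m, (m.choose x.1 : k) •
      ((th ^ x.1 * ta) ⊗ₜ[k] (th ^ x.2) + (th ^ x.1) ⊗ₜ[k] (th ^ x.2 * ta)) := by
  rw [mul_comm, h.comul_tau_mul, h.comul_theta_pow, map_sum, map_sum, ← Finset.sum_add_distrib]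
  refine Finset.sum_congr rfl fun x _ => ?_
  simp [h.parity_theta_pow, mul_comm ta]

lemma IsThetaTau.parity_theta_pow_mul (m : ℕ) (a : A) :
    parity (k := k) (th ^ m * a) = th ^ m * parity (k := k) a := by
  induction m with
  | zero => simp
  | succ m ih => rw [pow_succ', mul_assoc, h.parity_theta_mul, ih, mul_assoc]

end generalTheta

variable {r : ℕ}

lemma isThetaTau_coord : IsThetaTau (k := k) (theta : Coord k p r) tau where
  unit_eq := rfl
  comul_theta_mul := comul_theta_mul
  comul_tau_mul := by
    have hp0 : ∀ i j, parityHom k p r (mono k p r i j 0) = mono k p r i j 0 := by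
      intro i j
      simp [mono]
    have hp1 : ∀ i j, parityHom k p r (mono k p r i j 1) = -mono k p r i j 1 := by
      intro i j
      simp [mono]
    have ht0 : ∀ i j, tau * mono k p r i j 0 = mono k p r i j 1 := by
      intro i j
      rw [mono_one_eq, mul_comm]
    have ht1 : ∀ i j, tau * mono k p r i j 1 = 0 := by
      intro i j
      rw [mono_one_eq, mul_comm, mul_assoc, tau_mul_tau, mul_zero]
    have : comulLin k p r ∘ₗ LinearMap.mulLeft k tau =
        (LinearMap.mulLeft k tau).rTensor _ ∘ₗ comulLin k p r +
          TensorProduct.map (parityHom k p r).toLinearMap (LinearMap.mulLeft k tau) ∘ₗ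
            comulLin k p r := by
      apply coord_linearMap_ext
      intro i _ j e he
      interval_cases e
      · simp only [LinearMap.comp_apply, LinearMap.add_apply, LinearMap.mulLeft_apply, ht0,
          comul_mono_zero, comul_mono_one, map_sum, map_smul, ← Finset.sum_add_distrib, ← smul_add]
        refine Finset.sum_congr rfl fun m _ => ?_
        split_ifs
        · simp [ht0, ht1, hp0, hp1, Finset.sum_add_distrib]
        · simp [ht0, ht1, hp0, hp1, Finset.sum_add_distrib]
      · simp only [LinearMap.comp_apply, LinearMap.add_apply, LinearMap.mulLeft_apply, ht1,
          comul_mono_zero, comul_mono_one, map_sum, map_smul, ← Finset.sum_add_distrib, ← smul_add,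
          map_zero]
        refine (Finset.sum_eq_zero fun m _ => ?_).symm
        simp [ht0, ht1, hp0, hp1, TensorProduct.neg_tmul]
    exact fun a => LinearMap.congr_fun this a
  parity_theta_mul a := by
    change parityHom k p r (theta * a) = theta * parityHom k p r a
    simp
  parity_tau := parity_tau

lemma coordSubIncl_injective (s : ℕ) : Function.Injective (coordSubIncl k p r s).toLin :=
  Subtype.val_injective

lemma isThetaTau_coordSub (s : ℕ) :
    IsThetaTau (k := k) (thetaSub k p r s) (tauSub k p r s) :=
  IsThetaTau.of_injective (coordSubIncl k p r s) (coordSub k p r s).val (fun _ => rfl)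
    Subtype.val_injective isThetaTau_coord

omit [CharP k p] in
/-- This coefficient of `σ_i σ_j` vanishes, as the polynomial
`(1 + X)^{i+j} = (1 + X)^{i+j-p^s} (1 + X^{p^s})` has no term of degree `i`. -/
lemma prime_pow_add_choose [CharP k p] {s i j : ℕ} (hi : i < p ^ s) (hj : j < p ^ s)
    (h : p ^ s ≤ i + j) : ((i + j).choose i : k) = 0 := by
  have h1 : (1 + Polynomial.X : Polynomial k) ^ (i + j) =
      (1 + Polynomial.X) ^ (i + j - p ^ s) +
        Polynomial.X ^ p ^ s * (1 + Polynomial.X) ^ (i + j - p ^ s) := by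
    have h2 : (1 + Polynomial.X : Polynomial k) ^ p ^ s = 1 + Polynomial.X ^ p ^ s := by
      rw [add_pow_char_pow, one_pow]
    conv_lhs => rw [← Nat.sub_add_cancel h, pow_add, h2]
    ring
  have := congrArg (fun q => Polynomial.coeff q i) h1
  simp only [Polynomial.coeff_add, Polynomial.coeff_one_add_X_pow,
    Polynomial.coeff_X_pow_mul'] at this
  rw [this, if_neg (by omega), Nat.choose_eq_zero_of_lt (by omega)]
  simp

omit [CharP k p] in
lemma mono_mem (s i e : ℕ) {j : ℕ} (hj : j < p ^ s) : mono k p r i j e ∈ coordSub k p r s :=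
  mul_mem (mul_mem (pow_mem (theta_mem s) _) (sigma_mem hj)) (pow_mem (tau_mem s) _)

/-- `k[𝕄_{r;s}]` is spanned by the `θ^i σ_j τ^e` with `j < p^s`. -/
lemma coordSub_le_span {s : ℕ} (hs : s ≠ 0) {a : Coord k p r} (ha : a ∈ coordSub k p r s) :
    a ∈ Submodule.span k {b | ∃ i j e, i < p ^ (r - 1) ∧ j < p ^ s ∧ e < 2 ∧
      b = mono k p r i j e} := by
  set S := Submodule.span k {b | ∃ i j e, i < p ^ (r - 1) ∧ j < p ^ s ∧ e < 2 ∧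
      b = mono k p r i j e}
  have hsig : ∀ l, l < p ^ s → ∀ i j e, i < p ^ (r - 1) → j < p ^ s → e < 2 →
      sigma l * mono k p r i j e ∈ S := by
    intro l hl i j e hi hj he
    have : sigma l * mono k p r i j e = ((l + j).choose l : k) • mono k p r i (l + j) e := by
      rw [mono, mono, mul_comm (theta ^ i) (sigma j), ← mul_assoc, ← mul_assoc, sigma_mul,
        smul_mul_assoc, smul_mul_assoc, mul_comm (sigma _)]
    rw [this]
    rcases Nat.lt_or_ge (l + j) (p ^ s) with h | h
    · exact S.smul_mem _ (Submodule.subset_span ⟨i, l + j, e, hi, h, he, rfl⟩)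
    · rw [prime_pow_add_choose hl hj h, zero_smul]
      exact S.zero_mem
  -- The span is stable under multiplication by the generators.
  have key : ∀ x ∈ coordSub k p r s, ∀ y ∈ S, x * y ∈ S := by
    intro x hx
    induction hx using Algebra.adjoin_induction with
    | mem x hx =>
      intro y hy
      induction hy using Submodule.span_induction with
      | zero => simp
      | add u v _ _ hu hv => rw [mul_add]; exact add_mem hu hv
      | smul c u _ hu => rw [mul_smul_comm]; exact S.smul_mem _ hu
      | mem y hy =>
        obtain ⟨i, j, e, hi, hj, he, rfl⟩ := hy
        rcases hx with (rfl | rfl) | ⟨l, -, hl, rfl⟩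
        · interval_cases e
          · rw [mul_comm, ← mono_one_eq]
            exact Submodule.subset_span ⟨i, j, 1, hi, hj, by norm_num, rfl⟩
          · rw [mono_one_eq, mul_comm, mul_assoc, tau_mul_tau, mul_zero]
            exact S.zero_mem
        · have : theta * mono k p r i j e = mono k p r (i + 1) j e := by
            rw [mono, mono, pow_succ', mul_assoc, mul_assoc, mul_assoc]
          rcases Nat.lt_or_ge (i + 1) (p ^ (r - 1)) with h | h
          · rw [this]
            exact Submodule.subset_span ⟨i + 1, j, e, h, hj, he, rfl⟩
          · have h1 : i + 1 = p ^ (r - 1) := by omega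
            have h2 : mono k p r (i + 1) j e = sigma 1 * mono k p r 0 j e := by
              rw [h1, mono, mono, theta_pow, pow_zero, one_mul, mul_assoc]
            rw [this, h2]
            exact hsig 1 (Nat.one_lt_pow hs (Fact.out : p.Prime).one_lt) 0 j e (by omega) hj he
        · exact hsig l hl i j e hi hj he
    | algebraMap c =>
      intro y hy
      rw [← Algebra.smul_def]
      exact S.smul_mem _ hy
    | add x y _ _ hx hy =>
      intro z hz
      rw [add_mul]
      exact add_mem (hx z hz) (hy z hz)
    | mul x y _ _ hx hy =>
      intro z hz
      rw [mul_assoc]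
      exact hx _ (hy z hz)
  have := key a ha 1 (Submodule.subset_span ⟨0, 0, 0, prime_pow_pos _, prime_pow_pos _,
    by norm_num, by simp [mono, sigma_zero]⟩)
  rwa [mul_one] at this

/-! ### The principal maps in the tower of supergroup schemes -/

variable (k p r) in
/-- The operator `θ^i σ_j τ^e ↦ θ^i σ_{j-u} τ^e`, zero for `j < u`. It is dual to the
multiplication by `u_{r-1}^u`. -/
def lowerSigma (u : ℕ) : Coord k p r →ₗ[k] Coord k p r := slice (coeff k p r 0 u 0)

lemma lowerSigma_mono (u : ℕ) {i e : ℕ} (j : ℕ) (hi : i < p ^ (r - 1)) (he : e < 2) :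
    lowerSigma k p r u (mono k p r i j e) = if u ≤ j then mono k p r i (j - u) e else 0 := by
  rw [lowerSigma, slice_coeff_zero 0 u j hi he]
  simp

variable (k p r) in
/-- The operator `θ^i σ_j τ^e ↦ θ^i σ_{j+u} τ^e`, a linear section of `lowerSigma`. -/
def raiseSigma (u : ℕ) : Coord k p r →ₗ[k] Coord k p r :=
  coordLin fun i j e => mono k p r i (j + u) e

lemma raiseSigma_mono (u : ℕ) {i e : ℕ} (j : ℕ) (hi : i < p ^ (r - 1)) (he : e < 2) :
    raiseSigma k p r u (mono k p r i j e) = mono k p r i (j + u) e :=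
  coordLin_mono _ hi j he

lemma lowerSigma_raiseSigma (u : ℕ) : lowerSigma k p r u ∘ₗ raiseSigma k p r u = LinearMap.id := by
  apply coord_linearMap_ext
  intro i hi j e he
  rw [LinearMap.comp_apply, raiseSigma_mono u j hi he, lowerSigma_mono u _ hi he,
    if_pos (Nat.le_add_left _ _), Nat.add_sub_cancel]
  rfl

lemma mono_zero_zero_zero : mono k p r 0 0 0 = 1 := by simp [mono, sigma_zero]

lemma raiseSigma_unit (u : ℕ) : raiseSigma k p r u (unit k) = sigma u := by
  rw [(isThetaTau_coord (k := k) (p := p) (r := r)).unit_eq, ← mono_zero_zero_zero,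
    raiseSigma_mono u 0 (prime_pow_pos _) (by norm_num)]
  simp [mono]

/-- A homomorphism onto the span of the `θ^i σ_j τ^e` with `j < u` is principal. -/
lemma isPrincipal_lowerSigma {C : Type*} [AddCommGroup C] [Module k C] [UnitalSupercoalgebra k C]
    (j : Hom k C (Coord k p r)) (hj : Function.Injective j.toLin) (u : ℕ)
    (h1 : ∀ c, lowerSigma k p r u (j.toLin c) = 0)
    (h2 : ∀ i < p ^ (r - 1), ∀ l < u, ∀ e < 2, mono k p r i l e ∈ LinearMap.range j.toLin) :
    IsPrincipal j (lowerSigma k p r u) (raiseSigma k p r u) := by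
  have hD : ∀ a, lowerSigma k p r u (raiseSigma k p r u a) = a := by
    intro a
    rw [← LinearMap.comp_apply, lowerSigma_raiseSigma, LinearMap.id_apply]
  refine ⟨hj, ?_, rTensor_slice_comul _, lTensor_slice_comul coord_comul_comm _, fun a => hD _,
    fun a => ?_, Or.inr (hD _)⟩
  · apply le_antisymm
    · rintro _ ⟨c, rfl⟩
      exact h1 c
    · intro a ha
      have key : LinearMap.range (LinearMap.id - raiseSigma k p r u ∘ₗ lowerSigma k p r u) ≤
          LinearMap.range j.toLin := by
        rw [LinearMap.range_eq_map, ← (coordBasis k p r).span_eq, Submodule.map_span,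
          Submodule.span_le]
        rintro _ ⟨_, ⟨⟨i, l, e⟩, rfl⟩, rfl⟩
        rw [coordBasis_apply, LinearMap.sub_apply, LinearMap.comp_apply,
          lowerSigma_mono u l i.2 e.2]
        split_ifs with h
        · rw [raiseSigma_mono u _ i.2 e.2, Nat.sub_add_cancel h, LinearMap.id_apply, sub_self]
          exact zero_mem _
        · rw [map_zero, sub_zero]
          exact h2 i i.2 l (not_le.mp h) e e.2
      have := key ⟨a, rfl⟩
      rwa [LinearMap.sub_apply, LinearMap.comp_apply, LinearMap.mem_ker.mp ha, map_zero,
        sub_zero] at this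
  · rw [lowerSigma_raiseSigma, hD]
    simp

/-- The subalgebra `k[𝕄_{r;s}]` is the kernel of the operator `σ_j ↦ σ_{j-p^s}`. -/
lemma isPrincipal_coordSubIncl {s : ℕ} (hs : s ≠ 0) : IsPrincipal (coordSubIncl k p r s)
    (lowerSigma k p r (p ^ s)) (raiseSigma k p r (p ^ s)) := by
  refine isPrincipal_lowerSigma _ (coordSubIncl_injective s) _ ?_ ?_
  · intro c
    have : Submodule.span k {b | ∃ i j e, i < p ^ (r - 1) ∧ j < p ^ s ∧ e < 2 ∧
        b = mono k p r i j e} ≤ LinearMap.ker (lowerSigma k p r (p ^ s)) := by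
      rw [Submodule.span_le]
      rintro _ ⟨i, j, e, hi, hj, he, rfl⟩
      rw [SetLike.mem_coe, LinearMap.mem_ker, lowerSigma_mono _ _ hi he, if_neg (by omega)]
    exact this (coordSub_le_span hs c.2)
  · intro i hi l hl e he
    exact ⟨⟨_, mono_mem s i e hl⟩, rfl⟩

end
end MultiparameterSupergroup

namespace MultiparameterSupergroup
open UnitalSupercoalgebra Hochschild
open Finset.HasAntidiagonal (antidiagonal mem_antidiagonal)

section oddAdditiveCohomology
variable {k : Type*} [Field k]
open TensorAlgebra (ι)

/-! ### The cohomology of `𝔾_a⁻` -/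

lemma odd_comul_one : CoalgebraStruct.comul (R := k) (1 : OddAddCoord k) = 1 ⊗ₜ 1 := oddLin_one _ _

lemma odd_comul_tau : CoalgebraStruct.comul (R := k) (oddTau : OddAddCoord k) =
    oddTau ⊗ₜ 1 + 1 ⊗ₜ oddTau := oddLin_tau _ _

lemma odd_differential_one_mul (x : TensorAlgebra k (OddAddCoord k)) :
    differential k _ (ι k (1 : OddAddCoord k) * x) =
      ι k 1 * (ι k 1 * x) - ι k 1 * differential k _ x := by
  have h : (unit k : OddAddCoord k) = 1 := rfl
  rw [differential_ι_mul, differentialOne_eq, odd_comul_one, tensorTwo_tmul, h]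
  noncomm_ring

lemma odd_differential_tau_mul (x : TensorAlgebra k (OddAddCoord k)) :
    differential k _ (ι k (oddTau : OddAddCoord k) * x) = -(ι k oddTau * differential k _ x) := by
  have h : (unit k : OddAddCoord k) = 1 := rfl
  rw [differential_ι_mul, differentialOne_eq, odd_comul_tau, map_add, tensorTwo_tmul,
    tensorTwo_tmul, h]
  noncomm_ring

/-- A linear map on `T(k[τ])` is determined by its behaviour on the first factors `1` and `τ`. -/
lemma oddTensor_linearMap_ext {V : Type*} [AddCommGroup V] [Module k V]
    {f g : TensorAlgebra k (OddAddCoord k) →ₗ[k] V} (h1 : f 1 = g 1)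
    (he : ∀ x, f x = g x → f (ι k 1 * x) = g (ι k 1 * x))
    (ht : ∀ x, f x = g x → f (ι k oddTau * x) = g (ι k oddTau * x)) : f = g := by
  apply linearMap_ext_left h1
  intro a x hx
  rw [odd_eq a, map_add, map_smul, map_smul, add_mul, smul_mul_assoc, smul_mul_assoc, map_add,
    map_add, map_smul, map_smul, map_smul, map_smul, he x hx, ht x hx]

variable (k)

/-- The operator `S(e y) = e y`, `S(τ y) = 0`, `S(1) = 0`, where `e` is the unit, in degree `1`. -/
def oddHead : TensorAlgebra k (OddAddCoord k) →ₗ[k] TensorAlgebra k (OddAddCoord k) :=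
  leftRec (oddLin (LinearMap.mulLeft k (ι k 1)) 0) 0

/-- The homotopy `H(e x) = S(x)`, `H(τ x) = -τ H(x)`, `H(1) = 0`. -/
def oddHomotopy : TensorAlgebra k (OddAddCoord k) →ₗ[k] TensorAlgebra k (OddAddCoord k) :=
  leftRec (oddLin (oddHead k) 0) (oddLin 0 (-ι k oddTau))

/-- The projection `T(k[τ]) → k[X]`, `e ↦ 0`, `τ ↦ X`. -/
def oddProj : TensorAlgebra k (OddAddCoord k) →ₐ[k] Polynomial k :=
  TensorAlgebra.lift k (oddLin 0 Polynomial.X)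

/-- The section of `oddProj` with `X ↦ τ`. -/
def oddSection : Polynomial k →ₐ[k] TensorAlgebra k (OddAddCoord k) :=
  Polynomial.aeval (ι k oddTau)

variable {k}

lemma oddHead_differential (x : TensorAlgebra k (OddAddCoord k)) :
    oddHead k (differential k _ x) = differential k _ (oddHead k x) := by
  have h1 : ∀ x, oddHead k (ι k 1 * x) = ι k 1 * x := by
    intro x
    simp [oddHead, leftRec_ι_mul]
  have h2 : ∀ x, oddHead k (ι k oddTau * x) = 0 := by
    intro x
    simp [oddHead, leftRec_ι_mul]
  have : oddHead k ∘ₗ differential k _ = differential k _ ∘ₗ oddHead k := by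
    apply oddTensor_linearMap_ext
    · simp [differential_one, oddHead]
    · intro x _
      simp only [LinearMap.comp_apply, odd_differential_one_mul, map_sub, h1]
    · intro x _
      simp only [LinearMap.comp_apply, odd_differential_tau_mul, map_neg, h2, map_zero, neg_zero]
  exact LinearMap.congr_fun this x

/-- The homotopy connects the identity and the projection onto the span of the powers of `τ`. -/
lemma oddHomotopy_spec (x : TensorAlgebra k (OddAddCoord k)) :
    differential k _ (oddHomotopy k x) + oddHomotopy k (differential k _ x) =
      x - oddSection k (oddProj k x) := by
  have h1 : ∀ x, oddHead k (ι k 1 * x) = ι k 1 * x := by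
    intro x
    simp [oddHead, leftRec_ι_mul]
  have h2 : ∀ x, oddHomotopy k (ι k 1 * x) = oddHead k x := by
    intro x
    simp [oddHomotopy, leftRec_ι_mul]
  have h3 : ∀ x, oddHomotopy k (ι k oddTau * x) = -(ι k oddTau * oddHomotopy k x) := by
    intro x
    simp [oddHomotopy, leftRec_ι_mul]
  have : differential k _ ∘ₗ oddHomotopy k + oddHomotopy k ∘ₗ differential k _ =
      LinearMap.id - (oddSection k).toLinearMap ∘ₗ (oddProj k).toLinearMap := by
    apply oddTensor_linearMap_ext
    · simp [differential_one, oddHomotopy]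
    · intro x _
      have : oddProj k (ι k 1 * x) = 0 := by simp [oddProj]
      simp only [LinearMap.add_apply, LinearMap.sub_apply, LinearMap.comp_apply,
        LinearMap.id_apply, AlgHom.toLinearMap_apply, this, map_zero, odd_differential_one_mul,
        map_sub, h2, h1, oddHead_differential]
      abel
    · intro x hx
      have h4 : oddSection k (oddProj k (ι k oddTau * x)) =
          ι k oddTau * oddSection k (oddProj k x) := by simp [oddProj, oddSection]
      simp only [LinearMap.add_apply, LinearMap.sub_apply, LinearMap.comp_apply,
        LinearMap.id_apply, AlgHom.toLinearMap_apply] at hx ⊢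
      rw [h4, h3, odd_differential_tau_mul, map_neg, map_neg, h3, odd_differential_tau_mul,
        neg_neg, neg_neg, ← mul_add, hx, mul_sub]
  exact LinearMap.congr_fun this x

lemma oddProj_differential (x : TensorAlgebra k (OddAddCoord k)) :
    oddProj k (differential k _ x) = 0 := by
  have : (oddProj k).toLinearMap ∘ₗ differential k _ = 0 := by
    apply oddTensor_linearMap_ext
    · simp [differential_one]
    · intro x _
      simp [odd_differential_one_mul, oddProj]
    · intro x hx
      simp only [LinearMap.comp_apply, AlgHom.toLinearMap_apply, LinearMap.zero_apply] at hx ⊢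
      rw [odd_differential_tau_mul, map_neg, map_mul, hx, mul_zero, neg_zero]
  exact LinearMap.congr_fun this x

lemma odd_represents : ∃ l : Cohomology k (OddAddCoord k), Represents (ι k oddTau) l :=
  exists_represented (by simpa [differential_one] using odd_differential_tau_mul (k := k) 1)

/-- The cohomology ring of `𝔾_a⁻` is the polynomial ring on the class of `τ`. -/
theorem odd_bijective {l : Cohomology k (OddAddCoord k)} (hl : Represents (ι k oddTau) l) :
    Function.Bijective (Polynomial.aeval (R := k) l) := by
  have hrep : ∀ f : Polynomial k, Represents (oddSection k f) (Polynomial.aeval l f) := by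
    intro f
    induction f using Polynomial.induction_on' with
    | add f g hf hg => rw [map_add, map_add]; exact hf.add hg
    | monomial n c =>
      rw [oddSection, Polynomial.aeval_monomial, Polynomial.aeval_monomial, ← Algebra.smul_def,
        ← Algebra.smul_def]
      exact (hl.pow n).smul c
  have hps : ∀ f : Polynomial k, oddProj k (oddSection k f) = f := by
    intro f
    have : (oddProj k).comp (oddSection k) = AlgHom.id k _ := by
      ext
      simp [oddProj, oddSection]
    exact DFunLike.congr_fun this f
  constructor
  · rw [injective_iff_map_eq_zero]
    intro f hf
    obtain ⟨u, hu⟩ := (hrep f).eq_zero_iff.mp hf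
    rw [← hps f, hu, oddProj_differential]
  · intro h
    obtain ⟨z, hz⟩ := exists_represents h
    refine ⟨oddProj k z, ((hrep _).eq_iff hz).mpr ⟨-oddHomotopy k z, ?_⟩⟩
    have := oddHomotopy_spec z
    rw [hz.differential_eq, map_zero, add_zero] at this
    rw [map_neg, this]
    abel

lemma odd_homogeneous [NeZero (2 : k)] {l : Cohomology k (OddAddCoord k)}
    (hl : Represents (ι k oddTau) l) : l ∈ homogeneousPart k (OddAddCoord k) 1 1 := by
  obtain ⟨hz, hza⟩ := hl
  refine ⟨⟨_, hz⟩, ⟨?_, ?_⟩, hza⟩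
  · rw [pow_one]
    exact ⟨_, rfl⟩
  · refine LinearMap.mem_ker.mpr (sub_eq_zero.mpr ?_)
    change cochainMap (parity (k := k)) (ι k oddTau) =
      (if (1 : ZMod 2) = 0 then (1 : k) else -1) • ι k oddTau
    have : parity (k := k) (oddTau : OddAddCoord k) = -oddTau := oddLin_tau _ _
    rw [cochainMap_ι, this, if_neg one_ne_zero]
    simp

end oddAdditiveCohomology

section step
variable {k : Type*} [Field k] {p r : ℕ} [Fact p.Prime] [CharP k p]

/-! ### The homomorphisms that raise `r` -/

omit [Fact p.Prime] [CharP k p] in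
lemma sigma_one_pow (j : ℕ) : (sigma 1 : Coord k p r) ^ j = (j.factorial : k) • sigma j := by
  induction j with
  | zero => simp [sigma_zero]
  | succ j ih =>
    rw [pow_succ, ih, smul_mul_assoc, sigma_mul, smul_smul, Nat.factorial_succ,
      Nat.choose_succ_self_right]
    push_cast
    rw [mul_comm]

omit [Fact p.Prime] [CharP k p] in
lemma theta_pow_mul_tau (i j e : ℕ) :
    (theta ^ (i + p ^ (r - 1) * j) * tau ^ e : Coord k p r) =
      (j.factorial : k) • mono k p r i j e := by
  rw [pow_add, pow_mul, theta_pow, sigma_one_pow, mono, mul_smul_comm, smul_mul_assoc]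

variable [NeZero r]

omit [Fact p.Prime] [CharP k p] in
lemma pow_pred_mul : p ^ (r - 1) * p = p ^ r := by
  rw [← pow_succ, Nat.sub_add_cancel NeZero.one_le]

/-- The elements `θ^m τ^e` with `m < p^r`, `e < 2` span `k[𝕄_{r;1}]`, because the divided powers
`σ_j` with `j < p` are multiples of powers of `σ_1 = θ^{p^{r-1}}`. -/
lemma coordSub_one_linearMap_ext {V : Type*} [AddCommGroup V] [Module k V]
    {f g : coordSub k p r 1 →ₗ[k] V}
    (h : ∀ m < p ^ r, ∀ e < 2, f (thetaSub k p r 1 ^ m * tauSub k p r 1 ^ e) =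
      g (thetaSub k p r 1 ^ m * tauSub k p r 1 ^ e)) : f = g := by
  have key : Submodule.span k {b | ∃ i j e, i < p ^ (r - 1) ∧ j < p ^ 1 ∧ e < 2 ∧
      b = mono k p r i j e} ≤
      (LinearMap.eqLocus f g).map (coordSub k p r 1).val.toLinearMap := by
    rw [Submodule.span_le]
    rintro _ ⟨i, j, e, hi, hj, he, rfl⟩
    rw [pow_one] at hj
    have hlt : i + p ^ (r - 1) * j < p ^ r := by
      calc i + p ^ (r - 1) * j < p ^ (r - 1) + p ^ (r - 1) * j := by omega
        _ = p ^ (r - 1) * (j + 1) := by ring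
        _ ≤ p ^ (r - 1) * p := Nat.mul_le_mul_left _ hj
        _ = p ^ r := pow_pred_mul
    refine ⟨(j.factorial : k)⁻¹ • (thetaSub k p r 1 ^ (i + p ^ (r - 1) * j) *
      tauSub k p r 1 ^ e), Submodule.smul_mem _ _ (h _ hlt e he), ?_⟩
    rw [map_smul]
    change _ • (theta ^ (i + p ^ (r - 1) * j) * tau ^ e) = _
    rw [theta_pow_mul_tau, smul_smul, inv_mul_cancel₀ (factorial_ne_zero_of_lt (p := p) hj),
      one_smul]
  ext c
  obtain ⟨c', hc', h⟩ := key (coordSub_le_span one_ne_zero c.2)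
  obtain rfl : c' = c := Subtype.ext h
  exact hc'

variable (k p r) in
/-- The linear map `θ^m τ^e ↦ θ^m τ^e`, for `m < p^r`. In `k[𝕄_{r;1}]` one has
`θ^{i + p^{r-1} j} = j! θ^i σ_j`, whence the factor `1 / j!`. -/
def coordStepLin : coordSub k p r 1 →ₗ[k] Coord k p (r + 1) :=
  coordLin (fun i j e => (j.factorial : k)⁻¹ • mono k p (r + 1) (i + p ^ (r - 1) * j) 0 e) ∘ₗ
    (coordSub k p r 1).val.toLinearMap

lemma coordStepLin_apply {m e : ℕ} (hm : m < p ^ r) (he : e < 2) :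
    coordStepLin k p r (thetaSub k p r 1 ^ m * tauSub k p r 1 ^ e) = theta ^ m * tau ^ e := by
  have h1 : m % p ^ (r - 1) + p ^ (r - 1) * (m / p ^ (r - 1)) = m := Nat.mod_add_div _ _
  have h2 : m / p ^ (r - 1) < p := by
    rw [Nat.div_lt_iff_lt_mul (prime_pow_pos _), mul_comm]
    exact hm.trans_eq pow_pred_mul.symm
  have h3 : (theta ^ m * tau ^ e : Coord k p r) = ((m / p ^ (r - 1)).factorial : k) •
      mono k p r (m % p ^ (r - 1)) (m / p ^ (r - 1)) e := by
    rw [← theta_pow_mul_tau, h1]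
  have h4 : (coordSub k p r 1).val.toLinearMap (thetaSub k p r 1 ^ m * tauSub k p r 1 ^ e) =
      theta ^ m * tau ^ e := rfl
  rw [coordStepLin, LinearMap.comp_apply, h4, h3, map_smul,
    coordLin_mono _ (Nat.mod_lt _ (prime_pow_pos _)) _ he, smul_smul,
    mul_inv_cancel₀ (factorial_ne_zero_of_lt (p := p) h2), one_smul, h1, mono, sigma_zero, mul_one]

lemma coordStepLin_injective : Function.Injective (coordStepLin k p r) := by
  have : coordLin (fun i _ e => theta ^ i * tau ^ e) ∘ₗ coordStepLin k p r =
      (coordSub k p r 1).val.toLinearMap := by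
    apply coordSub_one_linearMap_ext
    intro m hm e he
    rw [LinearMap.comp_apply, coordStepLin_apply hm he, ← mul_one (theta ^ m), ← sigma_zero, ← mono,
      coordLin_mono _ hm _ he]
    rfl
  exact Function.Injective.of_comp (f := coordLin (fun i _ e => theta ^ i * tau ^ e)) (by
    rw [← LinearMap.coe_comp, this]
    exact Subtype.val_injective)

variable (k p r) in
/-- The homomorphism `k[𝕄_{r;1}] → k[𝕄_{r+1}]` with `θ^m τ^e ↦ θ^m τ^e` for `m < p^r`. -/
def coordStep : Hom k (coordSub k p r 1) (Coord k p (r + 1)) where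
  toLin := coordStepLin k p r
  map_comul a := by
    have hC := isThetaTau_coordSub (k := k) (p := p) (r := r) 1
    have hA := isThetaTau_coord (k := k) (p := p) (r := r + 1)
    have : CoalgebraStruct.comul (R := k) ∘ₗ coordStepLin k p r =
        TensorProduct.map (coordStepLin k p r) (coordStepLin k p r) ∘ₗ
          CoalgebraStruct.comul (R := k) := by
      apply coordSub_one_linearMap_ext
      intro m hm e he
      have h0 : ∀ m < p ^ r, coordStepLin k p r (thetaSub k p r 1 ^ m) = theta ^ m := by
        intro m hm
        simpa using coordStepLin_apply hm (show 0 < 2 by norm_num)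
      have h1 : ∀ m < p ^ r, coordStepLin k p r (thetaSub k p r 1 ^ m * tauSub k p r 1) =
          theta ^ m * tau := by
        intro m hm
        simpa using coordStepLin_apply hm (show 1 < 2 by norm_num)
      interval_cases e
      · rw [LinearMap.comp_apply, LinearMap.comp_apply, pow_zero, mul_one, h0 m hm,
          hA.comul_theta_pow, hC.comul_theta_pow, map_sum]
        refine Finset.sum_congr rfl fun x hx => ?_
        rw [mem_antidiagonal] at hx
        rw [map_smul, TensorProduct.map_tmul, h0 _ (by omega), h0 _ (by omega)]
      · rw [LinearMap.comp_apply, LinearMap.comp_apply, pow_one, h1 m hm,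
          hA.comul_theta_pow_mul_tau, hC.comul_theta_pow_mul_tau, map_sum]
        refine Finset.sum_congr rfl fun x hx => ?_
        rw [mem_antidiagonal] at hx
        rw [map_smul, map_add, TensorProduct.map_tmul, TensorProduct.map_tmul, h0 _ (by omega),
          h0 _ (by omega), h1 _ (by omega), h1 _ (by omega)]
    exact LinearMap.congr_fun this a
  map_counit a := by
    have : CoalgebraStruct.counit (R := k) ∘ₗ coordStepLin k p r =
        (counitHom k p r).toLinearMap ∘ₗ (coordSub k p r 1).val.toLinearMap := by
      apply coordSub_one_linearMap_ext
      intro m hm e he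
      rw [LinearMap.comp_apply, coordStepLin_apply hm he]
      change counitHom k p (r + 1) (theta ^ m * tau ^ e) = counitHom k p r (theta ^ m * tau ^ e)
      simp
    exact LinearMap.congr_fun this a
  map_unit := by
    have h := coordStepLin_apply (k := k) (p := p) (r := r) (prime_pow_pos r)
      (show 0 < 2 by norm_num)
    rw [(isThetaTau_coordSub (k := k) (p := p) (r := r) 1).unit_eq,
      (isThetaTau_coord (k := k) (p := p) (r := r + 1)).unit_eq]
    simpa using h
  map_parity a := by
    have hC := isThetaTau_coordSub (k := k) (p := p) (r := r) 1
    have hA := isThetaTau_coord (k := k) (p := p) (r := r + 1)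
    have : coordStepLin k p r ∘ₗ parity (k := k) = parity (k := k) ∘ₗ coordStepLin k p r := by
      apply coordSub_one_linearMap_ext
      intro m hm e he
      have h := coordStepLin_apply (k := k) hm he
      rw [LinearMap.comp_apply, LinearMap.comp_apply, h]
      interval_cases e
      · rw [pow_zero, pow_zero, mul_one, mul_one, hC.parity_theta_pow, hA.parity_theta_pow] at *
        exact h
      · rw [pow_one, pow_one] at *
        rw [hC.parity_theta_pow_mul, hA.parity_theta_pow_mul, hC.parity_tau, hA.parity_tau, mul_neg,
          mul_neg, map_neg, h]
    exact LinearMap.congr_fun this a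

/-- The image of `k[𝕄_{r;1}]` in `k[𝕄_{r+1}]` is the span of the `θ^m τ^e`, on which `σ_j ↦ σ_{j-1}`
vanishes. -/
lemma isPrincipal_coordStep : IsPrincipal (coordStep k p r) (lowerSigma k p (r + 1) 1)
    (raiseSigma k p (r + 1) 1) := by
  refine isPrincipal_lowerSigma _ coordStepLin_injective _ ?_ ?_
  · intro c
    have : lowerSigma k p (r + 1) 1 ∘ₗ coordStepLin k p r = 0 := by
      apply coordSub_one_linearMap_ext
      intro m hm e he
      rw [LinearMap.comp_apply, coordStepLin_apply hm he, ← mul_one (theta ^ m), ← sigma_zero,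
        ← mono, lowerSigma_mono _ _ hm he]
      rfl
    exact LinearMap.congr_fun this c
  · intro i hi l hl e he
    obtain rfl : l = 0 := by omega
    exact ⟨_, (coordStepLin_apply (r := r) hi he).trans (by rw [mono, sigma_zero, mul_one])⟩

variable (k p) in
/-- The homomorphism `k[𝔾_a⁻] → k[𝕄_1]`, `τ ↦ τ`. -/
def oddStep : Hom k (OddAddCoord k) (Coord k p 1) where
  toLin := oddLin 1 tau
  map_comul a := by
    have : CoalgebraStruct.comul (R := k) ∘ₗ oddLin (1 : Coord k p 1) tau =
        TensorProduct.map (oddLin 1 tau) (oddLin 1 tau) ∘ₗ CoalgebraStruct.comul (R := k) := by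
      apply odd_linearMap_ext
      · rw [LinearMap.comp_apply, LinearMap.comp_apply, odd_comul_one, oddLin_one,
          TensorProduct.map_tmul, oddLin_one]
        exact comul_one
      · rw [LinearMap.comp_apply, LinearMap.comp_apply, odd_comul_tau, oddLin_tau, map_add,
          TensorProduct.map_tmul, TensorProduct.map_tmul, oddLin_one, oddLin_tau]
        exact comul_tau
    exact LinearMap.congr_fun this a
  map_counit a := by
    have : (counitHom k p 1).toLinearMap ∘ₗ oddLin (1 : Coord k p 1) tau = oddLin 1 0 :=
      odd_linearMap_ext (by simp) (by simp)
    exact LinearMap.congr_fun this a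
  map_unit := oddLin_one _ _
  map_parity a := by
    have : oddLin (1 : Coord k p 1) tau ∘ₗ oddLin 1 (-oddTau) =
        (parityHom k p 1).toLinearMap ∘ₗ oddLin 1 tau :=
      odd_linearMap_ext (by simp) (by simp)
    exact LinearMap.congr_fun this a

lemma isPrincipal_oddStep : IsPrincipal (oddStep k p) (lowerSigma k p 1 1)
    (raiseSigma k p 1 1) := by
  have hm0 : (1 : Coord k p 1) = mono k p 1 0 0 0 := mono_zero_zero_zero.symm
  have hm1 : (tau : Coord k p 1) = mono k p 1 0 0 1 := by simp [mono, sigma_zero]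
  have hpos : 0 < p ^ (1 - 1) := prime_pow_pos _
  refine isPrincipal_lowerSigma _ ?_ _ ?_ ?_
  · have : coordLin (fun _ _ e => if e = 0 then (1 : OddAddCoord k) else oddTau) ∘ₗ
        oddLin (1 : Coord k p 1) tau = LinearMap.id := by
      apply odd_linearMap_ext
      · rw [LinearMap.comp_apply, oddLin_one, hm0, coordLin_mono _ hpos _ (by norm_num)]
        rfl
      · rw [LinearMap.comp_apply, oddLin_tau, hm1, coordLin_mono _ hpos _ (by norm_num)]
        rfl
    exact Function.LeftInverse.injective
      (g := coordLin (fun _ _ e => if e = 0 then (1 : OddAddCoord k) else oddTau))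
      fun c => LinearMap.congr_fun this c
  · intro c
    have : lowerSigma k p 1 1 ∘ₗ oddLin (1 : Coord k p 1) tau = 0 := by
      apply odd_linearMap_ext
      · rw [LinearMap.comp_apply, oddLin_one, hm0, lowerSigma_mono _ _ hpos (by norm_num)]
        rfl
      · rw [LinearMap.comp_apply, oddLin_tau, hm1, lowerSigma_mono _ _ hpos (by norm_num)]
        rfl
    exact LinearMap.congr_fun this c
  · intro i hi l hl e he
    obtain rfl : l = 0 := by omega
    obtain rfl : i = 0 := by
      rw [Nat.sub_self, pow_zero] at hi
      omega
    interval_cases e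
    · exact ⟨1, (oddLin_one _ _).trans hm0⟩
    · exact ⟨oddTau, (oddLin_tau _ _).trans hm1⟩

end step
end MultiparameterSupergroup

namespace MultiparameterSupergroup
open UnitalSupercoalgebra Hochschild
open Finset.HasAntidiagonal (antidiagonal mem_antidiagonal)
open TensorAlgebra (ι)

/-! ### The cocycles `w_s` -/

section wCocycle
variable {k : Type*} [Field k] {p r : ℕ} [Fact p.Prime] [CharP k p]

omit [Fact p.Prime] [CharP k p] in
lemma sum_antidiagonal_endpoints {M : Type*} [AddCommMonoid M] {n : ℕ} (hn : n ≠ 0)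
    (f : ℕ → ℕ → M) : ∑ x ∈ antidiagonal n, f x.1 x.2 =
      f 0 n + ∑ j ∈ Finset.Icc 1 (n - 1), f j (n - j) + f n 0 := by
  have h : Finset.Icc 1 (n - 1) = Finset.Ico 1 n := by
    ext i
    rw [Finset.mem_Icc, Finset.mem_Ico]
    omega
  rw [Finset.Nat.sum_antidiagonal_eq_sum_range_succ, Finset.sum_range_succ, Finset.range_eq_Ico,
    Finset.sum_eq_sum_Ico_succ_bot (Nat.pos_of_ne_zero hn), h, Nat.sub_self, Nat.sub_zero]

lemma coordSubIncl_sigmaSub {s i : ℕ} (hi : i < p ^ s) :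
    (coordSubIncl k p r s).toLin (sigmaSub k p r s i) = sigma i := by
  rw [sigmaSub, dif_pos hi]
  rfl

/-- In `k[𝕄_r]` the cocycle `w_s` is the coboundary of `σ_{p^s}`. -/
lemma cochainMap_wCochain {s : ℕ} (hs : s ≠ 0) :
    cochainMap (coordSubIncl k p r s).toLin (wCochain k p r s) =
      differential k _ (ι k (sigma (p ^ s))) := by
  have hp : p ≤ p ^ s := Nat.le_self_pow hs p
  have hpos := (Fact.out : p.Prime).pos
  have h1 : CoalgebraStruct.comul (R := k) (sigma (p ^ s) : Coord k p r) = comulSigma k p r (p ^ s) :=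
    comul_sigma _
  have h2 : (unit k : Coord k p r) = sigma 0 := sigma_zero.symm
  rw [differential_ι, differentialOne_eq, h1, comulSigma, if_pos hp, map_add, map_sum, map_sum, h2,
    wCochain, map_neg, map_add, map_sum, map_sum]
  simp only [tensorTwo_tmul]
  rw [sum_antidiagonal_endpoints (hpos.trans_le hp).ne' fun i j =>
    ι k (sigma i : Coord k p r) * ι k (sigma j)]
  have h3 : ∑ j ∈ Finset.Icc 1 (p ^ s - 1), cochainMap (coordSubIncl k p r s).toLin
      (ι k (sigmaSub k p r s j) * ι k (sigmaSub k p r s (p ^ s - j))) =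
      ∑ j ∈ Finset.Icc 1 (p ^ s - 1), ι k (sigma j) * ι k (sigma (p ^ s - j)) := by
    refine Finset.sum_congr rfl fun j hj => ?_
    rw [Finset.mem_Icc] at hj
    rw [map_mul, cochainMap_ι, cochainMap_ι, coordSubIncl_sigmaSub (by omega),
      coordSubIncl_sigmaSub (by omega)]
  have h4 : ∑ x ∈ antidiagonal (p ^ s - p), cochainMap (coordSubIncl k p r s).toLin
      (ι k (sigmaSub k p r s x.1 * tauSub k p r s) *
        ι k (sigmaSub k p r s x.2 * tauSub k p r s)) =
      ∑ x ∈ antidiagonal (p ^ s - p), ι k (sigma x.1 * tau) * ι k (sigma x.2 * tau) := by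
    have hm : ∀ i < p ^ s, (coordSubIncl k p r s).toLin (sigmaSub k p r s i * tauSub k p r s) =
        sigma i * tau := by
      intro i hi
      rw [← coordSubIncl_sigmaSub hi]
      rfl
    refine Finset.sum_congr rfl fun x hx => ?_
    rw [mem_antidiagonal] at hx
    rw [map_mul, cochainMap_ι, cochainMap_ι, hm _ (by omega), hm _ (by omega)]
  rw [h3, h4]
  abel

lemma differential_wCochain {s : ℕ} (hs : s ≠ 0) : differential k _ (wCochain k p r s) = 0 := by
  apply cochainMap_injective (coordSubIncl_injective s)
  rw [← differential_map, cochainMap_wCochain hs, differential_differential, map_zero]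

lemma wCochain_mem_degreePart (s : ℕ) : wCochain k p r s ∈ degreePart k _ 2 := by
  have h : ∀ a b : coordSub k p r s, ι k a * ι k b ∈ degreePart k _ 2 := by
    intro a b
    rw [← tensorTwo_tmul]
    exact tensorTwo_mem_degreePart _
  exact neg_mem (add_mem (sum_mem fun j _ => h _ _) (sum_mem fun j _ => h _ _))

lemma cochainMap_parity_wCochain {s : ℕ} (hs : s ≠ 0) :
    cochainMap (parity (k := k)) (wCochain k p r s) = wCochain k p r s := by
  apply cochainMap_injective (coordSubIncl_injective s)
  have h1 : ∀ z, cochainMap (coordSubIncl k p r s).toLin (cochainMap (parity (k := k)) z) =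
      cochainMap (parityEnd k _).toLin (cochainMap (coordSubIncl k p r s).toLin z) := by
    intro z
    have : (cochainMap (coordSubIncl k p r s).toLin).comp (cochainMap (parity (k := k))) =
        (cochainMap (parityEnd k _).toLin).comp (cochainMap (coordSubIncl k p r s).toLin) := by
      ext a
      simp only [AlgHom.toLinearMap_apply, LinearMap.comp_apply, AlgHom.comp_apply, cochainMap_ι,
        (coordSubIncl k p r s).map_parity]
      rfl
    exact DFunLike.congr_fun this z
  rw [h1, cochainMap_wCochain hs, ← differential_map, cochainMap_ι]
  congr 2
  exact parity_sigma _

omit [CharP k p] in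
lemma factorial_pred_eq_neg_one [CharP k p] : ((p - 1).factorial : k) = -1 := by
  have h := congrArg (ZMod.castHom (dvd_refl p) k) (ZMod.wilsons_lemma p)
  rw [map_natCast, map_neg, map_one] at h
  exact h

/-- For `s = 1` the coboundary of `σ_p` is the difference of the cocycles of `x_r` and `y^2`. -/
lemma wCochain_one : wCochain k p r 1 = xCochain p (thetaSub k p r 1 ^ p ^ (r - 1)) -
    ι k (tauSub k p r 1) * ι k (tauSub k p r 1) := by
  have hpos := (Fact.out : p.Prime).pos
  have h0 : sigmaSub k p r 1 0 = 1 := by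
    rw [sigmaSub, dif_pos (by simpa using hpos)]
    exact Subtype.ext sigma_zero
  have h1 : ∀ j < p, (thetaSub k p r 1 ^ p ^ (r - 1)) ^ j =
      (j.factorial : k) • sigmaSub k p r 1 j := by
    intro j hj
    rw [sigmaSub, dif_pos (by simpa using hj)]
    refine Subtype.ext ?_
    change (theta ^ p ^ (r - 1)) ^ j = (j.factorial : k) • sigma j
    rw [theta_pow, sigma_one_pow]
  rw [wCochain, pow_one, Nat.sub_self, Finset.HasAntidiagonal.antidiagonal_zero,
    Finset.sum_singleton, h0, one_mul, neg_add, sub_eq_add_neg, xCochain, ← Finset.sum_neg_distrib]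
  congr 1
  refine Finset.sum_congr rfl fun j hj => ?_
  rw [Finset.mem_Icc] at hj
  have h2 := factorial_ne_zero_of_lt (k := k) (show j < p by omega)
  have h3 := factorial_ne_zero_of_lt (k := k) (show p - j < p by omega)
  rw [h1 j (by omega), h1 (p - j) (by omega), map_smul, map_smul, smul_mul_smul_comm, smul_smul,
    div_mul_cancel₀ _ (mul_ne_zero h2 h3), factorial_pred_eq_neg_one, neg_one_smul]

end wCocycle

/-! ### Induction along the tower -/

section tower
variable {k : Type*} [Field k]

namespace CohModel
variable {r : ℕ} [NeZero r] {W : Type} {q : Prop}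

lemma commute_of_commute_gen {ω : CohModel k r W q} (h : ∀ a, Commute (gen q a) ω)
    (m : CohModel k r W q) : Commute m ω := by
  have : m ∈ Algebra.adjoin k (Set.range (gen (k := k) (r := r) (W := W) q)) := by
    rw [adjoin_range_gen]
    trivial
  induction this using Algebra.adjoin_induction with
  | mem x hx => obtain ⟨a, rfl⟩ := hx; exact h a
  | algebraMap c => exact Algebra.commutes c ω
  | add x y _ _ hx hy => exact hx.add_left hy
  | mul x y _ _ hx hy => exact hx.mul_left hy

lemma commute_gen_of_even {a : CohGen r W} (hd : Even a.deg) (hp : a.par = 0) (b : CohGen r W) :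
    Commute (gen (k := k) q b) (gen q a) := by
  have h := gen_mul (k := k) (q := q) b a
  rw [hp, mul_zero, add_zero, (hd.mul_left _).neg_one_pow, one_smul] at h
  exact h

lemma commute_gen_y_sq (b : CohGen r W) : Commute (gen (k := k) q b) (gen q CohGen.y ^ 2) := by
  have h := gen_mul (k := k) (q := q) b CohGen.y
  change _ * _ = _ * _
  rw [pow_two, ← mul_assoc, h, smul_mul_assoc, mul_assoc, h, mul_smul_comm, smul_smul, ← mul_pow,
    mul_assoc]
  simp

lemma eq_zero_of_eq_neg_one_smul [NeZero (2 : k)] {R : Type*} [Ring R] [Algebra k R] {x : R}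
    (h : x = (-1 : k) • x) : x = 0 := by
  rw [neg_smul, one_smul, eq_neg_iff_add_eq_zero, ← two_smul k] at h
  exact (smul_eq_zero.mp h).resolve_left (NeZero.ne _)

lemma gen_lam_sq [NeZero (2 : k)] (i : Fin r) :
    gen (k := k) (W := W) q (CohGen.lam i) * gen q (CohGen.lam i) = 0 := by
  have h := gen_mul (k := k) (q := q) (CohGen.lam i : CohGen r W) (CohGen.lam i)
  have h1 : (-1 : k) ^ ((CohGen.lam i : CohGen r W).deg * (CohGen.lam i : CohGen r W).deg +
      (CohGen.lam i : CohGen r W).par * (CohGen.lam i : CohGen r W).par) = -1 := by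
    simp [CohGen.deg, CohGen.par]
  rw [h1] at h
  exact eq_zero_of_eq_neg_one_smul h

lemma top_of_gen_mem {S : Subring (CohModel k r W q)} (hk : ∀ c : k, algebraMap k _ c ∈ S)
    (h : ∀ a, gen q a ∈ S) : S = ⊤ := by
  rw [eq_top_iff]
  intro m _
  have : m ∈ Algebra.adjoin k (Set.range (gen (k := k) (r := r) (W := W) q)) := by
    rw [adjoin_range_gen]
    trivial
  induction this using Algebra.adjoin_induction with
  | mem x hx => obtain ⟨a, rfl⟩ := hx; exact h a
  | algebraMap c => exact hk c
  | add x y _ _ hx hy => exact add_mem (hx trivial) (hy trivial)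
  | mul x y _ _ hx hy => exact mul_mem (hx trivial) (hy trivial)

/-- The homomorphism from the algebra with the relation `x_r = y²` that fixes the generators and
sends `x_r` to `y²`. -/
lemma exists_hom_of_true : ∃ i : CohModel k r Empty True →ₐ[k] CohModel k r W q,
    (∀ l, i (gen True (CohGen.x l)) = if l = lastIdx r then gen q CohGen.y ^ 2 else
      gen q (CohGen.x l)) ∧ (∀ l, i (gen True (CohGen.lam l)) = gen q (CohGen.lam l)) ∧
    i (gen True CohGen.y) = gen q CohGen.y := by
  set g : CohGen r Empty → CohModel k r W q := fun a => match a with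
    | CohGen.x l => if l = lastIdx r then gen q CohGen.y ^ 2 else gen q (CohGen.x l)
    | CohGen.lam l => gen q (CohGen.lam l)
    | CohGen.y => gen q CohGen.y
    | CohGen.w j => j.elim
  have hx : ∀ l m, Commute m (g (CohGen.x l)) := by
    intro l
    apply commute_of_commute_gen
    intro b
    change Commute _ (if l = lastIdx r then gen q CohGen.y ^ 2 else gen q (CohGen.x l))
    split_ifs
    · exact commute_gen_y_sq b
    · exact commute_gen_of_even even_two rfl b
  have hc : ∀ a b, g a * g b = (-1 : k) ^ (a.deg * b.deg + a.par * b.par) • (g b * g a) := by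
    intro a b
    cases a with
    | x l =>
      have : (-1 : k) ^ ((CohGen.x l : CohGen r Empty).deg * b.deg +
          (CohGen.x l : CohGen r Empty).par * b.par) = 1 := by
        simp [CohGen.deg, CohGen.par, pow_mul]
      rw [this, one_smul]
      exact (hx l _).symm
    | w j => exact j.elim
    | lam l =>
      cases b with
      | x l' =>
        have : (-1 : k) ^ ((CohGen.lam l : CohGen r Empty).deg * (CohGen.x l' : CohGen r Empty).deg +
          (CohGen.lam l : CohGen r Empty).par * (CohGen.x l' : CohGen r Empty).par) = 1 := by
          simp [CohGen.deg, CohGen.par]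
        rw [this, one_smul]
        exact hx l' _
      | w j => exact j.elim
      | lam l' => exact gen_mul _ _
      | y => exact gen_mul _ _
    | y =>
      cases b with
      | x l' =>
        have : (-1 : k) ^ ((CohGen.y : CohGen r Empty).deg * (CohGen.x l' : CohGen r Empty).deg +
          (CohGen.y : CohGen r Empty).par * (CohGen.x l' : CohGen r Empty).par) = 1 := by
          simp [CohGen.deg, CohGen.par]
        rw [this, one_smul]
        exact hx l' _
      | w j => exact j.elim
      | lam l' => exact gen_mul _ _
      | y => exact gen_mul _ _
  obtain ⟨i, hi⟩ := exists_lift (q := True) g hc fun _ => if_pos rfl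
  exact ⟨i, fun l => hi _, fun l => hi _, hi _⟩

end CohModel

variable {p r : ℕ} [Fact p.Prime] [CharP k p] [NeZero r]

lemma cochainMap_xCochain {A B : Type*} [CommRing A] [Algebra k A] [CommRing B] [Algebra k B]
    (f : A →ₗ[k] B) {a : A} {b : B} (h : ∀ j < p, f (a ^ j) = b ^ j) :
    cochainMap f (xCochain p a) = xCochain p b := by
  simp only [xCochain, map_sum, map_smul, map_mul, cochainMap_ι]
  refine Finset.sum_congr rfl fun j hj => ?_
  rw [Finset.mem_Icc] at hj
  rw [h _ (by omega), h _ (by omega)]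

/-- The step from `C` to `k[𝕄_r]`, where `C` is spanned by the `θ^i τ^e` with `i < p^{r-1}`: here
`σ_1 = θ^{p^{r-1}}` is a cocycle, with class `λ_r`, so the cohomology of `𝕄_r` is a free module
over that of `C`, with the basis `1`, `λ_r`. The algebra `M` presents the cohomology of `C`, and
its image contains all generators but `λ_r`. -/
lemma bijective_of_isPrincipal_one [NeZero (2 : k)] {C : Type*} [AddCommGroup C] [Module k C]
    [UnitalSupercoalgebra k C] {j : Hom k C (Coord k p r)}
    (hj : IsPrincipal j (lowerSigma k p r 1) (raiseSigma k p r 1))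
    {M : Type*} [Ring M] [Algebra k M] {ΦC : M →ₐ[k] Cohomology k C} (hC : Function.Bijective ΦC)
    {Φ : CohModel k r Empty True →ₐ[k] Cohomology k (Coord k p r)}
    (hΦ : ∀ a, Represents (genCochain p theta tau Empty.elim a) (Φ (CohModel.gen True a)))
    (i : M →ₐ[k] CohModel k r Empty True) (hi : ∀ m, Φ (i m) = cohomologyMap j (ΦC m))
    (hgen : ∀ a, a ≠ CohGen.lam (lastIdx r) → ∃ c, CohModel.gen True a = i c) :
    Function.Bijective Φ := by
  have hs : raiseSigma k p r 1 (unit k) = theta ^ p ^ (r - 1) := by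
    rw [raiseSigma_unit, theta_pow]
  set l := CohModel.gen (k := k) (W := Empty) True (CohGen.lam (lastIdx r)) with hldef
  have hl : Represents (ι k (raiseSigma k p r 1 (unit k))) (Φ l) := by
    rw [hs]
    exact hΦ (CohGen.lam (lastIdx r))
  refine hj.bijective_of_cocycle (hj.section_unit.resolve_left ?_) ?_ hC i hi hl ?_
  · rw [raiseSigma_unit]
    intro h
    have := congrArg (coeff k p r 0 1 0) h
    have h2 : (sigma 1 : Coord k p r) = mono k p r 0 1 0 := by simp [mono]
    rw [h2, coeff_mono (prime_pow_pos _) (by norm_num), map_zero] at this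
    simp at this
  · rw [hs]
    exact isThetaTau_coord.differential_theta_pow _
  · -- The elements `c + c' λ_r` form a right ideal that contains `1`.
    intro m
    set F : M × M →ₗ[k] CohModel k r Empty True :=
      i.toLinearMap.coprod (LinearMap.mulRight k l ∘ₗ i.toLinearMap)
    have hF : ∀ c c', i c + i c' * l ∈ LinearMap.range F := fun c c' => ⟨(c, c'), by simp [F]⟩
    have hcl : ∀ m ∈ LinearMap.range F, ∀ a, m * CohModel.gen True a ∈ LinearMap.range F := by
      rintro _ ⟨⟨c, c'⟩, rfl⟩ a
      have h1 : F (c, c') = i c + i c' * l := by simp [F]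
      rw [h1]
      by_cases ha : a = CohGen.lam (lastIdx r)
      · have := hF 0 c
        rw [map_zero, zero_add] at this
        rw [ha, ← hldef, add_mul, mul_assoc, CohModel.gen_lam_sq, mul_zero, add_zero]
        exact this
      · obtain ⟨b, hb⟩ := hgen a ha
        have h2 := CohModel.gen_mul (k := k) (q := True) (CohGen.lam (lastIdx r)) a
        rw [← hldef] at h2
        rw [add_mul, mul_assoc, h2, hb, mul_smul_comm, ← mul_assoc, ← map_mul, ← map_mul,
          ← smul_mul_assoc, ← map_smul]
        exact hF _ _
    have := CohModel.mul_mem_of_gen hcl (m := 1) (by simpa using hF 1 0) m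
    rw [one_mul] at this
    obtain ⟨⟨c, c'⟩, h⟩ := this
    exact ⟨c, c', by rw [← h]; simp [F]⟩

/-- The step from `k[𝕄_r]` to `k[𝕄_{r;s}]`: the class of `w_s = ∂ σ_{p^s}` is a new generator. In
the presented algebra it is the element `ω`, that is `x_r - y^2` for `s = 1` and a generator `w`
for `s ≥ 2`. -/
lemma bijective_of_coordSubIncl {s : ℕ} (hs : s ≠ 0) {W : Type} {q : Prop}
    {wc : W → TensorAlgebra k (coordSub k p r s)} (hwc : ∀ j, wc j ∈ degreePart k _ 2)
    {ΦA : CohModel k r Empty True →ₐ[k] Cohomology k (Coord k p r)} (hA : Function.Bijective ΦA)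
    (hΦA : ∀ a, Represents (genCochain p theta tau Empty.elim a) (ΦA (CohModel.gen True a)))
    {ΦC : CohModel k r W q →ₐ[k] Cohomology k (coordSub k p r s)}
    (hΦC : ∀ a, Represents (genCochain p (thetaSub k p r s) (tauSub k p r s) wc a)
      (ΦC (CohModel.gen q a)))
    {ω : CohModel k r W q} (hω : Represents (wCochain k p r s) (ΦC ω))
    (hcomm : ∀ a, Commute (CohModel.gen q a) ω)
    (hgen : ∀ S : Subring (CohModel k r W q), ω ∈ S →
      (∀ l, l ≠ lastIdx r → CohModel.gen q (CohGen.x l) ∈ S) → CohModel.gen q CohGen.y ∈ S →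
      CohModel.gen q (CohGen.x (lastIdx r)) ∈ S ∧ ∀ j, CohModel.gen q (CohGen.w j) ∈ S) :
    Function.Surjective (cohomologyMap (coordSubIncl k p r s)) ∧ Function.Bijective ΦC := by
  -- The presentation of `H(𝕄_r)` lifts to `H(𝕄_{r;s})` by `x_r ↦ y²`, also if `x_r ≠ y²` there.
  obtain ⟨i, hix, hil, hiy⟩ := CohModel.exists_hom_of_true (k := k) (r := r) (W := W) (q := q)
  have hP := isPrincipal_coordSubIncl (k := k) (p := p) (r := r) hs
  have hx : ∀ l, cohomologyMap (coordSubIncl k p r s) (ΦC (CohModel.gen q (CohGen.x l))) =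
      ΦA (CohModel.gen True (CohGen.x l)) := by
    intro l
    refine ((hΦC (CohGen.x l)).map _).unique ?_
    have : cochainMap (coordSubIncl k p r s).toLin (genCochain p (thetaSub k p r s) (tauSub k p r s)
        wc (CohGen.x l)) = genCochain p theta tau Empty.elim (CohGen.x l) :=
      cochainMap_xCochain _ fun j _ => rfl
    rw [this]
    exact hΦA _
  have hlam : ∀ l, cohomologyMap (coordSubIncl k p r s) (ΦC (CohModel.gen q (CohGen.lam l))) =
      ΦA (CohModel.gen True (CohGen.lam l)) := by
    intro l
    refine ((hΦC (CohGen.lam l)).map _).unique ?_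
    rw [genCochain, cochainMap_ι]
    exact hΦA (CohGen.lam l)
  have hy : cohomologyMap (coordSubIncl k p r s) (ΦC (CohModel.gen q CohGen.y)) =
      ΦA (CohModel.gen True CohGen.y) := by
    refine ((hΦC CohGen.y).map _).unique ?_
    rw [genCochain, cochainMap_ι]
    exact hΦA CohGen.y
  have hi : ∀ m, cohomologyMap (coordSubIncl k p r s) (ΦC (i m)) = ΦA m := by
    have : ((cohomologyMap (coordSubIncl k p r s)).comp ΦC).comp i = ΦA := by
      apply CohModel.algHom_ext
      intro a
      rw [AlgHom.comp_apply, AlgHom.comp_apply]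
      cases a with
      | x l =>
        rw [hix]
        split_ifs with h
        · rw [map_pow, map_pow, hy, h, CohModel.gen_last trivial, map_pow]
        · exact hx l
      | lam l => rw [hil, hlam]
      | y => rw [hiy, hy]
      | w j => exact j.elim
    exact fun m => DFunLike.congr_fun this m
  have hσ : lowerSigma k p r (p ^ s) (raiseSigma k p r (p ^ s) (unit k)) = unit k := by
    rw [← LinearMap.comp_apply, lowerSigma_raiseSigma, LinearMap.id_apply]
  refine hP.bijective_of_lift hσ (w := wCochain k p r s) ?_ (wCochain_mem_degreePart s) hA i hi hω
    (CohModel.commute_of_commute_gen hcomm) ?_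
    (CohModel.isGradedSubset_range hΦC (IsThetaTau.genCochain_mem_degreePart hwc))
  · rw [raiseSigma_unit, cochainMap_wCochain hs]
  · intro S hS hωS
    have hSy : CohModel.gen q CohGen.y ∈ S := hiy ▸ hS _
    have hSx : ∀ l, l ≠ lastIdx r → CohModel.gen q (CohGen.x l) ∈ S := by
      intro l hl
      have := hS (CohModel.gen True (CohGen.x l))
      rwa [hix, if_neg hl] at this
    obtain ⟨h1, h2⟩ := hgen S hωS hSx hSy
    refine CohModel.top_of_gen_mem (fun c => ?_) fun a => ?_
    · have := hS (algebraMap k _ c)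
      rwa [AlgHom.commutes] at this
    · cases a with
      | x l =>
        by_cases hl : l = lastIdx r
        · exact hl ▸ h1
        · exact hSx l hl
      | lam l => exact hil l ▸ hS _
      | y => exact hSy
      | w j => exact h2 j

end tower
end MultiparameterSupergroup

namespace MultiparameterSupergroup
open UnitalSupercoalgebra Hochschild
open TensorAlgebra (ι)

/-! ### The presentations of the cohomology rings -/

section presentations
variable {k : Type*} [Field k] {p r : ℕ} [Fact p.Prime] [CharP k p] [NeZero r]

/-- The algebra homomorphism `Φ` sends each generator to the class of the given cochain, homogeneous
of the expected bidegree, and is bijective. -/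
def IsPresentationHom {A : Type*} [AddCommGroup A] [Module k A] [UnitalSupercoalgebra k A]
    {W : Type} {q : Prop} (z : CohGen r W → TensorAlgebra k A)
    (Φ : CohModel k r W q →ₐ[k] Cohomology k A) : Prop :=
  (∀ a, Represents (z a) (Φ (CohModel.gen q a)) ∧
    Φ (CohModel.gen q a) ∈ homogeneousPart k A a.deg a.par) ∧ Function.Bijective Φ

lemma IsPresentationHom.exists_equiv {A : Type*} [AddCommGroup A] [Module k A]
    [UnitalSupercoalgebra k A] {W : Type} {q : Prop} {z : CohGen r W → TensorAlgebra k A}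
    {Φ : CohModel k r W q →ₐ[k] Cohomology k A} (h : IsPresentationHom z Φ) :
    ∃ Φ : CohModel k r W q ≃ₐ[k] Cohomology k A, IsPresentation z Φ :=
  ⟨AlgEquiv.ofBijective Φ h.2, h.1⟩

omit [NeZero r] in
/-- In `k[𝕄_r]` the cocycles of `x_r` and `y^2` differ by the coboundary of `σ_p`. -/
lemma coord_xCochain_sub : xCochain p ((theta : Coord k p r) ^ p ^ (r - 1)) - ι k tau * ι k tau =
    differential k _ (ι k (sigma (p ^ 1))) := by
  rw [← cochainMap_wCochain one_ne_zero, wCochain_one, map_sub, map_mul, cochainMap_ι,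
    cochainMap_xCochain (b := theta ^ p ^ (r - 1)) _ fun _ _ => rfl]
  rfl

omit [NeZero r] in
lemma coordSub_xCochain_sub {s : ℕ} (hs : 2 ≤ s) :
    xCochain p (thetaSub k p r s ^ p ^ (r - 1)) - ι k (tauSub k p r s) * ι k (tauSub k p r s) =
    differential k _ (ι k (sigmaSub k p r s (p ^ 1))) := by
  apply cochainMap_injective (coordSubIncl_injective s)
  rw [← differential_map, cochainMap_ι, coordSubIncl_sigmaSub
    (Nat.pow_lt_pow_right (Fact.out : p.Prime).one_lt hs), ← coord_xCochain_sub, map_sub, map_mul,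
    cochainMap_ι, cochainMap_xCochain (b := theta ^ p ^ (r - 1)) _ fun _ _ => rfl]
  rfl

/-- The kernel of the restriction to `𝕄_r` is generated by the class of `w_s`. -/
lemma ker_cohomologyMap_coordSubIncl {s : ℕ} (hs : s ≠ 0) : ∃ h : Cohomology k (coordSub k p r s),
    Represents (wCochain k p r s) h ∧
      RingHom.ker (cohomologyMap (coordSubIncl k p r s)) = Ideal.span {h} := by
  obtain ⟨h, hh⟩ := exists_represented (differential_wCochain (k := k) (p := p) (r := r) hs)
  have hP := isPrincipal_coordSubIncl (k := k) (p := p) (r := r) hs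
  have hw : cochainMap (coordSubIncl k p r s).toLin (wCochain k p r s) =
      differential k _ (ι k (raiseSigma k p r (p ^ s) (unit k))) := by
    rw [raiseSigma_unit, cochainMap_wCochain hs]
  have hσ : lowerSigma k p r (p ^ s) (raiseSigma k p r (p ^ s) (unit k)) = unit k := by
    rw [← LinearMap.comp_apply, lowerSigma_raiseSigma, LinearMap.id_apply]
  refine ⟨h, hh, ?_⟩
  ext c
  rw [RingHom.mem_ker, Ideal.mem_span_singleton']
  constructor
  · intro hc
    obtain ⟨c', rfl⟩ := hP.exists_mul_of_map_eq_zero hσ hw hh hc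
    exact ⟨c', rfl⟩
  · rintro ⟨c', rfl⟩
    rw [map_mul, hP.map_eq_zero hσ hw hh, mul_zero]

/-- From `𝕄_r` to `𝕄_{r;1}`: the new class is `x_r - y^2`, so that the relation `x_r = y^2` is
removed. -/
lemma presentation_coordSub_one {ΦA : CohModel k r Empty True →ₐ[k] Cohomology k (Coord k p r)}
    (hA : IsPresentationHom (genCochain p theta tau Empty.elim) ΦA) :
    Function.Surjective (cohomologyMap (coordSubIncl k p r 1)) ∧
      ∃ Φ : CohModel k r Empty False →ₐ[k] Cohomology k (coordSub k p r 1),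
        IsPresentationHom (genCochain p (thetaSub k p r 1) (tauSub k p r 1) Empty.elim) Φ := by
  obtain ⟨Φ, hΦ⟩ := (isThetaTau_coordSub (k := k) (p := p) (r := r) 1).exists_hom (r := r)
    (wc := Empty.elim) False (fun j => j.elim) (fun j => j.elim) (fun j => j.elim) False.elim
  have hω : Represents (wCochain k p r 1)
      (Φ (CohModel.gen False (CohGen.x (lastIdx r)) - CohModel.gen False CohGen.y ^ 2)) := by
    rw [wCochain_one, map_sub, map_pow, pow_two]
    exact (hΦ (CohGen.x (lastIdx r))).1.sub ((hΦ CohGen.y).1.mul (hΦ CohGen.y).1)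
  obtain ⟨h1, h2⟩ := bijective_of_coordSubIncl one_ne_zero (fun j => j.elim) hA.2
    (fun a => (hA.1 a).1) (fun a => (hΦ a).1) hω
    (fun a => (CohModel.commute_gen_of_even even_two rfl a).sub_right (CohModel.commute_gen_y_sq a))
    (fun S hS _ hy => ⟨by simpa using add_mem hS (pow_mem hy 2), fun j => j.elim⟩)
  exact ⟨h1, Φ, hΦ, h2⟩

/-- From `𝕄_r` to `𝕄_{r;s}` for `s ≥ 2`: the new class is the generator `w_s`, and the relation
`x_r = y^2` persists, as `σ_p` is in `k[𝕄_{r;s}]`. -/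
lemma presentation_coordSub {ΦA : CohModel k r Empty True →ₐ[k] Cohomology k (Coord k p r)}
    (hA : IsPresentationHom (genCochain p theta tau Empty.elim) ΦA) {s : ℕ} (hs : 2 ≤ s) :
    Function.Surjective (cohomologyMap (coordSubIncl k p r s)) ∧
      ∃ Φ : CohModel k r Unit True →ₐ[k] Cohomology k (coordSub k p r s),
        IsPresentationHom (genCochain p (thetaSub k p r s) (tauSub k p r s)
          fun _ => wCochain k p r s) Φ := by
  have hs0 : s ≠ 0 := by omega
  obtain ⟨Φ, hΦ⟩ := (isThetaTau_coordSub (k := k) (p := p) (r := r) s).exists_hom (r := r)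
    (wc := fun _ : Unit => wCochain k p r s) True (fun _ => differential_wCochain hs0)
    (fun _ => wCochain_mem_degreePart s) (fun _ => cochainMap_parity_wCochain hs0)
    (fun _ => ⟨_, coordSub_xCochain_sub hs⟩)
  obtain ⟨h1, h2⟩ := bijective_of_coordSubIncl hs0 (fun _ => wCochain_mem_degreePart s) hA.2
    (fun a => (hA.1 a).1) (fun a => (hΦ a).1) (hΦ (CohGen.w ())).1
    (fun a => CohModel.commute_gen_of_even even_two rfl a)
    (fun S hS _ hy => ⟨by rw [CohModel.gen_last trivial]; exact pow_mem hy 2, fun _ => hS⟩)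
  exact ⟨h1, Φ, hΦ, h2⟩

variable [NeZero (2 : k)]

variable (k p) in
/-- The cohomology ring of `𝕄_R` is presented by the classes `x_i`, `λ_i` and `y`, with the relation
`x_R = y^2`. -/
def HasCoordPresentation (R : ℕ) [NeZero R] : Prop :=
  ∃ Φ : CohModel k R Empty True →ₐ[k] Cohomology k (Coord k p R),
    IsPresentationHom (genCochain p theta tau Empty.elim) Φ

/-- The base of the induction: `k[𝔾_a⁻] → k[𝕄_1]` adjoins the exterior generator `λ_1`. -/
lemma hasCoordPresentation_one : HasCoordPresentation k p 1 := by
  obtain ⟨Φ, hΦ⟩ := (isThetaTau_coord (k := k) (p := p) (r := 1)).exists_hom (r := 1)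
    (wc := Empty.elim) True (fun j => j.elim) (fun j => j.elim) (fun j => j.elim)
    (fun _ => ⟨_, coord_xCochain_sub⟩)
  obtain ⟨l, hl⟩ := odd_represents (k := k)
  refine ⟨Φ, hΦ, bijective_of_isPrincipal_one isPrincipal_oddStep (odd_bijective hl)
    (fun a => (hΦ a).1) (Polynomial.aeval (CohModel.gen True CohGen.y)) ?_ ?_⟩
  · have : Φ.comp (Polynomial.aeval (CohModel.gen True CohGen.y)) =
        (cohomologyMap (oddStep k p)).comp (Polynomial.aeval l) := by
      apply Polynomial.algHom_ext
      rw [AlgHom.comp_apply, AlgHom.comp_apply, Polynomial.aeval_X, Polynomial.aeval_X]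
      refine (hΦ CohGen.y).1.unique ?_
      have := hl.map (oddStep k p)
      have hτ : (oddStep k p).toLin oddTau = tau := oddLin_tau _ _
      rw [cochainMap_ι, hτ] at this
      exact this
    exact fun m => DFunLike.congr_fun this m
  · intro a ha
    cases a with
    | x l =>
      rw [Subsingleton.elim l (lastIdx 1), CohModel.gen_last trivial]
      exact ⟨Polynomial.X ^ 2, by rw [map_pow, Polynomial.aeval_X]⟩
    | lam l => exact absurd (congrArg _ (Subsingleton.elim _ _)) ha
    | y => exact ⟨Polynomial.X, by rw [Polynomial.aeval_X]⟩
    | w j => exact j.elim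

/-- If `C` is presented by generators without relations other than graded commutativity, and the map
`g` identifies them with the generators of `H(𝕄_R)` other than `λ_R` and `x_R = y^2`, then `𝕄_R` has
the expected presentation. -/
lemma hasCoordPresentation_of_isPrincipal {R : ℕ} [NeZero R] {C : Type*} [AddCommGroup C]
    [Module k C] [UnitalSupercoalgebra k C] {j : Hom k C (Coord k p R)}
    (hj : IsPrincipal j (lowerSigma k p R 1) (raiseSigma k p R 1))
    {z : CohGen r Empty → TensorAlgebra k C} {ΦC : CohModel k r Empty False →ₐ[k] Cohomology k C}
    (hC : IsPresentationHom z ΦC) (g : CohGen r Empty → CohGen R Empty)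
    (hdeg : ∀ a, (g a).deg = a.deg) (hpar : ∀ a, (g a).par = a.par)
    (hz : ∀ a, cochainMap j.toLin (z a) = genCochain p theta tau Empty.elim (g a))
    (hy : g CohGen.y = CohGen.y)
    (hg : ∀ a, a ≠ CohGen.lam (lastIdx R) → a ≠ CohGen.x (lastIdx R) → ∃ b, g b = a) :
    HasCoordPresentation k p R := by
  obtain ⟨Φ, hΦ⟩ := (isThetaTau_coord (k := k) (p := p) (r := R)).exists_hom (r := R)
    (wc := Empty.elim) True (fun j => j.elim) (fun j => j.elim) (fun j => j.elim)
    (fun _ => ⟨_, coord_xCochain_sub⟩)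
  obtain ⟨i, hi⟩ := CohModel.exists_lift (k := k) (q := False)
    (fun a => CohModel.gen (k := k) True (g a))
    (fun a b => by rw [CohModel.gen_mul, hdeg, hdeg, hpar, hpar]) False.elim
  refine ⟨Φ, hΦ, bijective_of_isPrincipal_one hj hC.2 (fun a => (hΦ a).1) i ?_ ?_⟩
  · have : Φ.comp i = (cohomologyMap j).comp ΦC := by
      apply CohModel.algHom_ext
      intro a
      rw [AlgHom.comp_apply, AlgHom.comp_apply, hi]
      refine (hΦ (g a)).1.unique ?_
      rw [← hz]
      exact (hC.1 a).1.map _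
    exact fun m => DFunLike.congr_fun this m
  · intro a ha
    rcases eq_or_ne a (CohGen.x (lastIdx R)) with rfl | hx
    · exact ⟨CohModel.gen False CohGen.y ^ 2, by
        rw [map_pow, hi, hy, CohModel.gen_last trivial]⟩
    · obtain ⟨b, rfl⟩ := hg a ha hx
      exact ⟨_, (hi b).symm⟩

/-- From `𝕄_{r;1}` to `𝕄_{r+1}`: the exterior generator `λ_{r+1}` is adjoined, and `x_{r+1}` is
`y^2`. -/
lemma hasCoordPresentation_succ
    {ΦC : CohModel k r Empty False →ₐ[k] Cohomology k (coordSub k p r 1)}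
    (hC : IsPresentationHom (genCochain p (thetaSub k p r 1) (tauSub k p r 1) Empty.elim) ΦC) :
    HasCoordPresentation k p (r + 1) := by
  let g : CohGen r Empty → CohGen (r + 1) Empty := fun a => match a with
    | CohGen.x l => CohGen.x l.castSucc
    | CohGen.lam l => CohGen.lam l.castSucc
    | CohGen.y => CohGen.y
    | CohGen.w j => CohGen.w j
  have hpow : ∀ m < p ^ r, coordStepLin k p r (thetaSub k p r 1 ^ m) = theta ^ m := by
    intro m hm
    simpa using coordStepLin_apply hm (show 0 < 2 by norm_num)
  have hz : ∀ a, cochainMap (coordStep k p r).toLin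
      (genCochain p (thetaSub k p r 1) (tauSub k p r 1) Empty.elim a) =
      genCochain p theta tau Empty.elim (g a) := by
    intro a
    cases a with
    | x l =>
      refine cochainMap_xCochain _ fun m hm => ?_
      rw [← pow_mul, ← pow_mul]
      refine hpow _ (lt_of_lt_of_le (Nat.mul_lt_mul_of_pos_left hm (prime_pow_pos _)) ?_)
      rw [← pow_succ]
      exact Nat.pow_le_pow_right (Fact.out : p.Prime).pos l.2
    | lam l =>
      rw [genCochain, cochainMap_ι]
      exact congrArg _ (hpow _ (Nat.pow_lt_pow_right (Fact.out : p.Prime).one_lt l.2))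
    | y =>
      rw [genCochain, cochainMap_ι]
      have := coordStepLin_apply (k := k) (p := p) (r := r) (prime_pow_pos r)
        (show 1 < 2 by norm_num)
      rw [pow_zero, pow_zero, pow_one, pow_one, one_mul, one_mul] at this
      exact congrArg _ this
    | w j => exact j.elim
  refine hasCoordPresentation_of_isPrincipal isPrincipal_coordStep hC g ?_ ?_ hz rfl ?_
  · rintro (_ | _ | _ | _) <;> rfl
  · rintro (_ | _ | _ | _) <;> rfl
  · intro a ha hx
    cases a with
    | x l =>
      rcases Fin.eq_castSucc_or_eq_last l with ⟨l', rfl⟩ | rfl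
      · exact ⟨CohGen.x l', rfl⟩
      · exact absurd rfl hx
    | lam l =>
      rcases Fin.eq_castSucc_or_eq_last l with ⟨l', rfl⟩ | rfl
      · exact ⟨CohGen.lam l', rfl⟩
      · exact absurd rfl ha
    | y => exact ⟨CohGen.y, rfl⟩
    | w j => exact j.elim

omit [NeZero r] in
lemma hasCoordPresentation_add_one (n : ℕ) : HasCoordPresentation k p (n + 1) := by
  induction n with
  | zero => exact hasCoordPresentation_one
  | succ n ih =>
    obtain ⟨ΦA, hA⟩ := ih
    obtain ⟨-, ΦC, hC⟩ := presentation_coordSub_one hA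
    exact hasCoordPresentation_succ hC

/-- The cohomology of `𝕄_r`, by induction on `r` along `k[𝕄_r] ⊇ k[𝕄_{r;1}] → k[𝕄_{r+1}]`. -/
theorem hasCoordPresentation : HasCoordPresentation k p r := by
  obtain ⟨n, rfl⟩ := Nat.exists_eq_succ_of_ne_zero (NeZero.ne r)
  exact hasCoordPresentation_add_one n

end presentations
end MultiparameterSupergroup

namespace AugmentedSuperalgebra
open UnitalSupercoalgebra Hochschild

/-! ### Idempotents of the group algebra -/

section idempotent
variable {k Q : Type*} [Field k] [CommRing Q] [Algebra k Q] [AugmentedSuperalgebra k Q]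

/-- The transpose of the multiplication by `e`, an operator on the coordinate supercoalgebra. -/
def mulDual (e : Q) : DualCoord k Q →ₗ[k] DualCoord k Q :=
  toDual.symm.toLinearMap ∘ₗ (LinearMap.mulLeft k e).dualMap ∘ₗ toDual.toLinearMap

@[simp] lemma toDual_mulDual (e : Q) (f : DualCoord k Q) (x : Q) :
    toDual (mulDual e f) x = toDual f (e * x) := rfl

lemma dualCoord_ext {f g : DualCoord k Q} (h : ∀ x, toDual f x = toDual g x) : f = g :=
  toDual.injective (LinearMap.ext h)

variable [Module.Finite k Q] {e : Q}

lemma dualPair_rTensor_mulDual (z : DualCoord k Q ⊗[k] DualCoord k Q) (x y : Q) :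
    dualPair k Q ((mulDual e).rTensor _ z) (x ⊗ₜ y) = dualPair k Q z ((e * x) ⊗ₜ y) := by
  induction z with
  | zero => simp
  | add a b ha hb => simp only [map_add, LinearMap.add_apply, ha, hb]
  | tmul a b => rw [LinearMap.rTensor_tmul, dualPair_tmul, dualPair_tmul, toDual_mulDual]

lemma dualPair_lTensor_mulDual (z : DualCoord k Q ⊗[k] DualCoord k Q) (x y : Q) :
    dualPair k Q ((mulDual e).lTensor _ z) (x ⊗ₜ y) = dualPair k Q z (x ⊗ₜ (e * y)) := by
  induction z with
  | zero => simp
  | add a b ha hb => simp only [map_add, LinearMap.add_apply, ha, hb]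
  | tmul a b => rw [LinearMap.lTensor_tmul, dualPair_tmul, dualPair_tmul, toDual_mulDual]

variable [NeZero (2 : k)]

/-- A homomorphism onto the functionals that vanish on `eQ`, for an even idempotent `e` of
augmentation zero, induces an isomorphism of cohomology rings. -/
theorem bijective_cohomologyMap_of_idempotent (he : e * e = e) (h0 : aug (k := k) e = 0)
    (hp : parity (k := k) e = e) {C : Type*} [AddCommGroup C] [Module k C]
    [UnitalSupercoalgebra k C] {j : Hom k C (DualCoord k Q)} (hj : Function.Injective j.toLin)
    (hr : LinearMap.range j.toLin = LinearMap.ker (mulDual e)) :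
    Function.Bijective (cohomologyMap j) := by
  have hl : ∀ f : DualCoord k Q, (mulDual e).rTensor _ (CoalgebraStruct.comul (R := k) f) =
      CoalgebraStruct.comul (R := k) (mulDual e f) := by
    intro f
    apply dual_ext2
    intro x y
    rw [dualPair_rTensor_mulDual]
    refine (dualPair_comul _ _).trans (Eq.trans ?_ (dualPair_comul _ _).symm)
    rw [toDual_mulDual, koszulMul_tmul, koszulMul_tmul, map_mul, hp]
    congr 1
    rw [Algebra.mul_smul_comm]
    congr 1
    ring
  have hrr : ∀ f : DualCoord k Q, (mulDual e).lTensor _ (CoalgebraStruct.comul (R := k) f) =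
      CoalgebraStruct.comul (R := k) (mulDual e f) := by
    intro f
    apply dual_ext2
    intro x y
    rw [dualPair_lTensor_mulDual]
    refine (dualPair_comul _ _).trans (Eq.trans ?_ (dualPair_comul _ _).symm)
    rw [toDual_mulDual, koszulMul_tmul, koszulMul_tmul, map_mul, hp]
    congr 1
    rw [Algebra.mul_smul_comm]
    congr 1
    ring
  have hD : ∀ f : DualCoord k Q, mulDual e (mulDual e f) = mulDual e f := fun f =>
    dualCoord_ext fun x => by rw [toDual_mulDual, toDual_mulDual, toDual_mulDual, ← mul_assoc, he]
  have hu : mulDual e (UnitalSupercoalgebra.unit k : DualCoord k Q) = 0 :=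
    dualCoord_ext fun x => by
      change aug (k := k) (e * x) = 0
      rw [map_mul, h0, zero_mul]
  have hP : IsPrincipal j (mulDual e) (mulDual e) :=
    { injective := hj
      range_eq := hr
      comul_left := hl
      comul_right := hrr
      section_apply := fun f => by rw [hD, hD]
      comul_section := fun f => by
        have : mulDual e ∘ₗ mulDual e = mulDual (k := k) e := LinearMap.ext hD
        rw [this, hl, hD]
      section_unit := Or.inl hu }
  exact hP.bijective_cohomologyMap hu

end idempotent
end AugmentedSuperalgebra

namespace MultiparameterSupergroup
open UnitalSupercoalgebra Hochschild
open AugmentedSuperalgebra (aug parity DualCoord toDual dualHom transpose mulDual toDual_mulDual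
  dualCoord_ext)

/-! ### The isomorphism `φ` -/

section phi
variable {k : Type*} [Field k] {p r : ℕ} [NeZero r] [Fact p.Prime] [CharP k p]
  (f : InsepPPoly k p) (η : k)

variable (r) in
/-- The inverse of `phi`, with `u_i ↦ u_{i+1}` and `v ↦ v`. The relation `f(u_{r-1})^p = 0` holds
in the target because `f(u_r) = -η u_0` and `u_0^p = 0`. -/
def phiInv : GroupAlg k p r f.frob 0 →ₐ[k] GroupAlg k p (r + 1) f η :=
  groupAlgLift (fun i => uGen i.succ) vGen
    (fun i hi => uGen_pow _ fun h => hi (by rwa [lastIdx_succ, Fin.succ_inj] at h))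
    (by rw [← lastIdx_succ]; exact uGen_last_pow)
    (by
      have h0 : (0 : Fin (r + 1)) ≠ lastIdx (r + 1) := by
        rw [lastIdx_succ]
        exact (Fin.succ_ne_zero _).symm
      have h := aeval_uGen_last (k := k) (p := p) (r := r + 1) (f := f) (η := η)
      change Polynomial.aeval _ (f.poly ^ p) + _ = 0
      rw [zero_smul, add_zero, map_pow, ← lastIdx_succ, eq_neg_of_add_eq_zero_left h, neg_pow,
        smul_pow, uGen_pow 0 h0, smul_zero, mul_zero])

variable {f η} (hη : η ≠ 0)

lemma phi_phiInv (x : GroupAlg k p r f.frob 0) : phi r f η hη (phiInv r f η x) = x := by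
  have : (phi r f η hη).comp (phiInv r f η) = AlgHom.id k _ :=
    groupAlg_ext (fun i => by simp [phi, phiInv]) (by simp [phi, phiInv])
  exact DFunLike.congr_fun this x

lemma phiInv_phi (x : GroupAlg k p (r + 1) f η) : phiInv r f η (phi r f η hη x) = x := by
  have : (phiInv r f η).comp (phi r f η hη) = AlgHom.id k _ := by
    apply groupAlg_ext
    · intro i
      induction i using Fin.cases with
      | zero =>
        have h := aeval_uGen_last (k := k) (p := p) (r := r + 1) (f := f) (η := η)
        rw [lastIdx_succ] at h
        simp only [AlgHom.comp_apply, phi, groupAlgLift_uGen, Fin.cons_zero, map_neg, map_smul]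
        rw [← Polynomial.aeval_algHom_apply, phiInv, groupAlgLift_uGen,
          eq_neg_of_add_eq_zero_left h, smul_neg, neg_neg, smul_smul, inv_mul_cancel₀ hη, one_smul]
        rfl
      | succ i => simp [phi, phiInv]
    · simp [phi, phiInv]
  exact DFunLike.congr_fun this x

lemma phi_bijective : Function.Bijective (phi r f η hη) :=
  Function.bijective_iff_has_inverse.mpr ⟨phiInv r f η, phiInv_phi hη, phi_phiInv hη⟩

variable [NeZero (2 : k)]

lemma bijective_cohomologyMap_phi : Function.Bijective
    (cohomologyMap (dualHom (phi r f η hη) (phi_aug f η hη) (phi_parity f η hη))) := by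
  refine cohomologyMap_bijective_of_inverse _ (dualHom (phiInv r f η) (fun x => ?_) fun x => ?_)
    (fun b => ?_) fun a => ?_
  · rw [← phi_aug f η hη, phi_phiInv]
  · apply (phi_bijective hη).1
    rw [phi_phiInv, phi_parity, phi_phiInv]
  · exact dualCoord_ext fun x => congrArg (toDual b) (phiInv_phi hη x)
  · exact dualCoord_ext fun x => congrArg (toDual a) (phi_phiInv hη x)

end phi

/-! ### The quotient map to `𝔾_a⁻` -/

section parity
variable {k : Type*} [Field k] {p r : ℕ} [NeZero r] [Fact p.Prime] {f : InsepPPoly k p} {η : k}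

lemma parity_uGen (i : Fin r) : parity (k := k) (uGen i : GroupAlg k p r f η) = uGen i := by
  change groupAlgParity k p r f η _ = _
  simp [groupAlgParity]

lemma parity_vGen : parity (k := k) (vGen : GroupAlg k p r f η) = -vGen := by
  change groupAlgParity k p r f η _ = _
  simp [groupAlgParity]

lemma parity_aeval_uGen (i : Fin r) (q : Polynomial k) :
    parity (k := k) (Polynomial.aeval (uGen i : GroupAlg k p r f η) q) =
      Polynomial.aeval (uGen i) q := by
  rw [← Polynomial.aeval_algHom_apply, parity_uGen]

lemma aug_uGen (i : Fin r) : aug (k := k) (uGen i : GroupAlg k p r f η) = 0 := by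
  change groupAlgAug k p r f η _ = _
  simp [groupAlgAug]

lemma aug_vGen : aug (k := k) (vGen : GroupAlg k p r f η) = 0 := by
  change groupAlgAug k p r f η _ = _
  simp [groupAlgAug]

end parity

section qMinus
variable {k : Type*} [Field k] {p : ℕ} [Fact p.Prime] [CharP k p] (f : InsepPPoly k p) {η : k}

/-- In `k𝕄_{1;f,η}` with `η ≠ 0` the ideal of `u_0` is generated by an even idempotent of
augmentation zero, as `u_0 e = u_0` for a multiple `e` of `u_0`. -/
lemma exists_idempotent_one (hη : η ≠ 0) : ∃ e h : GroupAlg k p 1 f η, e = uGen 0 * h ∧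
    uGen 0 * e = uGen 0 ∧ parity (k := k) e = e := by
  -- As `f` is inseparable, `f = T² g`, and the relation `u_0² g(u_0) + η u_0 = 0` shows that
  -- `e = -η⁻¹ u_0 g(u_0)` acts as the identity on the ideal of `u_0`.
  obtain ⟨g, hg⟩ : Polynomial.X ^ 2 ∣ f.poly := by
    rw [Polynomial.X_pow_dvd_iff]
    intro d hd
    interval_cases d
    · rw [Polynomial.coeff_zero_eq_eval_zero, f.eval_zero]
    · exact f.coeff_one
  have h := aeval_uGen_last (k := k) (p := p) (r := 1) (f := f) (η := η)
  rw [Subsingleton.elim (lastIdx 1) 0, hg, map_mul, map_pow, Polynomial.aeval_X] at h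
  refine ⟨uGen 0 * -(η⁻¹ • Polynomial.aeval (uGen 0) g),
    -(η⁻¹ • Polynomial.aeval (uGen 0) g), rfl, ?_, ?_⟩
  · rw [← mul_assoc, mul_neg, mul_smul_comm, ← pow_two, eq_neg_of_add_eq_zero_left h, smul_neg,
      neg_neg, smul_smul, inv_mul_cancel₀ hη, one_smul]
  · rw [map_mul, map_neg, map_smul, parity_aeval_uGen, parity_uGen]

/-- Modulo an ideal that contains `u_0`, every element of `k𝕄_{1;f,η}` is congruent to a linear
combination of `1` and `v`. -/
lemma mk_eq_of_uGen_mem {I : Ideal (GroupAlg k p 1 f η)} (hI : uGen 0 ∈ I)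
    (x : GroupAlg k p 1 f η) : Ideal.Quotient.mkₐ k I x =
      Ideal.Quotient.mkₐ k I ((qMinus 1 f η x).fst • 1 + (qMinus 1 f η x).snd • vGen) := by
  have hu : Ideal.Quotient.mkₐ k I (uGen 0) = 0 := Ideal.Quotient.eq_zero_iff_mem.mpr hI
  have hv : Ideal.Quotient.mkₐ k I vGen * Ideal.Quotient.mkₐ k I vGen = 0 := by
    have h := uGen_last_pow (k := k) (p := p) (r := 1) (f := f) (η := η)
    rw [Subsingleton.elim (lastIdx 1) 0] at h
    rw [← map_mul, ← pow_two, eq_neg_of_add_eq_zero_right h, map_neg, map_pow, hu,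
      zero_pow (Fact.out : p.Prime).ne_zero, neg_zero]
  set c : DualNumber k →ₐ[k] GroupAlg k p 1 f η ⧸ I :=
    DualNumber.lift ⟨(Algebra.ofId k _, Ideal.Quotient.mkₐ k I vGen), hv, fun _ => Commute.all _ _⟩
    with hc
  have : Ideal.Quotient.mkₐ k I = c.comp (qMinus 1 f η) := by
    apply groupAlg_ext
    · intro i
      rw [Subsingleton.elim i 0, hu]
      simp [qMinus]
    · simp [qMinus, hc]
  rw [this, AlgHom.comp_apply, hc, DualNumber.lift_apply_apply, ← this, map_add, map_smul, map_smul,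
    map_one]
  simp [Algebra.ofId_apply, Algebra.smul_def]

variable [NeZero (2 : k)]

lemma toDual_qMinusStar (a : OddAddCoord k) (x : GroupAlg k p 1 f η) :
    toDual ((qMinusStar 1 f η).toLin a) x =
      oddFst k a * (qMinus 1 f η x).fst - oddSnd k a * (qMinus 1 f η x).snd := by
  rw [qMinus_fst]
  change oddFst k a * aug (k := k) x + oddSnd k a * (-(qMinus 1 f η x).snd) = _
  ring

lemma qMinusStar_injective : Function.Injective (qMinusStar 1 f η).toLin := by
  rw [injective_iff_map_eq_zero]
  intro a ha
  have h : ∀ x, oddFst k a * (qMinus 1 f η x).fst - oddSnd k a * (qMinus 1 f η x).snd = 0 := by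
    intro x
    rw [← toDual_qMinusStar, ha]
    rfl
  have h1 := h 1
  have h2 := h vGen
  simp [qMinus] at h1 h2
  rw [odd_eq a, h1, h2, zero_smul, zero_smul, add_zero]

/-- The inclusion is the kernel of an idempotent operator. -/
lemma bijective_cohomologyMap_qMinusStar (hη : η ≠ 0) :
    Function.Bijective (cohomologyMap (qMinusStar 1 f η)) := by
  obtain ⟨e, h, he, hue, hpar⟩ := exists_idempotent_one f hη
  have hqu : qMinus 1 f η (uGen 0) = 0 := by simp [qMinus]
  have hq : qMinus 1 f η e = 0 := by rw [he, map_mul, hqu, zero_mul]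
  refine AugmentedSuperalgebra.bijective_cohomologyMap_of_idempotent (e := e) ?_ ?_ hpar
    (qMinusStar_injective f) (le_antisymm ?_ ?_)
  · nth_rw 1 [he]
    rw [mul_right_comm, hue, ← he]
  · rw [← qMinus_fst, hq]
    rfl
  · rintro _ ⟨a, rfl⟩
    refine dualCoord_ext fun x => ?_
    rw [toDual_mulDual, toDual_qMinusStar, map_mul, hq, zero_mul]
    simp
  · intro φ hφ
    have hφ' : ∀ x, toDual φ (e * x) = 0 := fun x => by
      rw [← toDual_mulDual, LinearMap.mem_ker.mp hφ]
      rfl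
    refine ⟨toDual φ 1 • 1 + (-toDual φ vGen) • oddTau, dualCoord_ext fun x => ?_⟩
    -- Modulo `e` every element is a combination of `1` and `v`, so `φ` is determined by its values
    -- there; the sign is that of the pairing with the odd coordinate.
    have hx := mk_eq_of_uGen_mem f (I := Ideal.span {e})
      (Ideal.mem_span_singleton'.mpr ⟨uGen 0, hue⟩) x
    have hx' := Ideal.mem_span_singleton'.mp (Ideal.Quotient.eq.mp hx)
    obtain ⟨y, hy⟩ := hx'
    have h3 := hφ' y
    rw [mul_comm, hy, map_sub, map_add, map_smul, map_smul] at h3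
    rw [toDual_qMinusStar, eq_of_sub_eq_zero h3]
    simp
    ring

end qMinus
end MultiparameterSupergroup

namespace MultiparameterSupergroup
open UnitalSupercoalgebra Hochschild
open AugmentedSuperalgebra (aug DualCoord toDual koszulMul koszulMul_tmul dual_ext2 dualPair
  dualPair_tmul dualPair_comul dualCoord_ext)

/-! ### Actions of the group algebra on supercoalgebras -/

section action
variable {k : Type*} [Field k] {p r : ℕ} [NeZero r] {f : InsepPPoly k p} {η : k}

/-- Commuting operators that satisfy the relations define a module over the group algebra. -/
lemma exists_action {M : Type*} [AddCommGroup M] [Module k M] (U : Fin r → Module.End k M)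
    (V : Module.End k M) (hUU : ∀ i j, Commute (U i) (U j)) (hUV : ∀ i, Commute (U i) V)
    (h0 : ∀ i, i ≠ lastIdx r → U i ^ p = 0) (h1 : U (lastIdx r) ^ p + V ^ 2 = 0)
    (h2 : Polynomial.aeval (U (lastIdx r)) f.poly + η • U 0 = 0) :
    ∃ ρ : GroupAlg k p r f η →ₐ[k] Module.End k M, (∀ i, ρ (uGen i) = U i) ∧ ρ vGen = V := by
  set S : Set (Module.End k M) := Set.range U ∪ {V} with hS
  have hcomm : ∀ a ∈ S, ∀ b ∈ S, a * b = b * a := by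
    rintro _ (⟨i, rfl⟩ | rfl) _ (⟨j, rfl⟩ | rfl)
    · exact hUU i j
    · exact hUV i
    · exact (hUV j).symm
    · rfl
  -- The universal property of the group algebra is used for the commutative algebra of operators.
  let R : CommRing (Algebra.adjoin k S) :=
    { (Algebra.adjoin k S).toRing with
      mul_comm := (Algebra.isMulCommutative_adjoin k hcomm).is_comm.comm }
  let u : Fin r → Algebra.adjoin k S := fun i => ⟨U i, Algebra.subset_adjoin (Or.inl ⟨i, rfl⟩)⟩
  let v : Algebra.adjoin k S := ⟨V, Algebra.subset_adjoin (Or.inr rfl)⟩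
  have hval : ∀ q : Polynomial k, ((Polynomial.aeval (u (lastIdx r)) q : Algebra.adjoin k S) :
      Module.End k M) = Polynomial.aeval (U (lastIdx r)) q := fun q =>
    (Polynomial.aeval_algHom_apply (Algebra.adjoin k S).val (u (lastIdx r)) q).symm
  have h0' : ∀ i, i ≠ lastIdx r → u i ^ p = 0 := fun i hi => Subtype.ext (h0 i hi)
  have h1' : u (lastIdx r) ^ p + v ^ 2 = 0 := Subtype.ext h1
  have h2' : Polynomial.aeval (u (lastIdx r)) f.poly + η • u 0 = 0 :=
    Subtype.ext ((congrArg (· + η • U 0) (hval f.poly)).trans h2)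
  refine ⟨(Algebra.adjoin k S).val.comp (groupAlgLift u v h0' h1' h2'), fun i => ?_, ?_⟩
  · exact congrArg Subtype.val (groupAlgLift_uGen u v h0' h1' h2' i)
  · exact congrArg Subtype.val (groupAlgLift_vGen u v h0' h1' h2')

/-- Induction on the number of factors of the monomials in the generators. -/
lemma groupAlg_induction {motive : GroupAlg k p r f η → Prop}
    (hC : ∀ c : k, motive (algebraMap k _ c)) (hadd : ∀ x y, motive x → motive y → motive (x + y))
    (hu : ∀ x i, motive x → motive (x * uGen i)) (hv : ∀ x, motive x → motive (x * vGen))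
    (x : GroupAlg k p r f η) : motive x := by
  obtain ⟨q, rfl⟩ : ∃ q, groupAlgMk k p r f η q = x := Ideal.Quotient.mk_surjective x
  induction q using MvPolynomial.induction_on with
  | C a =>
    rw [← MvPolynomial.algebraMap_eq, AlgHom.commutes]
    exact hC a
  | add x y hx hy => rw [map_add]; exact hadd _ _ hx hy
  | mul_X q n hq =>
    rw [map_mul]
    cases n with
    | none => exact hv _ hq
    | some i => exact hu _ i hq

/-- An action of `k𝕄_{r;f,η}` on a supercoalgebra `C`, by operators that are comodule
endomorphisms up to the sign rule and that kill the unit according to the augmentation. -/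
structure IsSuperAction {C : Type*} [AddCommGroup C] [Module k C] [UnitalSupercoalgebra k C]
    (ρ : GroupAlg k p r f η →ₐ[k] Module.End k C) : Prop where
  comul_u : ∀ i c, (ρ (uGen i)).rTensor C (CoalgebraStruct.comul (R := k) c) =
    CoalgebraStruct.comul (R := k) (ρ (uGen i) c)
  comul_v : ∀ c, (ρ vGen).rTensor C (CoalgebraStruct.comul (R := k) c) =
    (parity (k := k)).lTensor C (CoalgebraStruct.comul (R := k) (ρ vGen c))
  parity_u : ∀ i c, parity (k := k) (ρ (uGen i) c) = ρ (uGen i) (parity (k := k) c)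
  parity_v : ∀ c, parity (k := k) (ρ vGen c) = -ρ vGen (parity (k := k) c)
  unit_u : ∀ i, ρ (uGen i) (unit k) = 0
  unit_v : ρ vGen (unit k) = 0

namespace IsSuperAction
variable [Fact p.Prime] {C : Type*} [AddCommGroup C] [Module k C] [UnitalSupercoalgebra k C]
  {ρ : GroupAlg k p r f η →ₐ[k] Module.End k C}

lemma apply_unit (h : IsSuperAction ρ) (x : GroupAlg k p r f η) :
    ρ x (unit k) = aug (k := k) x • unit k := by
  induction x using groupAlg_induction with
  | hC c => rw [AlgHom.commutes, AlgHom.commutes]; rfl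
  | hadd x y hx hy => rw [map_add, map_add, LinearMap.add_apply, hx, hy, add_smul]
  | hu x i hx =>
    rw [map_mul, map_mul, Module.End.mul_apply, h.unit_u, aug_uGen, mul_zero, zero_smul, map_zero]
  | hv x hx =>
    rw [map_mul, map_mul, Module.End.mul_apply, h.unit_v, aug_vGen, mul_zero, zero_smul, map_zero]

lemma parity_apply (h : IsSuperAction ρ) (x : GroupAlg k p r f η) (c : C) :
    parity (k := k) (ρ x c) =
      ρ (AugmentedSuperalgebra.parity (k := k) x) (parity (k := k) c) := by
  induction x using groupAlg_induction generalizing c with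
  | hC a =>
    rw [AlgHom.commutes, AlgHom.commutes, AlgHom.commutes, Module.algebraMap_end_apply,
      Module.algebraMap_end_apply, map_smul]
  | hadd x y hx hy =>
    rw [map_add, map_add, map_add, LinearMap.add_apply, LinearMap.add_apply, map_add, hx, hy]
  | hu x i hx =>
    rw [map_mul, map_mul, map_mul, Module.End.mul_apply, Module.End.mul_apply, hx, parity_uGen,
      h.parity_u]
  | hv x hx =>
    rw [map_mul, map_mul, Module.End.mul_apply, hx, parity_vGen, h.parity_v, map_neg, mul_neg,
      map_neg, map_mul, LinearMap.neg_apply]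
    rfl

variable [NeZero (2 : k)]

/-- The operator of an even element is a comodule endomorphism, that of an odd one is so up to the
parity in the second factor. Here `x + P x` and `x - P x` are twice the even and the odd part of
`x`. -/
lemma rTensor_comul (h : IsSuperAction ρ) (x : GroupAlg k p r f η) (c : C) :
    (2 : k) • (ρ x).rTensor C (CoalgebraStruct.comul (R := k) c) =
      CoalgebraStruct.comul (R := k) (ρ (x + AugmentedSuperalgebra.parity (k := k) x) c) +
      (parity (k := k)).lTensor C (CoalgebraStruct.comul (R := k)
        (ρ (x - AugmentedSuperalgebra.parity (k := k) x) c)) := by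
  have hPP : ∀ z : C ⊗[k] C, (parity (k := k)).lTensor C ((parity (k := k)).lTensor C z) = z := by
    intro z
    have : parity (k := k) ∘ₗ parity (k := k) = (LinearMap.id : C →ₗ[k] C) :=
      LinearMap.ext parity_parity
    rw [← LinearMap.comp_apply, ← LinearMap.lTensor_comp, this, LinearMap.lTensor_id,
      LinearMap.id_apply]
  induction x using groupAlg_induction generalizing c with
  | hC a =>
    have : ρ (algebraMap k _ a) = a • LinearMap.id := by rw [AlgHom.commutes]; rfl
    rw [(AugmentedSuperalgebra.parity (k := k)).commutes, sub_self, map_zero,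
      LinearMap.zero_apply, map_zero, map_zero, add_zero, map_add, this, ← two_smul k,
      LinearMap.rTensor_smul, LinearMap.rTensor_id]
    simp
  | hadd x y hx hy =>
    rw [map_add, LinearMap.rTensor_add, LinearMap.add_apply, smul_add, hx, hy]
    simp only [map_add, map_sub, LinearMap.add_apply, LinearMap.sub_apply]
    abel
  | hu x i hx =>
    rw [map_mul, Module.End.mul_eq_comp, LinearMap.rTensor_comp, LinearMap.comp_apply, h.comul_u,
      hx, map_mul, parity_uGen, ← add_mul, ← sub_mul, map_mul, map_mul]
    rfl
  | hv x hx =>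
    have hcomm : ∀ z : C ⊗[k] C, (ρ x).rTensor C ((parity (k := k)).lTensor C z) =
        (parity (k := k)).lTensor C ((ρ x).rTensor C z) := by
      intro z
      rw [← LinearMap.comp_apply, ← LinearMap.comp_apply, LinearMap.rTensor_comp_lTensor,
        LinearMap.lTensor_comp_rTensor]
    rw [map_mul, Module.End.mul_eq_comp, LinearMap.rTensor_comp, LinearMap.comp_apply, h.comul_v,
      hcomm, ← map_smul, hx, map_mul, parity_vGen, mul_neg, ← sub_eq_add_neg, sub_neg_eq_add,
      ← add_mul, ← sub_mul, map_mul, map_mul, map_add, hPP, add_comm]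
    rfl

variable [CharP k p]

variable (ρ) in
/-- The map `c ↦ (x ↦ ε(x c))` from `C` to the functionals on the group algebra. -/
def dualLin : C →ₗ[k] DualCoord k (GroupAlg k p r f η) :=
  toDual.symm.toLinearMap ∘ₗ
    (LinearMap.llcomp k (GroupAlg k p r f η) C k (CoalgebraStruct.counit (R := k))) ∘ₗ
      ρ.toLinearMap.flip

omit [Fact p.Prime] [NeZero (2 : k)] [CharP k p] in
@[simp] lemma toDual_dualLin (c : C) (x : GroupAlg k p r f η) :
    toDual (dualLin ρ c) x = CoalgebraStruct.counit (R := k) (ρ x c) := rfl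

/-- The homomorphism `C → (k𝕄_{r;f,η})^*` of supercoalgebras given by an action. -/
def toHom (h : IsSuperAction ρ) : Hom k C (DualCoord k (GroupAlg k p r f η)) where
  toLin := dualLin ρ
  map_comul c := by
    apply dual_ext2
    intro x y
    set ε : C →ₗ[k] k := CoalgebraStruct.counit (R := k) with hε
    set T : C ⊗[k] C →ₗ[k] k :=
      LinearMap.mul' k k ∘ₗ TensorProduct.map ε (ε ∘ₗ ρ y) with hT
    have h1 : ∀ z : C ⊗[k] C, dualPair k _ (TensorProduct.map (dualLin ρ) (dualLin ρ) z) (x ⊗ₜ y) =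
        T ((ρ x).rTensor C z) := by
      intro z
      induction z with
      | zero => simp
      | add a b ha hb => simp only [map_add, LinearMap.add_apply, ha, hb]
      | tmul a b => rw [TensorProduct.map_tmul, dualPair_tmul]; rfl
    have h2 : ∀ (g : C →ₗ[k] k) (c : C), LinearMap.mul' k k (TensorProduct.map ε g
        (CoalgebraStruct.comul (R := k) c)) = g c := by
      intro g c
      have hz : ∀ z : C ⊗[k] C, LinearMap.mul' k k (TensorProduct.map ε g z) =
          g (TensorProduct.lid k C (ε.rTensor C z)) := by
        intro z
        induction z with
        | zero => simp
        | add a b ha hb => simp only [map_add, ha, hb]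
        | tmul a b => simp
      rw [hz, hε, Coalgebra.rTensor_counit_comul]
      simp
    have h3 : ∀ c, T ((parity (k := k)).lTensor C (CoalgebraStruct.comul (R := k) c)) =
        ε (ρ (AugmentedSuperalgebra.parity (k := k) y) c) := by
      intro c
      have : ∀ z : C ⊗[k] C, T ((parity (k := k)).lTensor C z) =
          LinearMap.mul' k k (TensorProduct.map ε (ε ∘ₗ ρ y ∘ₗ parity (k := k)) z) := by
        intro z
        induction z with
        | zero => simp
        | add a b ha hb => simp only [map_add, ha, hb]
        | tmul a b => rfl
      rw [this, h2]
      change ε (ρ y (parity (k := k) c)) = _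
      rw [hε, ← counit_parity, h.parity_apply, parity_parity]
    have h4 : (2 : k) • T ((ρ x).rTensor C (CoalgebraStruct.comul (R := k) c)) =
        ε (ρ (y * (x + AugmentedSuperalgebra.parity (k := k) x)) c) +
        ε (ρ (AugmentedSuperalgebra.parity (k := k) y *
          (x - AugmentedSuperalgebra.parity (k := k) x)) c) := by
      rw [← map_smul, h.rTensor_comul, map_add, h3]
      congr 1
      · rw [hT, LinearMap.comp_apply, h2, map_mul]
        rfl
      · rw [map_mul]
        rfl
    rw [h1]
    refine (dualPair_comul _ _).trans ?_
    rw [toDual_dualLin, koszulMul_tmul, map_smul, LinearMap.smul_apply, map_smul,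
      inv_smul_eq_iff₀ (NeZero.ne _), h4, ← map_add, ← LinearMap.add_apply, ← map_add]
    congr 3
    ring
  map_counit c := by
    change toDual (dualLin ρ c) 1 = _
    rw [toDual_dualLin, map_one, Module.End.one_apply]
  map_unit := dualCoord_ext fun x => by
    rw [toDual_dualLin, h.apply_unit, map_smul, counit_unit, smul_eq_mul, mul_one]
    rfl
  map_parity c := dualCoord_ext fun x => by
    change _ = toDual (dualLin ρ c) (AugmentedSuperalgebra.parity (k := k) x)
    rw [toDual_dualLin, toDual_dualLin, ← counit_parity, h.parity_apply, parity_parity]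

end IsSuperAction
end action
end MultiparameterSupergroup

namespace UnitalSupercoalgebra
section slice
variable {k A : Type*} [Field k] [AddCommGroup A] [Module k A] [UnitalSupercoalgebra k A]

lemma slice_comm (h : ∀ a : A, TensorProduct.comm k A A (CoalgebraStruct.comul (R := k) a) =
    CoalgebraStruct.comul (R := k) a) (φ ψ : A →ₗ[k] k) (a : A) :
    slice φ (slice ψ a) = slice ψ (slice φ a) := by
  have : ∀ z : A ⊗[k] A, TensorProduct.lid k A (φ.rTensor A ((slice ψ).lTensor A z)) =
      slice ψ (TensorProduct.lid k A (φ.rTensor A z)) := by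
    intro z
    induction z with
    | zero => simp
    | add x y hx hy => simp only [map_add, hx, hy]
    | tmul x y => simp
  change TensorProduct.lid k A (φ.rTensor A (CoalgebraStruct.comul (R := k) (slice ψ a))) = _
  rw [← lTensor_slice_comul h, this]
  rfl

lemma slice_parity (φ : A →ₗ[k] k) (a : A) : slice φ (parity (k := k) a) =
    parity (k := k) (slice (φ ∘ₗ parity (k := k)) a) := by
  simp only [slice, LinearMap.comp_apply, comul_parity]
  generalize CoalgebraStruct.comul (R := k) a = z
  induction z with
  | zero => simp
  | add x y hx hy => simp only [map_add, hx, hy]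
  | tmul x y => simp

lemma slice_unit (φ : A →ₗ[k] k) : slice φ (unit k) = φ (unit k) • (unit k : A) := by
  simp [slice, comul_unit]

lemma slice_neg (φ : A →ₗ[k] k) : slice (-φ) = -slice φ := by
  ext a
  simp only [slice, LinearMap.comp_apply, LinearMap.neg_apply, LinearEquiv.coe_coe]
  generalize CoalgebraStruct.comul (R := k) a = z
  induction z with
  | zero => simp
  | add x y hx hy => rw [map_add, map_add, hx, hy, map_add, map_add, neg_add]
  | tmul x y => simp

lemma map_slice {C : Type*} [AddCommGroup C] [Module k C] [UnitalSupercoalgebra k C]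
    (j : Hom k C A) (φ : A →ₗ[k] k) (c : C) :
    j.toLin (slice (φ ∘ₗ j.toLin) c) = slice φ (j.toLin c) := by
  simp only [slice, LinearMap.comp_apply, j.map_comul]
  generalize CoalgebraStruct.comul (R := k) c = z
  induction z with
  | zero => simp
  | add x y hx hy => simp only [map_add, hx, hy]
  | tmul x y => simp

end slice
end UnitalSupercoalgebra

namespace MultiparameterSupergroup
open UnitalSupercoalgebra Hochschild
open AugmentedSuperalgebra (aug DualCoord toDual)

/-! ### The operators of `u_l` and `v` on `k[𝕄_{r;s}]` -/

section operators
variable {k : Type*} [Field k] {p r : ℕ} [Fact p.Prime] [CharP k p]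

lemma parity_mono (i j e : ℕ) :
    parity (k := k) (mono k p r i j e) = (-1 : k) ^ e • mono k p r i j e := by
  change parityHom k p r _ = _
  rw [mono, map_mul, map_mul, map_pow, map_pow, parity_theta, parity_sigma, parity_tau, neg_pow,
    mul_left_comm, Algebra.smul_def]
  simp

lemma counit_mono (i j e : ℕ) : CoalgebraStruct.counit (R := k) (mono k p r i j e) =
    if i = 0 ∧ j = 0 ∧ e = 0 then 1 else 0 := by
  have h : CoalgebraStruct.counit (R := k) (mono k p r i j e) = counitHom k p r (mono k p r i j e) :=
    rfl
  rw [h, mono, map_mul, map_mul, map_pow, map_pow, counit_theta, counit_sigma, counit_tau,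
    zero_pow_eq, zero_pow_eq]
  split_ifs <;> simp_all

lemma coeff_comp_parity (a u d : ℕ) : coeff k p r a u d ∘ₗ parity (k := k) =
    (-1 : k) ^ d • coeff k p r a u d := by
  apply coord_linearMap_ext
  intro i hi j e he
  rw [LinearMap.comp_apply, parity_mono, map_smul, LinearMap.smul_apply, coeff_mono hi he]
  split_ifs with h
  · rw [h.2.2]
  · rw [smul_zero, smul_zero]

/-- By the theorem of Lucas, both sides are the `l`-th `p`-adic digit of `n`, modulo `p`. -/
lemma choose_prime_pow_cast (n l : ℕ) : (n.choose (p ^ l) : k) = (n / p ^ l : ℕ) := by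
  rw [CharP.cast_eq_iff_mod_eq k p]
  induction l generalizing n with
  | zero => simp
  | succ l ih =>
    have h := Choose.choose_modEq_choose_mod_mul_choose_div_nat (n := n) (k := p ^ (l + 1)) (p := p)
    rw [pow_succ, Nat.mul_mod_left, Nat.choose_zero_right, one_mul,
      Nat.mul_div_cancel _ (Fact.out : p.Prime).pos] at h
    rw [pow_succ, h, ih, Nat.div_div_eq_div_mul, mul_comm p]

variable (k p r) in
/-- The operator attached to the functional dual to `θ^{p^l}`: the derivation in the `l`-th
`p`-adic digit of the exponent of `θ`. -/
def thetaDer (l : ℕ) : Module.End k (Coord k p r) := slice (coeff k p r (p ^ l) 0 0)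

lemma thetaDer_pow_mono (l n : ℕ) {i e : ℕ} (j : ℕ) (hi : i < p ^ (r - 1)) (he : e < 2) :
    (thetaDer k p r l ^ n) (mono k p r i j e) =
      ((i / p ^ l).descFactorial n : k) • mono k p r (i - n * p ^ l) j e := by
  induction n with
  | zero => simp
  | succ n ih =>
    have h : (i - n * p ^ l) / p ^ l = i / p ^ l - n := by
      rw [mul_comm, Nat.sub_mul_div]
    rw [pow_succ', Module.End.mul_apply, ih, map_smul, thetaDer,
      slice_coeff_zero _ _ _ (by omega) he, if_pos (Nat.zero_le _), choose_prime_pow_cast, h,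
      smul_smul, Nat.descFactorial_succ, Nat.sub_zero, Nat.cast_mul, mul_comm, Nat.sub_sub,
      Nat.succ_mul]

lemma thetaDer_pow_prime (l : ℕ) : thetaDer k p r l ^ p = 0 := by
  apply coord_linearMap_ext
  intro i hi j e he
  have : ((i / p ^ l).descFactorial p : k) = 0 := by
    rw [CharP.cast_eq_zero_iff k p]
    exact ((Fact.out : p.Prime).dvd_factorial.mpr le_rfl).trans (Nat.factorial_dvd_descFactorial _ _)
  rw [thetaDer_pow_mono l p j hi he, this, zero_smul, LinearMap.zero_apply]

lemma lowerSigma_one_pow (n : ℕ) : (lowerSigma k p r 1 : Module.End k (Coord k p r)) ^ n =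
    lowerSigma k p r n := by
  apply coord_linearMap_ext
  intro i hi j e he
  induction n with
  | zero => rw [pow_zero, lowerSigma_mono _ _ hi he, if_pos (Nat.zero_le _)]; rfl
  | succ n ih =>
    rw [pow_succ', Module.End.mul_apply, ih, lowerSigma_mono _ _ hi he, lowerSigma_mono _ _ hi he]
    split_ifs with h1 h2 h2
    · rw [lowerSigma_mono _ _ hi he, if_pos (by omega), Nat.sub_sub]
    · rw [lowerSigma_mono _ _ hi he, if_neg (by omega)]
    · omega
    · rw [map_zero]

variable (k p r) in
/-- The operator attached to the functional dual to `τ`, up to the sign and the parity that make it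
odd. -/
def tauDer : Module.End k (Coord k p r) := -(parity (k := k) ∘ₗ slice (coeff k p r 0 0 1))

lemma tauDer_mono_zero {i : ℕ} (j : ℕ) (hi : i < p ^ (r - 1)) :
    tauDer k p r (mono k p r i j 0) = if p ≤ j then mono k p r i (j - p) 1 else 0 := by
  rw [tauDer, LinearMap.neg_apply, LinearMap.comp_apply, slice_coeff_tau_zero j hi]
  split_ifs
  · rw [parity_mono, pow_one, neg_one_smul, neg_neg]
  · rw [map_zero, neg_zero]

lemma tauDer_mono_one {i : ℕ} (j : ℕ) (hi : i < p ^ (r - 1)) :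
    tauDer k p r (mono k p r i j 1) = -mono k p r i j 0 := by
  rw [tauDer, LinearMap.neg_apply, LinearMap.comp_apply, slice_coeff_tau_one j hi, parity_mono,
    pow_zero, one_smul]

/-- The relation `u_{r-1}^p + v^2 = 0` for the operators: it comes from the terms
`σ_u τ ⊗ σ_v τ` with `u + v + p = i` of `Δ(σ_i)`. -/
lemma tauDer_sq : lowerSigma k p r p + tauDer k p r ^ 2 = 0 := by
  apply coord_linearMap_ext
  intro i hi j e he
  rw [LinearMap.add_apply, pow_two, Module.End.mul_apply, lowerSigma_mono _ _ hi he,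
    LinearMap.zero_apply]
  interval_cases e
  · rw [tauDer_mono_zero j hi]
    split_ifs
    · rw [tauDer_mono_one _ hi, add_neg_cancel]
    · rw [map_zero, add_zero]
  · rw [tauDer_mono_one j hi, map_neg, tauDer_mono_zero j hi]
    split_ifs
    · rw [add_neg_cancel]
    · rw [neg_zero, add_zero]

end operators

section subaction
variable {k : Type*} [Field k] {p r : ℕ} [Fact p.Prime] [CharP k p] {s : ℕ}

lemma coordSub_comul_comm (a : coordSub k p r s) :
    TensorProduct.comm k _ _ (CoalgebraStruct.comul (R := k) a) =
      CoalgebraStruct.comul (R := k) a := by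
  have hinj := TensorProduct.map_injective_of_flat_flat (R := k) _ _
    (coordSubIncl_injective (k := k) (p := p) (r := r) s)
    (coordSubIncl_injective (k := k) (p := p) (r := r) s)
  apply hinj
  have h : ∀ z, TensorProduct.map (coordSubIncl k p r s).toLin (coordSubIncl k p r s).toLin
      (TensorProduct.comm k _ _ z) = TensorProduct.comm k _ _
        (TensorProduct.map (coordSubIncl k p r s).toLin (coordSubIncl k p r s).toLin z) := by
    intro z
    induction z with
    | zero => simp
    | add x y hx hy => simp only [map_add, hx, hy]
    | tmul x y => simp
  rw [h, ← (coordSubIncl k p r s).map_comul, coord_comul_comm]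

variable [NeZero r]

variable (k p r) in
/-- The functionals `u_l` on `k[𝕄_r]`: dual to `θ^{p^l}`, where `θ^{p^{r-1}} = σ_1`. -/
def uFunctional (l : Fin r) : Coord k p r →ₗ[k] k :=
  if l = lastIdx r then coeff k p r 0 1 0 else coeff k p r (p ^ (l : ℕ)) 0 0

lemma uFunctional_last : uFunctional k p r (lastIdx r) = coeff k p r 0 1 0 := if_pos rfl

lemma uFunctional_of_ne {l : Fin r} (hl : l ≠ lastIdx r) :
    uFunctional k p r l = coeff k p r (p ^ (l : ℕ)) 0 0 := if_neg hl

lemma uFunctional_comp_parity (l : Fin r) :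
    uFunctional k p r l ∘ₗ parity (k := k) = uFunctional k p r l := by
  rw [uFunctional]
  split_ifs <;> rw [coeff_comp_parity, pow_zero, one_smul]

lemma uFunctional_unit (l : Fin r) : uFunctional k p r l (unit k) = 0 := by
  have h : (unit k : Coord k p r) = mono k p r 0 0 0 := mono_zero_zero_zero.symm
  have hp := (Fact.out : p.Prime).pos
  rw [uFunctional, h]
  split_ifs
  · rw [coeff_mono (prime_pow_pos _) two_pos, if_neg (by omega)]
  · rw [coeff_mono (prime_pow_pos _) two_pos, if_neg]
    exact fun h => absurd h.1.symm (pow_ne_zero _ hp.ne')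

variable (k p r s) in
/-- The operator of `u_l` on `k[𝕄_{r;s}]`, given by its functional. -/
def uOp (l : Fin r) : Module.End k (coordSub k p r s) :=
  slice (uFunctional k p r l ∘ₗ (coordSubIncl k p r s).toLin)

variable (k p r s) in
/-- The operator of `v` on `k[𝕄_{r;s}]`: the restriction of `tauDer`. -/
def vOp : Module.End k (coordSub k p r s) :=
  -(parity (k := k) ∘ₗ slice (coeff k p r 0 0 1 ∘ₗ (coordSubIncl k p r s).toLin))

lemma incl_uOp (l : Fin r) (c : coordSub k p r s) : (coordSubIncl k p r s).toLin (uOp k p r s l c) =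
    slice (uFunctional k p r l) ((coordSubIncl k p r s).toLin c) := map_slice _ _ c

lemma incl_uOp_pow (l : Fin r) (n : ℕ) (c : coordSub k p r s) :
    (coordSubIncl k p r s).toLin ((uOp k p r s l ^ n) c) =
    ((slice (uFunctional k p r l) : Module.End k (Coord k p r)) ^ n)
      ((coordSubIncl k p r s).toLin c) := by
  induction n with
  | zero => rfl
  | succ n ih =>
    rw [pow_succ', pow_succ', Module.End.mul_apply, Module.End.mul_apply, incl_uOp, ih]

lemma incl_uOp_last_pow (n : ℕ) (c : coordSub k p r s) :
    (coordSubIncl k p r s).toLin ((uOp k p r s (lastIdx r) ^ n) c) =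
      lowerSigma k p r n ((coordSubIncl k p r s).toLin c) := by
  rw [incl_uOp_pow, uFunctional_last, ← lowerSigma_one_pow]
  rfl

lemma incl_vOp (c : coordSub k p r s) : (coordSubIncl k p r s).toLin (vOp k p r s c) =
    tauDer k p r ((coordSubIncl k p r s).toLin c) := by
  rw [vOp, tauDer, LinearMap.neg_apply, map_neg, LinearMap.comp_apply,
    (coordSubIncl k p r s).map_parity, map_slice]
  rfl

lemma uOp_parity (l : Fin r) (c : coordSub k p r s) :
    parity (k := k) (uOp k p r s l c) = uOp k p r s l (parity (k := k) c) := by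
  have h : (uFunctional k p r l ∘ₗ (coordSubIncl k p r s).toLin) ∘ₗ parity (k := k) =
      uFunctional k p r l ∘ₗ (coordSubIncl k p r s).toLin := by
    ext c
    rw [LinearMap.comp_apply, LinearMap.comp_apply, (coordSubIncl k p r s).map_parity,
      ← LinearMap.comp_apply, uFunctional_comp_parity]
    rfl
  rw [uOp, slice_parity, h]

lemma slice_tau_parity (c : coordSub k p r s) :
    slice (coeff k p r 0 0 1 ∘ₗ (coordSubIncl k p r s).toLin) (parity (k := k) c) =
      -parity (k := k) (slice (coeff k p r 0 0 1 ∘ₗ (coordSubIncl k p r s).toLin) c) := by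
  have h : (coeff k p r 0 0 1 ∘ₗ (coordSubIncl k p r s).toLin) ∘ₗ parity (k := k) =
      -(coeff k p r 0 0 1 ∘ₗ (coordSubIncl k p r s).toLin) := by
    ext c
    rw [LinearMap.comp_apply, LinearMap.comp_apply, (coordSubIncl k p r s).map_parity,
      ← LinearMap.comp_apply, coeff_comp_parity, pow_one]
    simp
  rw [slice_parity, h, slice_neg, LinearMap.neg_apply, map_neg]

lemma uOp_last_pow_eq_zero (hs : s ≠ 0) : uOp k p r s (lastIdx r) ^ p ^ s = 0 := by
  ext1 c
  apply coordSubIncl_injective s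
  rw [incl_uOp_last_pow, LinearMap.zero_apply, map_zero, ← LinearMap.mem_ker,
    ← (isPrincipal_coordSubIncl hs).range_eq]
  exact LinearMap.mem_range_self _ c

variable {f : InsepPPoly k p}

/-- The action of `k𝕄_{r;f}` on `k[𝕄_{r;s}]`, if `T^{p^s}` divides `f`. -/
lemma exists_superAction (hs : s ≠ 0) (hf : Polynomial.X ^ p ^ s ∣ f.poly) :
    ∃ ρ : GroupAlg k p r f 0 →ₐ[k] Module.End k (coordSub k p r s), IsSuperAction ρ ∧
      (∀ l, ρ (uGen l) = uOp k p r s l) ∧ ρ vGen = vOp k p r s := by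
  have hinj := coordSubIncl_injective (k := k) (p := p) (r := r) s
  obtain ⟨ρ, hu, hv⟩ := exists_action (f := f) (η := 0) (uOp k p r s) (vOp k p r s)
    (fun i j => LinearMap.ext fun c => slice_comm coordSub_comul_comm _ _ c)
    (fun i => LinearMap.ext fun c => by
      rw [Module.End.mul_apply, Module.End.mul_apply, vOp, LinearMap.neg_apply, LinearMap.neg_apply,
        map_neg, LinearMap.comp_apply, LinearMap.comp_apply, ← uOp_parity]
      congr 2
      exact slice_comm coordSub_comul_comm _ _ c)
    (fun i hi => LinearMap.ext fun c => hinj (by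
      rw [incl_uOp_pow, uFunctional_of_ne hi]
      change (thetaDer k p r i ^ p) _ = _
      rw [thetaDer_pow_prime]
      rfl))
    (LinearMap.ext fun c => hinj (by
      rw [LinearMap.add_apply, map_add, incl_uOp_last_pow, pow_two, Module.End.mul_apply, incl_vOp,
        incl_vOp, ← Module.End.mul_apply, ← pow_two, ← LinearMap.add_apply, tauDer_sq]
      rfl))
    (by
      obtain ⟨g, hg⟩ := hf
      rw [zero_smul, add_zero, hg, map_mul, map_pow, Polynomial.aeval_X, uOp_last_pow_eq_zero hs,
        zero_mul])
  refine ⟨ρ, ⟨fun i c => ?_, fun c => ?_, fun i c => ?_, fun c => ?_, fun i => ?_, ?_⟩, hu, hv⟩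
  · rw [hu]
    exact rTensor_slice_comul _ _
  · rw [hv, vOp, LinearMap.rTensor_neg, LinearMap.neg_apply, LinearMap.neg_apply, map_neg, map_neg,
      LinearMap.rTensor_comp, LinearMap.comp_apply, LinearMap.comp_apply, rTensor_slice_comul,
      comul_parity]
    generalize CoalgebraStruct.comul (R := k)
      (slice (coeff k p r 0 0 1 ∘ₗ (coordSubIncl k p r s).toLin) c) = z
    congr 1
    induction z with
    | zero => simp
    | add x y hx hy => simp only [map_add, hx, hy]
    | tmul x y => simp [parity_parity]
  · rw [hu, uOp_parity]
  · rw [hv, vOp, LinearMap.neg_apply, LinearMap.neg_apply, LinearMap.comp_apply,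
      LinearMap.comp_apply, slice_tau_parity]
    simp
  · rw [hu, uOp, slice_unit, LinearMap.comp_apply, (coordSubIncl k p r s).map_unit,
      uFunctional_unit, zero_smul]
  · have h : (unit k : Coord k p r) = mono k p r 0 0 0 := mono_zero_zero_zero.symm
    rw [hv, vOp, LinearMap.neg_apply, LinearMap.comp_apply, slice_unit, LinearMap.comp_apply,
      (coordSubIncl k p r s).map_unit, h, coeff_mono (prime_pow_pos _) two_pos, if_neg (by omega),
      zero_smul, map_zero, neg_zero]

end subaction
end MultiparameterSupergroup

namespace MultiparameterSupergroup
open UnitalSupercoalgebra Hochschild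
open AugmentedSuperalgebra (aug DualCoord toDual mulDual toDual_mulDual dualCoord_ext)

/-! ### The pairing of `k𝕄_{r;f}` with `k[𝕄_{r;s}]` -/

section digits
variable {p : ℕ} {a : ℕ → ℕ}

lemma sum_mul_pow_lt {m : ℕ} (h : ∀ l < m, a l < p) :
    ∑ l ∈ Finset.range m, a l * p ^ l < p ^ m := by
  induction m with
  | zero => simp
  | succ m ih =>
    rw [Finset.sum_range_succ, pow_succ']
    have h1 := ih fun l hl => h l (by omega)
    have h2 : (a m + 1) * p ^ m ≤ p * p ^ m := Nat.mul_le_mul_right _ (h m (by omega))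
    rw [Nat.succ_mul] at h2
    omega

lemma digit_sum_mul_pow {m l : ℕ} (h : ∀ l < m, a l < p) (hl : l < m) :
    (∑ l ∈ Finset.range m, a l * p ^ l) / p ^ l % p = a l := by
  induction m with
  | zero => omega
  | succ m ih =>
    have hp : 0 < p := lt_of_le_of_lt (Nat.zero_le _) (h l hl)
    rw [Finset.sum_range_succ]
    rcases Nat.lt_succ_iff_lt_or_eq.mp hl with h1 | rfl
    · have h2 : a m * p ^ m = p ^ l * (p * (a m * p ^ (m - l - 1))) := by
        have : p ^ m = p ^ l * (p * p ^ (m - l - 1)) := by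
          rw [← pow_succ', ← pow_add]
          congr 1
          omega
        rw [this]
        ring
      rw [h2, Nat.add_mul_div_left _ _ (pow_pos hp l), Nat.add_mul_mod_self_left,
        ih (fun l hl => h l (by omega)) h1]
    · rw [Nat.add_mul_div_right _ _ (pow_pos hp l),
        Nat.div_eq_of_lt (sum_mul_pow_lt fun l hl => h l (by omega)), zero_add,
        Nat.mod_eq_of_lt (h l hl)]

lemma sum_digit_mul_pow (i m : ℕ) :
    ∑ l ∈ Finset.range m, i / p ^ l % p * p ^ l = i % p ^ m := by
  induction m with
  | zero => simp [Nat.mod_one]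
  | succ m ih => rw [Finset.sum_range_succ, ih, Nat.mod_pow_succ, mul_comm]

/-- Reindexing of a product over the indices different from the last one. -/
@[to_additive]
lemma prod_erase_lastIdx {r : ℕ} [NeZero r] {M : Type*} [CommMonoid M] (F : Fin r → M) (G : ℕ → M)
    (h : ∀ l : Fin r, l ≠ lastIdx r → F l = G l) :
    ∏ l ∈ Finset.univ.erase (lastIdx r), F l = ∏ l ∈ Finset.range (r - 1), G l := by
  have hr := NeZero.pos r
  refine Finset.prod_nbij (fun l => (l : ℕ)) ?_ ?_ ?_ ?_
  · intro l hl
    have h1 : (l : ℕ) ≠ r - 1 := fun h => (Finset.mem_erase.mp hl).1 (Fin.ext h)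
    rw [Finset.mem_range]
    omega
  · exact fun _ _ _ _ h => Fin.ext h
  · intro l hl
    have hl' : l < r - 1 := by simpa using hl
    refine ⟨⟨l, by omega⟩, ?_, rfl⟩
    rw [Finset.mem_coe, Finset.mem_erase]
    refine ⟨fun h => ?_, Finset.mem_univ _⟩
    have h1 : l = r - 1 := congrArg Fin.val h
    omega
  · exact fun l hl => h l (Finset.mem_erase.mp hl).1

end digits

section evaluation
variable {k : Type*} [Field k] {p r : ℕ} [Fact p.Prime] [CharP k p]

variable (k p r) in
/-- The composite of the operators `u_l^{a_l}` for `l < m`. -/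
def thetaOp (a : ℕ → ℕ) : ℕ → Module.End k (Coord k p r)
  | 0 => 1
  | m + 1 => thetaOp a m * thetaDer k p r m ^ a m

/-- The composite lowers the exponent of `θ`, up to a scalar. -/
lemma thetaOp_mono (a : ℕ → ℕ) (m : ℕ) {i e : ℕ} (j : ℕ) (hi : i < p ^ (r - 1)) (he : e < 2) :
    ∃ c : k, thetaOp k p r a m (mono k p r i j e) =
      c • mono k p r (i - ∑ l ∈ Finset.range m, a l * p ^ l) j e := by
  induction m generalizing i with
  | zero => exact ⟨1, by simp [thetaOp]⟩
  | succ m ih =>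
    obtain ⟨c, hc⟩ := ih (i := i - a m * p ^ m) (by omega)
    refine ⟨((i / p ^ m).descFactorial (a m) : k) * c, ?_⟩
    rw [thetaOp, Module.End.mul_apply, thetaDer_pow_mono _ _ _ hi he, map_smul, hc, smul_smul,
      Nat.sub_sub, Finset.sum_range_succ, add_comm (a m * p ^ m)]

/-- The composite of the operators detects the exponent of `θ` with the digits `a_l`. -/
lemma counit_thetaOp_mono {a : ℕ → ℕ} {m : ℕ} (ha : ∀ l < m, a l < p) (hm : m ≤ r - 1) {i e : ℕ}
    (j : ℕ) (hi : i < p ^ m) (he : e < 2) :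
    CoalgebraStruct.counit (R := k) (thetaOp k p r a m (mono k p r i j e)) =
      if i = ∑ l ∈ Finset.range m, a l * p ^ l ∧ j = 0 ∧ e = 0 then
        ∏ l ∈ Finset.range m, ((a l).factorial : k) else 0 := by
  have hpp := (Fact.out : p.Prime).pos
  induction m generalizing i with
  | zero =>
    rw [thetaOp, Module.End.one_apply, counit_mono]
    exact if_congr (by simp) (by simp) rfl
  | succ m ih =>
    have hi' : i < p ^ (r - 1) := hi.trans_le (Nat.pow_le_pow_right hpp hm)
    have ha' : ∀ l < m, a l < p := fun l hl => ha l (by omega)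
    have hlt := sum_mul_pow_lt ha'
    have hdm := Nat.div_add_mod i (p ^ m)
    have hmod := Nat.mod_lt i (pow_pos hpp m)
    rw [mul_comm] at hdm
    have hmod0 := Nat.zero_le (i % p ^ m)
    rw [thetaOp, Module.End.mul_apply, thetaDer_pow_mono _ _ _ hi' he, map_smul, map_smul,
      smul_eq_mul, Finset.sum_range_succ, Finset.prod_range_succ]
    -- Compare the leading digit of `i` with `a_m`; the lower digits are left to the induction.
    rcases lt_trichotomy (i / p ^ m) (a m) with h | h | h
    · rw [Nat.descFactorial_eq_zero_iff_lt.mpr h, Nat.cast_zero, zero_mul, if_neg]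
      rintro ⟨h1, -⟩
      have : (i / p ^ m + 1) * p ^ m ≤ a m * p ^ m := Nat.mul_le_mul_right _ h
      rw [Nat.succ_mul] at this
      omega
    · have h2 : i - a m * p ^ m = i % p ^ m := by
        rw [h] at hdm
        exact Nat.sub_eq_of_eq_add' hdm.symm
      rw [h, Nat.descFactorial_self, h2, ih ha' (by omega) hmod, mul_ite, mul_zero,
        mul_comm ((a m).factorial : k)]
      rw [h] at hdm
      refine if_congr (and_congr_left fun _ => ?_) rfl rfl
      omega
    · obtain ⟨c, hc⟩ := thetaOp_mono (k := k) a m j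
        (show i - a m * p ^ m < p ^ (r - 1) by omega) he
      have : (a m + 1) * p ^ m ≤ i / p ^ m * p ^ m := Nat.mul_le_mul_right _ h
      rw [Nat.succ_mul] at this
      generalize i % p ^ m = q at *
      rw [hc, map_smul, counit_mono, if_neg (by omega), smul_zero, mul_zero, if_neg (by omega)]

variable [NeZero r] {s : ℕ} {f : InsepPPoly k p}

lemma incl_monomial {i j e : ℕ} (hj : j < p ^ s) : (coordSubIncl k p r s).toLin
    (thetaSub k p r s ^ i * sigmaSub k p r s j * tauSub k p r s ^ e) = mono k p r i j e := by
  have h : (coordSubIncl k p r s).toLin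
      (thetaSub k p r s ^ i * sigmaSub k p r s j * tauSub k p r s ^ e) =
      theta ^ i * (coordSubIncl k p r s).toLin (sigmaSub k p r s j) * tau ^ e := rfl
  rw [h, coordSubIncl_sigmaSub hj]
  rfl

lemma incl_apply_prod {ρ : GroupAlg k p r f 0 →ₐ[k] Module.End k (coordSub k p r s)}
    (hu : ∀ l, ρ (uGen l) = uOp k p r s l) {a : ℕ → ℕ} {w : ℕ → GroupAlg k p r f 0}
    (hw : ∀ l : Fin r, l ≠ lastIdx r → w l = uGen l) {m : ℕ} (hm : m ≤ r - 1)
    (c : coordSub k p r s) :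
    (coordSubIncl k p r s).toLin (ρ (∏ l ∈ Finset.range m, w l ^ a l) c) =
      thetaOp k p r a m ((coordSubIncl k p r s).toLin c) := by
  induction m generalizing c with
  | zero => simp [thetaOp]
  | succ m ih =>
    have hlt : m < r := by omega
    have hne : (⟨m, hlt⟩ : Fin r) ≠ lastIdx r := fun h => by
      have : m = r - 1 := congrArg Fin.val h
      omega
    rw [Finset.prod_range_succ, map_mul, Module.End.mul_apply, ih (by omega), map_pow,
      show w m = uGen ⟨m, hlt⟩ from hw ⟨m, hlt⟩ hne, hu, incl_uOp_pow, uFunctional_of_ne hne,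
      thetaOp, Module.End.mul_apply]
    rfl

/-- The pairing of the monomials in the `u_l` and `v` with the monomials `θ^i σ_j τ^e`. -/
theorem counit_apply_monomial {ρ : GroupAlg k p r f 0 →ₐ[k] Module.End k (coordSub k p r s)}
    (hu : ∀ l, ρ (uGen l) = uOp k p r s l) (hv : ρ vGen = vOp k p r s) {a : ℕ → ℕ}
    {w : ℕ → GroupAlg k p r f 0} (hw : ∀ l : Fin r, l ≠ lastIdx r → w l = uGen l)
    (ha : ∀ l < r - 1, a l < p) (A : ℕ) {i j e e' : ℕ} (hi : i < p ^ (r - 1)) (hj : j < p ^ s)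
    (he : e < 2) (he' : e' < 2) :
    CoalgebraStruct.counit (R := k) (ρ ((∏ l ∈ Finset.range (r - 1), w l ^ a l) *
      (uGen (lastIdx r) ^ A * vGen ^ e'))
        (thetaSub k p r s ^ i * sigmaSub k p r s j * tauSub k p r s ^ e)) =
      if e = e' ∧ A = j ∧ ∑ l ∈ Finset.range (r - 1), a l * p ^ l = i then
        (-1) ^ e * ∏ l ∈ Finset.range (r - 1), ((a l).factorial : k) else 0 := by
  -- The operator of `v^{e'}` leaves a monomial without `τ` exactly if `e = e'`, and the counit
  -- kills those with `τ`.
  have hV : ∃ (c : k) (j' e'' : ℕ), e'' < 2 ∧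
      (coordSubIncl k p r s).toLin (ρ (vGen ^ e')
        (thetaSub k p r s ^ i * sigmaSub k p r s j * tauSub k p r s ^ e)) =
        c • mono k p r i j' e'' ∧ (e = e' → c = (-1) ^ e ∧ j' = j ∧ e'' = 0) ∧
        (e ≠ e' → e'' = 1) := by
    rw [map_pow, hv]
    interval_cases e' <;> interval_cases e
    · exact ⟨1, j, 0, two_pos, by rw [pow_zero, Module.End.one_apply, incl_monomial hj, one_smul],
        by simp, by simp⟩
    · exact ⟨1, j, 1, one_lt_two,
        by rw [pow_zero, Module.End.one_apply, incl_monomial hj, one_smul], by simp, by simp⟩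
    · refine ⟨if p ≤ j then 1 else 0, j - p, 1, one_lt_two, ?_, by simp, by simp⟩
      rw [pow_one, incl_vOp, incl_monomial hj, tauDer_mono_zero j hi, ite_smul, one_smul, zero_smul]
    · refine ⟨-1, j, 0, two_pos, ?_, by simp, by simp⟩
      rw [pow_one, incl_vOp, incl_monomial hj, tauDer_mono_one j hi, neg_one_smul]
  obtain ⟨c, j', e'', he'', hV, h1, h2⟩ := hV
  rw [← (coordSubIncl k p r s).map_counit, map_mul ρ, Module.End.mul_apply,
    incl_apply_prod hu hw le_rfl, map_mul ρ, Module.End.mul_apply, map_pow ρ, hu, incl_uOp_last_pow,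
    hV, map_smul, lowerSigma_mono _ _ hi he'', map_smul, map_smul, smul_eq_mul]
  rcases eq_or_ne e e' with h | h
  · obtain ⟨rfl, rfl, rfl⟩ := h1 h
    by_cases hA : A ≤ j'
    · rw [if_pos hA, counit_thetaOp_mono ha le_rfl _ hi two_pos, mul_ite, mul_zero]
      refine if_congr ?_ rfl rfl
      constructor
      · rintro ⟨h3, h4, -⟩
        exact ⟨h, by omega, h3.symm⟩
      · rintro ⟨-, h4, h3⟩
        exact ⟨h3.symm, by omega, rfl⟩
    · rw [if_neg hA, map_zero, map_zero, mul_zero, if_neg (by omega)]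
  · obtain rfl := h2 h
    by_cases hA : A ≤ j'
    · rw [if_pos hA, counit_thetaOp_mono ha le_rfl _ hi one_lt_two, if_neg (by omega), mul_zero,
        if_neg (by tauto)]
    · rw [if_neg hA, map_zero, map_zero, mul_zero, if_neg (by tauto)]

lemma coordSub_linearMap_ext (hs : s ≠ 0) {V : Type*} [AddCommGroup V] [Module k V]
    {F G : coordSub k p r s →ₗ[k] V}
    (h : ∀ i < p ^ (r - 1), ∀ j < p ^ s, ∀ e < 2,
      F (thetaSub k p r s ^ i * sigmaSub k p r s j * tauSub k p r s ^ e) =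
      G (thetaSub k p r s ^ i * sigmaSub k p r s j * tauSub k p r s ^ e)) : F = G := by
  have key : Submodule.span k {b | ∃ i j e, i < p ^ (r - 1) ∧ j < p ^ s ∧ e < 2 ∧
      b = mono k p r i j e} ≤
      (LinearMap.eqLocus F G).map (coordSubIncl k p r s).toLin := by
    rw [Submodule.span_le]
    rintro _ ⟨i, j, e, hi, hj, he, rfl⟩
    exact ⟨_, h i hi j hj e he, incl_monomial hj⟩
  ext c
  obtain ⟨c', hc', h⟩ := key (coordSub_le_span hs c.2)
  obtain rfl : c' = c := Subtype.ext h
  exact hc'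

end evaluation

section spanning
variable {k : Type*} [Field k] {p r : ℕ} [NeZero r] {f : InsepPPoly k p} {η : k}

/-- A functional on the group algebra that vanishes on the multiples of `u_{r-1}^N` is determined by
its values at the monomials with exponents bounded by `p` (for `u_l`, `l < r - 1`), `N` (for
`u_{r-1}`) and `2` (for `v`). -/
lemma eq_zero_of_monomials {N : ℕ} {φ : GroupAlg k p r f η →ₗ[k] k}
    (hN : ∀ x, φ (uGen (lastIdx r) ^ N * x) = 0)
    (h : ∀ a : Fin r → ℕ, (∀ l, l ≠ lastIdx r → a l < p) → ∀ j < N, ∀ e < 2,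
      φ ((∏ l ∈ Finset.univ.erase (lastIdx r), uGen l ^ a l) *
        (uGen (lastIdx r) ^ j * vGen ^ e)) = 0) : φ = 0 := by
  have key : φ ∘ₗ (groupAlgMk k p r f η).toLinearMap = 0 := by
    apply MvPolynomial.linearMap_ext
    intro d
    apply LinearMap.ext_ring
    change φ (groupAlgMk k p r f η (MvPolynomial.monomial d 1)) = 0
    have hd : groupAlgMk k p r f η (MvPolynomial.monomial d 1) =
        vGen ^ d none * ∏ l, uGen l ^ d (some l) := by
      rw [MvPolynomial.monomial_eq, map_one, one_mul, Finsupp.prod_fintype _ _ (fun _ => pow_zero _),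
        Fintype.prod_option, map_mul, map_pow, map_prod]
      simp only [map_pow]
      rfl
    have hv : (vGen : GroupAlg k p r f η) ^ d none =
        (-1 : k) ^ (d none / 2) • (uGen (lastIdx r) ^ (p * (d none / 2)) * vGen ^ (d none % 2)) := by
      have h2 : (vGen : GroupAlg k p r f η) ^ 2 = (-1 : k) • uGen (lastIdx r) ^ p := by
        rw [neg_one_smul]
        exact eq_neg_of_add_eq_zero_right uGen_last_pow
      conv_lhs => rw [← Nat.div_add_mod (d none) 2]
      rw [pow_add, pow_mul, h2, smul_pow, ← pow_mul, smul_mul_assoc]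
    -- As `v² = -u_{r-1}^p`, the powers of `v` contribute to the exponent of `u_{r-1}`.
    set j := p * (d none / 2) + d (some (lastIdx r)) with hj
    have hd' : groupAlgMk k p r f η (MvPolynomial.monomial d 1) = (-1 : k) ^ (d none / 2) •
        ((∏ l ∈ Finset.univ.erase (lastIdx r), uGen l ^ d (some l)) *
          (uGen (lastIdx r) ^ j * vGen ^ (d none % 2))) := by
      rw [hd, hv, ← Finset.prod_erase_mul _ _ (Finset.mem_univ (lastIdx r)), hj, pow_add,
        smul_mul_assoc]
      congr 1
      ring
    rw [hd', map_smul]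
    by_cases hp : ∀ l, l ≠ lastIdx r → d (some l) < p
    · by_cases hjN : j < N
      · rw [h (fun l => d (some l)) hp j hjN _ (Nat.mod_lt _ two_pos), smul_zero]
      · have : (∏ l ∈ Finset.univ.erase (lastIdx r), uGen l ^ d (some l)) *
            (uGen (lastIdx r) ^ j * vGen ^ (d none % 2)) =
            (uGen (lastIdx r) : GroupAlg k p r f η) ^ N * ((uGen (lastIdx r)) ^ (j - N) *
              (vGen ^ (d none % 2) *
              ∏ l ∈ Finset.univ.erase (lastIdx r), uGen l ^ d (some l))) := by
          rw [← mul_assoc, ← mul_assoc, ← mul_assoc, ← pow_add, Nat.add_sub_of_le (by omega)]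
          ring
        rw [this, hN, smul_zero]
    · push Not at hp
      obtain ⟨l, hl, hp⟩ := hp
      rw [Finset.prod_eq_zero (Finset.mem_erase.mpr ⟨hl, Finset.mem_univ l⟩), zero_mul, map_zero,
        smul_zero]
      rw [← Nat.add_sub_of_le hp, pow_add, uGen_pow l hl, zero_mul]
  ext x
  obtain ⟨q, rfl⟩ : ∃ q, groupAlgMk k p r f η q = x := Ideal.Quotient.mk_surjective x
  exact LinearMap.congr_fun key q

/-- If `f = T^N g` with `g(0) ≠ 0`, the ideal of `u_{r-1}^N` in `k𝕄_{r;f}` is generated by an even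
idempotent of augmentation zero, by the Chinese remainder theorem. -/
lemma exists_idempotent_of_eq_mul [Fact p.Prime] {N : ℕ} {g : Polynomial k}
    (hf : f.poly = Polynomial.X ^ N * g) (hg : g.coeff 0 ≠ 0) :
    ∃ e h : GroupAlg k p r f 0, e = uGen (lastIdx r) ^ N * h ∧
      e * uGen (lastIdx r) ^ N = uGen (lastIdx r) ^ N ∧
      AugmentedSuperalgebra.parity (k := k) e = e := by
  have hco : IsCoprime (Polynomial.X ^ N) g := by
    refine IsCoprime.pow_left ?_
    rw [Polynomial.irreducible_X.coprime_iff_not_dvd, Polynomial.X_dvd_iff]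
    exact hg
  obtain ⟨A, B, hAB⟩ := hco
  set u : GroupAlg k p r f 0 := uGen (lastIdx r) with hu
  have h0 := aeval_uGen_last (k := k) (p := p) (r := r) (f := f) (η := 0)
  rw [zero_smul, add_zero, hf, map_mul, map_pow, Polynomial.aeval_X, ← hu] at h0
  have h1 := congrArg (Polynomial.aeval u) hAB
  rw [map_add, map_mul, map_mul, map_pow, Polynomial.aeval_X, map_one] at h1
  refine ⟨u ^ N * Polynomial.aeval u A, Polynomial.aeval u A, rfl, ?_, ?_⟩
  · linear_combination u ^ N * h1 - Polynomial.aeval u B * h0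
  · rw [map_mul, map_pow, hu, parity_uGen, parity_aeval_uGen]

end spanning

/-! ### The inclusion `π^*` -/

section piStar
variable {k : Type*} [Field k] {p r : ℕ} [Fact p.Prime] [CharP k p] [NeZero r] [NeZero (2 : k)]
  {s : ℕ} {f : InsepPPoly k p}

/-- The evaluation of the functionals given by an action at the monomials in `u_l` and `v`. -/
lemma IsSuperAction.toDual_toHom_monomial
    {ρ : GroupAlg k p r f 0 →ₐ[k] Module.End k (coordSub k p r s)} (hρ : IsSuperAction ρ)
    (hu : ∀ l, ρ (uGen l) = uOp k p r s l) (hv : ρ vGen = vOp k p r s) {a : Fin r → ℕ}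
    (ha : ∀ l, l ≠ lastIdx r → a l < p) (A : ℕ) {i j e e' : ℕ} (hi : i < p ^ (r - 1))
    (hj : j < p ^ s) (he : e < 2) (he' : e' < 2) :
    toDual (hρ.toHom.toLin (thetaSub k p r s ^ i * sigmaSub k p r s j * tauSub k p r s ^ e))
      ((∏ l ∈ Finset.univ.erase (lastIdx r), uGen l ^ a l) *
        (uGen (lastIdx r) ^ A * vGen ^ e')) =
      if e = e' ∧ A = j ∧ ∑ l ∈ Finset.univ.erase (lastIdx r), a l * p ^ (l : ℕ) = i
      then (-1) ^ e * ∏ l ∈ Finset.univ.erase (lastIdx r), ((a l).factorial : k) else 0 := by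
  set a' : ℕ → ℕ := fun l => if h : l < r then a ⟨l, h⟩ else 0 with ha'
  set w : ℕ → GroupAlg k p r f 0 := fun l => if h : l < r then uGen ⟨l, h⟩ else 0 with hw
  have h1 : ∀ l : Fin r, a' l = a l := fun l => by simp [ha']
  have h2 : ∀ l : Fin r, w l = uGen l := fun l => by simp [hw]
  have h3 : ∀ l < r - 1, a' l < p := by
    intro l hl
    have hlr : l < r := by omega
    refine (h1 ⟨l, hlr⟩).trans_lt (ha _ fun h => ?_)
    have : l = r - 1 := congrArg Fin.val h
    omega
  rw [prod_erase_lastIdx _ (fun l => w l ^ a' l) (fun l _ => by rw [h1, h2]),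
    prod_erase_lastIdx _ (fun l => ((a' l).factorial : k)) (fun l _ => by rw [h1]),
    sum_erase_lastIdx _ (fun l => a' l * p ^ l) (fun l _ => by rw [h1])]
  exact counit_apply_monomial hu hv (fun l _ => h2 l) h3 A hi hj he he'

variable (k p r s) in
/-- The monomial in `k𝕄_{r;f}` that is dual, up to a scalar, to `θ^i σ_j τ^e`; its exponents are
the digits of `i`. -/
def dualMonomial (f : InsepPPoly k p) (i j e : ℕ) : GroupAlg k p r f 0 :=
  (∏ l ∈ Finset.univ.erase (lastIdx r), uGen l ^ (i / p ^ (l : ℕ) % p)) *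
    (uGen (lastIdx r) ^ j * vGen ^ e)

/-- The functionals given by the action of `k𝕄_{r;f}` on `k[𝕄_{r;s}]` are exactly those that vanish
on the multiples of `u_{r-1}^{p^s}`, because the pairing of monomials is diagonal with nonzero
entries. -/
theorem IsSuperAction.toHom_injective_and_range
    {ρ : GroupAlg k p r f 0 →ₐ[k] Module.End k (coordSub k p r s)} (hρ : IsSuperAction ρ)
    (hs : s ≠ 0) (hu : ∀ l, ρ (uGen l) = uOp k p r s l) (hv : ρ vGen = vOp k p r s) :
    Function.Injective hρ.toHom.toLin ∧ ∀ φ : DualCoord k (GroupAlg k p r f 0),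
      (∀ x, toDual φ (uGen (lastIdx r) ^ p ^ s * x) = 0) → φ ∈ LinearMap.range hρ.toHom.toLin := by
  have hp := (Fact.out : p.Prime).pos
  set I := (Finset.range (p ^ (r - 1)) ×ˢ Finset.range (p ^ s)) ×ˢ Finset.range 2 with hI
  set γ : ℕ → ℕ → k := fun i e => ((-1) ^ e * ∏ l ∈ Finset.univ.erase (lastIdx r),
    ((i / p ^ (l : ℕ) % p).factorial : k)) with hγ
  have hγ0 : ∀ i e, γ i e ≠ 0 := fun i e =>
    mul_ne_zero (pow_ne_zero _ (neg_ne_zero.mpr one_ne_zero))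
      (Finset.prod_ne_zero_iff.mpr fun l _ => factorial_ne_zero_of_lt (Nat.mod_lt _ hp))
  set m : (ℕ × ℕ) × ℕ → coordSub k p r s := fun t =>
    thetaSub k p r s ^ t.1.1 * sigmaSub k p r s t.1.2 * tauSub k p r s ^ t.2 with hm
  -- `R` reads off the coefficients from the values at the dual monomials.
  set R : DualCoord k (GroupAlg k p r f 0) →ₗ[k] coordSub k p r s :=
    ∑ t ∈ I, ((γ t.1.1 t.2)⁻¹ • (LinearMap.applyₗ (dualMonomial k p r f t.1.1 t.1.2 t.2) ∘ₗ
      toDual.toLinearMap)).smulRight (m t) with hR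
  have hRa : ∀ φ, R φ = ∑ t ∈ I,
      ((γ t.1.1 t.2)⁻¹ * toDual φ (dualMonomial k p r f t.1.1 t.1.2 t.2)) • m t := by
    intro φ
    rw [hR, LinearMap.sum_apply]
    rfl
  have hsum : ∀ i < p ^ (r - 1), ∑ l ∈ Finset.univ.erase (lastIdx r),
      i / p ^ (l : ℕ) % p * p ^ (l : ℕ) = i := by
    intro i hi
    rw [sum_erase_lastIdx _ (fun l => i / p ^ l % p * p ^ l) (fun l _ => rfl), sum_digit_mul_pow,
      Nat.mod_eq_of_lt hi]
  constructor
  · have : R ∘ₗ hρ.toHom.toLin = LinearMap.id := by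
      apply coordSub_linearMap_ext hs
      intro i hi j hj e he
      rw [LinearMap.comp_apply, LinearMap.id_apply, hRa, Finset.sum_eq_single ((i, j), e)]
      · rw [dualMonomial, hρ.toDual_toHom_monomial hu hv (fun l _ => Nat.mod_lt _ hp) _ hi hj he he,
          if_pos ⟨rfl, rfl, hsum i hi⟩, inv_mul_cancel₀ (hγ0 i e), one_smul]
      · rintro ⟨⟨i', j'⟩, e'⟩ ht hne
        simp only [hI, Finset.mem_product, Finset.mem_range] at ht
        rw [dualMonomial, hρ.toDual_toHom_monomial hu hv (fun l _ => Nat.mod_lt _ hp) _ hi hj he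
          ht.2, if_neg, mul_zero, zero_smul]
        rintro ⟨rfl, rfl, h3⟩
        rw [hsum i' ht.1.1] at h3
        exact hne (by rw [h3])
      · intro h
        simp only [hI, Finset.mem_product, Finset.mem_range] at h
        exact absurd ⟨⟨hi, hj⟩, he⟩ h
    exact Function.LeftInverse.injective (LinearMap.congr_fun this)
  · intro φ hφ
    refine ⟨R φ, ?_⟩
    rw [← sub_eq_zero]
    apply toDual.injective
    rw [map_zero]
    refine eq_zero_of_monomials (N := p ^ s) (fun x => ?_) fun a ha j hj e he => ?_
    · rw [map_sub, LinearMap.sub_apply, hφ, sub_zero]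
      change CoalgebraStruct.counit (R := k) (ρ _ (R φ)) = 0
      rw [map_mul, map_pow, hu, uOp_last_pow_eq_zero hs, zero_mul, LinearMap.zero_apply, map_zero]
    · set i := ∑ l ∈ Finset.univ.erase (lastIdx r), a l * p ^ (l : ℕ) with hi
      set a' : ℕ → ℕ := fun l => if h : l < r then a ⟨l, h⟩ else 0 with ha'
      have h1 : ∀ l : Fin r, a' l = a l := fun l => by simp [ha']
      have h3 : ∀ l < r - 1, a' l < p := by
        intro l hl
        have hlr : l < r := by omega
        refine (h1 ⟨l, hlr⟩).trans_lt (ha _ fun h => ?_)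
        have : l = r - 1 := congrArg Fin.val h
        omega
      rw [sum_erase_lastIdx _ (fun l => a' l * p ^ l) (fun l _ => by rw [h1])] at hi
      have hilt : i < p ^ (r - 1) := hi ▸ sum_mul_pow_lt h3
      have hdig : ∀ l ∈ Finset.univ.erase (lastIdx r), i / p ^ (l : ℕ) % p = a l := by
        intro l hl
        have hl1 : (l : ℕ) ≠ r - 1 := fun h => (Finset.mem_erase.mp hl).1 (Fin.ext h)
        rw [hi, digit_sum_mul_pow h3 (by omega), h1]
      have hmon : (∏ l ∈ Finset.univ.erase (lastIdx r), uGen l ^ a l) *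
          (uGen (lastIdx r) ^ j * vGen ^ e) = dualMonomial k p r f i j e := by
        rw [dualMonomial]
        congr 1
        exact Finset.prod_congr rfl fun l hl => by rw [hdig l hl]
      rw [hmon, map_sub, LinearMap.sub_apply, sub_eq_zero, hRa, map_sum, map_sum,
        LinearMap.sum_apply, Finset.sum_eq_single ((i, j), e)]
      · rw [map_smul, map_smul, LinearMap.smul_apply, dualMonomial,
          hρ.toDual_toHom_monomial hu hv (fun l _ => Nat.mod_lt _ hp) _ hilt hj he he,
          if_pos ⟨rfl, rfl, hsum i hilt⟩, smul_eq_mul, mul_right_comm,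
          inv_mul_cancel₀ (hγ0 i e), one_mul]
      · rintro ⟨⟨i', j'⟩, e'⟩ ht hne
        simp only [hI, Finset.mem_product, Finset.mem_range] at ht
        have hz : toDual (hρ.toHom.toLin (m ((i', j'), e'))) (dualMonomial k p r f i j e) = 0 := by
          rw [dualMonomial]
          refine (hρ.toDual_toHom_monomial hu hv (fun l _ => Nat.mod_lt _ hp) _ ht.1.1 ht.1.2
            ht.2 he).trans (if_neg ?_)
          rintro ⟨rfl, rfl, h3⟩
          rw [hsum i hilt] at h3
          exact hne (by rw [h3])
        rw [map_smul, map_smul, LinearMap.smul_apply, hz, smul_zero]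
      · intro h
        simp only [hI, Finset.mem_product, Finset.mem_range] at h
        exact absurd ⟨⟨hilt, hj⟩, he⟩ h

/-- The inclusion `π^*` exists, is injective and induces an isomorphism of cohomology rings: it is
the homomorphism given by the action of the group algebra on `k[𝕄_{r;s}]`, and its image is the
kernel of the operator of an idempotent. -/
theorem exists_piStar (hs : s ≠ 0) {g : Polynomial k} (hf : f.poly = Polynomial.X ^ p ^ s * g)
    (hg : g.coeff 0 ≠ 0) :
    ∃ π : Hom k (coordSub k p r s) (DualCoord k (GroupAlg k p r f 0)),
      IsPiStar f π ∧ Function.Injective π.toLin ∧ Function.Bijective (cohomologyMap π) := by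
  have hps : p ^ s ≠ 0 := pow_ne_zero _ (Fact.out : p.Prime).ne_zero
  obtain ⟨ρ, hρ, hu, hv⟩ := exists_superAction (k := k) (p := p) (r := r) (f := f) hs ⟨g, hf⟩
  obtain ⟨hinj, hrange⟩ := hρ.toHom_injective_and_range hs hu hv
  obtain ⟨e, h, he, hue, hpar⟩ := exists_idempotent_of_eq_mul (r := r) hf hg
  have hρe : ρ e = 0 := by
    rw [he, map_mul, map_pow, hu, uOp_last_pow_eq_zero hs, zero_mul]
  refine ⟨hρ.toHom, ?_, hinj, AugmentedSuperalgebra.bijective_cohomologyMap_of_idempotent (e := e)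
    ?_ ?_ hpar hinj (le_antisymm ?_ ?_)⟩
  · intro i hi j hj e he a ha e' he'
    have hprod : (∏ l, uGen l ^ a l : GroupAlg k p r f 0) * vGen ^ e' =
        (∏ l ∈ Finset.univ.erase (lastIdx r), uGen l ^ a l) *
          (uGen (lastIdx r) ^ a (lastIdx r) * vGen ^ e') := by
      rw [← mul_assoc]
      exact congrArg (· * vGen ^ e')
        (Finset.prod_erase_mul Finset.univ (fun l => uGen l ^ a l) (Finset.mem_univ _)).symm
    rw [hprod]
    exact hρ.toDual_toHom_monomial hu hv ha _ hi hj he he'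
  · nth_rw 2 [he]
    rw [← mul_assoc, hue, ← he]
  · rw [he, map_mul, map_pow, aug_uGen, zero_pow hps, zero_mul]
  · rintro _ ⟨c, rfl⟩
    refine dualCoord_ext fun x => ?_
    change CoalgebraStruct.counit (R := k) (ρ (e * x) c) = 0
    rw [map_mul, hρe, zero_mul, LinearMap.zero_apply, map_zero]
  · intro φ hφ
    refine hrange φ fun x => ?_
    rw [← hue, mul_assoc, ← toDual_mulDual, LinearMap.mem_ker.mp hφ]
    rfl

/-- The factorisation of an inseparable `p`-polynomial with lowest term `a_s T^{p^s}`. -/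
lemma exists_eq_X_pow_mul {s t : ℕ} {a : ℕ → k} (hst : s ≤ t) (ha : a s ≠ 0) :
    ∃ g : Polynomial k, g.coeff 0 ≠ 0 ∧
      ∑ i ∈ Finset.Icc s t, Polynomial.C (a i) * Polynomial.X ^ p ^ i =
        Polynomial.X ^ p ^ s * g := by
  have hp := (Fact.out : p.Prime).one_lt
  refine ⟨∑ i ∈ Finset.Icc s t, Polynomial.C (a i) * Polynomial.X ^ (p ^ i - p ^ s), ?_, ?_⟩
  · rw [Polynomial.finsetSum_coeff, Finset.sum_eq_single s]
    · simpa using ha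
    · intro i hi hne
      have h1 : p ^ s < p ^ i :=
        Nat.pow_lt_pow_right hp (lt_of_le_of_ne (Finset.mem_Icc.mp hi).1 hne.symm)
      rw [Polynomial.coeff_C_mul, Polynomial.coeff_X_pow, if_neg (by omega), mul_zero]
    · exact fun h => absurd (Finset.mem_Icc.mpr ⟨le_rfl, hst⟩) h
  · rw [Finset.mul_sum]
    refine Finset.sum_congr rfl fun i hi => ?_
    rw [mul_left_comm, ← pow_add,
      Nat.add_sub_of_le (Nat.pow_le_pow_right (by omega) (Finset.mem_Icc.mp hi).1)]

end piStar
end MultiparameterSupergroup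

end

open MultiparameterSupergroup UnitalSupercoalgebra Hochschild AugmentedSuperalgebra in
theorem mainTheorem5 (k : Type*) [Field k] (p : ℕ) [Fact p.Prime] [CharP k p] [NeZero (2 : k)]
    (r : ℕ) [NeZero r] :
    (∃ Φ : CohModel k r Empty False ≃ₐ[k] Cohomology k (coordSub k p r 1),
      IsPresentation (genCochain p (thetaSub k p r 1) (tauSub k p r 1) Empty.elim) Φ) ∧
    (Function.Surjective (cohomologyMap (coordSubIncl k p r 1)) ∧
      (∃ h : Cohomology k (coordSub k p r 1),
        Represents (xCochain p (thetaSub k p r 1 ^ p ^ (r - 1))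
            - TensorAlgebra.ι k (tauSub k p r 1) * TensorAlgebra.ι k (tauSub k p r 1)) h ∧
        RingHom.ker (cohomologyMap (coordSubIncl k p r 1)) = Ideal.span {h}) ∧
      ∃ Φ : CohModel k r Empty True ≃ₐ[k] Cohomology k (Coord k p r),
        IsPresentation (genCochain p theta tau Empty.elim) Φ) ∧
    (∀ s, 2 ≤ s →
      Function.Surjective (cohomologyMap (coordSubIncl k p r s)) ∧
      (∃ h : Cohomology k (coordSub k p r s),
        Represents (wCochain k p r s) h ∧
        RingHom.ker (cohomologyMap (coordSubIncl k p r s)) = Ideal.span {h}) ∧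
      ∃ Φ : CohModel k r Unit True ≃ₐ[k] Cohomology k (coordSub k p r s),
        IsPresentation (genCochain p (thetaSub k p r s) (tauSub k p r s)
          fun _ => wCochain k p r s) Φ) ∧
    (∀ (s t : ℕ) (a : ℕ → k) (f : InsepPPoly k p), 1 ≤ s → s ≤ t → a s ≠ 0 → a t ≠ 0 →
      f.poly = ∑ i ∈ Finset.Icc s t, Polynomial.C (a i) * Polynomial.X ^ p ^ i →
      ∃ π : UnitalSupercoalgebra.Hom k (coordSub k p r s) (DualCoord k (GroupAlg k p r f 0)),
        IsPiStar f π ∧ Function.Injective π.toLin ∧ Function.Bijective (cohomologyMap π)) ∧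
    (∀ (f : InsepPPoly k p) (η : k) (hη : η ≠ 0),
      Function.Bijective (phi r f η hη) ∧
      Function.Bijective
        (cohomologyMap (dualHom (phi r f η hη) (phi_aug f η hη) (phi_parity f η hη)))) ∧
    ((∃ Ψ : Polynomial k ≃ₐ[k] Cohomology k (OddAddCoord k),
        Represents (TensorAlgebra.ι k oddTau) (Ψ Polynomial.X) ∧
        Ψ Polynomial.X ∈ homogeneousPart k (OddAddCoord k) 1 1) ∧
      ∀ (f : InsepPPoly k p) (η : k), η ≠ 0 →
        Function.Injective (qMinusStar 1 f η).toLin ∧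
        Function.Bijective (cohomologyMap (qMinusStar 1 f η))) := by
  refine ⟨?_, ⟨?_, ?_, ?_⟩, fun s hs => ?_, ?_, fun f η hη => ?_, ?_, fun f η hη => ?_⟩
  · obtain ⟨ΦA, hA⟩ := hasCoordPresentation (k := k) (p := p) (r := r)
    obtain ⟨-, Φ, hΦ⟩ := presentation_coordSub_one hA
    exact hΦ.exists_equiv
  · obtain ⟨ΦA, hA⟩ := hasCoordPresentation (k := k) (p := p) (r := r)
    exact (presentation_coordSub_one hA).1
  · rw [← wCochain_one]
    exact ker_cohomologyMap_coordSubIncl one_ne_zero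
  · obtain ⟨ΦA, hA⟩ := hasCoordPresentation (k := k) (p := p) (r := r)
    exact hA.exists_equiv
  · obtain ⟨ΦA, hA⟩ := hasCoordPresentation (k := k) (p := p) (r := r)
    obtain ⟨h1, Φ, hΦ⟩ := presentation_coordSub hA hs
    exact ⟨h1, ker_cohomologyMap_coordSubIncl (by omega), hΦ.exists_equiv⟩
  · intro s t a f hs hst has _ hf
    obtain ⟨g, hg, hfg⟩ := exists_eq_X_pow_mul (p := p) hst has
    exact exists_piStar (by omega) (hf.trans hfg) hg
  · exact ⟨phi_bijective hη, bijective_cohomologyMap_phi hη⟩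
  · obtain ⟨l, hl⟩ := odd_represents (k := k)
    have hX : AlgEquiv.ofBijective (Polynomial.aeval l) (odd_bijective hl) Polynomial.X = l :=
      Polynomial.aeval_X l
    exact ⟨AlgEquiv.ofBijective (Polynomial.aeval l) (odd_bijective hl), by rwa [hX],
      by rw [hX]; exact odd_homogeneous hl⟩
  · exact ⟨qMinusStar_injective f, bijective_cohomologyMap_qMinusStar f hη⟩
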